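/- Let $k$ be an algebraically closed field of characteristic $0$ and $n\ge 1$. Let $X$ be a proper smooth integral surface and $C$ a proper smooth integral curve over $k$, and let $\pi:X\to C$ be a proper flat surjective $k$-morphism whose generic fiber is a smooth curve. **Notation.** For a smooth $k$-scheme $Z$ let $T^*_Z$ be the total space of its cotangent bundle, and let $\mathcal A_Z=\bigoplus_{i=1}^n H^0(Z,\mathrm{Sym}^i\Omega^1_Z)$. For $x\in Z(k)$ we say that the value $a(x)$ of $a=(a_1,\dots,a_n)\in\mathcal A_Z$ is the zero-cycle $[\xi_1,\dots,\xi_n]$ of $T^*_{Z,x}$ if $a_i(x)\in\mathrm{Sym}^i(T^*_{Z,x})$ is the $i$-th elementary symmetric polynomial of $\xi_1,\dots,\xi_n$, for $i=1,\dots,n$. Let $\mathcal B_Z\subset\mathcal A_Z$ be the set of those $a$ whose value at every $x\in Z(k)$ is a zero-cycle, and let $\mathcal B_Z^\heartsuit\subset\mathcal B_Z$ be the set of those $a$ for which, moreover, the value at some $x\in Z(k)$ is a zero-cycle with $n$ distinct points. For $a\in\mathcal A_Z$ let the spectral cover $Z^\bullet_a\subset T^*_Z$ be the closed subscheme defined by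 the vanishing of the section $\xi^n-a_1\xi^{n-1}+\dots+(-1)^na_n$ of the pull-back of $\mathrm{Sym}^n\Omega^1_Z$ to $T^*_Z$, where $\xi$ is the tautological section of the pull-back of $\Omega^1_Z$. For $b\in\mathcal B_C$ let $b_X\in\mathcal A_X$ be its pull-back along $\pi$; write $X^\bullet_b=X^\bullet_{b_X}$ and $X^+_b=C^\bullet_b\times_CX$, a closed subscheme of $T^*_C\times_CX$. Let $d\pi:T^*_C\times_CX\to T^*_X$ be the cotangent morphism (codifferential) of $\pi$. A morphism is called a *generic isomorphism* if it is an isomorphism over some dense open subset of its target whose preimage is dense in the source. A *finite Cohen–Macaulayfication* of a scheme $S$ is a finite generic isomorphism $S'\to S$ with $S'$ Cohen–Macaulay. For $a\in\mathcal B_X^\heartsuit$, the Cohen–Macaulay spectral surface $X^{\mathrm{CM}}_a$ is the finite flat covering $p:Y\to X$ of degree $n$ with an $X$-morphism $\iota:Y\to T^*_X$, unique up to isomorphism, with the following property: there is an open subset $U\subset X$, whose complement has codimension at least $2$, such that $\iota$ is a closed embedding over $U$ and, for every $x\in U(k)$, the cycle $\sum_{z\in p^{-1}(x)}\mathrm{length}(\mathcal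 O_{p^{-1}(x),z})\,\iota(z)$ of $T^*_{X,x}$ is the value $a(x)$. The morphism $\iota$ factors through $X^\bullet_a$, which gives $q^{\mathrm{CM}}_a:X^{\mathrm{CM}}_a\to X^\bullet_a$. **Lemma.** The pull-back $b_X$ and the cotangent morphism $d\pi$ exist and are unique. For every $b\in\mathcal B_C$: 1. $b_X\in\mathcal B_X$, and the restriction of $d\pi$ to $X^+_b$ factors through a finite $X$-morphism $q^+_b:X^+_b\to X^\bullet_b$. 2. If $b\in\mathcal B_C^\heartsuit$, then $b_X\in\mathcal B_X^\heartsuit$ and $q^+_b$ is a generic isomorphism. 3. If $b\in\mathcal B_C^\heartsuit$ and all fibers of $\pi$ are reduced, then $q^+_b$ is a finite Cohen–Macaulayfication of $X^\bullet_b$, and it is isomorphic to $q^{\mathrm{CM}}_{b_X}:X^{\mathrm{CM}}_{b_X}\to X^\bullet_b$. More precisely, $X^+_b\to X$ together with $X^+_b\to X^\bullet_b\subset T^*_X$ has the property which characterizes $X^{\mathrm{CM}}_{b_X}$, and for every $(p:Y\to X,\ \iota:Y\to T^*_X)$ with this property, $\iota$ factors through a morphism $q:Y\to X^\bullet_b$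 and there is an isomorphism $e:X^+_b\to Y$ with $q\circ e=q^+_b$. -/

import Mathlib

open CategoryTheory CategoryTheory.Limits AlgebraicGeometry TopologicalSpace

universe u

noncomputable section

namespace SpectralSurface

section Algebra

open SymmetricAlgebra

variable {R R' M M' : Type u} [CommRing R] [CommRing R'] [Algebra R R']
  [AddCommGroup M] [Module R M] [AddCommGroup M'] [Module R M'] [Module R' M']
  [IsScalarTower R R' M']

/-- The map `Sym_R(M) → Sym_{R'}(M')` induced by an `R`-linear map `M → M'`. -/
def symMap (m : M →ₗ[R] M') : SymmetricAlgebra R M →ₐ[R] SymmetricAlgebra R' M' :=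
  SymmetricAlgebra.lift (((SymmetricAlgebra.ι R' M').restrictScalars R).comp m)

lemma symMap_ι (m : M →ₗ[R] M') (x : M) :
    symMap (R' := R') m (ι R M x) = ι R' M' (m x) := by
  simp [symMap]

lemma symMap_algebraMap (m : M →ₗ[R] M') (r : R) :
    symMap (R' := R') m (algebraMap R _ r) = algebraMap R' _ (algebraMap R R' r) := by
  rw [AlgHom.commutes, IsScalarTower.algebraMap_apply R R' (SymmetricAlgebra R' M')]

lemma sym_ringHom_ext {A : Type u} [CommRing A] {f g : SymmetricAlgebra R M →+* A}
    (h₁ : ∀ r, f (algebraMap R _ r) = g (algebraMap R _ r))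
    (h₂ : ∀ x, f (ι R M x) = g (ι R M x)) : f = g := by
  refine RingHom.ext fun x ↦ ?_
  induction x using SymmetricAlgebra.induction with
  | algebraMap r => exact h₁ r
  | ι x => exact h₂ x
  | mul a b ha hb => rw [map_mul, map_mul, ha, hb]
  | add a b ha hb => rw [map_add, map_add, ha, hb]

lemma exists_factor_of_isLocalizedModule (f : R) [IsLocalization.Away f R'] (m : M →ₗ[R] M')
    [IsLocalizedModule (.powers f) m] {L : Type u} [CommRing L]
    (g : SymmetricAlgebra R M →+* L) (hg : IsUnit (g (algebraMap R _ f))) :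
    ∃ ψ : SymmetricAlgebra R' M' →+* L, ∀ x, ψ (symMap (R' := R') m x) = g x := by
  let φ : R →+* L := g.comp (algebraMap R _)
  let φ' : R' →+* L := IsLocalization.Away.lift (S := R') (g := φ) f hg
  have hφ' : ∀ r, φ' (algebraMap R R' r) = φ r := fun r ↦ IsLocalization.Away.lift_eq f hg r
  let _ : Algebra R' L := φ'.toAlgebra
  let _ : Algebra R L := φ.toAlgebra
  have _ : IsScalarTower R R' L := .of_algebraMap_eq fun r ↦ (hφ' r).symm
  let g' : SymmetricAlgebra R M →ₐ[R] L := { g with commutes' := fun _ ↦ rfl }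
  let l₀ : M →ₗ[R] L := g'.toLinearMap.comp (ι R M)
  have hl : ∀ x : Submonoid.powers f, IsUnit ((algebraMap R (Module.End R L)) x) := by
    rintro ⟨_, n, rfl⟩
    rw [Module.End.isUnit_iff]
    have h₁ : ⇑((algebraMap R (Module.End R L)) (f ^ n)) = fun z ↦ φ f ^ n * z := by
      funext z
      rw [Module.algebraMap_end_apply, Algebra.smul_def, map_pow]; rfl
    change Function.Bijective ⇑((algebraMap R (Module.End R L)) (f ^ n))
    rw [h₁]
    exact IsUnit.isUnit_iff_mulLeft_bijective.mp (IsUnit.pow n hg)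
  let l : M' →ₗ[R] L := IsLocalizedModule.lift (.powers f) m l₀ hl
  let l' : M' →ₗ[R'] L := l.extendScalarsOfIsLocalization (.powers f) R'
  let ψ : SymmetricAlgebra R' M' →ₐ[R'] L := SymmetricAlgebra.lift l'
  refine ⟨ψ.toRingHom, fun x ↦ ?_⟩
  have key : ψ.toRingHom.comp (symMap (R' := R') m).toRingHom = g := by
    refine sym_ringHom_ext (fun r ↦ ?_) (fun x ↦ ?_)
    · change ψ (symMap (R' := R') m (algebraMap R _ r)) = φ r
      rw [symMap_algebraMap, ψ.commutes]
      exact hφ' r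
    · change ψ (symMap (R' := R') m (ι R M x)) = l₀ x
      rw [symMap_ι]
      refine (SymmetricAlgebra.lift_ι_apply l' _).trans ?_
      exact IsLocalizedModule.lift_apply (.powers f) m l₀ hl x
  exact congr($key x)

/-- Symmetric algebras commute with localization. -/
lemma isLocalization_symMap (f : R) [IsLocalization.Away f R'] (m : M →ₗ[R] M')
    [IsLocalizedModule (.powers f) m] :
    letI := (symMap (R' := R') m).toRingHom.toAlgebra
    IsLocalization.Away (algebraMap R (SymmetricAlgebra R M) f) (SymmetricAlgebra R' M') := by
  let _ := (symMap (R' := R') m).toRingHom.toAlgebra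
  have hmap : ∀ x, algebraMap (SymmetricAlgebra R M) (SymmetricAlgebra R' M') x =
    symMap (R' := R') m x := fun _ ↦ rfl
  have hu : IsUnit (algebraMap R R' f) := IsLocalization.Away.algebraMap_isUnit f
  refine IsLocalization.Away.mk (S := SymmetricAlgebra R' M') _ ?_ ?_ ?_
  · rw [hmap, symMap_algebraMap]
    exact hu.map _
  · intro s
    induction s using SymmetricAlgebra.induction with
    | algebraMap r =>
      obtain ⟨n, a, ha⟩ := IsLocalization.Away.surj f r
      refine ⟨n, algebraMap _ _ a, ?_⟩
      rw [hmap, hmap, symMap_algebraMap, symMap_algebraMap, ← ha, map_mul, map_pow]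
    | ι x =>
      obtain ⟨⟨y, s⟩, h⟩ := IsLocalizedModule.surj (.powers f) m x
      obtain ⟨n, hn⟩ := s.2
      have h' : (f ^ n) • x = m y := by rw [← h, Submonoid.smul_def, ← hn]
      refine ⟨n, ι R M y, ?_⟩
      rw [hmap, hmap, symMap_algebraMap, symMap_ι, ← h', ← algebraMap_smul R' (f ^ n) x, map_smul,
        Algebra.smul_def, mul_comm]
      simp
    | mul a b ha hb =>
      obtain ⟨n, a', ha⟩ := ha
      obtain ⟨n', b', hb⟩ := hb
      refine ⟨n + n', a' * b', ?_⟩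
      rw [map_mul, ← ha, ← hb]; ring
    | add a b ha hb =>
      obtain ⟨n, a', ha⟩ := ha
      obtain ⟨n', b', hb⟩ := hb
      refine ⟨n + n', a' * algebraMap _ _ f ^ n' + b' * algebraMap _ _ f ^ n, ?_⟩
      rw [map_add, map_mul, map_mul, ← ha, ← hb, map_pow, map_pow]; ring
  · intro a b hab
    let L := Localization.Away (algebraMap R (SymmetricAlgebra R M) f)
    obtain ⟨ψ, hψ⟩ := exists_factor_of_isLocalizedModule (R' := R') f m
      (algebraMap (SymmetricAlgebra R M) L) (IsLocalization.Away.algebraMap_isUnit _)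
    have h : algebraMap (SymmetricAlgebra R M) L a = algebraMap (SymmetricAlgebra R M) L b := by
      rw [← hψ, ← hψ]
      exact congrArg ψ hab
    obtain ⟨c, hc⟩ := (IsLocalization.eq_iff_exists
      (.powers (algebraMap R (SymmetricAlgebra R M) f)) L).mp h
    obtain ⟨n, hn⟩ := c.2
    exact ⟨n, by simpa [← hn] using hc⟩

end Algebra
section Derivations

variable (k : Type u) {R R' : Type u} [CommRing k] [CommRing R] [CommRing R'] [Algebra k R]
  [Algebra k R'] [Algebra R R'] [IsScalarTower k R R']

lemma exists_derivation_extend [Algebra.FormallyEtale R R'] (δ : Derivation k R R) :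
    ∃ δ' : Derivation k R' R', ∀ r, δ' (algebraMap R R' r) = algebraMap R R' (δ r) := by
  let l : Ω[R⁄k] →ₗ[R] R' := (Algebra.linearMap R R').comp δ.liftKaehlerDifferential
  let h := KaehlerDifferential.isBaseChange_of_formallyEtale k R R'
  refine ⟨(h.lift l).compDer (KaehlerDifferential.D k R'), fun r ↦ ?_⟩
  have := h.lift_eq l (KaehlerDifferential.D k R r)
  rw [KaehlerDifferential.map_D] at this
  exact this.trans (by simp [l])

variable {k} in
lemma derivation_ext_of_formallyEtale [Algebra.FormallyEtale R R'] {δ₁ δ₂ : Derivation k R' R'}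
    (h : ∀ r, δ₁ (algebraMap R R' r) = δ₂ (algebraMap R R' r)) : δ₁ = δ₂ := by
  have hb := KaehlerDifferential.isBaseChange_of_formallyEtale k R R'
  let l (δ : Derivation k R' R') : Ω[R⁄k] →ₗ[R] R' :=
    (δ.liftKaehlerDifferential.restrictScalars R).comp (KaehlerDifferential.map k k R R')
  have hl : l δ₁ = l δ₂ := Derivation.liftKaehlerDifferential_unique _ _ <| Derivation.ext fun r ↦ by
    simpa [l] using h r
  have hd : δ₁.liftKaehlerDifferential = δ₂.liftKaehlerDifferential :=
    hb.algHom_ext _ _ fun x ↦ congr($hl x)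
  rw [← Derivation.liftKaehlerDifferential_comp δ₁, hd, Derivation.liftKaehlerDifferential_comp]

/-- The restriction of vector fields along a formally étale `R → R'`: a derivation `δ` of `R` is
sent to the unique derivation of `R'` which extends it. -/
def derExtend [Algebra.FormallyEtale R R'] : Derivation k R R →ₗ[R] Derivation k R' R' where
  toFun δ := (exists_derivation_extend k (R' := R') δ).choose
  map_add' δ₁ δ₂ := derivation_ext_of_formallyEtale (R := R) fun r ↦ by
    rw [Derivation.add_apply, (exists_derivation_extend k (R' := R') (δ₁ + δ₂)).choose_spec,
      (exists_derivation_extend k (R' := R') δ₁).choose_spec,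
      (exists_derivation_extend k (R' := R') δ₂).choose_spec, Derivation.add_apply, map_add]
  map_smul' a δ := derivation_ext_of_formallyEtale (R := R) fun r ↦ by
    rw [(exists_derivation_extend k (R' := R') (a • δ)).choose_spec, RingHom.id_apply,
      Derivation.smul_apply, Derivation.smul_apply,
      (exists_derivation_extend k (R' := R') δ).choose_spec, smul_eq_mul, map_mul,
      Algebra.smul_def]

lemma derExtend_algebraMap [Algebra.FormallyEtale R R'] (δ : Derivation k R R) (r : R) :
    derExtend k (R' := R') δ (algebraMap R R' r) = algebraMap R R' (δ r) :=
  (exists_derivation_extend k (R' := R') δ).choose_spec r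

lemma isLocalizedModule_derExtend (f : R) [IsLocalization.Away f R']
    [Algebra.FormallyEtale R R'] [Module.FinitePresentation R Ω[R⁄k]] :
    IsLocalizedModule (.powers f) (derExtend k (R := R) (R' := R')) := by
  have e : derExtend k (R := R) (R' := R') =
      ((KaehlerDifferential.linearMapEquivDerivation k R' (M := R')).restrictScalars R).toLinearMap ∘ₗ
      (IsLocalizedModule.mapExtendScalars (.powers f) (KaehlerDifferential.map k k R R')
        (Algebra.linearMap R R') R') ∘ₗ
      (KaehlerDifferential.linearMapEquivDerivation k R (M := R)).symm.toLinearMap := by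
    refine LinearMap.ext fun δ ↦ derivation_ext_of_formallyEtale (R := R) fun r ↦ ?_
    rw [derExtend_algebraMap]
    let l : Ω[R⁄k] →ₗ[R] R := δ.liftKaehlerDifferential
    have h := IsLocalizedModule.map_apply (.powers f) (KaehlerDifferential.map k k R R')
      (Algebra.linearMap R R') l (KaehlerDifferential.D k R r)
    rw [KaehlerDifferential.map_D] at h
    have hl : l (KaehlerDifferential.D k R r) = δ r := δ.liftKaehlerDifferential_comp_D r
    rw [hl] at h
    exact h.symm
  rw [e]
  have h₁ : IsLocalizedModule (.powers f) ((IsLocalizedModule.mapExtendScalars (.powers f)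
      (KaehlerDifferential.map k k R R') (Algebra.linearMap R R') R') ∘ₗ
      (KaehlerDifferential.linearMapEquivDerivation k R (M := R)).symm.toLinearMap) :=
    inferInstance
  exact IsLocalizedModule.of_linearEquiv (.powers f) _
    ((KaehlerDifferential.linearMapEquivDerivation k R' (M := R')).restrictScalars R)

end Derivations

section Restriction

open SymmetricAlgebra

variable {k R R' : Type u} [CommRing k] [CommRing R] [CommRing R'] [Algebra k R] [Algebra k R']
  (φ : R →+* R') (hk : ∀ a, φ (algebraMap k R a) = algebraMap k R' a)

/-- Restriction of vector fields along a formally étale homomorphism of `k`-algebras. -/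
def derRes (hφ : φ.FormallyEtale) (δ : Derivation k R R) : Derivation k R' R' :=
  letI := φ.toAlgebra
  haveI : IsScalarTower k R R' := .of_algebraMap_eq fun a ↦ (hk a).symm
  haveI : Algebra.FormallyEtale R R' := hφ
  derExtend k δ

lemma derRes_apply (hφ : φ.FormallyEtale) (δ : Derivation k R R) (r : R) :
    derRes φ hk hφ δ (φ r) = φ (δ r) := by
  let _ := φ.toAlgebra
  have : IsScalarTower k R R' := .of_algebraMap_eq fun a ↦ (hk a).symm
  have : Algebra.FormallyEtale R R' := hφ
  exact derExtend_algebraMap k δ r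

lemma der_ext (φ : R →+* R') (hk : ∀ a, φ (algebraMap k R a) = algebraMap k R' a)
    (hφ : φ.FormallyEtale) {δ₁ δ₂ : Derivation k R' R'}
    (h : ∀ r, δ₁ (φ r) = δ₂ (φ r)) : δ₁ = δ₂ := by
  let _ := φ.toAlgebra
  have : IsScalarTower k R R' := .of_algebraMap_eq fun a ↦ (hk a).symm
  have : Algebra.FormallyEtale R R' := hφ
  exact derivation_ext_of_formallyEtale (R := R) h

/-- The map `Sym_R (Der_k(R)) → Sym_{R'} (Der_k(R'))` induced by a formally étale homomorphism. -/
def symDerRes (hφ : φ.FormallyEtale) :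
    SymmetricAlgebra R (Derivation k R R) →+* SymmetricAlgebra R' (Derivation k R' R') :=
  letI := φ.toAlgebra
  haveI : IsScalarTower k R R' := .of_algebraMap_eq fun a ↦ (hk a).symm
  haveI : Algebra.FormallyEtale R R' := hφ
  (symMap (R' := R') (derExtend k (R := R) (R' := R'))).toRingHom

lemma symDerRes_algebraMap (hφ : φ.FormallyEtale) (r : R) :
    symDerRes φ hk hφ (algebraMap _ _ r) = algebraMap _ _ (φ r) := by
  let _ := φ.toAlgebra
  have : IsScalarTower k R R' := .of_algebraMap_eq fun a ↦ (hk a).symm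
  have : Algebra.FormallyEtale R R' := hφ
  exact symMap_algebraMap _ r

lemma symDerRes_ι (hφ : φ.FormallyEtale) (δ : Derivation k R R) :
    symDerRes φ hk hφ (ι _ _ δ) = ι _ _ (derRes φ hk hφ δ) := by
  let _ := φ.toAlgebra
  have : IsScalarTower k R R' := .of_algebraMap_eq fun a ↦ (hk a).symm
  have : Algebra.FormallyEtale R R' := hφ
  exact symMap_ι _ δ

lemma isLocalization_symDerRes (hφ : φ.FormallyEtale) [Algebra.FinitePresentation k R] (f : R)
    (hf : letI := φ.toAlgebra; IsLocalization.Away f R') :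
    letI := (symDerRes φ hk hφ).toAlgebra
    IsLocalization.Away (algebraMap R (SymmetricAlgebra R (Derivation k R R)) f)
      (SymmetricAlgebra R' (Derivation k R' R')) := by
  let _ := φ.toAlgebra
  have : IsScalarTower k R R' := .of_algebraMap_eq fun a ↦ (hk a).symm
  have : Algebra.FormallyEtale R R' := hφ
  have : IsLocalization.Away f R' := hf
  have := isLocalizedModule_derExtend k (R := R) (R' := R') f
  exact isLocalization_symMap f (derExtend k (R := R) (R' := R'))

/-- The map `Sym_R (Ω_{R/k}) → Sym_{R'} (Ω_{R'/k})` induced by a homomorphism of `k`-algebras. -/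
def symKaehlerMap : SymmetricAlgebra R Ω[R⁄k] →+* SymmetricAlgebra R' Ω[R'⁄k] :=
  letI := φ.toAlgebra
  haveI : IsScalarTower k R R' := .of_algebraMap_eq fun a ↦ (hk a).symm
  (symMap (R' := R') (KaehlerDifferential.map k k R R')).toRingHom

end Restriction

section CotangentBundle

open Scheme SymmetricAlgebra

lemma le_preimage_top {X Y : Scheme.{u}} (f : X ⟶ Y) (U : X.Opens) : U ≤ f ⁻¹ᵁ ⊤ :=
  fun _ _ ↦ trivial

variable (k : Type u) [Field k] (X : Scheme.{u}) [X.Over (Spec (.of k))]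

/-- The rings of sections of a `k`-scheme are `k`-algebras. -/
instance sectionsAlgebra (U : X.Opens) : Algebra k Γ(X, U) :=
  ((Scheme.ΓSpecIso (.of k)).inv ≫ (X ↘ Spec (.of k)).appLE ⊤ U (le_preimage_top _ _)).hom.toAlgebra

lemma appLE_algebraMap {k : Type u} [Field k] {X Y : Scheme.{u}} [X.Over (Spec (.of k))]
    [Y.Over (Spec (.of k))] (π : X ⟶ Y) [π.IsOver (Spec (.of k))] (W : Y.Opens) (U : X.Opens)
    (h : U ≤ π ⁻¹ᵁ W) (a : k) :
    (π.appLE W U h).hom (algebraMap k Γ(Y, W) a) = algebraMap k Γ(X, U) a := by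
  have : (Y ↘ Spec (.of k)).appLE ⊤ W (le_preimage_top _ _) ≫ π.appLE W U h =
      (X ↘ Spec (.of k)).appLE ⊤ U (le_preimage_top _ _) := by
    rw [Scheme.Hom.appLE_comp_appLE]
    simp only [comp_over]
  change (((Scheme.ΓSpecIso (.of k)).inv ≫ (Y ↘ Spec (.of k)).appLE ⊤ W (le_preimage_top _ _)) ≫
    π.appLE W U h).hom a = _
  rw [Category.assoc, this]
  rfl

lemma res_algebraMap {U V : X.Opens} (h : V ≤ U) (a : k) :
    (X.presheaf.map (homOfLE h).op).hom (algebraMap k Γ(X, U) a) = algebraMap k Γ(X, V) a := by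
  have : (X ↘ Spec (.of k)).appLE ⊤ U (le_preimage_top _ _) ≫ X.presheaf.map (homOfLE h).op =
      (X ↘ Spec (.of k)).appLE ⊤ V (le_preimage_top _ _) := by
    rw [Scheme.Hom.appLE_map]
  change (((Scheme.ΓSpecIso (.of k)).inv ≫ (X ↘ Spec (.of k)).appLE ⊤ U (le_preimage_top _ _)) ≫
    X.presheaf.map (homOfLE h).op).hom a = _
  rw [Category.assoc, this]
  rfl

lemma finitePresentation_sections [LocallyOfFinitePresentation (X ↘ Spec (.of k))] {U : X.Opens}
    (hU : IsAffineOpen U) : Algebra.FinitePresentation k Γ(X, U) := by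
  have h := LocallyOfFinitePresentation.finitePresentation_appLE (X ↘ Spec (.of k))
    (isAffineOpen_top _) hU (le_preimage_top _ _)
  have : ((Scheme.ΓSpecIso (.of k)).inv ≫
      (X ↘ Spec (.of k)).appLE ⊤ U (le_preimage_top _ _)).hom.FinitePresentation := by
    rw [CommRingCat.hom_comp]
    exact h.comp (RingHom.FinitePresentation.of_bijective
      (ConcreteCategory.bijective_of_isIso (Scheme.ΓSpecIso (.of k)).inv))
  exact this

/-- Vector fields on an open subset, i.e. `k`-derivations of its ring of functions. (On an affine
open subset of `X` these are the sections of the tangent sheaf.) -/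
abbrev VectorField (U : X.Opens) : Type u := Derivation k Γ(X, U) Γ(X, U)

variable {X}

/-- Restriction of functions. -/
abbrev res {U V : X.AffineZariskiSite} (h : V ≤ U) : Γ(X, U.1) →+* Γ(X, V.1) :=
  (X.presheaf.map (homOfLE (AffineZariskiSite.toOpens_mono h)).op).hom

lemma isLocalization_res (U : X.AffineZariskiSite) (f : Γ(X, U.1)) :
    letI := (res (U.basicOpen_le f)).toAlgebra
    IsLocalization.Away f Γ(X, (U.basicOpen f).1) :=
  U.2.isLocalization_basicOpen f

lemma formallyEtale_of_isLocalization {R R' : Type u} [CommRing R] [CommRing R'] (φ : R →+* R')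
    (f : R) (hf : letI := φ.toAlgebra; IsLocalization.Away f R') : φ.FormallyEtale := by
  let _ := φ.toAlgebra
  have : IsLocalization.Away f R' := hf
  exact Algebra.FormallyEtale.of_isLocalization (.powers f)

lemma formallyEtale_res {U V : X.AffineZariskiSite} (h : V ≤ U) : (res h).FormallyEtale := by
  obtain ⟨f, hf⟩ := id h
  obtain rfl : U.basicOpen f = V := Subtype.ext hf
  exact formallyEtale_of_isLocalization _ f (isLocalization_res U f)

lemma res_algebraMap' {U V : X.AffineZariskiSite} (h : V ≤ U) (a : k) :
    res h (algebraMap k _ a) = algebraMap k _ a :=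
  res_algebraMap k X _ a

lemma res_self {U : X.AffineZariskiSite} (h : U ≤ U) (r : Γ(X, U.1)) : res h r = r :=
  congr($(X.presheaf.map_id (.op U.1)) r)

lemma res_res {U V W : X.AffineZariskiSite} (h : V ≤ U) (h' : W ≤ V) (r : Γ(X, U.1)) :
    res h' (res h r) = res (h'.trans h) r :=
  congr($(X.presheaf.map_comp (homOfLE (AffineZariskiSite.toOpens_mono h)).op
    (homOfLE (AffineZariskiSite.toOpens_mono h')).op) r).symm

variable (X) in
/-- The quasi-coherent algebra `U ↦ Sym (T_X(U))` on the affine open subsets of `X`. -/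
def symTangent : X.AffineZariskiSiteᵒᵖ ⥤ CommRingCat.{u} where
  obj U := .of (SymmetricAlgebra Γ(X, U.unop.1) (VectorField k X U.unop.1))
  map i := CommRingCat.ofHom
    (symDerRes (res i.unop.le) (res_algebraMap' k i.unop.le) (formallyEtale_res i.unop.le))
  map_id U := by
    refine CommRingCat.hom_ext (sym_ringHom_ext (fun r ↦ ?_) fun δ ↦ ?_)
    · refine (symDerRes_algebraMap (res le_rfl) (res_algebraMap' k _) _ r).trans ?_
      exact congrArg _ (res_self _ r)
    · refine (symDerRes_ι (res le_rfl) (res_algebraMap' k _) _ δ).trans (congrArg _ ?_)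
      refine der_ext (res le_rfl) (res_algebraMap' k _) (formallyEtale_res le_rfl) fun r ↦ ?_
      rw [derRes_apply, res_self, res_self]
  map_comp {U V W} i j := by
    refine CommRingCat.hom_ext (sym_ringHom_ext (fun r ↦ ?_) fun δ ↦ ?_)
    · refine (symDerRes_algebraMap (res (i ≫ j).unop.le) (res_algebraMap' k _) _ r).trans ?_
      refine Eq.symm ((congrArg (symDerRes (res j.unop.le) (res_algebraMap' k _) _)
        (symDerRes_algebraMap (res i.unop.le) (res_algebraMap' k _)
          (formallyEtale_res i.unop.le) r)).trans ?_)
      refine (symDerRes_algebraMap (res j.unop.le) (res_algebraMap' k _)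
        (formallyEtale_res j.unop.le) _).trans (congrArg _ (res_res _ _ r))
    · refine (symDerRes_ι (res (i ≫ j).unop.le) (res_algebraMap' k _) _ δ).trans ?_
      refine Eq.symm ((congrArg (symDerRes (res j.unop.le) (res_algebraMap' k _) _)
        (symDerRes_ι (res i.unop.le) (res_algebraMap' k _) (formallyEtale_res i.unop.le) δ)).trans ?_)
      refine (symDerRes_ι (res j.unop.le) (res_algebraMap' k _)
        (formallyEtale_res j.unop.le) _).trans (congrArg _ ?_)
      refine der_ext (res (i ≫ j).unop.le) (res_algebraMap' k _)
        (formallyEtale_res (i ≫ j).unop.le) fun r ↦ ?_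
      rw [derRes_apply]
      refine (congrArg _ (res_res i.unop.le j.unop.le r).symm).trans ?_
      rw [derRes_apply, derRes_apply, res_res]

variable (X) in
/-- The structure map `𝒪_X → Sym (T_X)`. -/
def symTangentUnit : (AffineZariskiSite.toOpensFunctor X).op ⋙ X.presheaf ⟶ symTangent k X where
  app U := CommRingCat.ofHom (algebraMap Γ(X, U.unop.1) _)
  naturality U V i := by
    refine CommRingCat.hom_ext (RingHom.ext fun r ↦ ?_)
    exact (symDerRes_algebraMap (res i.unop.le) (res_algebraMap' k _) (formallyEtale_res _) r).symm

lemma coequifibered_symTangentUnit [LocallyOfFinitePresentation (X ↘ Spec (.of k))] :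
    (symTangentUnit k X).Coequifibered := by
  refine AffineZariskiSite.coequifibered_iff_forall_isLocalizationAway.mpr fun U f ↦ ?_
  have := finitePresentation_sections k X U.2
  exact isLocalization_symDerRes (res (U.basicOpen_le f)) (res_algebraMap' k _)
    (formallyEtale_res _) f (isLocalization_res U f)

variable (X)

/-- The gluing data of the relative spectrum of `Sym (T_X)`. -/
def cotangentGluingData [LocallyOfFinitePresentation (X ↘ Spec (.of k))] :=
  AffineZariskiSite.relativeGluingData (coequifibered_symTangentUnit k (X := X))

instance [LocallyOfFinitePresentation (X ↘ Spec (.of k))] :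
    ((cotangentGluingData k X).functor ⋙ Scheme.forget).IsLocallyDirected :=
  Cover.RelativeGluingData.instIsLocallyDirectedI₀CompFunctorForgetOfIsThin ..

/-- The total space `T^*_X` of the cotangent bundle of `X` over `k`, that is the
relative spectrum of `Sym (T_X)`. -/
def cotangentBundle [LocallyOfFinitePresentation (X ↘ Spec (.of k))] : Scheme.{u} :=
  (cotangentGluingData k X).glued

variable [LocallyOfFinitePresentation (X ↘ Spec (.of k))]

/-- The projection `T^*_X → X`. -/
def cotangentProj : cotangentBundle k X ⟶ X := (cotangentGluingData k X).toBase

/-- The open chart `Spec Sym (T_X(U)) → T^*_X` over an affine open subset `U` of `X`. -/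
def cotangentChart (U : X.affineOpens) :
    Spec (.of (SymmetricAlgebra Γ(X, U.1) (VectorField k X U.1))) ⟶ cotangentBundle k X :=
  (cotangentGluingData k X).cover.f U

instance (U : X.affineOpens) : IsOpenImmersion (cotangentChart k X U) :=
  (cotangentGluingData k X).cover.map_prop U

lemma cotangentProj_preimage (U : X.affineOpens) :
    cotangentProj k X ⁻¹ᵁ U.1 = (cotangentChart k X U).opensRange := by
  simpa using! (cotangentGluingData k X).toBase_preimage_eq_opensRange_ι U

lemma isAffineOpen_cotangentProj_preimage (U : X.affineOpens) :
    IsAffineOpen (cotangentProj k X ⁻¹ᵁ U.1) := by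
  rw [cotangentProj_preimage]
  exact isAffineOpen_opensRange _

/-- The identification of the ring of functions of the open subset `T^*_U` of `T^*_X`
with `Sym (T_X(U))`. -/
def cotangentSections (U : X.affineOpens) :
    Γ(cotangentBundle k X, cotangentProj k X ⁻¹ᵁ U.1) ≅
      .of (SymmetricAlgebra Γ(X, U.1) (VectorField k X U.1)) :=
  (cotangentBundle k X).presheaf.mapIso (eqToIso ((Scheme.Hom.image_top_eq_opensRange _).trans
    (cotangentProj_preimage k X U).symm)).op ≪≫
    (cotangentChart k X U).appIso ⊤ ≪≫ Scheme.ΓSpecIso _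

end CotangentBundle

section HitchinBase

variable (k : Type u) [Field k] (X : Scheme.{u}) [X.Over (Spec (.of k))]

/-- A global section of `Sym^i Ω¹_{X/k}`: a compatible family of elements of `Sym^i Ω¹(U)`, for
all affine open subsets `U` of `X`. -/
structure SymDifferential (i : ℕ) where
  /-- the restriction to an affine open subset -/
  val (U : X.affineOpens) : SymmetricAlgebra Γ(X, U.1) Ω[Γ(X, U.1)⁄k]
  homogeneous (U : X.affineOpens) :
    val U ∈ LinearMap.range (SymmetricAlgebra.ι Γ(X, U.1) Ω[Γ(X, U.1)⁄k]) ^ i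
  compatible {U V : X.affineOpens} (h : V.1 ≤ U.1) :
    symKaehlerMap (X.presheaf.map (homOfLE h).op).hom (res_algebraMap k X h) (val U) = val V

/-- The `k`-points of the Hitchin base for `GL_n`: tuples `(a_1, …, a_n)` with `a_i` a global
section of `Sym^i Ω¹_{X/k}`. The component with index `i : Fin n` is `a_{i+1}`. -/
abbrev HitchinBase (n : ℕ) : Type u := (i : Fin n) → SymDifferential k X (i + 1)

/-- A `k`-rational point of `X`. -/
abbrev RatPoint : Type u := {x : Spec (.of k) ⟶ X // x ≫ (X ↘ Spec (.of k)) = 𝟙 _}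

variable {k X} {n : ℕ}

/-- The value of a function at a `k`-point of its domain of definition. -/
def valueAt {Y : Scheme.{u}} (y : Spec (.of k) ⟶ Y) (V : Y.Opens) (hy : ⊤ ≤ y ⁻¹ᵁ V) :
    Γ(Y, V) →+* k :=
  (y.appLE V ⊤ hy ≫ (Scheme.ΓSpecIso (.of k)).hom).hom

/-- The function obtained by evaluating a symmetric differential at a vector field. -/
def evalVectorField {U : X.Opens} (δ : VectorField k X U) :
    SymmetricAlgebra Γ(X, U) Ω[Γ(X, U)⁄k] →ₐ[Γ(X, U)] Γ(X, U) :=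
  SymmetricAlgebra.lift δ.liftKaehlerDifferential

/-- The polynomial `T^n - a_1(δ) T^{n-1} + ⋯ + (-1)^n a_n(δ)` attached to `(a_1, …, a_n)` and to a
vector field `δ`. -/
def charPoly (a : HitchinBase k X n) (U : X.affineOpens) (δ : VectorField k X U.1) :
    Polynomial Γ(X, U.1) :=
  Polynomial.X ^ n + ∑ i : Fin n, Polynomial.C
    ((-1) ^ (i.1 + 1) * evalVectorField δ ((a i).val U)) * Polynomial.X ^ (n - (i.1 + 1))

variable [LocallyOfFinitePresentation (X ↘ Spec (.of k))]

/-- The function on the open subset `T^*_U` of `T^*_X`, linear in the fibres, which is given by a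
vector field on the affine open subset `U`. -/
def linearFunction (U : X.affineOpens) (δ : VectorField k X U.1) :
    Γ(cotangentBundle k X, cotangentProj k X ⁻¹ᵁ U.1) :=
  (cotangentSections k X U).inv (SymmetricAlgebra.ι _ _ δ)

/-- The function `δ^n - a_1(δ) δ^{n-1} + ⋯ + (-1)^n a_n(δ)` on `T^*_U`, i.e. the contraction with
`δ^n` of `ξ^n - a_1 ξ^{n-1} + ⋯ + (-1)^n a_n`, for `ξ` the tautological section. -/
def spectralFunction (a : HitchinBase k X n) (U : X.affineOpens) (δ : VectorField k X U.1) :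
    Γ(cotangentBundle k X, cotangentProj k X ⁻¹ᵁ U.1) :=
  (cotangentSections k X U).inv (Polynomial.aeval (SymmetricAlgebra.ι _ _ δ) (charPoly a U δ))

/-- The ideal sheaf on `T^*_X` generated by the functions `spectralFunction a U δ` (in
characteristic zero, these generate the ideal of the vanishing locus of the section
`ξ^n - a_1 ξ^{n-1} + ⋯ + (-1)^n a_n` of the pull-back of `Sym^n Ω¹_X` to `T^*_X`, as
the `n`-th powers of vector fields span the dual of `Sym^n Ω¹_X`). -/
def spectralIdeal (a : HitchinBase k X n) : (cotangentBundle k X).IdealSheafData :=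
  sInf {I | ∀ (U : X.affineOpens) (δ : VectorField k X U.1), spectralFunction a U δ ∈
    I.ideal ⟨cotangentProj k X ⁻¹ᵁ U.1, isAffineOpen_cotangentProj_preimage k X U⟩}

/-- The spectral cover `X^•_a`, as a closed subscheme of `T^*_X`. -/
def spectralCover (a : HitchinBase k X n) : Scheme.{u} := (spectralIdeal a).subscheme

/-- The inclusion `X^•_a → T^*_X`. -/
def spectralIncl (a : HitchinBase k X n) : spectralCover a ⟶ cotangentBundle k X :=
  (spectralIdeal a).subschemeι

/-- The projection `X^•_a → X`. -/
def spectralProj (a : HitchinBase k X n) : spectralCover a ⟶ X :=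
  spectralIncl a ≫ cotangentProj k X

/-- A `k`-point of the fibre of `T^*_X` over a `k`-point `x` of `X`. -/
abbrev CotangentVector (x : RatPoint k X) : Type u :=
  {ξ : Spec (.of k) ⟶ cotangentBundle k X // ξ ≫ cotangentProj k X = x.1}

lemma CotangentVector.le_preimage {x : RatPoint k X} (ξ : CotangentVector x) {U : X.Opens}
    (hx : ⊤ ≤ x.1 ⁻¹ᵁ U) : ⊤ ≤ ξ.1 ⁻¹ᵁ (cotangentProj k X ⁻¹ᵁ U) := by
  rw [← Scheme.Hom.comp_preimage, ξ.2]
  exact hx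

/-- The pairing `⟨ξ, δ(x)⟩` of a cotangent vector at `x` and a vector field near `x`. -/
def CotangentVector.pair {x : RatPoint k X} (ξ : CotangentVector x) (U : X.affineOpens)
    (hx : ⊤ ≤ x.1 ⁻¹ᵁ U.1) (δ : VectorField k X U.1) : k :=
  valueAt ξ.1 _ (ξ.le_preimage hx) (linearFunction U δ)

/-- The value of `a` at `x` is (the image under Weyl's polarization map of) the zero-cycle
`[ξ_1, …, ξ_n]` of the fibre of `T^*_X` at `x`: the symmetric form `a_i(x)` is the `i`-th
elementary symmetric polynomial of `ξ_1, …, ξ_n`. -/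
def IsCycleAt (a : HitchinBase k X n) (x : RatPoint k X) (ξ : Fin n → CotangentVector x) : Prop :=
  ∀ (U : X.affineOpens) (hx : ⊤ ≤ x.1 ⁻¹ᵁ U.1) (δ : VectorField k X U.1),
    (charPoly a U δ).map (valueAt x.1 U.1 hx) =
      ∏ i, (Polynomial.X - Polynomial.C ((ξ i).pair U hx δ))

variable (k X n)

/-- The `k`-points of the postulated image `𝓑_X` of the Hitchin map: those `a` in the Hitchin base
whose value at every `k`-point `x` of `X` lies in the image of the Chow variety of zero-cycles of
degree `n` on the fibre of `T^*_X` at `x`. -/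
def postulatedImage : Set (HitchinBase k X n) :=
  {a | ∀ x : RatPoint k X, ∃ ξ : Fin n → CotangentVector x, IsCycleAt a x ξ}

/-- The `k`-points of `𝓑_X^♡`: those `a` in `𝓑_X` whose value at some `k`-point is a multiplicity
free zero-cycle. -/
def heartLocus : Set (HitchinBase k X n) :=
  {a | a ∈ postulatedImage k X n ∧ ∃ (x : RatPoint k X) (ξ : Fin n → CotangentVector x),
    Function.Injective ξ ∧ IsCycleAt a x ξ}

end HitchinBase

section CohenMacaulay

/-- A noetherian local ring is Cohen-Macaulay if its maximal ideal contains a regular sequence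
whose length is the Krull dimension of the ring. -/
def IsCohenMacaulayLocalRing (R : Type u) [CommRing R] [IsLocalRing R] : Prop :=
  IsNoetherianRing R ∧ ∃ rs : List R, (∀ r ∈ rs, r ∈ IsLocalRing.maximalIdeal R) ∧
    RingTheory.Sequence.IsRegular R rs ∧ (rs.length : WithBot ℕ∞) = ringKrullDim R

/-- Cohen-Macaulay schemes. -/
def IsCohenMacaulay (Y : Scheme.{u}) : Prop :=
  IsLocallyNoetherian Y ∧ ∀ y : Y, IsCohenMacaulayLocalRing (Y.presheaf.stalk y)

/-- A morphism is a generic isomorphism if it is an isomorphism over a dense open subset whose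
preimage is dense. -/
def IsGenericIso {Y Z : Scheme.{u}} (q : Y ⟶ Z) : Prop :=
  ∃ V : Z.Opens, Dense (V : Set Z) ∧ Dense ((q ⁻¹ᵁ V : Y.Opens) : Set Y) ∧ IsIso (q ∣_ V)

/-- A finite Cohen-Macaulayfication: a finite generic isomorphism from a Cohen-Macaulay scheme. -/
structure IsFiniteCohenMacaulayfication {Y Z : Scheme.{u}} (q : Y ⟶ Z) : Prop where
  isFinite : IsFinite q
  isGenericIso : IsGenericIso q
  isCohenMacaulay : IsCohenMacaulay Y

variable {k : Type u} [Field k] {X : Scheme.{u}} [X.Over (Spec (.of k))]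
  [LocallyOfFinitePresentation (X ↘ Spec (.of k))] {n : ℕ}

/-- The fibre of `p : Y → X` at `x`, which is mapped to the fibre of `T^*_X` at `x` by `j`,
lies over the value of `a` at `x` under the Hilbert-Chow morphism: the zero-cycle
`∑_z length(𝒪_{Y_x, z}) j(z)` is equal to the value of `a` at `x`. -/
def LiesOverAt (a : HitchinBase k X n) {Y : Scheme.{u}} (p : Y ⟶ X) (j : Y ⟶ cotangentBundle k X)
    (x : RatPoint k X) : Prop :=
  ∃ ξ : Fin n → CotangentVector x, IsCycleAt a x ξ ∧ ∀ z : (pullback p x.1 : Scheme.{u}),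
    Module.length ((pullback p x.1).presheaf.stalk z) ((pullback p x.1).presheaf.stalk z) =
      Nat.card {i : Fin n // (ξ i).1 (IsLocalRing.closedPoint k) = (pullback.fst p x.1 ≫ j) z}

/-- The property which characterizes the Cohen-Macaulay spectral surface `X^CM_a`, for `X` a smooth
surface and `a` in `𝓑_X^♡`: `p : Y → X` is finite flat of degree `n`, `j : Y → T^*_X` is an
`X`-morphism, and there is an open subset `U` of `X` whose complement has codimension at least
two, such that `j` is a closed embedding over `U` and, for every `x` in `U`, the fibre
`p⁻¹(x)`, as a point of the Hilbert scheme of `T^*_{X,x}`, lies over the value of `a` at `x`. -/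
structure IsCMSpectralSurface (a : HitchinBase k X n) {Y : Scheme.{u}} (p : Y ⟶ X)
    (j : Y ⟶ cotangentBundle k X) : Prop where
  comp_proj : j ≫ cotangentProj k X = p
  isFinite : IsFinite p
  flat : Flat p
  degree (x : X) : p.finrank x = n
  exists_open : ∃ U : X.Opens, (∀ z : X, z ∉ U → 2 ≤ ringKrullDim (X.presheaf.stalk z)) ∧
    IsClosedImmersion (j ∣_ (cotangentProj k X ⁻¹ᵁ U)) ∧
    ∀ x : RatPoint k X, ⊤ ≤ x.1 ⁻¹ᵁ U → LiesOverAt a p j x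

end CohenMacaulay

section Fibration

variable {k : Type u} [Field k] {X C : Scheme.{u}} [X.Over (Spec (.of k))]
  [C.Over (Spec (.of k))] (π : X ⟶ C) [π.IsOver (Spec (.of k))] {n : ℕ}

/-- `aX` is the pull-back of `aC` along `π`. -/
def IsPullbackOf (aC : HitchinBase k C n) (aX : HitchinBase k X n) : Prop :=
  ∀ (i : Fin n) (W : C.affineOpens) (U : X.affineOpens) (h : U.1 ≤ π ⁻¹ᵁ W.1),
    symKaehlerMap (π.appLE W.1 U.1 h).hom (appLE_algebraMap π W.1 U.1 h) ((aC i).val W) =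
      (aX i).val U

variable [LocallyOfFinitePresentation (X ↘ Spec (.of k))]
  [LocallyOfFinitePresentation (C ↘ Spec (.of k))]

/-- `d : T^*_C ×_C X → T^*_X` is the cotangent morphism (codifferential) of `π : X → C`:
it is a morphism over `X`, and its dual is the differential `T_X → π^* T_C`, i.e. if a vector
field `δ` on `U` has the image `∑ r_j ⊗ δ_j` under the differential, then the pull-back of the
linear function `δ` along `d` is the function `∑ r_j δ_j`. -/
structure IsCodifferential
    (d : pullback (cotangentProj k C) π ⟶ cotangentBundle k X) : Prop where
  comp_proj : d ≫ cotangentProj k X = pullback.snd (cotangentProj k C) π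
  pair (W : C.affineOpens) (U : X.affineOpens) (h : U.1 ≤ π ⁻¹ᵁ W.1) (δ : VectorField k X U.1)
    (m : ℕ) (r : Fin m → Γ(X, U.1)) (δ' : Fin m → VectorField k C W.1)
    (hδ : ∀ f : Γ(C, W.1),
      δ ((π.appLE W.1 U.1 h).hom f) = ∑ j, r j * (π.appLE W.1 U.1 h).hom (δ' j f))
    (V : (pullback (cotangentProj k C) π).Opens)
    (hVX : V ≤ pullback.snd (cotangentProj k C) π ⁻¹ᵁ U.1)
    (hVC : V ≤ pullback.fst (cotangentProj k C) π ⁻¹ᵁ (cotangentProj k C ⁻¹ᵁ W.1))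
    (hVd : V ≤ d ⁻¹ᵁ (cotangentProj k X ⁻¹ᵁ U.1)) :
    (d.appLE _ V hVd).hom (linearFunction U δ) =
      ∑ j, ((pullback.snd (cotangentProj k C) π).appLE _ V hVX).hom (r j) *
        ((pullback.fst (cotangentProj k C) π).appLE _ V hVC).hom (linearFunction W (δ' j))

/-- The surface `X^+_b = C^•_b ×_C X`. -/
abbrev plusSurface (b : HitchinBase k C n) : Scheme.{u} := pullback (spectralProj b) π

/-- The projection `X^+_b → X`. -/
abbrev plusProj (b : HitchinBase k C n) : plusSurface π b ⟶ X := pullback.snd (spectralProj b) π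

/-- The inclusion of `X^+_b` in `T^*_C ×_C X`. -/
def plusIncl (b : HitchinBase k C n) : plusSurface π b ⟶ pullback (cotangentProj k C) π :=
  pullback.map _ _ _ _ (spectralIncl b) (𝟙 X) (𝟙 C) (by simp [spectralProj]) (by simp)

end Fibration


end SpectralSurface

end

open SpectralSurface

noncomputable section

set_option linter.unusedSectionVars false

/-! Everything is computed in an étale coordinate `t` on `C` with vector field `D = ∂/∂t`. Over such
a chart `T_C` is free on `D`, and the differential of `π` sends a vector field `δ` on `X` to
`δ(π^*t) ⊗ D` (`IsChart.der_apply`). With `y` the linear function of `D`, the codifferential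
therefore pulls the linear function of `δ` back to `δ(π^*t) y`; this formula gives its uniqueness,
its existence and its compatibility with base change. The characteristic polynomial of `b_X` at `δ`
is that of `b` at `D` with roots multiplied by `δ(π^*t)` (`charPoly_pullback`). Hence the values of
`b_X` are zero-cycles, and the equations of `X^•_b` pull back to multiples of those of `C^•_b`
(`IsCodiff.appLE_spectralFunction`), which yields `q`. As `T_C` has rank one, `C^•_b` is locally
`Spec A[y]/(χ)` with `χ` monic of degree `n` (`IsChart.exists_isPullback`). So `X^+_b` is finite
flat of degree `n` over `X`, and `q` is finite.

Near the generic point of `X` the morphism `π` is smooth, so some `δ₀` satisfies `δ₀(π^*t) = 1`; for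
`b` in the heart locus `χ` may be assumed separable there. At a point of `X^•_b` the value `η` of
`δ₀` is a root of `χ`. If `δ` kills `π^*t`, then `η + c δ` is a root for every `c` in the infinite
field `k`, and separability forces `δ = 0` (`eq_zero_of_forall_eval₂_add_mul`). Thus the point comes
from the root `η`, and `q` is an isomorphism there (`IsChart.isIso_restrict`). This locus is dense
in `X^•_b` because `q` is surjective (`surjective_of_comp_eq_plusIncl`): at a geometric point the
equation makes a vector space a finite union of subspaces, so one of them is everything.

If the fibres are reduced, they are generically smooth, and by the fibral criterion the non-smooth
locus of `π` has codimension at least two (`two_le_ringKrullDim_of_notMem_smoothLocus`). Over the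
smooth locus `X^+_b → T^*_X` is a finite monomorphism, hence a closed immersion, and the fibre at
`x` is `Spec k[y]/∏ (y - c_i)` with the right lengths (`IsChart.liesOverAt`). The Cohen-Macaulay
property holds because `X^+_b` is locally flat and quasi-finite over the factorial ring `k[x_1,
x_2]` (`isCohenMacaulay_of_isFinite_of_flat`).

For the comparison with another covering `Y` having the characteristic property, the fibres of `Y`
over multiplicity-free values are reduced, so the spectral functions vanish on `Y` generically and
then everywhere by flatness (`exists_spectral_lift_of_liesOverAt`). Where `q` is an isomorphism, `Y`
maps to `X^+_b` by a closed immersion between coverings of equal degree, so by an isomorphism. It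
extends over the locus where both coverings are embedded, and then over codimension two by a Hartogs
argument (`exists_extension`, `exists_iso_of_restrict`). -/

namespace SpectralSurface

/-! ### Restriction of vector fields between affine open subsets. -/

section Restriction

variable {k : Type u} [Field k] {X : Scheme.{u}} [X.Over (Spec (.of k))]

/-- `res` covers only basic open subsets, where restriction is a localization. For an arbitrary
inclusion of affine opens it is étale because the identity morphism is. -/
lemma formallyEtale_map {U V : X.affineOpens} (h : V.1 ≤ U.1) :
    (X.presheaf.map (homOfLE h).op).hom.FormallyEtale := by
  have : ((𝟙 X : X ⟶ X).appLE U.1 V.1 h).hom.Etale :=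
    HasRingHomProperty.appLE @Etale (𝟙 X) inferInstance U V h
  have e : (𝟙 X : X ⟶ X).appLE U.1 V.1 h = X.presheaf.map (homOfLE h).op := by
    simp only [Scheme.Hom.appLE, Scheme.Hom.id_app]; exact Category.id_comp _
  rw [e] at this
  let _ := (X.presheaf.map (homOfLE h).op).hom.toAlgebra
  have : Algebra.Etale Γ(X, U.1) Γ(X, V.1) := this
  exact this.formallyEtale

/-- Restriction of vector fields to a smaller affine open subset. -/
def derRestrict {U V : X.affineOpens} (h : V.1 ≤ U.1) (δ : VectorField k X U.1) :
    VectorField k X V.1 :=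
  derRes (X.presheaf.map (homOfLE h).op).hom (res_algebraMap k X h) (formallyEtale_map h) δ

lemma derRestrict_apply {U V : X.affineOpens} (h : V.1 ≤ U.1) (δ : VectorField k X U.1)
    (r : Γ(X, U.1)) : derRestrict h δ ((X.presheaf.map (homOfLE h).op).hom r) =
      (X.presheaf.map (homOfLE h).op).hom (δ r) :=
  derRes_apply ..

lemma derRestrict_eq {U V : X.affineOpens} (h : V.1 ≤ U.1) {δ : VectorField k X U.1}
    {δ' : VectorField k X V.1} (H : ∀ r, δ' ((X.presheaf.map (homOfLE h).op).hom r) =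
      (X.presheaf.map (homOfLE h).op).hom (δ r)) : derRestrict h δ = δ' :=
  der_ext _ (res_algebraMap k X h) (formallyEtale_map h) fun r ↦ by rw [derRestrict_apply, H]

lemma presheaf_map_map {U V W : X.Opens} (h : V ≤ U) (h' : W ≤ V) (r : Γ(X, U)) :
    (X.presheaf.map (homOfLE h').op).hom ((X.presheaf.map (homOfLE h).op).hom r) =
      (X.presheaf.map (homOfLE (h'.trans h)).op).hom r :=
  congr($(X.presheaf.map_comp (homOfLE h).op (homOfLE h').op) r).symm

lemma derRestrict_derRestrict {U V W : X.affineOpens} (h : V.1 ≤ U.1) (h' : W.1 ≤ V.1)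
    (δ : VectorField k X U.1) :
    derRestrict h' (derRestrict h δ) = derRestrict (h'.trans h) δ :=
  (derRestrict_eq _ fun r ↦ by
    rw [← presheaf_map_map h h', derRestrict_apply, derRestrict_apply, presheaf_map_map]).symm

/-- Every vector field on a basic open subset is a fraction of a vector field. -/
lemma exists_derRestrict_eq [LocallyOfFinitePresentation (X ↘ Spec (.of k))]
    {U V : X.affineOpens} (f : Γ(X, U.1)) (hV : V.1 = X.basicOpen f) (h : V.1 ≤ U.1)
    (δ : VectorField k X V.1) :
    ∃ (δ' : VectorField k X U.1) (m : ℕ),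
      derRestrict h δ' = (X.presheaf.map (homOfLE h).op).hom f ^ m • δ := by
  obtain ⟨V, hVa⟩ := V
  subst hV
  have := finitePresentation_sections k X U.2
  let φ := (X.presheaf.map (homOfLE h).op).hom
  let _ := φ.toAlgebra
  have : IsScalarTower k Γ(X, U.1) Γ(X, X.basicOpen f) :=
    .of_algebraMap_eq fun a ↦ (res_algebraMap k X h a).symm
  have : IsLocalization.Away f Γ(X, X.basicOpen f) := U.2.isLocalization_basicOpen f
  have : Algebra.FormallyEtale Γ(X, U.1) Γ(X, X.basicOpen f) := formallyEtale_map (V := ⟨_, hVa⟩) h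
  have := isLocalizedModule_derExtend k (R := Γ(X, U.1)) (R' := Γ(X, X.basicOpen f)) f
  obtain ⟨⟨δ', s⟩, hs⟩ := IsLocalizedModule.surj (.powers f)
    (derExtend k (R := Γ(X, U.1)) (R' := Γ(X, X.basicOpen f))) δ
  obtain ⟨m, hm⟩ := s.2
  refine ⟨δ', m, ?_⟩
  refine Eq.trans hs.symm ?_
  rw [Submonoid.smul_def, ← hm, ← map_pow]
  exact (algebraMap_smul Γ(X, X.basicOpen f) (f ^ m) δ).symm

end Restriction

/-! ### Charts of the cotangent bundle and linear functions. -/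

section Cotangent

variable {k : Type u} [Field k] {X : Scheme.{u}} [X.Over (Spec (.of k))]
  [LocallyOfFinitePresentation (X ↘ Spec (.of k))]

lemma top_le_cotangentChart_preimage (U : X.affineOpens) :
    ⊤ ≤ cotangentChart k X U ⁻¹ᵁ (cotangentProj k X ⁻¹ᵁ U.1) := by
  rw [cotangentProj_preimage]
  exact fun x _ ↦ ⟨x, rfl⟩

/-- Identities between functions on `T^*_U` are checked after pull-back to the chart, where
`cotangentSections` becomes the canonical identification with the symmetric algebra. -/
lemma cotangentSections_inv_appLE (U : X.affineOpens) :
    (cotangentSections k X U).inv ≫ (cotangentChart k X U).appLE _ ⊤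
      (top_le_cotangentChart_preimage U) = (Scheme.ΓSpecIso _).inv := by
  rw [Iso.inv_comp_eq, cotangentSections]
  simp only [Iso.trans_hom, Functor.mapIso_hom, Category.assoc, Iso.hom_inv_id, Category.comp_id]
  rw [Scheme.Hom.appIso_hom']
  rw [Iso.op_hom, eqToIso.hom, Scheme.Hom.map_appLE]

lemma cotangentChart_proj (U : X.affineOpens) :
    cotangentChart k X U ≫ cotangentProj k X =
      Spec.map (CommRingCat.ofHom (algebraMap Γ(X, U.1) _)) ≫ U.2.fromSpec := by
  refine ((cotangentGluingData k X).ι_toBase U).trans ?_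
  rfl

end Cotangent

lemma appLE_congr_hom {T Z : Scheme.{u}} {f g : T ⟶ Z} (e : f = g) {U : Z.Opens} {V : T.Opens}
    (h : V ≤ f ⁻¹ᵁ U) : f.appLE U V h = g.appLE U V (e ▸ h) := by
  subst e; rfl

lemma appLE_top_top {T Z : Scheme.{u}} (f : T ⟶ Z) (h : (⊤ : T.Opens) ≤ f ⁻¹ᵁ ⊤) :
    f.appLE ⊤ ⊤ h = f.appTop := by
  simp only [Scheme.Hom.appLE]
  exact (congrArg _ (T.presheaf.map_id _)).trans (Category.comp_id _)

lemma top_le_fromSpec_preimage {Z : Scheme.{u}} {U : Z.Opens} (hU : IsAffineOpen U) :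
    ⊤ ≤ hU.fromSpec ⁻¹ᵁ U := by
  rw [IsAffineOpen.fromSpec_preimage_self]

lemma fromSpec_appLE {Z : Scheme.{u}} {U : Z.Opens} (hU : IsAffineOpen U) :
    hU.fromSpec.appLE U ⊤ (top_le_fromSpec_preimage hU) = (Scheme.ΓSpecIso _).inv := by
  rw [Scheme.Hom.appLE, IsAffineOpen.fromSpec_app_self, Category.assoc, ← Functor.map_comp]
  exact (congrArg _ ((Spec Γ(Z, U)).presheaf.map_id _)).trans (Category.comp_id _)

section Cotangent

variable {k : Type u} [Field k] {X : Scheme.{u}} [X.Over (Spec (.of k))]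
  [LocallyOfFinitePresentation (X ↘ Spec (.of k))]

lemma isIso_cotangentChart_appLE (U : X.affineOpens) :
    IsIso ((cotangentChart k X U).appLE _ ⊤ (top_le_cotangentChart_preimage U)) := by
  have := cotangentSections_inv_appLE (k := k) U
  rw [Iso.inv_comp_eq] at this
  rw [this]
  infer_instance

lemma cotangentChart_appLE_linearFunction (U : X.affineOpens) (δ : VectorField k X U.1) :
    ((cotangentChart k X U).appLE _ ⊤ (top_le_cotangentChart_preimage U)).hom (linearFunction U δ) =
      (Scheme.ΓSpecIso _).inv.hom (SymmetricAlgebra.ι _ _ δ) :=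
  congr($(cotangentSections_inv_appLE (k := k) U).hom (SymmetricAlgebra.ι _ _ δ))

lemma cotangentSections_inv_algebraMap (U : X.affineOpens) (r : Γ(X, U.1)) :
    (cotangentSections k X U).inv (algebraMap _ _ r) = (cotangentProj k X).app U.1 r := by
  have h₁ := congr($(cotangentSections_inv_appLE (k := k) U).hom (algebraMap _ _ r))
  have := isIso_cotangentChart_appLE (k := k) U
  refine (ConcreteCategory.bijective_of_isIso ((cotangentChart k X U).appLE _ ⊤
    (top_le_cotangentChart_preimage U))).1 (h₁.trans ?_)
  have h₂ : (cotangentProj k X).app U.1 ≫ (cotangentChart k X U).appLE _ ⊤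
      (top_le_cotangentChart_preimage U) = CommRingCat.ofHom (algebraMap Γ(X, U.1) _) ≫
        (Scheme.ΓSpecIso _).inv := by
    rw [Scheme.Hom.app_eq_appLE, Scheme.Hom.appLE_comp_appLE]
    rw [appLE_congr_hom (cotangentChart_proj (k := k) U)]
    rw [← Scheme.Hom.appLE_comp_appLE _ _ _ ⊤ _ (top_le_fromSpec_preimage U.2)
      (by exact fun _ _ ↦ trivial)]
    refine congr($(fromSpec_appLE U.2) ≫ $(appLE_top_top _ _)).trans ?_
    exact (Scheme.ΓSpecIso_inv_naturality _).symm
  exact congr($(h₂).hom r).symm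

lemma cotangentChart_map {U V : X.AffineZariskiSite} (h : V ≤ U) :
    Spec.map ((symTangent k X).map (homOfLE h).op) ≫ cotangentChart k X U = cotangentChart k X V :=
  colimit.w (cotangentGluingData k X).functor (homOfLE h)

lemma cotangentProj_preimage_mono {U V : X.Opens} (h : V ≤ U) :
    cotangentProj k X ⁻¹ᵁ V ≤ cotangentProj k X ⁻¹ᵁ U :=
  fun _ hx ↦ h hx

/-- Inclusions of basic open subsets are the transition maps of the gluing data, so here the
compatibility is built into the charts. -/
lemma linearFunction_res_of_basicOpen {U V : X.affineOpens} (h : V.1 ≤ U.1)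
    (hs : ∃ f : Γ(X, U.1), X.basicOpen f = V.1) (δ : VectorField k X U.1) :
    ((cotangentBundle k X).presheaf.map (homOfLE (cotangentProj_preimage_mono h)).op).hom
      (linearFunction U δ) = linearFunction V (derRestrict h δ) := by
  let i : Opposite.op (show X.AffineZariskiSite from U) ⟶
    Opposite.op (show X.AffineZariskiSite from V) := (homOfLE hs).op
  have := isIso_cotangentChart_appLE (k := k) (X := X) V
  refine (ConcreteCategory.bijective_of_isIso ((cotangentChart k X V).appLE _ ⊤
    (top_le_cotangentChart_preimage V))).1 ?_
  refine Eq.trans ?_ (cotangentChart_appLE_linearFunction (k := k) V _).symm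
  have h₁ : (cotangentBundle k X).presheaf.map (homOfLE (cotangentProj_preimage_mono h)).op ≫
      (cotangentChart k X V).appLE _ ⊤ (top_le_cotangentChart_preimage V) =
      (cotangentChart k X U).appLE _ ⊤ (top_le_cotangentChart_preimage U) ≫
        (Spec.map ((symTangent k X).map i)).appTop := by
    rw [Scheme.Hom.map_appLE]
    refine (appLE_congr_hom (cotangentChart_map (k := k) hs).symm _).trans ?_
    refine (Scheme.Hom.appLE_comp_appLE _ _ _ ⊤ _ (top_le_cotangentChart_preimage U)
      (by exact fun _ _ ↦ trivial)).symm.trans ?_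
    exact congr(_ ≫ $(appLE_top_top _ _))
  refine congr($(h₁).hom (linearFunction U δ)).trans ?_
  refine congr((Spec.map ((symTangent k X).map i)).appTop.hom
    $(cotangentChart_appLE_linearFunction (k := k) U δ)).trans ?_
  refine congr($(Scheme.ΓSpecIso_inv_naturality ((symTangent k X).map i)).hom
    (SymmetricAlgebra.ι _ _ δ)).symm.trans ?_
  exact congrArg (Scheme.ΓSpecIso _).inv.hom (symDerRes_ι _ _ _ δ)

lemma exists_basicOpen_le {U V : X.affineOpens} {x : X} (hU : x ∈ U.1) (hV : x ∈ V.1) :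
    ∃ (W : X.affineOpens), x ∈ W.1 ∧ (∃ f : Γ(X, U.1), X.basicOpen f = W.1) ∧
      (∃ f : Γ(X, V.1), X.basicOpen f = W.1) ∧ W.1 ≤ U.1 ∧ W.1 ≤ V.1 := by
  obtain ⟨f, g, e, hf⟩ := exists_basicOpen_le_affine_inter U.2 V.2 x ⟨hU, hV⟩
  exact ⟨⟨X.basicOpen f, U.2.basicOpen f⟩, hf, ⟨f, rfl⟩, ⟨g, e.symm⟩, X.basicOpen_le f,
    e.trans_le (X.basicOpen_le g)⟩

/-- Linear functions are compatible with restriction. -/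
lemma linearFunction_res {U V : X.affineOpens} (h : V.1 ≤ U.1) (δ : VectorField k X U.1) :
    ((cotangentBundle k X).presheaf.map (homOfLE (cotangentProj_preimage_mono h)).op).hom
      (linearFunction U δ) = linearFunction V (derRestrict h δ) := by
  -- An arbitrary inclusion is not a transition map of the gluing data. Each point of `V` has a
  -- neighbourhood that is basic in both `U` and `V`, and equality is local.
  have H (x : V.1) := exists_basicOpen_le (h x.2) x.2
  choose W hx hWU hWV hWU' hWV' using H
  refine TopCat.Sheaf.eq_of_locally_eq' (cotangentBundle k X).sheaf
    (fun x : V.1 ↦ cotangentProj k X ⁻¹ᵁ (W x).1) _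
    (fun x ↦ homOfLE (cotangentProj_preimage_mono (hWV' x)))
    (fun y hy ↦ Opens.mem_iSup.mpr ⟨⟨_, hy⟩, hx _⟩) _ _ fun x ↦ ?_
  refine (presheaf_map_map _ _ _).trans ?_
  refine (linearFunction_res_of_basicOpen (hWU' x) (hWU x) δ).trans ?_
  refine Eq.trans ?_ (linearFunction_res_of_basicOpen (hWV' x) (hWV x) _).symm
  rw [derRestrict_derRestrict]

lemma linearFunction_add (U : X.affineOpens) (δ δ' : VectorField k X U.1) :
    linearFunction U (δ + δ') = linearFunction U δ + linearFunction U δ' := by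
  simp [linearFunction]

lemma linearFunction_smul (U : X.affineOpens) (r : Γ(X, U.1)) (δ : VectorField k X U.1) :
    linearFunction U (r • δ) = (cotangentProj k X).app U.1 r * linearFunction U δ := by
  rw [← cotangentSections_inv_algebraMap, linearFunction, linearFunction, map_smul,
    Algebra.smul_def, map_mul]

/-- The functions on `T^*_U` are generated by those on `U` and the linear functions. -/
lemma cotangent_ringHom_ext {U : X.affineOpens} {A : Type u} [CommRing A]
    {f g : Γ(cotangentBundle k X, cotangentProj k X ⁻¹ᵁ U.1) →+* A}
    (h₁ : ∀ r, f ((cotangentProj k X).app U.1 r) = g ((cotangentProj k X).app U.1 r))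
    (h₂ : ∀ δ, f (linearFunction U δ) = g (linearFunction U δ)) : f = g := by
  have : f.comp (cotangentSections k X U).inv.hom = g.comp (cotangentSections k X U).inv.hom := by
    refine sym_ringHom_ext (fun r ↦ ?_) h₂
    exact (congrArg f (cotangentSections_inv_algebraMap (k := k) U r)).trans
      ((h₁ r).trans (congrArg g (cotangentSections_inv_algebraMap (k := k) U r)).symm)
  refine RingHom.ext fun x ↦ ?_
  obtain ⟨y, rfl⟩ := (ConcreteCategory.bijective_of_isIso (cotangentSections k X U).inv).2 x
  exact congr($this y)

end Cotangent

/-! ### Morphisms into affine open subsets. -/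

section AffineTarget

lemma toSpecΓ_appLE_fromSpec {T Z : Scheme.{u}} (f : T ⟶ Z) {W : Z.Opens} (hW : IsAffineOpen W)
    (h : ⊤ ≤ f ⁻¹ᵁ W) : T.toSpecΓ ≫ Spec.map (f.appLE W ⊤ h) ≫ hW.fromSpec = f := by
  have e := Scheme.Opens.toSpecΓ_SpecMap_appLE f W ⊤ h
  have e₁ : (⊤ : T.Opens).ι ≫ T.toSpecΓ ≫ Spec.map (f.appLE W ⊤ h) ≫ hW.fromSpec =
      (⊤ : T.Opens).ι ≫ f := by
    rw [← reassoc_of% (Scheme.Opens.toSpecΓ_top (X := T)), reassoc_of% e,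
      IsAffineOpen.toSpecΓ_fromSpec, Scheme.Hom.resLE_comp_ι]
  have : IsIso (⊤ : T.Opens).ι := (Scheme.topIso T).isIso_hom
  exact (cancel_epi _).mp e₁

lemma hom_ext_of_appLE {T Z : Scheme.{u}} {f g : T ⟶ Z} {W : Z.Opens} (hW : IsAffineOpen W)
    (hf : ⊤ ≤ f ⁻¹ᵁ W) (hg : ⊤ ≤ g ⁻¹ᵁ W) (h : f.appLE W ⊤ hf = g.appLE W ⊤ hg) : f = g := by
  rw [← toSpecΓ_appLE_fromSpec f hW hf, ← toSpecΓ_appLE_fromSpec g hW hg, h]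

lemma hom_ext_of_locally {T Z : Scheme.{u}} {f g : T ⟶ Z}
    (h : ∀ x : T, ∃ V : T.Opens, x ∈ V ∧ V.ι ≫ f = V.ι ≫ g) : f = g := by
  choose V hx hV using h
  refine (T.openCoverOfIsOpenCover V (.mk (top_le_iff.mp fun x _ ↦
    Opens.mem_iSup.mpr ⟨x, hx x⟩))).hom_ext _ _ fun x ↦ hV x

end AffineTarget

/-! ### The universal property of the cotangent bundle. -/

section CotangentMaps

variable {k : Type u} [Field k] {X : Scheme.{u}} [X.Over (Spec (.of k))]
  [LocallyOfFinitePresentation (X ↘ Spec (.of k))]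

/-- Two morphisms to `T^*_X` over `X` are equal if the linear functions have the same pull-backs. -/
lemma cotangent_hom_ext {T : Scheme.{u}} {g₁ g₂ : T ⟶ cotangentBundle k X}
    (h : g₁ ≫ cotangentProj k X = g₂ ≫ cotangentProj k X)
    (H : ∀ x : T, ∃ (U : X.affineOpens) (V : T.Opens)
      (h₁ : V ≤ g₁ ⁻¹ᵁ (cotangentProj k X ⁻¹ᵁ U.1)) (h₂ : V ≤ g₂ ⁻¹ᵁ (cotangentProj k X ⁻¹ᵁ U.1)),
      x ∈ V ∧ ∀ δ, (g₁.appLE _ V h₁).hom (linearFunction U δ) =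
        (g₂.appLE _ V h₂).hom (linearFunction U δ)) : g₁ = g₂ := by
  refine hom_ext_of_locally fun x ↦ ?_
  obtain ⟨U, V, h₁, h₂, hx, H⟩ := H x
  refine ⟨V, hx, ?_⟩
  have hV : (⊤ : V.toScheme.Opens) ≤ V.ι ⁻¹ᵁ V := V.ι_preimage_self.ge
  refine hom_ext_of_appLE (isAffineOpen_cotangentProj_preimage k X U)
    (fun y _ ↦ h₁ y.2) (fun y _ ↦ h₂ y.2) ?_
  rw [← Scheme.Hom.appLE_comp_appLE V.ι g₁ _ V ⊤ h₁ hV,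
    ← Scheme.Hom.appLE_comp_appLE V.ι g₂ _ V ⊤ h₂ hV]
  congr 1
  refine CommRingCat.hom_ext (cotangent_ringHom_ext (fun r ↦ ?_) H)
  have e₁ := Scheme.Hom.comp_appLE g₁ (cotangentProj k X) U.1 V h₁
  have e₂ := Scheme.Hom.comp_appLE g₂ (cotangentProj k X) U.1 V h₂
  exact congr($(e₁.symm.trans ((appLE_congr_hom h _).trans e₂)).hom r)

/-- The existence half of the universal property of `Spec Sym T_X`: an additive map on vector fields
which is semilinear along `f` extends to the symmetric algebra. -/
lemma exists_cotangent_lift {T : Scheme.{u}} (f : T ⟶ X) (U : X.affineOpens) (hf : ⊤ ≤ f ⁻¹ᵁ U.1)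
    (l : VectorField k X U.1 →+ Γ(T, ⊤))
    (hl : ∀ r δ, l (r • δ) = (f.appLE U.1 ⊤ hf).hom r * l δ) :
    ∃ g : T ⟶ cotangentBundle k X, g ≫ cotangentProj k X = f ∧
      ∀ (h : ⊤ ≤ g ⁻¹ᵁ (cotangentProj k X ⁻¹ᵁ U.1)) (δ : VectorField k X U.1),
        (g.appLE _ ⊤ h).hom (linearFunction U δ) = l δ := by
  let _ : Algebra Γ(X, U.1) Γ(T, ⊤) := (f.appLE U.1 ⊤ hf).hom.toAlgebra
  let l' : VectorField k X U.1 →ₗ[Γ(X, U.1)] Γ(T, ⊤) :=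
    { l with map_smul' := fun r δ ↦ (hl r δ).trans (Algebra.smul_def r (l δ)).symm }
  let ψ := SymmetricAlgebra.lift l'
  let φ : CommRingCat.of (SymmetricAlgebra Γ(X, U.1) (VectorField k X U.1)) ⟶ Γ(T, ⊤) :=
    CommRingCat.ofHom ψ.toRingHom
  have hφ : CommRingCat.ofHom (algebraMap Γ(X, U.1) _) ≫ φ = f.appLE U.1 ⊤ hf :=
    CommRingCat.hom_ext (RingHom.ext fun r ↦ ψ.commutes r)
  refine ⟨T.toSpecΓ ≫ Spec.map φ ≫ cotangentChart k X U, ?_, fun h δ ↦ ?_⟩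
  · simp only [Category.assoc, cotangentChart_proj]
    rw [← Spec.map_comp_assoc, hφ]
    exact toSpecΓ_appLE_fromSpec f U.2 hf
  · have e₁ : (T.toSpecΓ ≫ Spec.map φ).appTop = (Scheme.ΓSpecIso _).hom ≫ φ := by
      rw [Scheme.Hom.comp_appTop, Scheme.toSpecΓ_appTop, Scheme.ΓSpecIso_naturality]
    have e₂ : (T.toSpecΓ ≫ Spec.map φ ≫ cotangentChart k X U).appLE _ ⊤ h =
        (cotangentChart k X U).appLE _ ⊤ (top_le_cotangentChart_preimage U) ≫
          (Scheme.ΓSpecIso _).hom ≫ φ := by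
      rw [← e₁, ← appLE_top_top _ (by exact fun _ _ ↦ trivial)]
      exact (Scheme.Hom.appLE_comp_appLE (T.toSpecΓ ≫ Spec.map φ) (cotangentChart k X U) _ ⊤ ⊤ _
        _).symm
    rw [e₂]
    refine congr(((Scheme.ΓSpecIso _).hom ≫ φ).hom
      $(cotangentChart_appLE_linearFunction (k := k) U δ)).trans ?_
    have e₃ : (Scheme.ΓSpecIso (.of (SymmetricAlgebra Γ(X, U.1) (VectorField k X U.1)))).inv ≫
      (Scheme.ΓSpecIso _).hom ≫ φ = φ := by simp
    refine congr($(e₃).hom (SymmetricAlgebra.ι _ _ δ)).trans ?_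
    exact SymmetricAlgebra.lift_ι_apply l' δ

lemma appLE_linearFunction_res {T : Scheme.{u}} (g : T ⟶ cotangentBundle k X)
    {U U' : X.affineOpens} (h : U'.1 ≤ U.1) {V V' : T.Opens}
    (hV : V ≤ g ⁻¹ᵁ (cotangentProj k X ⁻¹ᵁ U.1)) (hV' : V' ≤ g ⁻¹ᵁ (cotangentProj k X ⁻¹ᵁ U'.1))
    (hVV : V' ≤ V) (δ : VectorField k X U.1) :
    (T.presheaf.map (homOfLE hVV).op).hom ((g.appLE _ V hV).hom (linearFunction U δ)) =
      (g.appLE _ V' hV').hom (linearFunction U' (derRestrict h δ)) := by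
  rw [← linearFunction_res h]
  refine (congr($(Scheme.Hom.appLE_map g hV (homOfLE hVV).op).hom (linearFunction U δ))).trans ?_
  exact (congr($(Scheme.Hom.map_appLE g hV'
    (homOfLE (cotangentProj_preimage_mono h)).op).hom (linearFunction U δ))).symm

end CotangentMaps

/-! ### Monic polynomials and scaling of their roots. -/

section CharPoly

open Polynomial

/-- The polynomial `X^n + c_0 X^{n-1} + ⋯ + c_{n-1}`. -/
def monicOfCoeffs {R : Type*} [CommRing R] {n : ℕ} (c : Fin n → R) : R[X] :=
  X ^ n + ∑ i : Fin n, C (c i) * X ^ (n - (i.1 + 1))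

variable {R S : Type*} [CommRing R] [CommRing S] {n : ℕ} (c : Fin n → R)

lemma degree_sum_lt : (∑ i : Fin n, C (c i) * X ^ (n - (i.1 + 1))).degree < (n : WithBot ℕ) := by
  refine (degree_sum_le _ _).trans_lt ((Finset.sup_lt_iff (WithBot.bot_lt_coe n)).mpr fun i _ ↦ ?_)
  refine (degree_C_mul_X_pow_le _ _).trans_lt (Nat.cast_lt.mpr ?_)
  omega

lemma monic_monicOfCoeffs : (monicOfCoeffs c).Monic :=
  monic_X_pow_add (degree_sum_lt c)

lemma natDegree_monicOfCoeffs [Nontrivial R] : (monicOfCoeffs c).natDegree = n := by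
  rw [monicOfCoeffs, natDegree_add_eq_left_of_degree_lt, natDegree_X_pow]
  rw [degree_X_pow]
  exact degree_sum_lt c

lemma map_monicOfCoeffs (f : R →+* S) :
    (monicOfCoeffs c).map f = monicOfCoeffs fun i ↦ f (c i) := by
  simp [monicOfCoeffs, Polynomial.map_sum]

lemma eval₂_monicOfCoeffs (f : R →+* S) (x : S) :
    (monicOfCoeffs c).eval₂ f x = x ^ n + ∑ i : Fin n, f (c i) * x ^ (n - (i.1 + 1)) := by
  simp [monicOfCoeffs, eval₂_finsetSum]

/-- Giving `c i` the weight `i + 1` and the variable the weight one makes the polynomial homogeneous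
of weight `n`. -/
lemma eval₂_monicOfCoeffs_mul (f : R →+* S) (s : R) (x : S) :
    (monicOfCoeffs fun i ↦ s ^ (i.1 + 1) * c i).eval₂ f (f s * x) =
      f s ^ n * (monicOfCoeffs c).eval₂ f x := by
  rw [eval₂_monicOfCoeffs, eval₂_monicOfCoeffs, mul_add, mul_pow, Finset.mul_sum]
  congr 1
  refine Finset.sum_congr rfl fun i _ ↦ ?_
  have : f s ^ n = f s ^ (i.1 + 1) * f s ^ (n - (i.1 + 1)) := by
    rw [← pow_add]; congr 1; omega
  rw [this, map_mul, map_pow, mul_pow]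
  ring

lemma scaleRoots_prod_X_sub_C (l : Fin n → R) (s : R) :
    (∏ i, (X - C (l i))).scaleRoots s = ∏ i, (X - C (s * l i)) := by
  -- `mul_scaleRoots'` needs the product of the leading coefficients to be nonzero; both factors are
  -- monic, so that product is `1`.
  nontriviality R
  induction n with
  | zero => simp
  | succ n ih =>
    rw [Fin.prod_univ_succ, Fin.prod_univ_succ, mul_scaleRoots', ih fun i ↦ l i.succ]
    · simp [mul_comm s]
    · rw [(monic_prod_of_monic _ _ fun i _ ↦ monic_X_sub_C _).leadingCoeff]
      simp

/-- If `∏ (X - λ_i)` is the polynomial with coefficients `c`, then `∏ (X - s λ_i)` is the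
polynomial with coefficients `s^{i+1} c_i`. -/
lemma monicOfCoeffs_scale_eq_prod {c : Fin n → R} {l : Fin n → R}
    (h : monicOfCoeffs c = ∏ i, (X - C (l i))) (s : R) :
    monicOfCoeffs (fun i ↦ s ^ (i.1 + 1) * c i) = ∏ i, (X - C (s * l i)) := by
  nontriviality R
  have key : monicOfCoeffs (fun i ↦ s ^ (i.1 + 1) * c i) = (monicOfCoeffs c).scaleRoots s := by
    ext m
    rw [coeff_scaleRoots, natDegree_monicOfCoeffs]
    simp only [monicOfCoeffs, coeff_add, coeff_X_pow, finsetSum_coeff, coeff_C_mul, add_mul,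
      Finset.sum_mul]
    congr 1
    · split_ifs with h
      · simp [h]
      · simp
    · refine Finset.sum_congr rfl fun i _ ↦ ?_
      split_ifs with h
      · have : n - m = i.1 + 1 := by omega
        rw [this]; ring
      · simp
  rw [key, h, scaleRoots_prod_X_sub_C]

end CharPoly

/-! ### Evaluation of symmetric differentials at vector fields. -/

section Evaluation

variable {k : Type u} [Field k]

lemma evalVectorField_ι {X : Scheme.{u}} [X.Over (Spec (.of k))] {U : X.Opens}
    (δ : VectorField k X U) (f g : Γ(X, U)) :
    evalVectorField δ (SymmetricAlgebra.ι _ _ (f • KaehlerDifferential.D k _ g)) = f * δ g := by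
  refine (SymmetricAlgebra.lift_ι_apply _ _).trans ?_
  rw [map_smul, smul_eq_mul]
  exact congrArg _ (δ.liftKaehlerDifferential_comp_D g)

lemma symKaehlerMap_algebraMap {R R' : Type u} [CommRing R] [CommRing R'] [Algebra k R]
    [Algebra k R'] (φ : R →+* R') (hk : ∀ a, φ (algebraMap k R a) = algebraMap k R' a) (r : R) :
    symKaehlerMap φ hk (algebraMap R _ r) = algebraMap R' _ (φ r) := by
  let _ := φ.toAlgebra
  have : IsScalarTower k R R' := .of_algebraMap_eq fun a ↦ (hk a).symm
  exact symMap_algebraMap _ r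

lemma symKaehlerMap_ι {R R' : Type u} [CommRing R] [CommRing R'] [Algebra k R]
    [Algebra k R'] (φ : R →+* R') (hk : ∀ a, φ (algebraMap k R a) = algebraMap k R' a) (f g : R) :
    symKaehlerMap φ hk (SymmetricAlgebra.ι _ _ (f • KaehlerDifferential.D k _ g)) =
      SymmetricAlgebra.ι _ _ (φ f • KaehlerDifferential.D k _ (φ g)) := by
  let _ := φ.toAlgebra
  have : IsScalarTower k R R' := .of_algebraMap_eq fun a ↦ (hk a).symm
  refine (symMap_ι _ _).trans (congrArg _ ?_)
  rw [map_smul, KaehlerDifferential.map_D]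
  rfl

lemma kaehler_induction {R : Type u} [CommRing R] [Algebra k R] {P : Ω[R⁄k] → Prop}
    (h₁ : ∀ (f : R) (g : R), P (f • KaehlerDifferential.D k R g)) (h₂ : ∀ x y, P x → P y → P (x + y)) (x) :
    P x := by
  have hx : x ∈ Submodule.span R (Set.range (KaehlerDifferential.D k R)) := by
    rw [KaehlerDifferential.span_range_derivation]; trivial
  have h0 : P 0 := by simpa using h₁ 0 0
  -- The claim is strengthened to all multiples `f • x`, so that scalars arising in the span are
  -- absorbed into `f`; the original claim is the case `f = 1`.
  refine Submodule.span_induction (p := fun x _ ↦ ∀ f : R, P (f • x)) ?_ ?_ ?_ ?_ hx 1 |> (by simpa using ·)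
  · rintro _ ⟨g, rfl⟩ f
    exact h₁ f g
  · simpa using h0
  · intro x y _ _ hx hy f
    rw [smul_add]; exact h₂ _ _ (hx f) (hy f)
  · intro a x _ hx f
    rw [smul_smul]; exact hx _

lemma symKaehlerMap_comp {R₁ R₂ R₃ : Type u} [CommRing R₁] [CommRing R₂] [CommRing R₃]
    [Algebra k R₁] [Algebra k R₂] [Algebra k R₃] (φ : R₁ →+* R₂) (ψ : R₂ →+* R₃) (χ : R₁ →+* R₃)
    (hφ : ∀ a, φ (algebraMap k R₁ a) = algebraMap k R₂ a)
    (hψ : ∀ a, ψ (algebraMap k R₂ a) = algebraMap k R₃ a)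
    (hχ : ∀ a, χ (algebraMap k R₁ a) = algebraMap k R₃ a) (e : ∀ r, ψ (φ r) = χ r) (x) :
    symKaehlerMap ψ hψ (symKaehlerMap φ hφ x) = symKaehlerMap χ hχ x := by
  have : (symKaehlerMap ψ hψ).comp (symKaehlerMap φ hφ) = symKaehlerMap χ hχ := by
    refine sym_ringHom_ext (fun r ↦ ?_) fun x ↦ ?_
    · simp only [RingHom.comp_apply, symKaehlerMap_algebraMap, e]
    · induction x using kaehler_induction with
      | h₁ f g => simp only [RingHom.comp_apply, symKaehlerMap_ι, e]
      | h₂ x y hx hy => simp only [map_add, hx, hy]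
  exact congr($this x)

/-- If the vector fields `δ` and `∂` satisfy `δ ∘ φ = s • φ ∘ ∂`, then evaluation on `δ` of the
pull-back of a form of degree `i` is `s ^ i` times the pull-back of the evaluation on `∂`. -/
lemma eval_symKaehlerMap {X Z : Scheme.{u}} [X.Over (Spec (.of k))] [Z.Over (Spec (.of k))]
    {U : X.Opens} {W : Z.Opens} (φ : Γ(Z, W) →+* Γ(X, U))
    (hk : ∀ a, φ (algebraMap k _ a) = algebraMap k _ a) (δ : VectorField k X U)
    (d : VectorField k Z W) (s : Γ(X, U)) (h : ∀ f, δ (φ f) = s * φ (d f)) (i : ℕ)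
    {x : SymmetricAlgebra Γ(Z, W) Ω[Γ(Z, W)⁄k]}
    (hx : x ∈ LinearMap.range (SymmetricAlgebra.ι Γ(Z, W) Ω[Γ(Z, W)⁄k]) ^ i) :
    evalVectorField δ (symKaehlerMap φ hk x) = s ^ i * φ (evalVectorField d x) := by
  refine Submodule.pow_induction_on_left' _ (C := fun i x _ ↦
    evalVectorField δ (symKaehlerMap φ hk x) = s ^ i * φ (evalVectorField d x)) ?_ ?_ ?_ hx
  · intro r
    rw [symKaehlerMap_algebraMap, AlgHom.commutes, AlgHom.commutes]
    simp
  · intro x y i _ _ h₁ h₂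
    simp only [map_add, mul_add, h₁, h₂]
  · rintro _ ⟨m, rfl⟩ i x _ hx
    rw [map_mul, map_mul, map_mul, map_mul, hx]
    have : evalVectorField δ (symKaehlerMap φ hk (SymmetricAlgebra.ι _ _ m)) =
        s * φ (evalVectorField d (SymmetricAlgebra.ι _ _ m)) := by
      induction m using kaehler_induction with
      | h₁ f g =>
        rw [symKaehlerMap_ι, evalVectorField_ι, evalVectorField_ι, h, map_mul]; ring
      | h₂ x y hx hy => simp only [map_add, mul_add, hx, hy]
    rw [this, pow_succ]; ring

/-- The case `φ = id` of `eval_symKaehlerMap`, comparing `s • δ` with `δ`. -/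
lemma evalVectorField_smul {X : Scheme.{u}} [X.Over (Spec (.of k))]
    {U : X.Opens} (δ : VectorField k X U) (s : Γ(X, U)) (i : ℕ)
    {x : SymmetricAlgebra Γ(X, U) Ω[Γ(X, U)⁄k]}
    (hx : x ∈ LinearMap.range (SymmetricAlgebra.ι Γ(X, U) Ω[Γ(X, U)⁄k]) ^ i) :
    evalVectorField (s • δ) x = s ^ i * evalVectorField δ x := by
  have h := eval_symKaehlerMap (RingHom.id Γ(X, U)) (fun _ ↦ rfl) (s • δ) δ s (fun _ ↦ rfl) i hx
  have e : symKaehlerMap (k := k) (RingHom.id Γ(X, U)) (fun _ ↦ rfl) x = x := by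
    have : symKaehlerMap (k := k) (RingHom.id Γ(X, U)) (fun _ ↦ rfl) = RingHom.id _ := by
      refine sym_ringHom_ext (fun r ↦ symKaehlerMap_algebraMap _ _ _) fun x ↦ ?_
      induction x using kaehler_induction with
      | h₁ f g => exact symKaehlerMap_ι _ _ _ _
      | h₂ x y hx hy => simp only [map_add, hx, hy]
    exact congr($this x)
  rw [e] at h
  exact h

end Evaluation

/-! ### Characteristic polynomials and spectral functions. -/

section CharPoly

variable {k : Type u} [Field k] {X : Scheme.{u}} [X.Over (Spec (.of k))] {n : ℕ}

/-- The coefficients of `charPoly`. -/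
def charCoeff (a : HitchinBase k X n) (U : X.affineOpens) (δ : VectorField k X U.1) (i : Fin n) :
    Γ(X, U.1) :=
  (-1) ^ (i.1 + 1) * evalVectorField δ ((a i).val U)

lemma charPoly_eq (a : HitchinBase k X n) (U : X.affineOpens) (δ : VectorField k X U.1) :
    charPoly a U δ = monicOfCoeffs (charCoeff a U δ) := rfl

lemma charCoeff_smul (a : HitchinBase k X n) (U : X.affineOpens) (s : Γ(X, U.1))
    (δ : VectorField k X U.1) (i : Fin n) :
    charCoeff a U (s • δ) i = s ^ (i.1 + 1) * charCoeff a U δ i := by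
  rw [charCoeff, evalVectorField_smul _ _ _ ((a i).homogeneous U), charCoeff]; ring

lemma charCoeff_derRestrict (a : HitchinBase k X n) {U V : X.affineOpens} (h : V.1 ≤ U.1)
    (δ : VectorField k X U.1) (i : Fin n) :
    charCoeff a V (derRestrict h δ) i =
      (X.presheaf.map (homOfLE h).op).hom (charCoeff a U δ i) := by
  rw [charCoeff, ← (a i).compatible h, eval_symKaehlerMap _ _ _ δ 1 _ _ ((a i).homogeneous U)]
  · simp [charCoeff]
  · intro f
    rw [derRestrict_apply, one_mul]

lemma charPoly_derRestrict (a : HitchinBase k X n) {U V : X.affineOpens} (h : V.1 ≤ U.1)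
    (δ : VectorField k X U.1) :
    charPoly a V (derRestrict h δ) =
      (charPoly a U δ).map (X.presheaf.map (homOfLE h).op).hom := by
  rw [charPoly_eq, charPoly_eq, map_monicOfCoeffs]
  exact congrArg _ (funext fun i ↦ charCoeff_derRestrict a h δ i)

lemma charCoeff_pullback {C : Scheme.{u}} [C.Over (Spec (.of k))] {π : X ⟶ C}
    [π.IsOver (Spec (.of k))] {b : HitchinBase k C n} {a : HitchinBase k X n}
    (hab : IsPullbackOf π b a) {W : C.affineOpens} {U : X.affineOpens} (h : U.1 ≤ π ⁻¹ᵁ W.1)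
    (δ : VectorField k X U.1) (d : VectorField k C W.1) (s : Γ(X, U.1))
    (hs : ∀ f, δ ((π.appLE W.1 U.1 h).hom f) = s * (π.appLE W.1 U.1 h).hom (d f)) (i : Fin n) :
    charCoeff a U δ i = s ^ (i.1 + 1) * (π.appLE W.1 U.1 h).hom (charCoeff b W d i) := by
  rw [charCoeff, ← hab i W U h, eval_symKaehlerMap _ _ _ d s hs _ ((b i).homogeneous W), charCoeff,
    map_mul]
  simp only [map_pow, map_neg, map_one]
  ring

variable [LocallyOfFinitePresentation (X ↘ Spec (.of k))]

lemma spectralFunction_eq (a : HitchinBase k X n) (U : X.affineOpens) (δ : VectorField k X U.1) :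
    spectralFunction a U δ = (charPoly a U δ).eval₂ ((cotangentProj k X).app U.1).hom
      (linearFunction U δ) := by
  rw [spectralFunction, Polynomial.aeval_def]
  refine (Polynomial.hom_eval₂ _ _ (cotangentSections k X U).inv.hom _).trans ?_
  have : (cotangentSections k X U).inv.hom.comp (algebraMap _ _) =
      ((cotangentProj k X).app U.1).hom :=
    RingHom.ext fun r ↦ cotangentSections_inv_algebraMap (k := k) U r
  exact congr(Polynomial.eval₂ $this (linearFunction U δ) (charPoly a U δ))

lemma spectralFunction_smul (a : HitchinBase k X n) (U : X.affineOpens) (s : Γ(X, U.1))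
    (δ : VectorField k X U.1) :
    spectralFunction a U (s • δ) = ((cotangentProj k X).app U.1 s) ^ n * spectralFunction a U δ := by
  rw [spectralFunction_eq, spectralFunction_eq, linearFunction_smul, charPoly_eq, charPoly_eq,
    funext (charCoeff_smul a U s δ)]
  exact eval₂_monicOfCoeffs_mul _ _ _ _

lemma spectralFunction_res (a : HitchinBase k X n) {U V : X.affineOpens} (h : V.1 ≤ U.1)
    (δ : VectorField k X U.1) :
    ((cotangentBundle k X).presheaf.map (homOfLE (cotangentProj_preimage_mono h)).op).hom
      (spectralFunction a U δ) = spectralFunction a V (derRestrict h δ) := by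
  rw [spectralFunction_eq, spectralFunction_eq, Polynomial.hom_eval₂, linearFunction_res h,
    charPoly_derRestrict, Polynomial.eval₂_map]
  refine congr(Polynomial.eval₂ $(?_) _ _)
  have := (cotangentProj k X).naturality (homOfLE h).op
  exact congr(($this).hom).symm

/-- The pull-back of a spectral function along a morphism to the cotangent bundle. -/
lemma appLE_spectralFunction (a : HitchinBase k X n) (U : X.affineOpens) (δ : VectorField k X U.1)
    {T : Scheme.{u}} (g : T ⟶ cotangentBundle k X) {f : T ⟶ X} (hf : g ≫ cotangentProj k X = f)
    {V : T.Opens} (hV : V ≤ g ⁻¹ᵁ (cotangentProj k X ⁻¹ᵁ U.1)) (hV' : V ≤ f ⁻¹ᵁ U.1) :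
    (g.appLE _ V hV).hom (spectralFunction a U δ) =
      (charPoly a U δ).eval₂ (f.appLE U.1 V hV').hom ((g.appLE _ V hV).hom (linearFunction U δ)) := by
  subst hf
  rw [spectralFunction_eq, Polynomial.hom_eval₂]
  have := Scheme.Hom.comp_appLE g (cotangentProj k X) U.1 V hV'
  rw [this]
  rfl

/-- The pull-back of a spectral function vanishes if it does so locally. -/
lemma appLE_spectralFunction_eq_zero (a : HitchinBase k X n) {T : Scheme.{u}}
    (g : T ⟶ cotangentBundle k X)
    (H : ∀ x : T, ∃ (U : X.affineOpens) (V : T.Opens)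
      (h : V ≤ g ⁻¹ᵁ (cotangentProj k X ⁻¹ᵁ U.1)), x ∈ V ∧
        ∀ δ, (g.appLE _ V h).hom (spectralFunction a U δ) = 0)
    (U : X.affineOpens) (δ : VectorField k X U.1) {V : T.Opens}
    (hV : V ≤ g ⁻¹ᵁ (cotangentProj k X ⁻¹ᵁ U.1)) :
    (g.appLE _ V hV).hom (spectralFunction a U δ) = 0 := by
  choose U' V' h' hx H using H
  have hU (x : V) := exists_basicOpen_le (h' x.1 (hx x.1)) (hV x.2)
  choose W hxW hWU hWV hWU' hWV' using hU
  refine TopCat.Sheaf.eq_of_locally_eq' T.sheaf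
    (fun x : V ↦ (V ⊓ V' x.1) ⊓ g ⁻¹ᵁ (cotangentProj k X ⁻¹ᵁ (W x).1)) _
    (fun x ↦ homOfLE (inf_le_left.trans inf_le_left))
    (fun y hy ↦ Opens.mem_iSup.mpr ⟨⟨_, hy⟩, ⟨hy, hx _⟩, hxW _⟩) _ _ fun x ↦ ?_
  refine Eq.trans ?_ (map_zero (T.presheaf.map (homOfLE (inf_le_left.trans inf_le_left)).op).hom).symm
  obtain ⟨f, hf⟩ := hWU x
  -- The hypothesis concerns vector fields on the larger set `U'`. The given one becomes the
  -- restriction of such a field after multiplication by `f ^ m`, which multiplies the spectral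
  -- function by the unit `f ^ (m n)`.
  obtain ⟨δ', m, hm⟩ := exists_derRestrict_eq (k := k) f hf.symm (hWU' x)
    (derRestrict (hWV' x) δ)
  have h₁ := H x.1 δ'
  set V'' := (V ⊓ V' x.1) ⊓ g ⁻¹ᵁ (cotangentProj k X ⁻¹ᵁ (W x).1)
  have hW : V'' ≤ g ⁻¹ᵁ (cotangentProj k X ⁻¹ᵁ (W x).1) := inf_le_right
  have key (U₁ : X.affineOpens) (V₁ : T.Opens) (hV₁ : V₁ ≤ g ⁻¹ᵁ (cotangentProj k X ⁻¹ᵁ U₁.1))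
      (hU₁ : (W x).1 ≤ U₁.1) (hV₂ : V'' ≤ V₁) (η : VectorField k X U₁.1) :
      (T.presheaf.map (homOfLE hV₂).op).hom ((g.appLE _ V₁ hV₁).hom (spectralFunction a U₁ η)) =
        (g.appLE _ V'' hW).hom (spectralFunction a (W x) (derRestrict hU₁ η)) := by
    rw [← spectralFunction_res a hU₁]
    refine (congr($(Scheme.Hom.appLE_map g hV₁ (homOfLE hV₂).op).hom (spectralFunction a U₁ η))).trans ?_
    exact (congr($(Scheme.Hom.map_appLE g hW
      (homOfLE (cotangentProj_preimage_mono hU₁)).op).hom (spectralFunction a U₁ η))).symm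
  have h₂ := key (U' x.1) (V' x.1) (h' x.1) (hWU' x) (inf_le_left.trans inf_le_right) δ'
  rw [h₁, map_zero, hm, spectralFunction_smul, map_mul] at h₂
  refine (key U V hV (hWV' x) _ δ).trans ?_
  refine ((IsUnit.mul_right_eq_zero ?_).mp h₂.symm)
  have hu : IsUnit ((X.presheaf.map (homOfLE (hWU' x)).op).hom f) := by
    have := RingedSpace.isUnit_res_basicOpen X.toRingedSpace f
    have h3 := (this.map (X.presheaf.map (homOfLE hf.ge).op).hom)
    refine (congrArg IsUnit ?_).mp h3
    exact presheaf_map_map (X.basicOpen_le f) hf.ge f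
  exact (((hu.pow m).map ((cotangentProj k X).app (W x).1).hom).pow n).map (g.appLE _ V'' hW).hom

end CharPoly

/-! ### Kernels of morphisms, tested locally. -/

section IdealSheaf

/-- An ideal sheaf is contained in the kernel of `g` if its sections vanish on the source of `g`,
locally. -/
lemma le_ker_of_locally {T Z : Scheme.{u}} (g : T ⟶ Z) (I : Z.IdealSheafData)
    (H : ∀ x : T, ∃ (U : Z.affineOpens) (V : T.Opens) (h : V ≤ g ⁻¹ᵁ U.1), x ∈ V ∧
      ∀ f ∈ I.ideal U, (g.appLE U.1 V h).hom f = 0) : I ≤ g.ker := by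
  refine Scheme.IdealSheafData.le_ofIdeals_iff.mpr fun U f hf ↦ ?_
  rw [RingHom.mem_ker]
  choose U' V h hx H using H
  have hU (x : g ⁻¹ᵁ U.1) := exists_basicOpen_le (h x.1 (hx x.1)) x.2
  choose W hxW _ _ hWU' hWV' using hU
  refine TopCat.Sheaf.eq_of_locally_eq' T.sheaf
    (fun x : g ⁻¹ᵁ U.1 ↦ (g ⁻¹ᵁ U.1 ⊓ V x.1) ⊓ g ⁻¹ᵁ (W x).1) _
    (fun x ↦ homOfLE (inf_le_left.trans inf_le_left))
    (fun y hy ↦ Opens.mem_iSup.mpr ⟨⟨_, hy⟩, ⟨hy, hx _⟩, hxW _⟩) _ _ fun x ↦ ?_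
  refine Eq.trans ?_ (map_zero (T.presheaf.map (homOfLE (inf_le_left.trans inf_le_left)).op).hom).symm
  set V'' := (g ⁻¹ᵁ U.1 ⊓ V x.1) ⊓ g ⁻¹ᵁ (W x).1
  have hW : V'' ≤ g ⁻¹ᵁ (W x).1 := inf_le_right
  have e₁ : (T.presheaf.map (homOfLE (inf_le_left.trans inf_le_left)).op).hom ((g.app U.1).hom f) =
      (g.appLE _ V'' hW).hom ((Z.presheaf.map (homOfLE (hWV' x)).op).hom f) :=
    (congr($(Scheme.Hom.map_appLE g hW (homOfLE (hWV' x)).op).hom f)).symm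
  have hf' : (Z.presheaf.map (homOfLE (hWV' x)).op).hom f ∈ I.ideal (W x) :=
    I.ideal_le_comap_ideal (U := W x) (V := U) (hWV' x) hf
  -- By quasi-coherence the ideal on `W` is generated by restrictions from `U'`, where the vanishing
  -- is assumed.
  have hle : I.ideal (W x) ≤ RingHom.ker (g.appLE _ V'' hW).hom := by
    rw [← I.map_ideal (U := W x) (V := U' x.1) (hWU' x), Ideal.map_le_iff_le_comap]
    intro f' hf'
    have e₂ : (T.presheaf.map (homOfLE (inf_le_left.trans inf_le_right)).op).hom
        ((g.appLE _ (V x.1) (h x.1)).hom f') =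
        (g.appLE _ V'' hW).hom ((Z.presheaf.map (homOfLE (hWU' x)).op).hom f') :=
      (congr($(Scheme.Hom.appLE_map g (h x.1)
        (homOfLE (inf_le_left.trans inf_le_right)).op).hom f')).trans
      (congr($(Scheme.Hom.map_appLE g hW (homOfLE (hWU' x)).op).hom f')).symm
    rw [H x.1 f' hf', map_zero] at e₂
    exact e₂.symm
  exact e₁.trans (hle hf')

end IdealSheaf

/-! ### Equations and universal property of the spectral cover. -/

section SpectralCover

variable {k : Type u} [Field k] {X : Scheme.{u}} [X.Over (Spec (.of k))]
  [LocallyOfFinitePresentation (X ↘ Spec (.of k))] {n : ℕ}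

instance : IsAffineHom (cotangentProj k X) := by
  refine isAffineHom_of_forall_exists_isAffineOpen _ fun x ↦ ?_
  obtain ⟨_, ⟨U, hU, rfl⟩, hx, -⟩ :=
    X.isBasis_affineOpens.exists_subset_of_mem_open (Set.mem_univ x) isOpen_univ
  exact ⟨U, hx, hU, isAffineOpen_cotangentProj_preimage k X ⟨U, hU⟩⟩

/-- The affine open subset `T^*_U` of `T^*_X`. -/
abbrev cotangentOpen (U : X.affineOpens) : (cotangentBundle k X).affineOpens :=
  ⟨cotangentProj k X ⁻¹ᵁ U.1, isAffineOpen_cotangentProj_preimage k X U⟩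

/-- The ideal of functions on `T^*_U` generated by the spectral functions. -/
def spectralSpan (a : HitchinBase k X n) (U : X.affineOpens) :
    Ideal Γ(cotangentBundle k X, cotangentProj k X ⁻¹ᵁ U.1) :=
  Ideal.span (Set.range (spectralFunction a U))

/-- The closed subscheme of `T^*_U` defined by the spectral functions. -/
def spectralChart (a : HitchinBase k X n) (U : X.affineOpens) :
    Spec (.of (Γ(cotangentBundle k X, cotangentProj k X ⁻¹ᵁ U.1) ⧸ spectralSpan a U)) ⟶
      cotangentBundle k X :=
  Spec.map (CommRingCat.ofHom (Ideal.Quotient.mk _)) ≫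
    (isAffineOpen_cotangentProj_preimage k X U).fromSpec

lemma top_le_spectralChart_preimage (a : HitchinBase k X n) (U : X.affineOpens) :
    ⊤ ≤ spectralChart a U ⁻¹ᵁ (cotangentProj k X ⁻¹ᵁ U.1) := by
  rw [spectralChart, Scheme.Hom.comp_preimage, IsAffineOpen.fromSpec_preimage_self]
  exact le_rfl

lemma spectralChart_appLE (a : HitchinBase k X n) (U : X.affineOpens) :
    (spectralChart a U).appLE _ ⊤ (top_le_spectralChart_preimage a U) =
      CommRingCat.ofHom (Ideal.Quotient.mk _) ≫ (Scheme.ΓSpecIso _).inv := by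
  refine (Scheme.Hom.appLE_comp_appLE _ _ _ ⊤ _ (top_le_fromSpec_preimage
    (isAffineOpen_cotangentProj_preimage k X U)) (by exact fun _ _ ↦ trivial)).symm.trans ?_
  refine congr($(fromSpec_appLE (isAffineOpen_cotangentProj_preimage k X U)) ≫
    $(appLE_top_top _ _)).trans ?_
  exact (Scheme.ΓSpecIso_inv_naturality _).symm

lemma spectralChart_app_eq_zero_iff (a : HitchinBase k X n) (U : X.affineOpens) (f) :
    ((spectralChart a U).appLE _ ⊤ (top_le_spectralChart_preimage a U)).hom f = 0 ↔
      f ∈ spectralSpan a U := by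
  rw [spectralChart_appLE, ← Ideal.Quotient.eq_zero_iff_mem]
  exact map_eq_zero_iff _ (ConcreteCategory.bijective_of_isIso (Scheme.ΓSpecIso _).inv).1

lemma spectralFunction_mem_ker {T : Scheme.{u}} (a : HitchinBase k X n)
    (g : T ⟶ cotangentBundle k X) [QuasiCompact g]
    (H : ∀ x : T, ∃ (U : X.affineOpens) (V : T.Opens)
      (h : V ≤ g ⁻¹ᵁ (cotangentProj k X ⁻¹ᵁ U.1)), x ∈ V ∧
        ∀ δ, (g.appLE _ V h).hom (spectralFunction a U δ) = 0)
    (U : X.affineOpens) (δ : VectorField k X U.1) :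
    spectralFunction a U δ ∈ g.ker.ideal (cotangentOpen U) := by
  rw [Scheme.Hom.ker_apply]
  have := appLE_spectralFunction_eq_zero a g H U δ le_rfl
  rwa [← Scheme.Hom.app_eq_appLE] at this

instance (a : HitchinBase k X n) : IsClosedImmersion (spectralIncl a) :=
  inferInstanceAs (IsClosedImmersion (spectralIdeal a).subschemeι)

lemma ker_spectralIncl (a : HitchinBase k X n) : (spectralIncl a).ker = spectralIdeal a :=
  Scheme.IdealSheafData.ker_subschemeι _

variable [CompactSpace X] [X.IsSeparated]

instance : (cotangentBundle k X).IsSeparated := by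
  have : IsSeparated (cotangentProj k X) := inferInstance
  constructor
  rw [← terminal.comp_from (cotangentProj k X)]
  infer_instance

instance (a : HitchinBase k X n) (U : X.affineOpens) : QuasiCompact (spectralChart a U) := by
  infer_instance

/-- The ideal sheaf of the spectral cover is generated by the spectral functions. -/
lemma spectralIdeal_ideal (a : HitchinBase k X n) (U : X.affineOpens) :
    (spectralIdeal a).ideal (cotangentOpen U) = spectralSpan a U := by
  -- On the chart over `U` the functions attached to `U` vanish by construction. Vanishing is local
  -- and independent of the affine open used, so those attached to every `U'` vanish as well.
  have hker (U : X.affineOpens) (U' : X.affineOpens) (δ : VectorField k X U'.1) :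
      spectralFunction a U' δ ∈ (spectralChart a U).ker.ideal (cotangentOpen U') := by
    refine spectralFunction_mem_ker a _ (fun x ↦ ⟨U, ⊤, top_le_spectralChart_preimage a U,
      trivial, fun δ ↦ ?_⟩) U' δ
    rw [spectralChart_app_eq_zero_iff]
    exact Ideal.subset_span ⟨δ, rfl⟩
  have hker' (U : X.affineOpens) :
      (spectralChart a U).ker.ideal (cotangentOpen U) ≤ spectralSpan a U := by
    rw [Scheme.Hom.ker_apply]
    intro f hf
    rw [← spectralChart_app_eq_zero_iff]
    have e := Scheme.Hom.map_appLE (spectralChart a U) (top_le_spectralChart_preimage a U) (𝟙 _)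
    rw [RingHom.mem_ker] at hf
    refine (congr(((Spec _).presheaf.map (homOfLE (top_le_spectralChart_preimage a U)).op).hom
      $hf)).trans (map_zero _)
  refine le_antisymm ?_ ?_
  · refine le_trans ?_ (hker' U)
    have : spectralIdeal a ≤ (spectralChart a U).ker := sInf_le fun U' δ ↦ hker U U' δ
    exact this _
  · -- the infimum over a finite cover of the kernels of the charts is minimal
    obtain ⟨s, hs⟩ := (isCompact_univ (X := X)).elim_finite_subcover
      (fun U : X.affineOpens ↦ (U.1 : Set X)) (fun U ↦ U.1.2) (fun x _ ↦ by
        obtain ⟨_, ⟨U, hU, rfl⟩, hx, -⟩ :=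
          X.isBasis_affineOpens.exists_subset_of_mem_open (Set.mem_univ x) isOpen_univ
        exact Set.mem_iUnion.mpr ⟨⟨U, hU⟩, hx⟩)
    let J : (cotangentBundle k X).IdealSheafData := ⨅ U : s, (spectralChart a U.1).ker
    have hJ (U : X.affineOpens) (δ : VectorField k X U.1) :
        spectralFunction a U δ ∈ J.ideal (cotangentOpen U) := by
      have : J.ideal = ⨅ U : s, (spectralChart a U.1).ker.ideal :=
        Scheme.IdealSheafData.ideal_iInf _
      rw [this, iInf_apply, Ideal.mem_iInf]
      exact fun U' ↦ hker U'.1 U δ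
    -- The inclusion of `J` in a competitor `I` is tested on the finite cover. There `J` lies in the
    -- kernel of the chart, which is spanned by spectral functions, and these belong to `I`.
    have hle : J ≤ spectralIdeal a := by
      refine le_sInf fun I hI ↦ ?_
      refine Scheme.IdealSheafData.le_of_iSup_eq_top (fun U : s ↦ cotangentOpen U.1) ?_ fun U ↦ ?_
      · refine top_le_iff.mp fun x _ ↦ ?_
        obtain ⟨U, hU⟩ := Set.mem_iUnion.mp (hs (Set.mem_univ (cotangentProj k X x)))
        obtain ⟨hU, hx⟩ := Set.mem_iUnion.mp hU
        exact Opens.mem_iSup.mpr ⟨⟨U, hU⟩, hx⟩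
      · have h₁ : J ≤ (spectralChart a U.1).ker := iInf_le _ U
        refine (h₁ _).trans ((hker' U.1).trans ?_)
        rw [spectralSpan, Ideal.span_le]
        rintro _ ⟨δ, rfl⟩
        exact hI U.1 δ
    rw [spectralSpan, Ideal.span_le]
    rintro _ ⟨δ, rfl⟩
    exact hle _ (hJ U δ)

/-- The spectral functions vanish on the spectral cover. -/
lemma spectralIncl_appLE (a : HitchinBase k X n) (U : X.affineOpens) (δ : VectorField k X U.1)
    {V : (spectralCover a).Opens} (h : V ≤ spectralIncl a ⁻¹ᵁ (cotangentProj k X ⁻¹ᵁ U.1)) :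
    ((spectralIncl a).appLE _ V h).hom (spectralFunction a U δ) = 0 := by
  have h₁ : spectralFunction a U δ ∈ (spectralIncl a).ker.ideal (cotangentOpen U) := by
    rw [ker_spectralIncl, spectralIdeal_ideal]
    exact Ideal.subset_span ⟨δ, rfl⟩
  have h₂ := Scheme.Hom.ideal_ker_le _ _ h₁
  rw [RingHom.mem_ker] at h₂
  exact (congr(((spectralCover a).presheaf.map (homOfLE h).op).hom $h₂)).trans (map_zero _)

/-- The universal property of the spectral cover. -/
lemma exists_spectral_lift {T : Scheme.{u}} (a : HitchinBase k X n) (g : T ⟶ cotangentBundle k X)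
    (H : ∀ x : T, ∃ (U : X.affineOpens) (V : T.Opens)
      (h : V ≤ g ⁻¹ᵁ (cotangentProj k X ⁻¹ᵁ U.1)), x ∈ V ∧
        ∀ δ, (g.appLE _ V h).hom (spectralFunction a U δ) = 0) :
    ∃ q : T ⟶ spectralCover a, q ≫ spectralIncl a = g := by
  have : (spectralIncl a).ker ≤ g.ker := by
    rw [ker_spectralIncl]
    refine le_ker_of_locally g _ fun x ↦ ?_
    obtain ⟨U, V, h, hx, H⟩ := H x
    refine ⟨cotangentOpen U, V, h, hx, fun f hf ↦ ?_⟩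
    rw [spectralIdeal_ideal] at hf
    have hle : spectralSpan a U ≤ RingHom.ker (g.appLE _ V h).hom := by
      rw [spectralSpan, Ideal.span_le]
      rintro _ ⟨δ, rfl⟩
      exact H δ
    exact hle hf
  exact ⟨IsClosedImmersion.lift _ g this, IsClosedImmersion.lift_fac _ _ _⟩

end SpectralCover

/-! ### Derivations determined by their values on a subalgebra. -/

section Derivations

variable {k R R' : Type u} [CommRing k] [CommRing R] [CommRing R'] [Algebra k R] [Algebra k R']

/-- Arbitrary coefficient modules are allowed, since the derivations compared below take values in
Kähler differentials and in functions on another scheme. -/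
lemma derivation_ext_of_formallyEtale' [Algebra R R'] [IsScalarTower k R R']
    [Algebra.FormallyEtale R R'] {M : Type u} [AddCommGroup M] [Module R' M] [Module k M]
    [IsScalarTower k R' M] {d₁ d₂ : Derivation k R' M}
    (h : ∀ r, d₁ (algebraMap R R' r) = d₂ (algebraMap R R' r)) : d₁ = d₂ := by
  let _ : Module R M := Module.compHom M (algebraMap R R')
  have _ : IsScalarTower R R' M := ⟨fun a b m ↦ by
    rw [Algebra.smul_def, mul_smul]; rfl⟩
  have _ : IsScalarTower k R M := ⟨fun a b m ↦ by
    change algebraMap R R' (a • b) • m = a • (algebraMap R R' b • m)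
    rw [← smul_assoc]; congr 1
    rw [Algebra.smul_def a b, map_mul, ← IsScalarTower.algebraMap_apply, ← Algebra.smul_def]⟩
  have hb := KaehlerDifferential.isBaseChange_of_formallyEtale k R R'
  let l (δ : Derivation k R' M) : Ω[R⁄k] →ₗ[R] M :=
    (δ.liftKaehlerDifferential.restrictScalars R).comp (KaehlerDifferential.map k k R R')
  have hl : l d₁ = l d₂ := Derivation.liftKaehlerDifferential_unique _ _ <| Derivation.ext fun r ↦ by
    simpa [l] using h r
  have hd : d₁.liftKaehlerDifferential = d₂.liftKaehlerDifferential :=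
    hb.algHom_ext _ _ fun x ↦ congr($hl x)
  rw [← Derivation.liftKaehlerDifferential_comp d₁, hd, Derivation.liftKaehlerDifferential_comp]

/-- If `D f = d f • D t` for all `f`, then every derivation is determined by its value at `t`. -/
lemma der_apply_of_D_eq (φ : R →+* R') (hk : ∀ a, φ (algebraMap k R a) = algebraMap k R' a)
    {t : R} {d : Derivation k R R}
    (h : ∀ f, KaehlerDifferential.D k R f = d f • KaehlerDifferential.D k R t)
    (δ : Derivation k R' R') (f : R) : δ (φ f) = δ (φ t) * φ (d f) := by
  let _ := φ.toAlgebra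
  have : IsScalarTower k R R' := .of_algebraMap_eq fun a ↦ (hk a).symm
  let δ' : Derivation k R R' := δ.compAlgebraMap R
  have h₁ := congrArg δ'.liftKaehlerDifferential (h f)
  rw [map_smul, Derivation.liftKaehlerDifferential_comp_D,
    Derivation.liftKaehlerDifferential_comp_D, Algebra.smul_def, mul_comm] at h₁
  exact h₁

end Derivations

/-! ### Étale coordinates on a curve. -/

section Charts

variable {k : Type u} [Field k] {Z : Scheme.{u}} [Z.Over (Spec (.of k))]

/-- `t` is an étale coordinate on the affine open subset `W` of a curve, and `d` is the
vector field `∂/∂t`. -/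
structure IsChart (W : Z.affineOpens) (t : Γ(Z, W.1)) (d : VectorField k Z W.1) : Prop where
  apply_self : d t = 1
  D_eq (f : Γ(Z, W.1)) : KaehlerDifferential.D k _ f = d f • KaehlerDifferential.D k _ t

lemma IsChart.res {W W' : Z.affineOpens} {t : Γ(Z, W.1)} {d : VectorField k Z W.1}
    (h : IsChart W t d) (hW : W'.1 ≤ W.1) :
    IsChart W' ((Z.presheaf.map (homOfLE hW).op).hom t) (derRestrict hW d) where
  apply_self := by rw [derRestrict_apply, h.apply_self, map_one]
  D_eq f := by
    let φ := (Z.presheaf.map (homOfLE hW).op).hom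
    let _ := φ.toAlgebra
    have : IsScalarTower k Γ(Z, W.1) Γ(Z, W'.1) :=
      .of_algebraMap_eq fun a ↦ (res_algebraMap k Z hW a).symm
    have : Algebra.FormallyEtale Γ(Z, W.1) Γ(Z, W'.1) := formallyEtale_map hW
    let d₂ : Derivation k Γ(Z, W'.1) Ω[Γ(Z, W'.1)⁄k] :=
      (LinearMap.toSpanSingleton _ _ (KaehlerDifferential.D k _ (φ t))).compDer (derRestrict hW d)
    have : KaehlerDifferential.D k Γ(Z, W'.1) = d₂ := by
      refine derivation_ext_of_formallyEtale' (R := Γ(Z, W.1)) fun r ↦ ?_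
      have h₁ := congrArg (KaehlerDifferential.map k k Γ(Z, W.1) Γ(Z, W'.1)) (h.D_eq r)
      rw [map_smul, KaehlerDifferential.map_D, KaehlerDifferential.map_D] at h₁
      refine h₁.trans ?_
      have h₂ : d₂ (algebraMap Γ(Z, W.1) Γ(Z, W'.1) r) = derRestrict hW d (φ r) •
        KaehlerDifferential.D k _ (φ t) := rfl
      rw [h₂, derRestrict_apply]
      rfl
    exact congr($this f)

/-- In a chart the differential of `π` is given by the single function `δ(π^*t)`. All computations
with the codifferential rest on this formula. -/
lemma IsChart.der_apply {X : Scheme.{u}} [X.Over (Spec (.of k))] {π : X ⟶ Z}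
    [π.IsOver (Spec (.of k))] {W : Z.affineOpens} {t : Γ(Z, W.1)} {d : VectorField k Z W.1}
    (h : IsChart W t d) {U : X.Opens} (hU : U ≤ π ⁻¹ᵁ W.1) (δ : VectorField k X U)
    (f : Γ(Z, W.1)) : δ ((π.appLE W.1 U hU).hom f) =
      δ ((π.appLE W.1 U hU).hom t) * (π.appLE W.1 U hU).hom (d f) :=
  der_apply_of_D_eq _ (appLE_algebraMap π W.1 U hU) h.D_eq δ f

lemma IsChart.eq_smul {W : Z.affineOpens} {t : Γ(Z, W.1)} {d : VectorField k Z W.1}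
    (h : IsChart W t d) (δ : VectorField k Z W.1) : δ = δ t • d :=
  Derivation.ext fun f ↦ by
    have := congrArg δ.liftKaehlerDifferential (h.D_eq f)
    rw [map_smul, Derivation.liftKaehlerDifferential_comp_D,
      Derivation.liftKaehlerDifferential_comp_D] at this
    rw [this, Derivation.smul_apply, smul_eq_mul, smul_eq_mul, mul_comm]

/-- Smooth `k`-schemes of dimension `m` are locally étale over the affine space. -/
lemma exists_etale_mvPolynomial (m : ℕ) [SmoothOfRelativeDimension m (Z ↘ Spec (.of k))] (x : Z) :
    ∃ (W : Z.affineOpens) (g : MvPolynomial (Fin m) k →+* Γ(Z, W.1)),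
      x ∈ W.1 ∧ g.comp MvPolynomial.C = algebraMap k _ ∧ g.Etale := by
  obtain ⟨U, hU, V, hV, hxV, e, h⟩ :=
    SmoothOfRelativeDimension.exists_isStandardSmoothOfRelativeDimension (n := m)
      (f := Z ↘ Spec (.of k)) x
  -- The base has only one point.
  obtain rfl : U = ⊤ := by
    refine top_le_iff.mp fun y _ ↦ ?_
    have : y = (Z ↘ Spec (.of k)) x := Subsingleton.elim (α := PrimeSpectrum k) _ _
    exact this ▸ e hxV
  have h' : ((Scheme.ΓSpecIso (.of k)).inv ≫
      (Z ↘ Spec (.of k)).appLE ⊤ V e).hom.IsStandardSmoothOfRelativeDimension m := by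
    rw [CommRingCat.hom_comp]
    exact RingHom.isStandardSmoothOfRelativeDimension_respectsIso.2 _
      (Scheme.ΓSpecIso (.of k)).symm.commRingCatIsoToRingEquiv h
  obtain ⟨g, hg, hg'⟩ := h'.exists_etale_mvPolynomial
  exact ⟨⟨V, hV⟩, g, hxV, hg, hg'⟩

lemma exists_isChart [SmoothOfRelativeDimension 1 (Z ↘ Spec (.of k))] (x : Z) :
    ∃ (W : Z.affineOpens) (t : Γ(Z, W.1)) (d : VectorField k Z W.1), x ∈ W.1 ∧ IsChart W t d := by
  obtain ⟨W, g, hx, hg, hg'⟩ := exists_etale_mvPolynomial (k := k) 1 x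
  let _ := g.toAlgebra
  have : IsScalarTower k (MvPolynomial (Fin 1) k) Γ(Z, W.1) :=
    .of_algebraMap_eq fun a ↦ congr($hg a).symm
  have : Algebra.Etale (MvPolynomial (Fin 1) k) Γ(Z, W.1) := hg'
  have : Algebra.FormallyEtale (MvPolynomial (Fin 1) k) Γ(Z, W.1) := inferInstance
  let d := derExtend k (R' := Γ(Z, W.1)) (MvPolynomial.pderiv (R := k) (0 : Fin 1))
  refine ⟨W, g (.X 0), d, hx, ?_, fun f ↦ ?_⟩
  · refine (derExtend_algebraMap k _ _).trans ?_
    simp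
  · let d₂ : Derivation k Γ(Z, W.1) Ω[Γ(Z, W.1)⁄k] :=
      (LinearMap.toSpanSingleton _ _ (KaehlerDifferential.D k _ (g (.X 0)))).compDer d
    have : KaehlerDifferential.D k Γ(Z, W.1) = d₂ := by
      refine derivation_ext_of_formallyEtale' (R := MvPolynomial (Fin 1) k) fun r ↦ ?_
      let D₁ : Derivation k (MvPolynomial (Fin 1) k) Ω[Γ(Z, W.1)⁄k] :=
        (KaehlerDifferential.D k Γ(Z, W.1)).compAlgebraMap (MvPolynomial (Fin 1) k)
      let D₂ : Derivation k (MvPolynomial (Fin 1) k) Ω[Γ(Z, W.1)⁄k] :=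
        d₂.compAlgebraMap (MvPolynomial (Fin 1) k)
      -- Derivations of `k[T]` are determined by their value at the variable; étaleness then carries
      -- the equality to the whole ring.
      have hD : D₁ = D₂ := by
        refine MvPolynomial.derivation_ext fun i ↦ ?_
        obtain rfl : i = 0 := Subsingleton.elim _ _
        have e₂ : D₂ (.X 0) = d (algebraMap (MvPolynomial (Fin 1) k) Γ(Z, W.1) (.X 0)) •
          KaehlerDifferential.D k _ (g (.X 0)) := rfl
        rw [e₂, derExtend_algebraMap]
        simp
        rfl
      exact congr($hD r)
    exact congr($this f)

end Charts

/-! ### Restriction, pull-back and gluing of functions and morphisms. -/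

section Sections

variable {T Z : Scheme.{u}} (g : T ⟶ Z)

lemma res_appLE {U : Z.Opens} {V V' : T.Opens} (h : V ≤ g ⁻¹ᵁ U) (hV : V' ≤ V) (s : Γ(Z, U)) :
    (T.presheaf.map (homOfLE hV).op).hom ((g.appLE U V h).hom s) =
      (g.appLE U V' (hV.trans h)).hom s :=
  congr($(Scheme.Hom.appLE_map g h (homOfLE hV).op).hom s)

lemma appLE_res {U U' : Z.Opens} {V : T.Opens} (h : V ≤ g ⁻¹ᵁ U') (hU : U' ≤ U) (s : Γ(Z, U)) :
    (g.appLE U' V h).hom ((Z.presheaf.map (homOfLE hU).op).hom s) =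
      (g.appLE U V (h.trans (g.preimage_mono hU))).hom s :=
  congr($(Scheme.Hom.map_appLE g h (homOfLE hU).op).hom s)

lemma isUnit_res_of_basicOpen {U V : Z.Opens} (f : Γ(Z, U)) (hf : Z.basicOpen f = V) (h : V ≤ U) :
    IsUnit ((Z.presheaf.map (homOfLE h).op).hom f) := by
  subst hf
  exact RingedSpace.isUnit_res_basicOpen Z.toRingedSpace f

lemma section_ext_of_locally {V : T.Opens} {s t : Γ(T, V)}
    (H : ∀ x ∈ V, ∃ (V' : T.Opens) (h : V' ≤ V), x ∈ V' ∧
      (T.presheaf.map (homOfLE h).op).hom s = (T.presheaf.map (homOfLE h).op).hom t) : s = t := by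
  choose V' h hx H using H
  exact TopCat.Sheaf.eq_of_locally_eq' T.sheaf (fun x : V ↦ V' x.1 x.2) _
    (fun x ↦ homOfLE (h x.1 x.2)) (fun y hy ↦ Opens.mem_iSup.mpr ⟨⟨_, hy⟩, hx _ hy⟩) _ _
    fun x ↦ H x.1 x.2

lemma comp_appLE_apply {T' : Scheme.{u}} (f : T' ⟶ T) {U : Z.Opens} {V : T.Opens} {V' : T'.Opens}
    (h : V ≤ g ⁻¹ᵁ U) (h' : V' ≤ f ⁻¹ᵁ V) (s : Γ(Z, U)) :
    ((f ≫ g).appLE U V' (h'.trans (f.preimage_mono h))).hom s =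
      (f.appLE V V' h').hom ((g.appLE U V h).hom s) :=
  congr($(Scheme.Hom.appLE_comp_appLE f g U V V' h h').hom s).symm

lemma exists_glue {I : Type u} (V : I → T.Opens) (hV : ∀ y : T, ∃ i, y ∈ V i)
    (d : ∀ y, (V y).toScheme ⟶ Z)
    (H : ∀ (x y) {S : Scheme.{u}} (f₁ : S ⟶ V x) (f₂ : S ⟶ V y), f₁ ≫ (V x).ι = f₂ ≫ (V y).ι →
      f₁ ≫ d x = f₂ ≫ d y) : ∃ g : T ⟶ Z, ∀ y, (V y).ι ≫ g = d y :=
  let 𝒰 := T.openCoverOfIsOpenCover V (.mk (top_le_iff.mp fun x _ ↦ Opens.mem_iSup.mpr (hV x)))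
  ⟨𝒰.glueMorphisms d fun x y ↦ H x y _ _ pullback.condition, fun y ↦ 𝒰.ι_glueMorphisms d _ y⟩

end Sections

/-! ### Existence and uniqueness of the codifferential. -/

section Codifferential

variable {k : Type u} [Field k] {X C : Scheme.{u}} [X.Over (Spec (.of k))]
  [C.Over (Spec (.of k))] {π : X ⟶ C} [π.IsOver (Spec (.of k))]

/-- The image of a vector field under the differential of `π` may be computed locally. -/
lemma derRestrict_sum {W W' : C.affineOpens} {U U' : X.affineOpens} (hW : W'.1 ≤ W.1)
    (hU : U'.1 ≤ U.1) (h : U.1 ≤ π ⁻¹ᵁ W.1) (h' : U'.1 ≤ π ⁻¹ᵁ W'.1) (δ : VectorField k X U.1)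
    (m : ℕ) (r : Fin m → Γ(X, U.1)) (δ' : Fin m → VectorField k C W.1)
    (hδ : ∀ f : Γ(C, W.1),
      δ ((π.appLE W.1 U.1 h).hom f) = ∑ j, r j * (π.appLE W.1 U.1 h).hom (δ' j f))
    (f : Γ(C, W'.1)) : derRestrict hU δ ((π.appLE W'.1 U'.1 h').hom f) =
      ∑ j, (X.presheaf.map (homOfLE hU).op).hom (r j) *
        (π.appLE W'.1 U'.1 h').hom (derRestrict hW (δ' j) f) := by
  let ψ := (π.appLE W'.1 U'.1 h').hom
  let φ := (C.presheaf.map (homOfLE hW).op).hom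
  let _ := ψ.toAlgebra
  have : IsScalarTower k Γ(C, W'.1) Γ(X, U'.1) :=
    .of_algebraMap_eq fun a ↦ (appLE_algebraMap π W'.1 U'.1 h' a).symm
  let _ := φ.toAlgebra
  have : IsScalarTower k Γ(C, W.1) Γ(C, W'.1) :=
    .of_algebraMap_eq fun a ↦ (res_algebraMap k C hW a).symm
  have : Algebra.FormallyEtale Γ(C, W.1) Γ(C, W'.1) := formallyEtale_map hW
  let d₁ : Derivation k Γ(C, W'.1) Γ(X, U'.1) := (derRestrict hU δ).compAlgebraMap Γ(C, W'.1)
  let d₂ : Derivation k Γ(C, W'.1) Γ(X, U'.1) :=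
    ∑ j, (LinearMap.mulLeft Γ(C, W'.1) ((X.presheaf.map (homOfLE hU).op).hom (r j)) ∘ₗ
      Algebra.linearMap Γ(C, W'.1) Γ(X, U'.1)).compDer (derRestrict hW (δ' j))
  have hd₂ (f) : d₂ f = ∑ j, (X.presheaf.map (homOfLE hU).op).hom (r j) *
        (π.appLE W'.1 U'.1 h').hom (derRestrict hW (δ' j) f) := by
    have := congrFun (map_sum (Derivation.coeFnAddMonoidHom (R := k) (A := Γ(C, W'.1))
      (M := Γ(X, U'.1))) (fun j ↦ (LinearMap.mulLeft Γ(C, W'.1)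
        ((X.presheaf.map (homOfLE hU).op).hom (r j)) ∘ₗ
      Algebra.linearMap Γ(C, W'.1) Γ(X, U'.1)).compDer (derRestrict hW (δ' j))) Finset.univ) f
    rw [Finset.sum_apply] at this
    exact this
  -- Both sides are derivations of the functions on `W'` with values in those on `U'`. By étaleness
  -- they need only be compared on functions coming from `W`, where the hypothesis applies.
  have key : d₁ = d₂ := by
    refine derivation_ext_of_formallyEtale' (R := Γ(C, W.1)) fun s ↦ ?_
    rw [hd₂]
    have e₁ (s : Γ(C, W.1)) : ψ (φ s) =
        (X.presheaf.map (homOfLE hU).op).hom ((π.appLE W.1 U.1 h).hom s) :=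
      (appLE_res π h' hW s).trans (res_appLE π h hU s).symm
    refine Eq.trans (b := derRestrict hU δ (ψ (φ s))) rfl ?_
    rw [e₁, derRestrict_apply, hδ, map_sum]
    refine Finset.sum_congr rfl fun j _ ↦ ?_
    rw [map_mul, ← e₁]
    refine congrArg _ (congrArg ψ ?_)
    exact (derRestrict_apply hW (δ' j) s).symm
  exact (congr($key f)).trans (hd₂ f)

variable [LocallyOfFinitePresentation (X ↘ Spec (.of k))]
  [LocallyOfFinitePresentation (C ↘ Spec (.of k))]

variable (π) in
/-- `d` is the composition of `(u, v) : T → T^*_C ×_C X` and the codifferential of `π`. -/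
structure IsCodiff {T : Scheme.{u}} (a : T ⟶ cotangentBundle k C) (v : T ⟶ X)
    (d : T ⟶ cotangentBundle k X) : Prop where
  comp_proj : d ≫ cotangentProj k X = v
  pair (W : C.affineOpens) (U : X.affineOpens) (h : U.1 ≤ π ⁻¹ᵁ W.1) (δ : VectorField k X U.1)
    (m : ℕ) (r : Fin m → Γ(X, U.1)) (δ' : Fin m → VectorField k C W.1)
    (hδ : ∀ f : Γ(C, W.1),
      δ ((π.appLE W.1 U.1 h).hom f) = ∑ j, r j * (π.appLE W.1 U.1 h).hom (δ' j f))
    (V : T.Opens) (hVX : V ≤ v ⁻¹ᵁ U.1) (hVC : V ≤ a ⁻¹ᵁ (cotangentProj k C ⁻¹ᵁ W.1))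
    (hVd : V ≤ d ⁻¹ᵁ (cotangentProj k X ⁻¹ᵁ U.1)) :
    (d.appLE _ V hVd).hom (linearFunction U δ) =
      ∑ j, (v.appLE _ V hVX).hom (r j) * (a.appLE _ V hVC).hom (linearFunction W (δ' j))

variable {T : Scheme.{u}} {a : T ⟶ cotangentBundle k C} {v : T ⟶ X} {d : T ⟶ cotangentBundle k X}

lemma IsCodiff.chart (hd : IsCodiff π a v d) {W : C.affineOpens} {t : Γ(C, W.1)}
    {D : VectorField k C W.1} (hW : IsChart W t D) (U : X.affineOpens) (h : U.1 ≤ π ⁻¹ᵁ W.1)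
    (V : T.Opens) (hVX : V ≤ v ⁻¹ᵁ U.1) (hVC : V ≤ a ⁻¹ᵁ (cotangentProj k C ⁻¹ᵁ W.1))
    (hVd : V ≤ d ⁻¹ᵁ (cotangentProj k X ⁻¹ᵁ U.1)) (δ : VectorField k X U.1) :
    (d.appLE _ V hVd).hom (linearFunction U δ) =
      (v.appLE _ V hVX).hom (δ ((π.appLE W.1 U.1 h).hom t)) *
        (a.appLE _ V hVC).hom (linearFunction W D) := by
  have := hd.pair W U h δ 1 (fun _ ↦ δ ((π.appLE W.1 U.1 h).hom t)) (fun _ ↦ D)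
    (fun f ↦ by simpa using hW.der_apply h δ f) V hVX hVC hVd
  simpa using this

/-- The defining condition ranges over all affine opens and all presentations of the image of `δ`.
One chart near each point suffices, since `D` generates the vector fields there and both sides
become multiples of its linear function. -/
lemma isCodiff_of_locally (e : a ≫ cotangentProj k C = v ≫ π) (hd : d ≫ cotangentProj k X = v)
    (H : ∀ y : T, ∃ (W : C.affineOpens) (t : Γ(C, W.1)) (D : VectorField k C W.1)
      (_ : IsChart W t D) (U : X.affineOpens) (h : U.1 ≤ π ⁻¹ᵁ W.1) (V : T.Opens)
      (hVX : V ≤ v ⁻¹ᵁ U.1) (hVC : V ≤ a ⁻¹ᵁ (cotangentProj k C ⁻¹ᵁ W.1))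
      (hVd : V ≤ d ⁻¹ᵁ (cotangentProj k X ⁻¹ᵁ U.1)), y ∈ V ∧ ∀ δ : VectorField k X U.1,
      (d.appLE _ V hVd).hom (linearFunction U δ) =
      (v.appLE _ V hVX).hom (δ ((π.appLE W.1 U.1 h).hom t)) *
        (a.appLE _ V hVC).hom (linearFunction W D)) : IsCodiff π a v d := by
  refine ⟨hd, fun W' U' h' δ m r δ' hδ V hVX hVC hVd ↦ section_ext_of_locally fun y hy ↦ ?_⟩
  obtain ⟨W, t, D, hW, U, h, V₀, hVX₀, hVC₀, hVd₀, hy₀, H⟩ := H y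
  obtain ⟨W₂, hW₂, -, -, hWW, hWW'⟩ := exists_basicOpen_le (h (hVX₀ hy₀)) (h' (hVX hy))
  obtain ⟨f, hf, hxf⟩ := U.2.exists_basicOpen_le (V := U'.1 ⊓ π ⁻¹ᵁ W₂.1) ⟨v y, hVX hy, hW₂⟩
    (hVX₀ hy₀)
  let U₂ : X.affineOpens := ⟨X.basicOpen f, U.2.basicOpen f⟩
  have hUU : U₂.1 ≤ U.1 := X.basicOpen_le f
  have hUU' : U₂.1 ≤ U'.1 := hf.trans inf_le_left
  have h₂ : U₂.1 ≤ π ⁻¹ᵁ W₂.1 := hf.trans inf_le_right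
  let V₂ : T.Opens := V ⊓ V₀ ⊓ v ⁻¹ᵁ U₂.1
  have hV₂ : V₂ ≤ V := inf_le_left.trans inf_le_left
  have hV₂₀ : V₂ ≤ V₀ := inf_le_left.trans inf_le_right
  have hVX₂ : V₂ ≤ v ⁻¹ᵁ U₂.1 := inf_le_right
  have hVd₂ : V₂ ≤ d ⁻¹ᵁ (cotangentProj k X ⁻¹ᵁ U₂.1) := by
    rw [← Scheme.Hom.comp_preimage, hd]; exact hVX₂
  have hVC₂ : V₂ ≤ a ⁻¹ᵁ (cotangentProj k C ⁻¹ᵁ W₂.1) := by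
    rw [← Scheme.Hom.comp_preimage, e]; exact hVX₂.trans (v.preimage_mono h₂)
  refine ⟨V₂, hV₂, ⟨⟨hy, hy₀⟩, hxf⟩, ?_⟩
  have hW₂c := hW.res hWW
  set t₂ := (C.presheaf.map (homOfLE hWW).op).hom t
  set D₂ := derRestrict hWW D
  set δ₂ := derRestrict hUU' δ
  set s := δ₂ ((π.appLE W₂.1 U₂.1 h₂).hom t₂)
  -- the left hand side
  have hl : (d.appLE _ V₂ hVd₂).hom (linearFunction U₂ δ₂) =
      (v.appLE _ V₂ hVX₂).hom s * (a.appLE _ V₂ hVC₂).hom (linearFunction W₂ D₂) := by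
    -- The field `δ₂` need not extend to `U`, but `f ^ N • δ₂` does; the unit `f ^ N` is cancelled
    -- at the end.
    obtain ⟨δ₀, N, hδ₀⟩ := exists_derRestrict_eq (k := k) (V := U₂) f rfl hUU δ₂
    have h₀ := congrArg (T.presheaf.map (homOfLE hV₂₀).op).hom (H δ₀)
    rw [map_mul, appLE_linearFunction_res d hUU hVd₀ hVd₂, appLE_linearFunction_res a hWW hVC₀ hVC₂,
      res_appLE, hδ₀, linearFunction_smul, map_mul] at h₀
    have e₁ : (v.appLE U.1 V₂ (hV₂₀.trans hVX₀)).hom (δ₀ ((π.appLE W.1 U.1 h).hom t)) =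
        (v.appLE _ V₂ hVX₂).hom ((X.presheaf.map (homOfLE hUU).op).hom f ^ N * s) := by
      rw [← appLE_res v hVX₂ hUU, ← derRestrict_apply, hδ₀]
      refine congrArg _ ?_
      rw [Derivation.smul_apply, smul_eq_mul, res_appLE]
      refine congrArg _ (congrArg _ ?_)
      exact (appLE_res π h₂ hWW t).symm
    have e₂ (r : Γ(X, U₂.1)) : (d.appLE _ V₂ hVd₂).hom ((cotangentProj k X).app U₂.1 r) =
        (v.appLE _ V₂ hVX₂).hom r := by
      subst hd
      exact congr($(Scheme.Hom.comp_appLE d (cotangentProj k X) U₂.1 V₂ hVX₂).hom r).symm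
    rw [e₁, e₂, map_mul, mul_assoc] at h₀
    refine (IsUnit.mul_right_inj ?_).mp h₀
    exact ((isUnit_res_of_basicOpen f rfl hUU).pow N).map (v.appLE _ V₂ hVX₂).hom
  rw [appLE_linearFunction_res d hUU' hVd hVd₂, hl, map_sum]
  -- Evaluated at the coordinate `t₂`, the presentation of the image of `δ` expresses `s` through
  -- the coefficients `δ'_j(t₂)` of the `δ'_j` relative to `D₂`.
  have hs := derRestrict_sum hWW' hUU' h' h₂ δ m r δ' hδ t₂
  change s = _ at hs
  rw [hs, map_sum, Finset.sum_mul]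
  refine Finset.sum_congr rfl fun j _ ↦ ?_
  rw [map_mul, map_mul, res_appLE, appLE_res, appLE_linearFunction_res a hWW' hVC hVC₂,
    hW₂c.eq_smul (derRestrict hWW' (δ' j)), linearFunction_smul, map_mul, mul_assoc]
  congr 1
  have e₃ (r : Γ(C, W₂.1)) : (a.appLE _ V₂ hVC₂).hom ((cotangentProj k C).app W₂.1 r) =
      (v.appLE _ V₂ hVX₂).hom ((π.appLE W₂.1 U₂.1 h₂).hom r) := by
    refine (congr($(Scheme.Hom.comp_appLE a (cotangentProj k C) W₂.1 V₂ hVC₂).hom r)).symm.trans ?_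
    refine (congr($(appLE_congr_hom e hVC₂).hom r)).trans ?_
    exact comp_appLE_apply π v h₂ hVX₂ r
  rw [e₃, Derivation.smul_apply, hW₂c.apply_self, smul_eq_mul, mul_one]

lemma exists_chart_le [SmoothOfRelativeDimension 1 (C ↘ Spec (.of k))] (π : X ⟶ C) (x : X)
    (O : X.Opens) (hx : x ∈ O) :
    ∃ (W : C.affineOpens) (t : Γ(C, W.1)) (D : VectorField k C W.1) (U : X.affineOpens),
      IsChart W t D ∧ x ∈ U.1 ∧ U.1 ≤ π ⁻¹ᵁ W.1 ∧ U.1 ≤ O := by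
  obtain ⟨W, t, D, hW, hc⟩ := exists_isChart (k := k) (π x)
  obtain ⟨_, ⟨U, hU, rfl⟩, hxU, hU'⟩ :=
    X.isBasis_affineOpens.exists_subset_of_mem_open (a := x) (u := ((π ⁻¹ᵁ W.1 ⊓ O : X.Opens) : Set X))
      ⟨hW, hx⟩ (π ⁻¹ᵁ W.1 ⊓ O).2
  exact ⟨W, t, D, ⟨U, hU⟩, hc, hxU, fun y hy ↦ (hU' hy).1, fun y hy ↦ (hU' hy).2⟩

variable [SmoothOfRelativeDimension 1 (C ↘ Spec (.of k))]

lemma IsCodiff.unique {d' : T ⟶ cotangentBundle k X} (e : a ≫ cotangentProj k C = v ≫ π)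
    (hd : IsCodiff π a v d) (hd' : IsCodiff π a v d') : d = d' := by
  refine cotangent_hom_ext (hd.comp_proj.trans hd'.comp_proj.symm) fun y ↦ ?_
  obtain ⟨W, t, D, U, hW, hU, h, -⟩ := exists_chart_le (k := k) π (v y) ⊤ trivial
  have h₁ : v ⁻¹ᵁ U.1 ≤ d ⁻¹ᵁ (cotangentProj k X ⁻¹ᵁ U.1) := by
    rw [← Scheme.Hom.comp_preimage, hd.comp_proj]
  have h₂ : v ⁻¹ᵁ U.1 ≤ d' ⁻¹ᵁ (cotangentProj k X ⁻¹ᵁ U.1) := by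
    rw [← Scheme.Hom.comp_preimage, hd'.comp_proj]
  have h₃ : v ⁻¹ᵁ U.1 ≤ a ⁻¹ᵁ (cotangentProj k C ⁻¹ᵁ W.1) := by
    rw [← Scheme.Hom.comp_preimage, e]; exact v.preimage_mono h
  refine ⟨U, v ⁻¹ᵁ U.1, h₁, h₂, hU, fun δ ↦ ?_⟩
  rw [hd.chart hW U h _ le_rfl h₃ h₁, hd'.chart hW U h _ le_rfl h₃ h₂]

lemma IsCodiff.comp (e : a ≫ cotangentProj k C = v ≫ π) (hd : IsCodiff π a v d) {T' : Scheme.{u}}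
    (f : T' ⟶ T) : IsCodiff π (f ≫ a) (f ≫ v) (f ≫ d) := by
  refine isCodiff_of_locally (by simp [e]) (by simp [hd.comp_proj]) fun y ↦ ?_
  obtain ⟨W, t, D, U, hW, hU, h, -⟩ := exists_chart_le (k := k) π (v (f y)) ⊤ trivial
  have h₁ : v ⁻¹ᵁ U.1 ≤ d ⁻¹ᵁ (cotangentProj k X ⁻¹ᵁ U.1) := by
    rw [← Scheme.Hom.comp_preimage, hd.comp_proj]
  have h₃ : v ⁻¹ᵁ U.1 ≤ a ⁻¹ᵁ (cotangentProj k C ⁻¹ᵁ W.1) := by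
    rw [← Scheme.Hom.comp_preimage, e]; exact v.preimage_mono h
  refine ⟨W, t, D, hW, U, h, f ⁻¹ᵁ v ⁻¹ᵁ U.1, le_rfl, f.preimage_mono h₃, f.preimage_mono h₁, hU,
    fun δ ↦ ?_⟩
  rw [comp_appLE_apply d f h₁ le_rfl, comp_appLE_apply v f le_rfl le_rfl,
    comp_appLE_apply a f h₃ le_rfl, hd.chart hW U h _ le_rfl h₃ h₁, map_mul]

/-- The prescription `δ ↦ v^*(δ(π^*t)) · a^*D` is linear in `δ`, so it defines a morphism to the
cotangent bundle. -/
lemma exists_isCodiff_of_chart (e : a ≫ cotangentProj k C = v ≫ π) {W : C.affineOpens}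
    {t : Γ(C, W.1)} {D : VectorField k C W.1} (hW : IsChart W t D) (U : X.affineOpens)
    (h : U.1 ≤ π ⁻¹ᵁ W.1) (hv : ⊤ ≤ v ⁻¹ᵁ U.1) : ∃ d, IsCodiff π a v d := by
  have h₃ : ⊤ ≤ a ⁻¹ᵁ (cotangentProj k C ⁻¹ᵁ W.1) := by
    rw [← Scheme.Hom.comp_preimage, e]; exact hv.trans (v.preimage_mono h)
  obtain ⟨d, hd, H⟩ := exists_cotangent_lift (k := k) v U hv
    { toFun δ := (v.appLE _ ⊤ hv).hom (δ ((π.appLE W.1 U.1 h).hom t)) *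
        (a.appLE _ ⊤ h₃).hom (linearFunction W D)
      map_zero' := by simp
      map_add' δ δ' := by simp [add_mul] } (fun r δ ↦ by
        simp [mul_assoc])
  have h₁ : ⊤ ≤ d ⁻¹ᵁ (cotangentProj k X ⁻¹ᵁ U.1) := by
    rw [← Scheme.Hom.comp_preimage, hd]; exact hv
  exact ⟨d, isCodiff_of_locally e hd fun y ↦
    ⟨W, t, D, hW, U, h, ⊤, hv, h₃, h₁, trivial, fun δ ↦ H h₁ δ⟩⟩

lemma ι_appLE_injective {V V' : T.Opens} (h : V' ≤ V) (hV : ⊤ ≤ V'.ι ⁻¹ᵁ V) {s : Γ(T, V)}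
    {s' : Γ(T, V)} (e : (V'.ι.appLE V ⊤ hV).hom s = (V'.ι.appLE V ⊤ hV).hom s') :
    (T.presheaf.map (homOfLE h).op).hom s = (T.presheaf.map (homOfLE h).op).hom s' := by
  have h₁ : V'.ι.appLE V ⊤ hV = T.presheaf.map (homOfLE h).op ≫ V'.topIso.inv := by
    rw [Scheme.Opens.topIso_inv]
    exact (V'.ι_appLE V ⊤ hV).trans (T.presheaf.map_comp (homOfLE h).op _)
  rw [h₁] at e
  exact (ConcreteCategory.bijective_of_isIso V'.topIso.inv).1 e

variable (k) in
lemma isCodiff_of_openCover (e : a ≫ cotangentProj k C = v ≫ π)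
    (H : ∀ y : T, ∃ V : T.Opens, y ∈ V ∧ IsCodiff π (V.ι ≫ a) (V.ι ≫ v) (V.ι ≫ d)) :
    IsCodiff π a v d := by
  have hd : d ≫ cotangentProj k X = v := hom_ext_of_locally fun y ↦ by
    obtain ⟨V, hy, H⟩ := H y
    exact ⟨V, hy, by simpa using H.comp_proj⟩
  refine isCodiff_of_locally e hd fun y ↦ ?_
  obtain ⟨V, hy, H⟩ := H y
  obtain ⟨W, t, D, U, hW, hU, h, -⟩ := exists_chart_le (k := k) π (v y) ⊤ trivial
  let V' := V ⊓ v ⁻¹ᵁ U.1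
  have hV' : ⊤ ≤ V'.ι ⁻¹ᵁ V' := V'.ι_preimage_self.ge
  have hVX : V' ≤ v ⁻¹ᵁ U.1 := inf_le_right
  have hVd : V' ≤ d ⁻¹ᵁ (cotangentProj k X ⁻¹ᵁ U.1) := by
    rw [← Scheme.Hom.comp_preimage, hd]; exact hVX
  have hVC : V' ≤ a ⁻¹ᵁ (cotangentProj k C ⁻¹ᵁ W.1) := by
    rw [← Scheme.Hom.comp_preimage, e]; exact hVX.trans (v.preimage_mono h)
  refine ⟨W, t, D, hW, U, h, V', hVX, hVC, hVd, ⟨hy, hU⟩, fun δ ↦ ?_⟩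
  have H' := H.comp (by simp [e]) (T.homOfLE (show V' ≤ V from inf_le_left))
  simp only [Scheme.homOfLE_ι_assoc] at H'
  have h₁ := H'.chart hW U h ⊤ (hV'.trans (V'.ι.preimage_mono hVX))
    (hV'.trans (V'.ι.preimage_mono hVC)) (hV'.trans (V'.ι.preimage_mono hVd)) δ
  rw [comp_appLE_apply d V'.ι hVd hV', comp_appLE_apply a V'.ι hVC hV',
    comp_appLE_apply v V'.ι hVX hV', ← map_mul] at h₁
  have h₂ := ι_appLE_injective le_rfl hV' h₁
  have h₃ : T.presheaf.map (homOfLE (le_refl V')).op = 𝟙 _ := T.presheaf.map_id _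
  rw [h₃] at h₂
  exact h₂

/-- The composition of the codifferential with `(a, v)` exists for all `(a, v)`. -/
lemma exists_isCodiff (e : a ≫ cotangentProj k C = v ≫ π) : ∃ d, IsCodiff π a v d := by
  have H (y : T) : ∃ (V : T.Opens) (d : V.toScheme ⟶ cotangentBundle k X), y ∈ V ∧
      IsCodiff π (V.ι ≫ a) (V.ι ≫ v) d := by
    obtain ⟨W, t, D, U, hW, hU, h, -⟩ := exists_chart_le (k := k) π (v y) ⊤ trivial
    obtain ⟨d, hd⟩ := exists_isCodiff_of_chart (a := (v ⁻¹ᵁ U.1).ι ≫ a) (v := (v ⁻¹ᵁ U.1).ι ≫ v)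
      (by simp [e]) hW U h (by
        rw [Scheme.Hom.comp_preimage]
        exact (v ⁻¹ᵁ U.1).ι_preimage_self.ge)
    exact ⟨_, d, hU, hd⟩
  choose V d hy hd using H
  -- The local solutions agree on overlaps because the codifferential is stable under base change
  -- and unique.
  obtain ⟨g, hg⟩ := exists_glue V (fun y ↦ ⟨y, hy y⟩) d fun x y S f₁ f₂ e₁ ↦ by
    have h₁ := (hd x).comp (by simp [e]) f₁
    have h₂ := (hd y).comp (by simp [e]) f₂
    rw [← reassoc_of% e₁, ← reassoc_of% e₁] at h₂
    exact h₁.unique (by simp [e]) h₂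
  refine ⟨g, isCodiff_of_openCover k e fun y ↦ ⟨V y, hy y, ?_⟩⟩
  rw [hg]
  exact hd y

variable (π) in
lemma isCodifferential_iff {d : pullback (cotangentProj k C) π ⟶ cotangentBundle k X} :
    IsCodifferential π d ↔ IsCodiff π (pullback.fst _ _) (pullback.snd _ _) d :=
  ⟨fun h ↦ ⟨h.1, h.2⟩, fun h ↦ ⟨h.1, h.2⟩⟩

variable (k π) in
lemma existsUnique_isCodifferential :
    ∃! d : pullback (cotangentProj k C) π ⟶ cotangentBundle k X, IsCodifferential π d := by
  simp only [isCodifferential_iff]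
  obtain ⟨d, hd⟩ := exists_isCodiff (π := π) (a := pullback.fst (cotangentProj k C) π)
    (v := pullback.snd (cotangentProj k C) π) pullback.condition
  exact ⟨d, hd, fun d' hd' ↦ hd'.unique pullback.condition hd⟩

end Codifferential

/-! ### Gluing in localizations. -/

section Gluing

/-- Elements of localizations which agree on overlaps may be glued, also inside of a submodule. -/
lemma exists_glue_of_span_eq_top {R A I : Type*} [CommRing R] [CommRing A] [Algebra R A] [Finite I]
    (f : I → R) (hf : Ideal.span (Set.range f) = ⊤) {B : I → Type*} [∀ j, CommRing (B j)]
    (φ : ∀ j, A →+* B j) (hu : ∀ j, IsUnit (φ j (algebraMap R A (f j)))) (P : Submodule R A)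
    (s : ∀ j, B j)
    (h₁ : ∀ j, ∃ N : ℕ, ∃ a ∈ P, φ j a = φ j (algebraMap R A (f j)) ^ N * s j)
    (h₂ : ∀ j l a a' (N : ℕ), φ j a = φ j (algebraMap R A (f j)) ^ N * s j →
      φ l a' = φ l (algebraMap R A (f l)) ^ N * s l →
      ∃ M : ℕ, (f j * f l) ^ M • (f l ^ N • a - f j ^ N • a') = 0) :
    ∃ x ∈ P, ∀ j, φ j x = s j := by
  cases nonempty_fintype I
  choose N a haP ha using h₁
  -- a common exponent
  let N₀ := Finset.univ.sup N
  have hN (j) : N j ≤ N₀ := Finset.le_sup (Finset.mem_univ j)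
  let a₁ (j) := f j ^ (N₀ - N j) • a j
  have ha₁ (j) : φ j (a₁ j) = φ j (algebraMap R A (f j)) ^ N₀ * s j := by
    simp only [a₁, Algebra.smul_def, map_mul, ha, map_pow]
    rw [← mul_assoc, ← pow_add, Nat.sub_add_cancel (hN j)]
  have h₃ (j l) := h₂ j l (a₁ j) (a₁ l) N₀ (ha₁ j) (ha₁ l)
  choose M hM using h₃
  let M₀ := Finset.univ.sup fun p : I × I ↦ M p.1 p.2
  have hM₀ (j l) : (f j * f l) ^ M₀ • (f l ^ N₀ • a₁ j - f j ^ N₀ • a₁ l) = 0 := by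
    have : M j l ≤ M₀ := Finset.le_sup (f := fun p : I × I ↦ M p.1 p.2) (Finset.mem_univ (j, l))
    rw [← Nat.sub_add_cancel this, pow_add, mul_smul, hM, smul_zero]
  let a₂ (j) := f j ^ M₀ • a₁ j
  have ha₂ (j l) : f l ^ (N₀ + M₀) • a₂ j = f j ^ (N₀ + M₀) • a₂ l := by
    have := hM₀ j l
    rw [smul_sub, sub_eq_zero] at this
    simp only [a₂, smul_smul] at this ⊢
    convert this using 2 <;> ring
  have hspan : Ideal.span (Set.range fun j ↦ f j ^ (N₀ + M₀)) = ⊤ := by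
    have := Ideal.span_pow_eq_top (Set.range f) hf (N₀ + M₀)
    rwa [← Set.range_comp] at this
  -- With `1 = ∑ c_j f_j ^ (N₀ + M₀)`, the element `∑ c_j a₂ j` satisfies `f_l ^ (N₀ + M₀) x = a₂
  -- l`, so it has the prescribed images. It lies in `P` because all numerators do.
  obtain ⟨c, hc⟩ := (Ideal.mem_span_range_iff_exists_fun).mp
    ((Ideal.eq_top_iff_one _).mp hspan)
  refine ⟨∑ j, c j • a₂ j, P.sum_mem fun j _ ↦ P.smul_mem _ (P.smul_mem _ (P.smul_mem _ (haP j))),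
    fun l ↦ ?_⟩
  have hx : f l ^ (N₀ + M₀) • ∑ j, c j • a₂ j = a₂ l := by
    rw [Finset.smul_sum]
    have h (j : I) : f l ^ (N₀ + M₀) • c j • a₂ j = (c j * f j ^ (N₀ + M₀)) • a₂ l := by
      rw [smul_comm, ha₂, smul_smul]
    simp only [h]
    rw [← Finset.sum_smul, hc, one_smul]
  have h₄ := congrArg (φ l) hx
  rw [Algebra.smul_def, map_mul] at h₄
  simp only [a₂] at h₄
  rw [Algebra.smul_def (f l ^ M₀), map_mul (φ l) (algebraMap R A (f l ^ M₀)), ha₁, map_pow, map_pow,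
    map_pow, map_pow] at h₄
  have h₅ : φ l (algebraMap R A (f l)) ^ M₀ * (φ l (algebraMap R A (f l)) ^ N₀ * s l) =
    φ l (algebraMap R A (f l)) ^ (N₀ + M₀) * s l := by ring
  rw [h₅] at h₄
  refine ((hu l).pow (N₀ + M₀)).mul_right_injective h₄

end Gluing

/-! ### Localization and pull-back of symmetric differentials. -/

section SymKaehler

open SymmetricAlgebra

variable {k : Type u} [Field k] {X : Scheme.{u}} [X.Over (Spec (.of k))]

/-- Restriction of symmetric differentials. -/
abbrev symRes {U V : X.Opens} (h : V ≤ U) :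
    SymmetricAlgebra Γ(X, U) Ω[Γ(X, U)⁄k] →+* SymmetricAlgebra Γ(X, V) Ω[Γ(X, V)⁄k] :=
  symKaehlerMap (X.presheaf.map (homOfLE h).op).hom (res_algebraMap k X h)

lemma symRes_symRes {U V W : X.Opens} (h : V ≤ U) (h' : W ≤ V)
    (x : SymmetricAlgebra Γ(X, U) Ω[Γ(X, U)⁄k]) :
    symRes h' (symRes h x) = symRes (h'.trans h) x :=
  symKaehlerMap_comp _ _ _ _ _ _ (fun r ↦ presheaf_map_map h h' r) x

lemma symRes_self {U : X.Opens} (x : SymmetricAlgebra Γ(X, U) Ω[Γ(X, U)⁄k]) :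
    symRes (le_refl U) x = x := by
  have e (r : Γ(X, U)) : (X.presheaf.map (homOfLE (le_refl U)).op).hom r = r :=
    congr($(X.presheaf.map_id (.op U)) r)
  have : symRes (k := k) (le_refl U) = RingHom.id _ := by
    refine sym_ringHom_ext (fun r ↦ (symKaehlerMap_algebraMap _ _ _).trans (by rw [e]; rfl))
      fun x ↦ ?_
    induction x using kaehler_induction with
    | h₁ f g => exact (symKaehlerMap_ι _ _ _ _).trans (by rw [e, e]; rfl)
    | h₂ x y hx hy => simp only [map_add, hx, hy]
  exact congr($this x)

section

variable {U V : X.affineOpens} (f : Γ(X, U.1)) (hf : X.basicOpen f = V.1) (h : V.1 ≤ U.1)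

include hf

lemma isLocalization_symRes : letI := (symRes (k := k) h).toAlgebra
    IsLocalization.Away (algebraMap Γ(X, U.1) (SymmetricAlgebra Γ(X, U.1) Ω[Γ(X, U.1)⁄k]) f)
      (SymmetricAlgebra Γ(X, V.1) Ω[Γ(X, V.1)⁄k]) := by
  obtain ⟨V, hV⟩ := V
  subst hf
  let _ := (X.presheaf.map (homOfLE h).op).hom.toAlgebra
  have : IsScalarTower k Γ(X, U.1) Γ(X, X.basicOpen f) :=
    .of_algebraMap_eq fun a ↦ (res_algebraMap k X h a).symm
  have : IsLocalization.Away f Γ(X, X.basicOpen f) := U.2.isLocalization_basicOpen f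
  exact isLocalization_symMap f (KaehlerDifferential.map k k Γ(X, U.1) Γ(X, X.basicOpen f))

lemma exists_pow_smul_eq_zero_of_symRes (x : SymmetricAlgebra Γ(X, U.1) Ω[Γ(X, U.1)⁄k])
    (hx : symRes h x = 0) : ∃ N : ℕ, f ^ N • x = 0 := by
  let _ := (symRes (k := k) h).toAlgebra
  have := isLocalization_symRes (k := k) f hf h
  obtain ⟨⟨_, N, rfl⟩, hN⟩ := (IsLocalization.map_eq_zero_iff
    (.powers (algebraMap Γ(X, U.1) (SymmetricAlgebra Γ(X, U.1) Ω[Γ(X, U.1)⁄k]) f)) _ x).mp hx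
  exact ⟨N, by rw [Algebra.smul_def, map_pow]; exact hN⟩

/-- Induction on the degree produces a numerator which is again homogeneous of degree `i`; a
numerator supplied by localization alone need not be. This allows gluing inside the degree `i` part.
-/
lemma exists_symRes_eq {i : ℕ} {y : SymmetricAlgebra Γ(X, V.1) Ω[Γ(X, V.1)⁄k]}
    (hy : y ∈ LinearMap.range (ι Γ(X, V.1) Ω[Γ(X, V.1)⁄k]) ^ i) :
    ∃ N : ℕ, ∃ a ∈ LinearMap.range (ι Γ(X, U.1) Ω[Γ(X, U.1)⁄k]) ^ i,
      symRes h a = symRes h (algebraMap _ _ f) ^ N * y := by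
  obtain ⟨V, hV⟩ := V
  subst hf
  have hf' : symRes (k := k) h (algebraMap _ _ f) =
      algebraMap _ _ ((X.presheaf.map (homOfLE h).op).hom f) := symKaehlerMap_algebraMap _ _ _
  have _ : IsLocalization.Away f Γ(X, X.basicOpen f) := U.2.isLocalization_basicOpen f
  have e : algebraMap Γ(X, U.1) Γ(X, X.basicOpen f) = (X.presheaf.map (homOfLE h).op).hom := rfl
  refine Submodule.pow_induction_on_left' _ (C := fun i y _ ↦ ∃ N : ℕ,
    ∃ a ∈ LinearMap.range (ι Γ(X, U.1) Ω[Γ(X, U.1)⁄k]) ^ i,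
      symRes h a = symRes h (algebraMap _ _ f) ^ N * y) ?_ ?_ ?_ hy
  · intro r
    obtain ⟨N, a, ha⟩ := IsLocalization.Away.surj f r
    refine ⟨N, algebraMap _ _ a, Submodule.algebraMap_mem a, ?_⟩
    rw [hf', symKaehlerMap_algebraMap, ← e, ← ha, map_mul, map_pow, mul_comm]
  · rintro x y i _ _ ⟨N, a, ha, hax⟩ ⟨N', a', ha', hay⟩
    refine ⟨N + N', f ^ N' • a + f ^ N • a',
      Submodule.add_mem _ (Submodule.smul_mem _ _ ha) (Submodule.smul_mem _ _ ha'), ?_⟩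
    simp only [Algebra.smul_def, map_add, map_mul, map_pow, hax, hay]
    ring
  · rintro _ ⟨m, rfl⟩ i x _ ⟨N', a', ha', hax⟩
    have hm : ∃ N : ℕ, ∃ m' : Ω[Γ(X, U.1)⁄k],
        symRes h (ι _ _ m') = symRes h (algebraMap _ _ f) ^ N * ι _ _ m := by
      let _ := (X.presheaf.map (homOfLE h).op).hom.toAlgebra
      have : IsScalarTower k Γ(X, U.1) Γ(X, X.basicOpen f) :=
        .of_algebraMap_eq fun a ↦ (res_algebraMap k X h a).symm
      obtain ⟨⟨m', s⟩, hs⟩ := IsLocalizedModule.surj (.powers f)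
        (KaehlerDifferential.map k k Γ(X, U.1) Γ(X, X.basicOpen f)) m
      obtain ⟨N, hN⟩ := s.2
      refine ⟨N, m', ?_⟩
      have e₁ : symRes h (ι _ _ m') =
        ι _ _ (KaehlerDifferential.map k k Γ(X, U.1) Γ(X, X.basicOpen f) m') := symMap_ι _ _
      rw [e₁, hf', ← hs, Submonoid.smul_def, ← hN, ← map_pow, ← map_pow, ← Algebra.smul_def,
        ← map_smul]
      refine congrArg _ ?_
      exact (algebraMap_smul Γ(X, X.basicOpen f) (f ^ N) m).symm
    obtain ⟨N, m', hm'⟩ := hm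
    refine ⟨N + N', ι _ _ m' * a', ?_, ?_⟩
    · rw [pow_succ']
      exact Submodule.mul_mem_mul ⟨m', rfl⟩ ha'
    · rw [map_mul, hm', hax]; ring

end

/-- The annihilator of `x - y` contains a power of some function that is invertible at any given
point of `U`, so its radical is the unit ideal. -/
lemma symDifferential_ext_of_locally {U : X.affineOpens}
    {x y : SymmetricAlgebra Γ(X, U.1) Ω[Γ(X, U.1)⁄k]}
    (H : ∀ p ∈ U.1, ∃ (V : X.affineOpens) (h : V.1 ≤ U.1), p ∈ V.1 ∧ symRes h x = symRes h y) :
    x = y := by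
  let I : Ideal Γ(X, U.1) := LinearMap.ker (LinearMap.toSpanSingleton Γ(X, U.1) _ (x - y))
  suffices h : I = ⊤ by
    have : (1 : Γ(X, U.1)) ∈ I := h ▸ trivial
    simpa [I, sub_eq_zero] using this
  rw [← Ideal.radical_eq_top, ← top_le_iff, ← (IsAffineOpen.iSup_basicOpen_eq_self_iff U.2
    (s := (I.radical : Set Γ(X, U.1)))).mp]
  · rw [Ideal.span_eq]
  · refine le_antisymm (iSup_le fun f ↦ X.basicOpen_le _) fun p hp ↦ ?_
    obtain ⟨V, h, hpV, e⟩ := H p hp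
    obtain ⟨V', hpV', ⟨f, hf⟩, -, h₁, h₂⟩ := exists_basicOpen_le hp hpV
    have : symRes (k := k) h₁ (x - y) = 0 := by
      rw [← symRes_symRes h h₂, map_sub, e, sub_self, map_zero]
    obtain ⟨N, hN⟩ := exists_pow_smul_eq_zero_of_symRes (k := k) f hf h₁ _ this
    exact Opens.mem_iSup.mpr ⟨⟨f, N, hN⟩, hf ▸ hpV'⟩

section Pullback

variable {C : Scheme.{u}} [C.Over (Spec (.of k))] (π : X ⟶ C) [π.IsOver (Spec (.of k))] {i : ℕ}

/-- The pull-back of a symmetric differential, on an open subset which is mapped to an affine open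
subset of the target. -/
def symPullback (b : SymDifferential k C i) (W : C.affineOpens) (V : X.Opens)
    (h : V ≤ π ⁻¹ᵁ W.1) : SymmetricAlgebra Γ(X, V) Ω[Γ(X, V)⁄k] :=
  symKaehlerMap (π.appLE W.1 V h).hom (appLE_algebraMap π W.1 V h) (b.val W)

variable (b : SymDifferential k C i)

lemma symRes_symPullback (W : C.affineOpens) {V V' : X.Opens} (h : V ≤ π ⁻¹ᵁ W.1) (hV : V' ≤ V) :
    symRes hV (symPullback π b W V h) = symPullback π b W V' (hV.trans h) :=
  symKaehlerMap_comp _ _ _ _ _ _ (fun r ↦ res_appLE π h hV r) _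

lemma symPullback_eq_of_le {W W' : C.affineOpens} (hW : W'.1 ≤ W.1) (V : X.Opens)
    (h : V ≤ π ⁻¹ᵁ W.1) (h' : V ≤ π ⁻¹ᵁ W'.1) :
    symPullback π b W V h = symPullback π b W' V h' := by
  rw [symPullback, symPullback, ← b.compatible hW]
  exact (symKaehlerMap_comp _ _ _ _ _ _ (fun r ↦ appLE_res π h' hW r) _).symm

lemma symPullback_mem (W : C.affineOpens) (V : X.Opens) (h : V ≤ π ⁻¹ᵁ W.1) :
    symPullback π b W V h ∈ LinearMap.range (ι Γ(X, V) Ω[Γ(X, V)⁄k]) ^ i := by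
  refine Submodule.pow_induction_on_left' _ (C := fun i x _ ↦
    symKaehlerMap (π.appLE W.1 V h).hom (appLE_algebraMap π W.1 V h) x ∈
      LinearMap.range (ι Γ(X, V) Ω[Γ(X, V)⁄k]) ^ i) ?_ ?_ ?_ (b.homogeneous W)
  · intro r
    rw [symKaehlerMap_algebraMap]
    exact Submodule.algebraMap_mem _
  · intro x y i _ _ hx hy
    rw [map_add]
    exact Submodule.add_mem _ hx hy
  · rintro _ ⟨m, rfl⟩ i x _ hx
    rw [map_mul, pow_succ']
    refine Submodule.mul_mem_mul ?_ hx
    induction m using kaehler_induction with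
    | h₁ f g => exact ⟨_, (symKaehlerMap_ι _ (appLE_algebraMap π W.1 V h) f g).symm⟩
    | h₂ x y hx hy => rw [map_add, map_add]; exact Submodule.add_mem _ hx hy

variable [C.IsSeparated]

lemma symPullback_eq (W W' : C.affineOpens) (V : X.Opens) (h : V ≤ π ⁻¹ᵁ W.1)
    (h' : V ≤ π ⁻¹ᵁ W'.1) : symPullback π b W V h = symPullback π b W' V h' := by
  -- Separatedness of `C` makes the intersection affine.
  let W₂ : C.affineOpens := ⟨W.1 ⊓ W'.1, W.2.inf W'.2⟩
  have h₂ : V ≤ π ⁻¹ᵁ W₂.1 := fun x hx ↦ ⟨h hx, h' hx⟩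
  rw [symPullback_eq_of_le π b (W' := W₂) inf_le_left V h h₂,
    symPullback_eq_of_le π b (W' := W₂) inf_le_right V h' h₂]

/-- An affine `U` need not map into an affine open subset of `C`. It is covered by finitely many
basic opens that do, and the pull-backs on these are glued. -/
lemma exists_symPullback (U : X.affineOpens) :
    ∃ x ∈ LinearMap.range (ι Γ(X, U.1) Ω[Γ(X, U.1)⁄k]) ^ i,
      ∀ (W : C.affineOpens) (V : X.affineOpens) (hV : V.1 ≤ U.1) (h : V.1 ≤ π ⁻¹ᵁ W.1),
        symRes hV x = symPullback π b W V.1 h := by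
  have H (p : X) : ∃ W : C.affineOpens, π p ∈ W.1 := by
    obtain ⟨_, ⟨W, hW, rfl⟩, hx, -⟩ :=
      C.isBasis_affineOpens.exists_subset_of_mem_open (Set.mem_univ (π p)) isOpen_univ
    exact ⟨⟨W, hW⟩, hx⟩
  choose W hW using H
  have H (p : U.1) := U.2.exists_basicOpen_le (V := π ⁻¹ᵁ (W p.1).1) ⟨p.1, hW p.1⟩ p.2
  choose f hf hpf using H
  have hspan : Ideal.span (Set.range f) = ⊤ := by
    rw [← U.2.self_le_iSup_basicOpen_iff]
    exact fun p hp ↦ Opens.mem_iSup.mpr ⟨⟨_, ⟨p, hp⟩, rfl⟩, hpf _⟩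
  obtain ⟨T, hT, hT'⟩ := Submodule.mem_span_finite_of_mem_span
    ((Ideal.eq_top_iff_one _).mp hspan)
  have H (g : T) : ∃ p, f p = g := hT g.2
  choose p hp using H
  have hT₂ : Ideal.span (Set.range fun g : T ↦ f (p g)) = ⊤ := by
    rw [Ideal.eq_top_iff_one]
    convert hT'
    ext g
    simp [hp]
  let D (g : T) : X.affineOpens := ⟨X.basicOpen (f (p g)), U.2.basicOpen _⟩
  have hD (g) : (D g).1 ≤ U.1 := X.basicOpen_le _
  obtain ⟨x, hx, hx'⟩ := exists_glue_of_span_eq_top (fun g : T ↦ f (p g)) hT₂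
    (fun g ↦ symRes (k := k) (hD g)) (fun g ↦ by
      have e : symRes (k := k) (hD g) (algebraMap _ _ (f (p g))) =
        algebraMap _ _ ((X.presheaf.map (homOfLE (hD g)).op).hom (f (p g))) :=
          symKaehlerMap_algebraMap _ _ _
      rw [e]
      exact (isUnit_res_of_basicOpen _ rfl (hD g)).map _)
    (LinearMap.range (ι Γ(X, U.1) Ω[Γ(X, U.1)⁄k]) ^ i)
    (fun g ↦ symPullback π b (W (p g).1) (D g).1 (hf (p g)))
    (fun g ↦ exists_symRes_eq (V := D g) (f (p g)) rfl (hD g) (symPullback_mem π b _ _ _))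
    (fun g g' a a' N ha ha' ↦ by
      let D₂ : X.affineOpens := ⟨X.basicOpen (f (p g) * f (p g')), U.2.basicOpen _⟩
      have h₁ : D₂.1 ≤ (D g).1 := by
        change X.basicOpen _ ≤ _
        rw [X.basicOpen_mul]; exact inf_le_left
      have h₂ : D₂.1 ≤ (D g').1 := by
        change X.basicOpen _ ≤ _
        rw [X.basicOpen_mul]; exact inf_le_right
      refine exists_pow_smul_eq_zero_of_symRes (V := D₂) _ rfl (h₁.trans (hD g)) _ ?_
      have e₁ := congrArg (symRes (k := k) h₁) ha
      have e₂ := congrArg (symRes (k := k) h₂) ha'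
      rw [map_mul, map_pow, symRes_symRes, symRes_symRes, symRes_symPullback] at e₁ e₂
      rw [symPullback_eq π b _ (W (p g).1) _ _ (h₁.trans (hf _))] at e₂
      rw [Algebra.smul_def, Algebra.smul_def, map_sub, map_mul, map_mul, e₁, e₂, map_pow, map_pow,
        map_pow, map_pow]
      ring)
  refine ⟨x, hx, fun W' V hV h ↦ symDifferential_ext_of_locally fun q hq ↦ ?_⟩
  have : q ∈ ⨆ r : Set.range fun g : T ↦ f (p g), X.basicOpen r.1 := by
    rw [(IsAffineOpen.iSup_basicOpen_eq_self_iff U.2).mpr hT₂]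
    exact hV hq
  obtain ⟨⟨_, g, rfl⟩, hg⟩ := Opens.mem_iSup.mp this
  obtain ⟨V', hqV', -, -, h₁, h₂⟩ := exists_basicOpen_le (U := V) (V := D g) hq hg
  refine ⟨V', h₁, hqV', ?_⟩
  rw [symRes_symRes, symRes_symPullback, ← symRes_symRes (hD g) h₂, hx', symRes_symPullback]
  exact symPullback_eq π b _ _ _ _ _

/-- The pull-back of symmetric differentials. -/
lemma existsUnique_isPullbackOf {n : ℕ} (b : HitchinBase k C n) :
    ∃! a : HitchinBase k X n, IsPullbackOf π b a := by
  have H (i : Fin n) (U : X.affineOpens) := exists_symPullback π (b i) U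
  choose x hx H using H
  have Hloc (U : X.affineOpens) (p : X) (hp : p ∈ U.1) : ∃ (W : C.affineOpens) (V : X.affineOpens)
      (_ : V.1 ≤ U.1) (_ : V.1 ≤ π ⁻¹ᵁ W.1), p ∈ V.1 := by
    obtain ⟨_, ⟨W, hW, rfl⟩, hx, -⟩ :=
      C.isBasis_affineOpens.exists_subset_of_mem_open (Set.mem_univ (π p)) isOpen_univ
    obtain ⟨f, hf, hp'⟩ := U.2.exists_basicOpen_le (V := π ⁻¹ᵁ W) ⟨p, hx⟩ hp
    exact ⟨⟨W, hW⟩, ⟨X.basicOpen f, U.2.basicOpen f⟩, X.basicOpen_le f, hf, hp'⟩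
  refine ⟨fun i ↦ ⟨x i, hx i, fun {U V} h ↦ symDifferential_ext_of_locally fun p hp ↦ ?_⟩, ?_, ?_⟩
  · obtain ⟨W, V', h₁, h₂, hp'⟩ := Hloc V p hp
    refine ⟨V', h₁, hp', ?_⟩
    rw [H i V W V' h₁ h₂]
    exact (symRes_symRes h h₁ (x i U)).trans (H i U W V' (h₁.trans h) h₂)
  · intro i W U h
    exact ((symRes_self _).symm.trans (H i U W U le_rfl h)).symm
  · intro a ha
    funext i
    have : (a i).val = x i := funext fun U ↦ symDifferential_ext_of_locally fun p hp ↦ by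
      obtain ⟨W, V', h₁, h₂, hp'⟩ := Hloc U p hp
      exact ⟨V', h₁, hp', ((a i).compatible h₁).trans
        ((ha i W V' h₂).symm.trans (H i U W V' h₁ h₂).symm)⟩
    revert this
    cases a i
    rintro rfl
    rfl

end Pullback

end SymKaehler

/-! ### Pull-back of characteristic polynomials, spectral covers and cycles. -/

section Pullback

variable {k : Type u} [Field k] {X C : Scheme.{u}} [X.Over (Spec (.of k))]
  [C.Over (Spec (.of k))] {π : X ⟶ C} [π.IsOver (Spec (.of k))]
  [LocallyOfFinitePresentation (X ↘ Spec (.of k))]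
  [LocallyOfFinitePresentation (C ↘ Spec (.of k))] {n : ℕ} {b : HitchinBase k C n}
  {bX : HitchinBase k X n}

/-- The characteristic polynomials of a pull-back. -/
lemma charPoly_pullback (hb : IsPullbackOf π b bX) {W : C.affineOpens} {t : Γ(C, W.1)}
    {D : VectorField k C W.1} (hW : IsChart W t D) (U : X.affineOpens) (h : U.1 ≤ π ⁻¹ᵁ W.1)
    (δ : VectorField k X U.1) :
    charPoly bX U δ = monicOfCoeffs fun i ↦ δ ((π.appLE W.1 U.1 h).hom t) ^ (i.1 + 1) *
      (π.appLE W.1 U.1 h).hom (charCoeff b W D i) := by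
  rw [charPoly_eq]
  exact congrArg _ (funext fun i ↦ charCoeff_pullback hb h δ D _ (hW.der_apply h δ) i)

lemma charPoly_pullback_of_eq_one (hb : IsPullbackOf π b bX) {W : C.affineOpens} {t : Γ(C, W.1)}
    {D : VectorField k C W.1} (hW : IsChart W t D) (U : X.affineOpens) (h : U.1 ≤ π ⁻¹ᵁ W.1)
    (δ : VectorField k X U.1) (hδ : δ ((π.appLE W.1 U.1 h).hom t) = 1) :
    charPoly bX U δ = (charPoly b W D).map (π.appLE W.1 U.1 h).hom := by
  rw [charPoly_pullback hb hW U h, charPoly_eq, map_monicOfCoeffs]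
  simp [hδ]

/-- The pull-back of the spectral functions along the codifferential. -/
lemma IsCodiff.appLE_spectralFunction (hb : IsPullbackOf π b bX) {T : Scheme.{u}}
    {a : T ⟶ cotangentBundle k C} {v : T ⟶ X} {d : T ⟶ cotangentBundle k X}
    (hd : IsCodiff π a v d) (e : a ≫ cotangentProj k C = v ≫ π) {W : C.affineOpens}
    {t : Γ(C, W.1)} {D : VectorField k C W.1} (hW : IsChart W t D) (U : X.affineOpens)
    (h : U.1 ≤ π ⁻¹ᵁ W.1) (V : T.Opens) (hVX : V ≤ v ⁻¹ᵁ U.1)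
    (hVC : V ≤ a ⁻¹ᵁ (cotangentProj k C ⁻¹ᵁ W.1)) (hVd : V ≤ d ⁻¹ᵁ (cotangentProj k X ⁻¹ᵁ U.1))
    (δ : VectorField k X U.1) :
    (d.appLE _ V hVd).hom (spectralFunction bX U δ) =
      (v.appLE _ V hVX).hom (δ ((π.appLE W.1 U.1 h).hom t)) ^ n *
        (a.appLE _ V hVC).hom (spectralFunction b W D) := by
  rw [SpectralSurface.appLE_spectralFunction bX U δ d hd.comp_proj hVd hVX,
    SpectralSurface.appLE_spectralFunction b W D a e hVC (hVX.trans (v.preimage_mono h)),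
    hd.chart hW U h V hVX hVC hVd, charPoly_pullback hb hW U h, eval₂_monicOfCoeffs_mul, charPoly_eq,
    eval₂_monicOfCoeffs, eval₂_monicOfCoeffs]
  congr 2
  refine Finset.sum_congr rfl fun i _ ↦ ?_
  rw [comp_appLE_apply π v h hVX]

section

variable [CompactSpace X] [X.IsSeparated] [CompactSpace C] [C.IsSeparated]
  [SmoothOfRelativeDimension 1 (C ↘ Spec (.of k))]

/-- A `T`-point of the spectral cover of the base gives a `T`-point of the spectral cover. -/
lemma IsCodiff.exists_spectral_lift (hb : IsPullbackOf π b bX) {T : Scheme.{u}}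
    {a : T ⟶ spectralCover b} {v : T ⟶ X} {d : T ⟶ cotangentBundle k X}
    (hd : IsCodiff π (a ≫ spectralIncl b) v d) (e : a ≫ spectralProj b = v ≫ π) :
    ∃ q : T ⟶ spectralCover bX, q ≫ spectralIncl bX = d := by
  have e' : (a ≫ spectralIncl b) ≫ cotangentProj k C = v ≫ π := by simpa [spectralProj] using e
  refine SpectralSurface.exists_spectral_lift bX d fun y ↦ ?_
  obtain ⟨W, t, D, U, hW, hU, h, -⟩ := exists_chart_le (k := k) π (v y) ⊤ trivial
  have h₁ : v ⁻¹ᵁ U.1 ≤ d ⁻¹ᵁ (cotangentProj k X ⁻¹ᵁ U.1) := by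
    rw [← Scheme.Hom.comp_preimage, hd.comp_proj]
  have h₃ : v ⁻¹ᵁ U.1 ≤ a ⁻¹ᵁ (spectralIncl b ⁻¹ᵁ (cotangentProj k C ⁻¹ᵁ W.1)) := by
    rw [← Scheme.Hom.comp_preimage, ← Scheme.Hom.comp_preimage, e']
    exact v.preimage_mono h
  refine ⟨U, v ⁻¹ᵁ U.1, h₁, hU, fun δ ↦ ?_⟩
  rw [hd.appLE_spectralFunction hb e' hW U h _ le_rfl h₃ h₁, comp_appLE_apply _ a le_rfl h₃,
    spectralIncl_appLE, map_zero, mul_zero]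

variable (π b) in
lemma plusIncl_fst : plusIncl π b ≫ pullback.fst (cotangentProj k C) π =
    pullback.fst (spectralProj b) π ≫ spectralIncl b :=
  pullback.lift_fst _ _ _

variable (π b) in
lemma plusIncl_snd : plusIncl π b ≫ pullback.snd (cotangentProj k C) π = plusProj π b :=
  (pullback.lift_snd _ _ _).trans (Category.comp_id _)

lemma isCodiff_plus {d : pullback (cotangentProj k C) π ⟶ cotangentBundle k X}
    (hd : IsCodifferential π d) : IsCodiff π (pullback.fst (spectralProj b) π ≫ spectralIncl b)
      (plusProj π b) (plusIncl π b ≫ d) := by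
  have := ((isCodifferential_iff π).mp hd).comp pullback.condition (plusIncl π b)
  rwa [plusIncl_fst, plusIncl_snd] at this

lemma exists_plus_lift (hb : IsPullbackOf π b bX)
    {d : pullback (cotangentProj k C) π ⟶ cotangentBundle k X} (hd : IsCodifferential π d) :
    ∃ q : plusSurface π b ⟶ spectralCover bX, q ≫ spectralIncl bX = plusIncl π b ≫ d :=
  (isCodiff_plus hd).exists_spectral_lift hb pullback.condition

end

section Points

variable {Y Z : Scheme.{u}}

lemma valueAt_res (y : Spec (.of k) ⟶ Y) {V V' : Y.Opens} (h : V' ≤ V) (hy : ⊤ ≤ y ⁻¹ᵁ V')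
    (s : Γ(Y, V)) : valueAt y V' hy ((Y.presheaf.map (homOfLE h).op).hom s) =
      valueAt y V (hy.trans (y.preimage_mono h)) s :=
  congrArg (Scheme.ΓSpecIso (.of k)).hom.hom (appLE_res y hy h s)

lemma valueAt_comp (y : Spec (.of k) ⟶ Y) (f : Y ⟶ Z) {V : Y.Opens} {W : Z.Opens}
    (h : V ≤ f ⁻¹ᵁ W) (hy : ⊤ ≤ y ⁻¹ᵁ V) (hy' : ⊤ ≤ (y ≫ f) ⁻¹ᵁ W) (s : Γ(Z, W)) :
    valueAt (y ≫ f) W hy' s = valueAt y V hy ((f.appLE W V h).hom s) :=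
  congrArg (Scheme.ΓSpecIso (.of k)).hom.hom (comp_appLE_apply f y h hy s)

lemma valueAt_eq_comp {c : Spec (.of k) ⟶ Z} (y : Spec (.of k) ⟶ Y) (f : Y ⟶ Z)
    (hc : c = y ≫ f) {V : Y.Opens} {W : Z.Opens} (h : V ≤ f ⁻¹ᵁ W) (hy : ⊤ ≤ y ⁻¹ᵁ V)
    (hy' : ⊤ ≤ c ⁻¹ᵁ W) (s : Γ(Z, W)) :
    valueAt c W hy' s = valueAt y V hy ((f.appLE W V h).hom s) := by
  subst hc
  exact valueAt_comp y f h hy hy' s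

lemma top_le_preimage_of_mem (y : Spec (.of k) ⟶ Y) {V : Y.Opens}
    (hy : y (IsLocalRing.closedPoint k) ∈ V) : ⊤ ≤ y ⁻¹ᵁ V := fun p _ ↦ by
  obtain rfl : p = IsLocalRing.closedPoint k := Subsingleton.elim (α := PrimeSpectrum k) _ _
  exact hy

lemma pair_derRestrict {x : RatPoint k X} (ξ : CotangentVector x) {U U' : X.affineOpens}
    (h : U'.1 ≤ U.1) (hx : ⊤ ≤ x.1 ⁻¹ᵁ U'.1) (δ : VectorField k X U.1) :
    ξ.pair U' hx (derRestrict h δ) = ξ.pair U (hx.trans (x.1.preimage_mono h)) δ := by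
  rw [CotangentVector.pair, ← linearFunction_res h]
  exact valueAt_res _ (cotangentProj_preimage_mono h) _ _

lemma IsCodiff.pair_chart {x : RatPoint k X} {c : RatPoint k C}
    {ξ' : CotangentVector c} {ξ : CotangentVector x} (hd : IsCodiff π ξ'.1 x.1 ξ.1)
    {W : C.affineOpens} {t : Γ(C, W.1)} {D : VectorField k C W.1} (hW : IsChart W t D)
    (U : X.affineOpens) (h : U.1 ≤ π ⁻¹ᵁ W.1) (hx : ⊤ ≤ x.1 ⁻¹ᵁ U.1) (hcW : ⊤ ≤ c.1 ⁻¹ᵁ W.1)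
    (δ : VectorField k X U.1) :
    ξ.pair U hx δ = valueAt x.1 U.1 hx (δ ((π.appLE W.1 U.1 h).hom t)) * ξ'.pair W hcW D := by
  refine (congrArg (Scheme.ΓSpecIso (.of k)).hom.hom
    (hd.chart hW U h ⊤ hx (ξ'.le_preimage hcW) (ξ.le_preimage hx) δ)).trans ?_
  rw [map_mul]
  rfl

variable [SmoothOfRelativeDimension 1 (C ↘ Spec (.of k))]

/-- With `s` the value at `x` of `δ(π^*t)`, the coefficients of the characteristic polynomial of `b`
are multiplied by `s ^ (i + 1)` and the pairings with the cotangent vectors by `s`, so the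
factorization persists, also for `s = 0`. -/
lemma isCycleAt_pullback (hb : IsPullbackOf π b bX) {x : RatPoint k X} {c : RatPoint k C}
    (hc : c.1 = x.1 ≫ π) {ξ' : Fin n → CotangentVector c} (hξ' : IsCycleAt b c ξ')
    {ξ : Fin n → CotangentVector x} (hd : ∀ i, IsCodiff π (ξ' i).1 x.1 (ξ i).1) :
    IsCycleAt bX x ξ := by
  intro U hx δ
  obtain ⟨W, t, D, U', hW, hU', h, hUU⟩ := exists_chart_le (k := k) π
    (x.1 (IsLocalRing.closedPoint k)) U.1 (hx (show _ ∈ ⊤ from trivial))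
  have hx' : ⊤ ≤ x.1 ⁻¹ᵁ U'.1 := top_le_preimage_of_mem _ hU'
  have hcW : ⊤ ≤ c.1 ⁻¹ᵁ W.1 := by
    rw [hc]; exact hx'.trans (x.1.preimage_mono h)
  have e₁ : (charPoly bX U δ).map (valueAt x.1 U.1 hx) =
      (charPoly bX U' (derRestrict hUU δ)).map (valueAt x.1 U'.1 hx') := by
    rw [charPoly_derRestrict, Polynomial.map_map]
    congr 1
    exact RingHom.ext fun s ↦ (valueAt_res x.1 hUU hx' s).symm
  rw [e₁, charPoly_pullback hb hW U' h, map_monicOfCoeffs]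
  set s := derRestrict hUU δ ((π.appLE W.1 U'.1 h).hom t)
  have e₂ := hξ' W hcW D
  rw [charPoly_eq, map_monicOfCoeffs] at e₂
  have e₃ := monicOfCoeffs_scale_eq_prod e₂ (valueAt x.1 U'.1 hx' s)
  convert e₃ using 4 with i i hi
  · rw [map_mul, map_pow]
    refine congrArg _ ?_
    exact (valueAt_eq_comp x.1 π hc h hx' hcW _).symm
  · rw [← pair_derRestrict (ξ i) hUU hx', (hd i).pair_chart hW U' h hx' hcW]

variable (π) in
/-- The image of a `k`-point. -/
def RatPoint.map (x : RatPoint k X) : RatPoint k C :=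
  ⟨x.1 ≫ π, by rw [Category.assoc, comp_over, x.2]⟩

lemma exists_isCycleAt_pullback (hb : IsPullbackOf π b bX) (x : RatPoint k X)
    {ξ' : Fin n → CotangentVector (x.map π)} (hξ' : IsCycleAt b (x.map π) ξ') :
    ∃ ξ : Fin n → CotangentVector x, (∀ i, IsCodiff π (ξ' i).1 x.1 (ξ i).1) ∧
      IsCycleAt bX x ξ := by
  have H (i) := exists_isCodiff (π := π) (a := (ξ' i).1) (v := x.1) (ξ' i).2
  choose d hd using H
  exact ⟨fun i ↦ ⟨d i, (hd i).comp_proj⟩, hd, isCycleAt_pullback hb rfl hξ' hd⟩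

lemma pullback_mem_postulatedImage (hb : IsPullbackOf π b bX) (h : b ∈ postulatedImage k C n) :
    bX ∈ postulatedImage k X n := fun x ↦ by
  obtain ⟨ξ', hξ'⟩ := h (x.map π)
  obtain ⟨ξ, -, hξ⟩ := exists_isCycleAt_pullback hb x hξ'
  exact ⟨ξ, hξ⟩

end Points

end Pullback

lemma top_le_preimage_top {T Z : Scheme.{u}} (f : T ⟶ Z) : (⊤ : T.Opens) ≤ f ⁻¹ᵁ ⊤ :=
  fun _ _ ↦ trivial

/-! ### The universal property of `Spec A[y]/(χ)`. -/

section AdjoinRoot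

variable {A : CommRingCat.{u}} (χ : Polynomial A)

/-- The affine scheme `Spec A[y]/(χ)`. -/
abbrev specAdjoinRoot : Scheme.{u} := Spec (.of (AdjoinRoot χ))

/-- The projection `Spec A[y]/(χ) → Spec A`. -/
abbrev specAdjoinRootProj : specAdjoinRoot χ ⟶ Spec A :=
  Spec.map (CommRingCat.ofHom (AdjoinRoot.of χ))

/-- The function `y` on `Spec A[y]/(χ)`. -/
abbrev specAdjoinRootFun : Γ(specAdjoinRoot χ, ⊤) :=
  (Scheme.ΓSpecIso (.of (AdjoinRoot χ))).inv.hom (AdjoinRoot.root χ)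

variable {χ}

lemma specAdjoinRoot_hom_ext {T : Scheme.{u}} {m m' : T ⟶ specAdjoinRoot χ}
    (h : m ≫ specAdjoinRootProj χ = m' ≫ specAdjoinRootProj χ)
    (h' : m.appTop.hom (specAdjoinRootFun χ) = m'.appTop.hom (specAdjoinRootFun χ)) : m = m' := by
  refine ext_of_isAffine ?_
  rw [← cancel_epi (Scheme.ΓSpecIso (.of (AdjoinRoot χ))).inv]
  refine CommRingCat.hom_ext (AdjoinRoot.ringHom_ext (RingHom.ext fun x ↦ ?_) h')
  have e := congrArg Scheme.Hom.appTop h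
  rw [Scheme.Hom.comp_appTop, Scheme.Hom.comp_appTop] at e
  have e' := congr((Scheme.ΓSpecIso A).inv ≫ $e)
  rw [← Scheme.ΓSpecIso_inv_naturality_assoc, ← Scheme.ΓSpecIso_inv_naturality_assoc] at e'
  exact congr(($e').hom x)

lemma exists_specAdjoinRoot_lift {T : Scheme.{u}} (v : T ⟶ Spec A) (y : Γ(T, ⊤))
    (hy : χ.eval₂ (v.appTop.hom.comp (Scheme.ΓSpecIso A).inv.hom) y = 0) :
    ∃ m : T ⟶ specAdjoinRoot χ, m ≫ specAdjoinRootProj χ = v ∧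
      m.appTop.hom (specAdjoinRootFun χ) = y := by
  let ψ : CommRingCat.of (AdjoinRoot χ) ⟶ Γ(T, ⊤) :=
    CommRingCat.ofHom (AdjoinRoot.lift (v.appTop.hom.comp (Scheme.ΓSpecIso A).inv.hom) y hy)
  have e₁ : (T.toSpecΓ ≫ Spec.map ψ).appTop = (Scheme.ΓSpecIso _).hom ≫ ψ := by
    rw [Scheme.Hom.comp_appTop, Scheme.toSpecΓ_appTop, Scheme.ΓSpecIso_naturality]
  refine ⟨T.toSpecΓ ≫ Spec.map ψ, ext_of_isAffine ?_, ?_⟩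
  · rw [Scheme.Hom.comp_appTop, e₁, Scheme.ΓSpecIso_naturality_assoc,
      ← cancel_epi (Scheme.ΓSpecIso A).inv, Iso.inv_hom_id_assoc]
    exact CommRingCat.hom_ext (RingHom.ext fun x ↦ AdjoinRoot.lift_of (f := χ) hy)
  · rw [e₁]
    refine congr(((Scheme.ΓSpecIso (.of (AdjoinRoot χ))).inv ≫
      (Scheme.ΓSpecIso (.of (AdjoinRoot χ))).hom ≫ ψ).hom (AdjoinRoot.root χ)).trans ?_
    rw [Iso.inv_hom_id_assoc]
    exact AdjoinRoot.lift_root hy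

end AdjoinRoot

/-! ### Local structure of the spectral curve. -/

section SpectralCurve

variable {k : Type u} [Field k] {C : Scheme.{u}} [C.Over (Spec (.of k))]
  [LocallyOfFinitePresentation (C ↘ Spec (.of k))] {n : ℕ} {b : HitchinBase k C n}
  {W : C.affineOpens} {t : Γ(C, W.1)} {D : VectorField k C W.1}

lemma IsChart.linearFunction_eq (hW : IsChart W t D) (δ : VectorField k C W.1) :
    linearFunction W δ = (cotangentProj k C).app W.1 (δ t) * linearFunction W D := by
  conv_lhs => rw [hW.eq_smul δ]
  exact linearFunction_smul W _ _

/-- As `D` generates the vector fields, the spectral curve is cut out in a chart by the single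
function attached to `D`. -/
lemma IsChart.spectralFunction_eq (hW : IsChart W t D) (δ : VectorField k C W.1) :
    spectralFunction b W δ = (cotangentProj k C).app W.1 (δ t) ^ n * spectralFunction b W D := by
  conv_lhs => rw [hW.eq_smul δ]
  exact spectralFunction_smul b W _ _

lemma IsChart.cotangent_hom_ext (hW : IsChart W t D) {T : Scheme.{u}}
    {g₁ g₂ : T ⟶ cotangentBundle k C} (h : g₁ ≫ cotangentProj k C = g₂ ≫ cotangentProj k C)
    (h₁ : ⊤ ≤ g₁ ⁻¹ᵁ (cotangentProj k C ⁻¹ᵁ W.1)) (h₂ : ⊤ ≤ g₂ ⁻¹ᵁ (cotangentProj k C ⁻¹ᵁ W.1))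
    (H : (g₁.appLE _ ⊤ h₁).hom (linearFunction W D) = (g₂.appLE _ ⊤ h₂).hom (linearFunction W D)) :
    g₁ = g₂ := by
  refine SpectralSurface.cotangent_hom_ext h fun x ↦ ⟨W, ⊤, h₁, h₂, trivial, fun δ ↦ ?_⟩
  rw [hW.linearFunction_eq, map_mul, map_mul, H]
  congr 1
  have e₁ := Scheme.Hom.comp_appLE g₁ (cotangentProj k C) W.1 ⊤ h₁
  have e₂ := Scheme.Hom.comp_appLE g₂ (cotangentProj k C) W.1 ⊤ h₂
  exact congr($(e₁.symm.trans ((appLE_congr_hom h _).trans e₂)).hom (δ t))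

variable [CompactSpace C] [C.IsSeparated] {A : CommRingCat.{u}} {f : Spec A ⟶ C}

/-- The base change of the spectral curve along `Spec A → W` is `Spec A[y]/(χ)`, for `χ` the
characteristic polynomial. -/
lemma IsChart.exists_isPullback (hW : IsChart W t D) (hf : ⊤ ≤ f ⁻¹ᵁ W.1) {χ : Polynomial A}
    (hχ : χ = (charPoly b W D).map (f.appLE W.1 ⊤ hf ≫ (Scheme.ΓSpecIso A).hom).hom) :
    ∃ g : specAdjoinRoot χ ⟶ spectralCover b,
      IsPullback g (specAdjoinRootProj χ) (spectralProj b) f ∧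
      ∀ h : ⊤ ≤ (g ≫ spectralIncl b) ⁻¹ᵁ (cotangentProj k C ⁻¹ᵁ W.1),
        ((g ≫ spectralIncl b).appLE _ ⊤ h).hom (linearFunction W D) = specAdjoinRootFun χ := by
  have eval_eq {T : Scheme.{u}} (v : T ⟶ Spec A) (hv : ⊤ ≤ (v ≫ f) ⁻¹ᵁ W.1) (y : Γ(T, ⊤)) :
      χ.eval₂ (v.appTop.hom.comp (Scheme.ΓSpecIso A).inv.hom) y =
        (charPoly b W D).eval₂ ((v ≫ f).appLE W.1 ⊤ hv).hom y := by
    rw [hχ, Polynomial.eval₂_map]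
    congr 1
    have e : (f.appLE W.1 ⊤ hf ≫ (Scheme.ΓSpecIso A).hom) ≫ (Scheme.ΓSpecIso A).inv ≫ v.appTop =
        (v ≫ f).appLE W.1 ⊤ hv := by
      simp only [Category.assoc, Iso.hom_inv_id_assoc]
      rw [← appLE_top_top v (top_le_preimage_top v)]
      exact Scheme.Hom.appLE_comp_appLE v f W.1 ⊤ ⊤ hf _
    exact congrArg CommRingCat.Hom.hom e
  have hv {T : Scheme.{u}} (v : T ⟶ Spec A) : ⊤ ≤ (v ≫ f) ⁻¹ᵁ W.1 := fun x _ ↦ hf (Opens.mem_top _)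
  let f' := specAdjoinRootProj χ ≫ f
  obtain ⟨g, hg, Hg⟩ := exists_cotangent_lift (k := k) f' W (hv _)
    { toFun δ := (f'.appLE W.1 ⊤ (hv _)).hom (δ t) * specAdjoinRootFun χ
      map_zero' := by simp
      map_add' δ δ' := by simp [add_mul] }
    (fun r δ ↦ by simp [mul_assoc])
  have hgW : ⊤ ≤ g ⁻¹ᵁ (cotangentProj k C ⁻¹ᵁ W.1) := by
    rw [← Scheme.Hom.comp_preimage, hg]; exact hv _
  have hgD : (g.appLE _ ⊤ hgW).hom (linearFunction W D) = specAdjoinRootFun χ := by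
    refine (Hg hgW D).trans ?_
    simp [hW.apply_self]
  obtain ⟨q, hq⟩ := exists_spectral_lift b g fun x ↦ ⟨W, ⊤, hgW, trivial, fun δ ↦ by
    rw [hW.spectralFunction_eq, map_mul, appLE_spectralFunction b W D g hg hgW (hv _), hgD,
      ← eval_eq (specAdjoinRootProj χ) (hv _)]
    have e : ((specAdjoinRootProj χ).appTop.hom.comp (Scheme.ΓSpecIso A).inv.hom) =
        (Scheme.ΓSpecIso (.of (AdjoinRoot χ))).inv.hom.comp (AdjoinRoot.of χ) :=
      congrArg CommRingCat.Hom.hom (Scheme.ΓSpecIso_inv_naturality _).symm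
    rw [e, ← Polynomial.hom_eval₂, AdjoinRoot.eval₂_root, map_zero, mul_zero]⟩
  have hqp : q ≫ spectralProj b = f' := by rw [spectralProj, reassoc_of% hq, hg]
  -- A morphism from a scheme over `Spec A` to the cotangent bundle, over `C`, is a choice of
  -- function, the value of `D`; it lands in the spectral curve exactly when this function is a root
  -- of `χ`.
  have hlift (s : PullbackCone (spectralProj b) f) : ∃ m, m ≫ q = s.fst ∧
      m ≫ specAdjoinRootProj χ = s.snd := by
    have hs : (s.fst ≫ spectralIncl b) ≫ cotangentProj k C = s.snd ≫ f := by
      simpa [spectralProj] using s.condition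
    have hsW : ⊤ ≤ (s.fst ≫ spectralIncl b) ⁻¹ᵁ (cotangentProj k C ⁻¹ᵁ W.1) := by
      rw [← Scheme.Hom.comp_preimage, hs]; exact hv _
    obtain ⟨m, hm, hm'⟩ := exists_specAdjoinRoot_lift (χ := χ) s.snd
      (((s.fst ≫ spectralIncl b).appLE _ ⊤ hsW).hom (linearFunction W D)) (by
        rw [eval_eq s.snd (hv _), ← appLE_spectralFunction b W D _ hs hsW (hv _),
          comp_appLE_apply (spectralIncl b) s.fst le_rfl hsW, spectralIncl_appLE, map_zero])
    refine ⟨m, ?_, hm⟩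
    rw [← cancel_mono (spectralIncl b), Category.assoc, hq]
    have hmW : ⊤ ≤ (m ≫ g) ⁻¹ᵁ (cotangentProj k C ⁻¹ᵁ W.1) := fun x _ ↦ hgW (Opens.mem_top _)
    refine hW.cotangent_hom_ext ?_ hmW hsW ?_
    · rw [Category.assoc, hg, hs, ← hm, Category.assoc]
    · rw [comp_appLE_apply g m hgW (top_le_preimage_top m), hgD, appLE_top_top, hm']
  choose lift hl₁ hl₂ using hlift
  refine ⟨q, ⟨⟨hqp⟩, ⟨PullbackCone.IsLimit.mk _ lift hl₁ hl₂ fun s m h₁ h₂ ↦ ?_⟩⟩, fun h ↦ ?_⟩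
  · refine specAdjoinRoot_hom_ext (h₂.trans (hl₂ s).symm) ?_
    have key (m : s.pt ⟶ specAdjoinRoot χ) (hm : m ≫ q = s.fst) (h') :
        m.appTop.hom (specAdjoinRootFun χ) =
          ((s.fst ≫ spectralIncl b).appLE _ ⊤ h').hom (linearFunction W D) := by
      have e : s.fst ≫ spectralIncl b = m ≫ g := by rw [← hm, Category.assoc, hq]
      rw [appLE_congr_hom e, comp_appLE_apply g m hgW (top_le_preimage_top m), hgD, appLE_top_top]
    have h' : ⊤ ≤ (s.fst ≫ spectralIncl b) ⁻¹ᵁ (cotangentProj k C ⁻¹ᵁ W.1) := by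
      rw [← h₁, Category.assoc, hq]
      exact fun x _ ↦ hgW (Opens.mem_top _)
    rw [key m h₁ h', key _ (hl₁ s) h']
  · rw [appLE_congr_hom hq, hgD]

end SpectralCurve

/-! ### Properties which are local at the target. -/

lemma isAffineOpen_val {Z : Scheme.{u}} (U : Z.affineOpens) : IsAffineOpen U.1 := U.2

/-- The inclusion of an affine open subset, as a morphism from a spectrum. -/
abbrev affineIncl {Z : Scheme.{u}} (U : Z.affineOpens) : Spec Γ(Z, U.1) ⟶ Z :=
  (isAffineOpen_val U).fromSpec

lemma isZariskiLocalAtTarget_of_hasRingHomProperty (P : MorphismProperty Scheme.{u})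
    (Q : ∀ {R S : Type u} [CommRing R] [CommRing S], (R →+* S) → Prop) [HasRingHomProperty P Q] :
    IsZariskiLocalAtTarget P :=
  inferInstance

lemma isZariskiLocalAtTarget_of_hasAffineProperty (P : MorphismProperty Scheme.{u})
    (Q : AffineTargetMorphismProperty) [HasAffineProperty P Q] : IsZariskiLocalAtTarget P :=
  inferInstance

/-- Locality in terms of cartesian squares over arbitrary open immersions, the form in which the
charts `Spec A[y]/(χ) → Spec A` are available. -/
lemma of_isPullback_openImmersion (P : MorphismProperty Scheme.{u}) [IsZariskiLocalAtTarget P]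
    {Y Z : Scheme.{u}} {f : Y ⟶ Z} (H : ∀ z : Z, ∃ (U S : Scheme.{u}) (i : U ⟶ Z) (g : S ⟶ Y)
      (f' : S ⟶ U), IsOpenImmersion i ∧ z ∈ Set.range i ∧ IsPullback g f' f i ∧ P f') : P f := by
  refine IsZariskiLocalAtTarget.of_forall_exists_morphismRestrict fun z ↦ ?_
  obtain ⟨U, S, i, g, f', hi, hz, h, hf'⟩ := H z
  refine ⟨i.opensRange, hz, ?_⟩
  have h' : IsPullback g (f' ≫ i.isoOpensRange.hom) f i.opensRange.ι :=
    h.of_iso (Iso.refl _) (Iso.refl _) i.isoOpensRange (Iso.refl _) (by simp) (by simp) (by simp)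
      (by simp)
  have e := (isPullback_morphismRestrict f i.opensRange).flip.isoIsPullback_hom_snd _ _ h'
  rw [← e,
    P.cancel_left_of_respectsIso, P.cancel_right_of_respectsIso]
  exact hf'

lemma isZariskiLocalAtTarget_isFinite : IsZariskiLocalAtTarget (@IsFinite.{u}) :=
  @isZariskiLocalAtTarget_of_hasAffineProperty _ _
    IsFinite.instHasAffinePropertyAndIsAffineFiniteCarrierObjOppositeOpensCarrierCarrierCommRingCatPresheafOpOpensTopHomAppTop

lemma isZariskiLocalAtTarget_flat : IsZariskiLocalAtTarget (@Flat.{u}) :=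
  isZariskiLocalAtTarget_of_hasRingHomProperty _ RingHom.Flat

/-! ### Finiteness, flatness and degree of `A[y]/(χ)`. -/

section AdjoinRoot

variable {A : CommRingCat.{u}} {χ : Polynomial A}

lemma isFinite_specAdjoinRootProj (hχ : χ.Monic) : IsFinite (specAdjoinRootProj χ) := by
  rw [IsFinite.SpecMap_iff]
  exact RingHom.finite_algebraMap.mpr hχ.finite_adjoinRoot

lemma flat_specAdjoinRootProj (hχ : χ.Monic) : Flat (specAdjoinRootProj χ) := by
  rw [Flat.SpecMap_iff]
  have := hχ.free_adjoinRoot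
  exact RingHom.flat_algebraMap_iff.mpr inferInstance

lemma finrank_specAdjoinRootProj (hχ : χ.Monic) (x : Spec A) :
    (specAdjoinRootProj χ).finrank x = χ.natDegree := by
  have := hχ.free_adjoinRoot
  have := hχ.finite_adjoinRoot
  have : Nontrivial A := (x : PrimeSpectrum A).nontrivial
  refine (Scheme.Hom.finrank_SpecMap_algebraMap A (AdjoinRoot χ) x).trans ?_
  rw [Module.rankAtStalk_eq_finrank_of_free]
  exact (AdjoinRoot.powerBasis' hχ).finrank.trans (AdjoinRoot.powerBasis'_dim hχ)

end AdjoinRoot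

/-! ### The spectral curve is finite flat of degree `n`. -/

section Curve

variable {k : Type u} [Field k] {C : Scheme.{u}} [C.Over (Spec (.of k))]
  [LocallyOfFinitePresentation (C ↘ Spec (.of k))] {n : ℕ} (b : HitchinBase k C n)
  [CompactSpace C] [C.IsSeparated]

lemma monic_charPoly (U : C.affineOpens) (δ : VectorField k C U.1) : (charPoly b U δ).Monic :=
  monic_monicOfCoeffs _

lemma natDegree_charPoly (U : C.affineOpens) (δ : VectorField k C U.1) [Nontrivial Γ(C, U.1)] :
    (charPoly b U δ).natDegree = n :=
  natDegree_monicOfCoeffs _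

lemma IsChart.exists_isPullback_fromSpec {W : C.affineOpens} {t : Γ(C, W.1)}
    {D : VectorField k C W.1} (hW : IsChart W t D) :
    ∃ g : specAdjoinRoot (charPoly b W D) ⟶ spectralCover b,
      IsPullback g (specAdjoinRootProj (charPoly b W D)) (spectralProj b) (affineIncl W) ∧
      ∀ h : ⊤ ≤ (g ≫ spectralIncl b) ⁻¹ᵁ (cotangentProj k C ⁻¹ᵁ W.1),
        ((g ≫ spectralIncl b).appLE _ ⊤ h).hom (linearFunction W D) =
          specAdjoinRootFun (charPoly b W D) := by
  refine hW.exists_isPullback (top_le_fromSpec_preimage (isAffineOpen_val W)) ?_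
  rw [fromSpec_appLE, Iso.inv_hom_id]
  exact (Polynomial.map_id).symm

variable [SmoothOfRelativeDimension 1 (C ↘ Spec (.of k))]

lemma of_specAdjoinRoot {P : MorphismProperty Scheme.{u}} (hP : IsZariskiLocalAtTarget P)
    (H : ∀ (W : C.affineOpens) (D : VectorField k C W.1), P (specAdjoinRootProj (charPoly b W D))) :
    P (spectralProj b) := by
  refine of_isPullback_openImmersion P fun x ↦ ?_
  obtain ⟨W, t, D, hx, hW⟩ := exists_isChart (k := k) x
  obtain ⟨g, hg, -⟩ := hW.exists_isPullback_fromSpec b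
  exact ⟨_, _, _, _, _, inferInstance, by rwa [IsAffineOpen.range_fromSpec], hg, H W D⟩

instance : IsFinite (spectralProj b) :=
  of_specAdjoinRoot b isZariskiLocalAtTarget_isFinite fun _ _ ↦ isFinite_specAdjoinRootProj (monic_charPoly b _ _)

instance : Flat (spectralProj b) :=
  of_specAdjoinRoot b isZariskiLocalAtTarget_flat fun _ _ ↦ flat_specAdjoinRootProj (monic_charPoly b _ _)

lemma finrank_spectralProj (c : C) : (spectralProj b).finrank c = n := by
  obtain ⟨W, t, D, hx, hW⟩ := exists_isChart (k := k) c
  obtain ⟨g, hg, -⟩ := hW.exists_isPullback_fromSpec b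
  obtain ⟨w, rfl⟩ : c ∈ Set.range (affineIncl W) := by rwa [IsAffineOpen.range_fromSpec]
  have : Nontrivial Γ(C, W.1) := (w : PrimeSpectrum Γ(C, W.1)).nontrivial
  rw [← Scheme.Hom.finrank_of_isPullback _ _ _ _ hg w, finrank_specAdjoinRootProj
    (monic_charPoly b _ _), natDegree_charPoly]

end Curve

/-! ### The surface `X^+_b` as a base change of the spectral curve. -/

section Plus

variable {k : Type u} [Field k] {X C : Scheme.{u}} [X.Over (Spec (.of k))]
  [C.Over (Spec (.of k))] {π : X ⟶ C} [π.IsOver (Spec (.of k))]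
  [LocallyOfFinitePresentation (X ↘ Spec (.of k))]
  [LocallyOfFinitePresentation (C ↘ Spec (.of k))] {n : ℕ} {b : HitchinBase k C n}
  {bX : HitchinBase k X n} [CompactSpace X] [X.IsSeparated] [CompactSpace C] [C.IsSeparated]
  [SmoothOfRelativeDimension 1 (C ↘ Spec (.of k))]

variable (π b) in
lemma finrank_plusProj (x : X) : (plusProj π b).finrank x = n := by
  rw [Scheme.Hom.finrank_pullback_snd, finrank_spectralProj]

instance (a : HitchinBase k X n) : IsAffineHom (spectralProj a) := by
  rw [spectralProj]; infer_instance

/-- `X^•_b → X` is affine, hence separated, so finiteness of the composite passes to `q`. -/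
lemma isFinite_of_comp_spectralProj {q : plusSurface π b ⟶ spectralCover bX}
    (hq : q ≫ spectralProj bX = plusProj π b) : IsFinite q := by
  have : IsFinite (q ≫ spectralProj bX) := by rw [hq]; infer_instance
  exact .of_comp q (spectralProj bX)

/-- Over an affine open subset of `X` which lies over the domain of a chart, the surface `X^+_b`
is `Spec A[y]/(χ)`. -/
lemma IsChart.exists_isPullback_plus {W : C.affineOpens} {t : Γ(C, W.1)}
    {D : VectorField k C W.1} (hW : IsChart W t D) {A : CommRingCat.{u}} {f : Spec A ⟶ X}
    (hf : ⊤ ≤ f ⁻¹ᵁ (π ⁻¹ᵁ W.1)) {χ : Polynomial A}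
    (hχ : χ = (charPoly b W D).map
      ((f ≫ π).appLE W.1 ⊤ hf ≫ (Scheme.ΓSpecIso A).hom).hom) :
    ∃ g : specAdjoinRoot χ ⟶ plusSurface π b,
      IsPullback g (specAdjoinRootProj χ) (plusProj π b) f ∧
      ∀ h : ⊤ ≤ (g ≫ pullback.fst (spectralProj b) π ≫ spectralIncl b) ⁻¹ᵁ
          (cotangentProj k C ⁻¹ᵁ W.1),
        ((g ≫ pullback.fst (spectralProj b) π ≫ spectralIncl b).appLE _ ⊤ h).hom
          (linearFunction W D) = specAdjoinRootFun χ := by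
  obtain ⟨g, hg, H⟩ := hW.exists_isPullback hf hχ
  have e : g ≫ spectralProj b = (specAdjoinRootProj χ ≫ f) ≫ π := by
    rw [hg.w, Category.assoc]
  refine ⟨pullback.lift g _ e, ?_, fun h ↦ ?_⟩
  · refine IsPullback.of_right (h₁₂ := pullback.fst (spectralProj b) π) (h₂₂ := π) ?_
      (pullback.lift_snd _ _ _) (IsPullback.of_hasPullback _ _)
    rwa [pullback.lift_fst]
  · rw [← H]
    rw [appLE_congr_hom (pullback.lift_fst_assoc _ _ _ _)]

end Plus

/-! ### Rigidity of roots of separable polynomials. -/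

section Polynomial

open Polynomial

/-- Applying a `K`-linear form on `B` to the coefficients gives a polynomial over the infinite field
`K` vanishing everywhere. Linear forms separate the elements of `B`, which may have zero divisors.
-/
lemma eq_zero_of_forall_eval_algebraMap {K B : Type u} [Field K] [Infinite K] [CommRing B]
    [Algebra K B] {P : B[X]} (h : ∀ s : K, P.eval (algebraMap K B s) = 0) : P = 0 := by
  ext i
  rw [coeff_zero, ← Module.forall_dual_apply_eq_zero_iff K]
  intro l
  let Q : K[X] := ∑ j ∈ Finset.range (P.natDegree + 1), monomial j (l (P.coeff j))
  have hQ : Q = 0 := by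
    refine Polynomial.funext fun s ↦ ?_
    have := congrArg l (h s)
    rw [eval_eq_sum_range, map_sum, map_zero] at this
    simp only [Q, eval_finsetSum, eval_monomial, eval_zero]
    rw [← this]
    refine Finset.sum_congr rfl fun j _ ↦ ?_
    rw [mul_comm, ← map_pow, mul_comm (P.coeff j), ← Algebra.smul_def, map_smul, smul_eq_mul]
  have := congrArg (fun q ↦ q.coeff i) hQ
  simp only [Q, finsetSum_coeff, coeff_monomial, coeff_zero, Finset.sum_ite_eq'] at this
  split_ifs at this with hi
  · exact this
  · rw [coeff_eq_zero_of_natDegree_lt (by simpa using hi), map_zero]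

/-- If `χ` is separable, then its zeros are infinitesimally rigid: a line of zeros is constant. -/
lemma eq_zero_of_forall_eval₂_add_mul {K A B : Type u} [Field K] [Infinite K] [CommRing A]
    [CommRing B] (φ : K →+* B) (f : A →+* B) {χ : A[X]} (hχ : χ.Separable) {y e : B}
    (h : ∀ s : K, χ.eval₂ f (y + φ s * e) = 0) : e = 0 := by
  let _ := φ.toAlgebra
  have hP : (χ.map f).comp (C y + X * C e) = 0 := by
    refine eq_zero_of_forall_eval_algebraMap (K := K) fun s ↦ ?_
    rw [eval_comp]
    simp only [eval_add, eval_C, eval_mul, eval_X]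
    rw [Polynomial.eval_map]
    exact h s
  -- The derivative of `χ(y + X e)` at `X = 0` is `χ'(y) e`, and `χ'(y)` is invertible since `χ(y) =
  -- 0` and `u χ + v χ' = 1`.
  have h₁ := congrArg (fun P : B[X] ↦ (derivative P).eval 0) hP
  simp only [derivative_comp, derivative_add, derivative_C, derivative_mul, derivative_X, eval_mul,
    eval_comp, eval_add, eval_C, eval_X, derivative_zero, eval_zero, derivative_map] at h₁
  have h₀ : (χ.map f).eval y = 0 := by
    have := h 0
    rw [map_zero, zero_mul, add_zero] at this
    rwa [Polynomial.eval_map]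
  obtain ⟨u, v, huv⟩ := hχ
  have h₂ := congrArg (fun P : A[X] ↦ (P.map f).eval y) huv
  simp only [Polynomial.map_add, Polynomial.map_mul, eval_add, eval_mul, h₀, Polynomial.map_one,
    eval_one] at h₂
  have h₃ : (derivative χ |>.map f).eval y * e = 0 := by
    simpa [mul_comm] using h₁
  calc e = ((u.map f).eval y * 0 + (v.map f).eval y * ((derivative χ).map f).eval y) * e := by
        rw [h₂, one_mul]
    _ = (v.map f).eval y * (((derivative χ).map f).eval y * e) := by ring
    _ = 0 := by rw [h₃, mul_zero]

end Polynomial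

/-! ### Points of `X^+_b`, closed immersion and generic isomorphism. -/

section Plus

variable {k : Type u} [Field k] {X C : Scheme.{u}} [X.Over (Spec (.of k))]
  [C.Over (Spec (.of k))] {π : X ⟶ C} [π.IsOver (Spec (.of k))]
  [LocallyOfFinitePresentation (X ↘ Spec (.of k))]
  [LocallyOfFinitePresentation (C ↘ Spec (.of k))] {n : ℕ} {b : HitchinBase k C n}
  {bX : HitchinBase k X n} [CompactSpace C] [C.IsSeparated]
  {W : C.affineOpens} {t : Γ(C, W.1)} {D : VectorField k C W.1} {T : Scheme.{u}}

variable (π b) in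
/-- The projection `X^+_b → T^*_C`. -/
def plusToCotangent : plusSurface π b ⟶ cotangentBundle k C :=
  pullback.fst (spectralProj b) π ≫ spectralIncl b

lemma plusToCotangent_comp : plusToCotangent π b ≫ cotangentProj k C = plusProj π b ≫ π := by
  rw [plusToCotangent, Category.assoc]
  exact pullback.condition

lemma IsChart.plus_hom_ext (hW : IsChart W t D) {a a' : T ⟶ plusSurface π b}
    (h : a ≫ plusProj π b = a' ≫ plusProj π b)
    (h₁ : ⊤ ≤ (a ≫ plusToCotangent π b) ⁻¹ᵁ (cotangentProj k C ⁻¹ᵁ W.1))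
    (h₂ : ⊤ ≤ (a' ≫ plusToCotangent π b) ⁻¹ᵁ (cotangentProj k C ⁻¹ᵁ W.1))
    (H : ((a ≫ plusToCotangent π b).appLE _ ⊤ h₁).hom (linearFunction W D) =
      ((a' ≫ plusToCotangent π b).appLE _ ⊤ h₂).hom (linearFunction W D)) : a = a' := by
  refine pullback.hom_ext ?_ h
  rw [← cancel_mono (spectralIncl b), Category.assoc, Category.assoc]
  refine hW.cotangent_hom_ext ?_ h₁ h₂ H
  have e (a : T ⟶ plusSurface π b) : (a ≫ plusToCotangent π b) ≫ cotangentProj k C =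
      (a ≫ plusProj π b) ≫ π := by
    rw [Category.assoc, plusToCotangent_comp, Category.assoc]
  exact (e a).trans ((congrArg (· ≫ π) h).trans (e a').symm)

/-- Together with `IsChart.plus_hom_ext` this identifies the points of `X^+_b` over a chart with
pairs of a point of `X` and a root of the characteristic polynomial. -/
lemma IsChart.exists_plus_of_root (hW : IsChart W t D) (v : T ⟶ X) (hv : ⊤ ≤ (v ≫ π) ⁻¹ᵁ W.1)
    (y : Γ(T, ⊤)) (hy : (charPoly b W D).eval₂ ((v ≫ π).appLE W.1 ⊤ hv).hom y = 0) :
    ∃ a : T ⟶ plusSurface π b, a ≫ plusProj π b = v ∧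
      ∀ h : ⊤ ≤ (a ≫ plusToCotangent π b) ⁻¹ᵁ (cotangentProj k C ⁻¹ᵁ W.1),
        ((a ≫ plusToCotangent π b).appLE _ ⊤ h).hom (linearFunction W D) = y := by
  obtain ⟨g, hg, Hg⟩ := exists_cotangent_lift (k := k) (v ≫ π) W hv
    { toFun δ := ((v ≫ π).appLE W.1 ⊤ hv).hom (δ t) * y
      map_zero' := by simp
      map_add' δ δ' := by simp [add_mul] }
    (fun r δ ↦ by simp [mul_assoc])
  have hgW : ⊤ ≤ g ⁻¹ᵁ (cotangentProj k C ⁻¹ᵁ W.1) := by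
    rw [← Scheme.Hom.comp_preimage, hg]; exact hv
  have hgD : (g.appLE _ ⊤ hgW).hom (linearFunction W D) = y := by
    refine (Hg hgW D).trans ?_
    simp [hW.apply_self]
  obtain ⟨q, hq⟩ := exists_spectral_lift b g fun x ↦ ⟨W, ⊤, hgW, trivial, fun δ ↦ by
    rw [hW.spectralFunction_eq, map_mul, SpectralSurface.appLE_spectralFunction b W D g hg hgW hv,
      hgD, hy, mul_zero]⟩
  have e : q ≫ spectralProj b = v ≫ π := by rw [spectralProj, reassoc_of% hq, hg]
  refine ⟨pullback.lift q v e, pullback.lift_snd _ _ _, fun h ↦ ?_⟩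
  have e' : pullback.lift q v e ≫ plusToCotangent π b = g := by
    rw [plusToCotangent, pullback.lift_fst_assoc, hq]
  rw [appLE_congr_hom e', hgD]

variable [CompactSpace X] [X.IsSeparated] [SmoothOfRelativeDimension 1 (C ↘ Spec (.of k))]
  {d : pullback (cotangentProj k C) π ⟶ cotangentBundle k X} {U : X.affineOpens}
  {δ₀ : VectorField k X U.1}

lemma le_preimage_plusToCotangent (h : U.1 ≤ π ⁻¹ᵁ W.1) {a : T ⟶ plusSurface π b}
    (hv : ⊤ ≤ (a ≫ plusProj π b) ⁻¹ᵁ U.1) :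
    ⊤ ≤ (a ≫ plusToCotangent π b) ⁻¹ᵁ (cotangentProj k C ⁻¹ᵁ W.1) := by
  rw [← Scheme.Hom.comp_preimage, Category.assoc, plusToCotangent_comp]
  exact fun x hx ↦ h (hv hx)

lemma le_preimage_plusIncl (hd : IsCodifferential π d) {a : T ⟶ plusSurface π b}
    (hv : ⊤ ≤ (a ≫ plusProj π b) ⁻¹ᵁ U.1) :
    ⊤ ≤ (a ≫ plusIncl π b ≫ d) ⁻¹ᵁ (cotangentProj k X ⁻¹ᵁ U.1) := by
  rw [← Scheme.Hom.comp_preimage, Category.assoc, (isCodiff_plus hd).comp_proj]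
  exact hv

lemma IsChart.appLE_plusIncl (hW : IsChart W t D) (hd : IsCodifferential π d)
    (h : U.1 ≤ π ⁻¹ᵁ W.1) {a : T ⟶ plusSurface π b} (hv : ⊤ ≤ (a ≫ plusProj π b) ⁻¹ᵁ U.1)
    (δ : VectorField k X U.1) :
    ((a ≫ plusIncl π b ≫ d).appLE _ ⊤ (le_preimage_plusIncl hd hv)).hom (linearFunction U δ) =
      ((a ≫ plusProj π b).appLE _ ⊤ hv).hom (δ ((π.appLE W.1 U.1 h).hom t)) *
        ((a ≫ plusToCotangent π b).appLE _ ⊤ (le_preimage_plusToCotangent h hv)).hom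
          (linearFunction W D) :=
  ((isCodiff_plus hd).comp plusToCotangent_comp a).chart hW U h ⊤ hv _ _ δ

/-- Over the locus where the coordinate of the curve is part of a coordinate system of the surface,
the morphism `X^+_b → T^*_X` is a monomorphism. -/
lemma IsChart.plusIncl_comp_cancel (hW : IsChart W t D) (hd : IsCodifferential π d)
    (h : U.1 ≤ π ⁻¹ᵁ W.1) (hδ₀ : δ₀ ((π.appLE W.1 U.1 h).hom t) = 1) {a a' : T ⟶ plusSurface π b}
    (hv : ⊤ ≤ (a ≫ plusProj π b) ⁻¹ᵁ U.1)
    (e : a ≫ plusIncl π b ≫ d = a' ≫ plusIncl π b ≫ d) : a = a' := by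
  have e' : a ≫ plusProj π b = a' ≫ plusProj π b := by
    rw [← (isCodiff_plus hd).comp_proj, ← Category.assoc, e, Category.assoc]
  have hv' : ⊤ ≤ (a' ≫ plusProj π b) ⁻¹ᵁ U.1 := by rw [← e']; exact hv
  have key {a : T ⟶ plusSurface π b} (hv : ⊤ ≤ (a ≫ plusProj π b) ⁻¹ᵁ U.1) :=
    hW.appLE_plusIncl hd h hv δ₀
  simp only [hδ₀, map_one, one_mul] at key
  refine hW.plus_hom_ext e' (le_preimage_plusToCotangent h hv) (le_preimage_plusToCotangent h hv') ?_
  rw [← key hv, ← key hv']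
  exact congr($(appLE_congr_hom e _).hom _)

/-- A finite monomorphism is a closed immersion. Injectivity on points holds because the linear
function of `δ₀` pulls back to the root `y` itself. -/
lemma IsChart.isClosedImmersion_plusIncl (hW : IsChart W t D) (hd : IsCodifferential π d)
    (h : U.1 ≤ π ⁻¹ᵁ W.1) (hδ₀ : δ₀ ((π.appLE W.1 U.1 h).hom t) = 1) :
    IsClosedImmersion ((plusIncl π b ≫ d) ∣_ (cotangentProj k X ⁻¹ᵁ U.1)) := by
  set j := plusIncl π b ≫ d
  have hj : j ≫ cotangentProj k X = plusProj π b := (isCodiff_plus hd).comp_proj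
  have : IsFinite (j ≫ cotangentProj k X) := by rw [hj]; infer_instance
  have : IsFinite j := .of_comp j (cotangentProj k X)
  have : Mono (j ∣_ (cotangentProj k X ⁻¹ᵁ U.1)) := by
    refine ⟨fun {T} f g hfg ↦ ?_⟩
    rw [← cancel_mono (j ⁻¹ᵁ (cotangentProj k X ⁻¹ᵁ U.1)).ι]
    refine hW.plusIncl_comp_cancel hd h hδ₀ ?_ ?_
    · intro y _
      have := (f y).2
      rw [Category.assoc, ← hj]
      exact this
    · have := congr($hfg ≫ (cotangentProj k X ⁻¹ᵁ U.1).ι)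
      simp only [Category.assoc, morphismRestrict_ι] at this
      simpa using this
  exact (IsClosedImmersion.iff_isFinite_and_mono _).mpr ⟨inferInstance, this⟩

variable [CharZero k]

/-- Over the locus where the coordinate of the curve is part of a coordinate system of the surface,
and the characteristic polynomial is separable, the morphism `X^+_b → X^•_b` is an isomorphism. -/
lemma IsChart.isIso_restrict (hb : IsPullbackOf π b bX) (hW : IsChart W t D)
    (hd : IsCodifferential π d) (h : U.1 ≤ π ⁻¹ᵁ W.1)
    (hδ₀ : δ₀ ((π.appLE W.1 U.1 h).hom t) = 1) (hχ : (charPoly b W D).Separable)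
    {q : plusSurface π b ⟶ spectralCover bX} (hq : q ≫ spectralIncl bX = plusIncl π b ≫ d) :
    IsIso (q ∣_ (spectralProj bX ⁻¹ᵁ U.1)) := by
  have hqp : q ≫ spectralProj bX = plusProj π b := by
    rw [spectralProj, ← Category.assoc, hq, (isCodiff_plus hd).comp_proj]
  set V := spectralProj bX ⁻¹ᵁ U.1
  have hv : ⊤ ≤ (V.ι ≫ spectralProj bX) ⁻¹ᵁ U.1 := fun y _ ↦ y.2
  have hv' : ⊤ ≤ ((V.ι ≫ spectralProj bX) ≫ π) ⁻¹ᵁ W.1 := fun y _ ↦ h y.2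
  have hi : ⊤ ≤ (V.ι ≫ spectralIncl bX) ⁻¹ᵁ (cotangentProj k X ⁻¹ᵁ U.1) := fun y _ ↦ y.2
  -- On `X^•_b` the equation attached to `δ` reads `χ(δ) = 0` as soon as `δ(π^*t) = 1`.
  have hz (δ : VectorField k X U.1) (hδ : δ ((π.appLE W.1 U.1 h).hom t) = 1) :
      (charPoly b W D).eval₂ (((V.ι ≫ spectralProj bX) ≫ π).appLE W.1 ⊤ hv').hom
        (((V.ι ≫ spectralIncl bX).appLE _ ⊤ hi).hom (linearFunction U δ)) = 0 := by
    have e₁ := SpectralSurface.appLE_spectralFunction bX U δ (V.ι ≫ spectralIncl bX)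
      (f := V.ι ≫ spectralProj bX) (by rw [Category.assoc, spectralProj]) hi hv
    rw [comp_appLE_apply (spectralIncl bX) V.ι le_rfl hi, spectralIncl_appLE, map_zero,
      charPoly_pullback_of_eq_one hb hW U h δ hδ, Polynomial.eval₂_map] at e₁
    rw [e₁]
    congr 1
    exact RingHom.ext fun s ↦ comp_appLE_apply π _ h hv s
  set η := ((V.ι ≫ spectralIncl bX).appLE _ ⊤ hi).hom (linearFunction U δ₀)
  -- The candidate inverse of `q` is the morphism given by the root `η`.
  obtain ⟨r, hr, hrη⟩ := hW.exists_plus_of_root (b := b) (V.ι ≫ spectralProj bX) hv' η (hz δ₀ hδ₀)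
  have hrq : r ≫ q = V.ι := by
    rw [← cancel_mono (spectralIncl bX), Category.assoc, hq]
    have hrv : ⊤ ≤ (r ≫ plusProj π b) ⁻¹ᵁ U.1 := by rw [hr]; exact hv
    refine SpectralSurface.cotangent_hom_ext ?_ fun y ↦ ⟨U, ⊤, le_preimage_plusIncl hd hrv, hi, trivial, fun δ ↦ ?_⟩
    · rw [Category.assoc, (isCodiff_plus hd).comp_proj, hr, Category.assoc, spectralProj]
    rw [hW.appLE_plusIncl hd h hrv, hrη, appLE_congr_hom hr]
    set s := δ ((π.appLE W.1 U.1 h).hom t)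
    let φ : k →+* Γ(V, ⊤) := ((V.ι ≫ spectralProj bX).appLE U.1 ⊤ hv).hom.comp (algebraMap k _)
    -- The field `δ - s • δ₀` kills `π^*t`, so every member of the line `δ₀ + c (δ - s • δ₀)`, `c ∈
    -- k`, takes the value one at `π^*t` and gives a root of `χ`. By rigidity the function of `δ - s
    -- • δ₀` vanishes, so every linear function is determined by `η`.
    have e := eq_zero_of_forall_eval₂_add_mul φ _ hχ (y := η)
      (e := ((V.ι ≫ spectralIncl bX).appLE _ ⊤ hi).hom (linearFunction U (δ - s • δ₀))) fun c ↦ by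
        have := hz (δ₀ + (algebraMap k Γ(X, U.1) c) • (δ - s • δ₀)) (by
          simp [hδ₀, s])
        rw [← this, linearFunction_add, linearFunction_smul, map_add, map_mul]
        congr 3
    have e₂ : linearFunction U δ = linearFunction U (δ - s • δ₀) +
        (cotangentProj k X).app U.1 s * linearFunction U δ₀ := by
      rw [← linearFunction_smul, ← linearFunction_add, sub_add_cancel]
    rw [e₂, map_add, e, zero_add, map_mul]
    congr 1
  have hrV : Set.range r ⊆ Set.range (q ⁻¹ᵁ V).ι := by
    rintro _ ⟨y, rfl⟩
    rw [Scheme.Opens.range_ι]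
    change q (r y) ∈ V
    rw [← Scheme.Hom.comp_apply, hrq]
    exact y.2
  let s := IsOpenImmersion.lift (q ⁻¹ᵁ V).ι r hrV
  have hs : s ≫ (q ⁻¹ᵁ V).ι = r := IsOpenImmersion.lift_fac _ _ _
  -- That `r` splits `q` is `hrq`; the other composite is handled by the monomorphism property of
  -- `X^+_b → T^*_X` over `U`.
  refine ⟨s, ?_, ?_⟩
  · rw [← cancel_mono (q ⁻¹ᵁ V).ι, Category.assoc, hs, Category.id_comp]
    refine hW.plusIncl_comp_cancel hd h hδ₀ ?_ ?_
    · intro y _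
      rw [Category.assoc, hr]
      exact ((q ∣_ V) y).2
    · rw [← hq, Category.assoc, reassoc_of% hrq, morphismRestrict_ι_assoc]
  · rw [← cancel_mono V.ι, Category.assoc, morphismRestrict_ι, reassoc_of% hs, hrq, Category.id_comp]

end Plus

/-! ### Surjectivity of `q` and the generic isomorphism. -/

section Surjective

variable {k : Type u} [Field k] [CharZero k] {X C : Scheme.{u}} [X.Over (Spec (.of k))]
  [C.Over (Spec (.of k))] {π : X ⟶ C} [π.IsOver (Spec (.of k))]
  [LocallyOfFinitePresentation (X ↘ Spec (.of k))]
  [LocallyOfFinitePresentation (C ↘ Spec (.of k))] {n : ℕ} {b : HitchinBase k C n}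
  {bX : HitchinBase k X n} [CompactSpace C] [C.IsSeparated] [CompactSpace X] [X.IsSeparated]
  [SmoothOfRelativeDimension 1 (C ↘ Spec (.of k))]
  {d : pullback (cotangentProj k C) π ⟶ cotangentBundle k X}
  {q : plusSurface π b ⟶ spectralCover bX}

/-- A linear form on vector fields which satisfies the spectral equation is the pull-back of a
cotangent vector of the curve. -/
lemma exists_eq_mul_of_forall_prod_eq_zero {R M K : Type u} [CommRing R] [Algebra k R]
    [AddCommGroup M] [Module k M] [Field K] [Algebra k K] {ι : Type} [Finite ι] [Fintype ι]
    (l m : M →ₗ[k] K) (c : ι → K) (H : ∀ x, ∏ i, (l x - m x * c i) = 0) :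
    ∃ i, ∀ x, l x = m x * c i := by
  let p (i : ι) : Subspace k M := LinearMap.ker (l - (LinearMap.mulRight k (c i)).comp m)
  have hp : ⋃ i, (p i : Set M) = Set.univ := by
    refine Set.eq_univ_of_forall fun x ↦ ?_
    obtain ⟨i, -, hi⟩ := Finset.prod_eq_zero_iff.mp (H x)
    exact Set.mem_iUnion.mpr ⟨i, by simpa [p] using hi⟩
  obtain ⟨i, hi⟩ := Subspace.exists_eq_top_of_iUnion_eq_univ hp
  refine ⟨i, fun x ↦ ?_⟩
  -- A vector space over an infinite field is not a finite union of proper subspaces, so one index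
  -- `i` serves all `x`.
  have : x ∈ p i := hi ▸ trivial
  simpa [p, sub_eq_zero] using this

lemma exists_eq_prod_X_sub_C {K : Type u} [Field K] [IsAlgClosed K] {P : Polynomial K}
    (hP : P.Monic) {n : ℕ} (hn : P.natDegree = n) :
    ∃ c : Fin n → K, P = ∏ i, (Polynomial.X - Polynomial.C (c i)) := by
  have hs := IsAlgClosed.splits P
  have hc : P.roots.toList.length = n := by
    rw [Multiset.length_toList, ← hs.natDegree_eq_card_roots, hn]
  subst hc
  refine ⟨P.roots.toList.get, ?_⟩
  conv_lhs => rw [hs.eq_prod_roots_of_monic hP, ← Multiset.coe_toList P.roots]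
  rw [Multiset.map_coe, Multiset.prod_coe, ← Fin.prod_univ_getElem]
  refine Fintype.prod_equiv (finCongr (by simp)) _ _ fun i ↦ by simp

lemma natDegree_map_charPoly {Z : Scheme.{u}} [Z.Over (Spec (.of k))] (a : HitchinBase k Z n)
    (W : Z.affineOpens) (D : VectorField k Z W.1) {S : Type u} [CommRing S] [Nontrivial S]
    (φ : Γ(Z, W.1) →+* S) : ((charPoly a W D).map φ).natDegree = n := by
  rw [charPoly_eq, map_monicOfCoeffs, natDegree_monicOfCoeffs]

/-- Needed for density: without it `X^•_b` could have components away from the locus where `q` is an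
isomorphism. No smoothness of `π` or separability of `χ` is used. -/
lemma surjective_of_comp_eq_plusIncl (hb : IsPullbackOf π b bX) (hd : IsCodifferential π d)
    (hq : q ≫ spectralIncl bX = plusIncl π b ≫ d) : Function.Surjective q := by
  intro z
  obtain ⟨W, t, D, U, hW, hU, h, -⟩ := exists_chart_le (k := k) π (spectralProj bX z) ⊤ trivial
  -- Over an algebraically closed extension of the residue field the characteristic polynomial
  -- splits.
  let K := AlgebraicClosure ((spectralCover bX).residueField z)
  let ζ : Spec (.of K) ⟶ spectralCover bX := Spec.map (CommRingCat.ofHom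
    (algebraMap ((spectralCover bX).residueField z) K)) ≫ (spectralCover bX).fromSpecResidueField z
  have hζ (y) : ζ y = z := by
    change (spectralCover bX).fromSpecResidueField z _ = z
    exact Scheme.fromSpecResidueField_apply _ _
  have hv : ⊤ ≤ (ζ ≫ spectralProj bX) ⁻¹ᵁ U.1 := fun y _ ↦ by
    change spectralProj bX (ζ y) ∈ U.1
    rwa [hζ]
  have hv' : ⊤ ≤ ((ζ ≫ spectralProj bX) ≫ π) ⁻¹ᵁ W.1 := fun y hy ↦ h (hv hy)
  have hi' : ⊤ ≤ (ζ ≫ spectralIncl bX) ⁻¹ᵁ (cotangentProj k X ⁻¹ᵁ U.1) := hv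
  let e : Γ(Spec (.of K), ⊤) ≃+* K := (Scheme.ΓSpecIso (.of K)).commRingCatIsoToRingEquiv
  let f : Γ(X, U.1) →+* K := e.toRingHom.comp ((ζ ≫ spectralProj bX).appLE U.1 ⊤ hv).hom
  let f' : Γ(C, W.1) →+* K := f.comp (π.appLE W.1 U.1 h).hom
  let _ : Algebra Γ(X, U.1) K := f.toAlgebra
  let _ : Algebra k K := (f.comp (algebraMap k _)).toAlgebra
  have _ : IsScalarTower k Γ(X, U.1) K := .of_algebraMap_eq fun _ ↦ rfl
  let l : VectorField k X U.1 →ₗ[k] K :=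
    { toFun δ := e (((ζ ≫ spectralIncl bX).appLE _ ⊤ hi').hom (linearFunction U δ))
      map_add' δ δ' := by rw [linearFunction_add, map_add, map_add]
      map_smul' c δ := by
        rw [← algebraMap_smul Γ(X, U.1) c δ, linearFunction_smul, map_mul, map_mul, RingHom.id_apply,
          Algebra.smul_def]
        congr 1 }
  let m : VectorField k X U.1 →ₗ[k] K :=
    { toFun δ := f (δ ((π.appLE W.1 U.1 h).hom t))
      map_add' δ δ' := by simp
      map_smul' c δ := by
        rw [Derivation.smul_apply, Algebra.smul_def, map_mul, RingHom.id_apply, Algebra.smul_def]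
        rfl }
  obtain ⟨c, hc⟩ : ∃ c : Fin n → K, (charPoly b W D).map f' =
      ∏ i, (Polynomial.X - Polynomial.C (c i)) := by
    refine exists_eq_prod_X_sub_C ((monic_monicOfCoeffs _).map f') ?_
    exact natDegree_map_charPoly b W D f'
  -- The point is the linear form `l`, and the equation at `δ` says that `l(δ) = m(δ) c_i` for some
  -- `i` which may depend on `δ`. One `i` works for all `δ`, and then `c_i` is the root that lifts
  -- the point.
  obtain ⟨i, hi⟩ := exists_eq_mul_of_forall_prod_eq_zero (R := Γ(X, U.1)) l m c fun δ ↦ by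
    have e₁ := SpectralSurface.appLE_spectralFunction bX U δ (ζ ≫ spectralIncl bX)
      (f := ζ ≫ spectralProj bX) (by rw [Category.assoc, spectralProj]) hi' hv
    rw [comp_appLE_apply (spectralIncl bX) ζ le_rfl hi', spectralIncl_appLE, map_zero] at e₁
    have e₂ := congrArg e e₁.symm
    have e₃ : e.toRingHom (Polynomial.eval₂ _ _ _) = _ := e₂
    rw [Polynomial.hom_eval₂, map_zero, ← Polynomial.eval_map] at e₃
    rw [charPoly_eq, map_monicOfCoeffs] at hc
    have := monicOfCoeffs_scale_eq_prod hc (m δ)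
    have e₄ : (charPoly bX U δ).map f = ∏ i, (Polynomial.X - Polynomial.C (m δ * c i)) := by
      rw [← this, charPoly_pullback hb hW U h, map_monicOfCoeffs]
      simp [m, f']
    have e₅ := (congrArg (Polynomial.eval (l δ)) e₄).symm.trans e₃
    simpa [Polynomial.eval_prod] using e₅
  obtain ⟨a, ha, haη⟩ := hW.exists_plus_of_root (b := b) (ζ ≫ spectralProj bX) hv' (e.symm (c i)) (by
    apply e.injective
    change e.toRingHom (Polynomial.eval₂ _ _ _) = _
    rw [Polynomial.hom_eval₂, map_zero]
    have e₁ : e.toRingHom.comp (((ζ ≫ spectralProj bX) ≫ π).appLE W.1 ⊤ hv').hom = f' :=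
      RingHom.ext fun s ↦ congrArg e (comp_appLE_apply π _ h hv s)
    rw [e₁, ← Polynomial.eval_map, hc]
    have e₂ : e.toRingHom (e.symm (c i)) = c i := e.apply_symm_apply _
    rw [e₂, Polynomial.eval_prod]
    exact Finset.prod_eq_zero (Finset.mem_univ i) (by simp))
  have hav : ⊤ ≤ (a ≫ plusProj π b) ⁻¹ᵁ U.1 := by rw [ha]; exact hv
  have haq : a ≫ q = ζ := by
    rw [← cancel_mono (spectralIncl bX), Category.assoc, hq]
    refine cotangent_hom_ext ?_ fun y ↦ ⟨U, ⊤, le_preimage_plusIncl hd hav, hi', trivial, fun δ ↦ ?_⟩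
    · rw [Category.assoc, (isCodiff_plus hd).comp_proj, ha, spectralProj]
      exact (Category.assoc ζ _ _).symm
    · rw [hW.appLE_plusIncl hd h hav, haη, appLE_congr_hom ha]
      apply e.injective
      rw [map_mul, e.apply_symm_apply]
      exact (hi δ).symm
  obtain ⟨y⟩ : Nonempty (Spec (.of K)) := inferInstance
  exact ⟨a y, by rw [← Scheme.Hom.comp_apply, haq, hζ]⟩

lemma isGenericIso_of_separable [IsLocallyNoetherian X] [IrreducibleSpace X]
    (hb : IsPullbackOf π b bX) (hd : IsCodifferential π d)
    (hq : q ≫ spectralIncl bX = plusIncl π b ≫ d) {W : C.affineOpens} {t : Γ(C, W.1)}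
    {D : VectorField k C W.1} (hW : IsChart W t D) {U : X.affineOpens} (h : U.1 ≤ π ⁻¹ᵁ W.1)
    {δ₀ : VectorField k X U.1} (hδ₀ : δ₀ ((π.appLE W.1 U.1 h).hom t) = 1)
    (hχ : (charPoly b W D).Separable) (hU : (U.1 : Set X).Nonempty) : IsGenericIso q := by
  have hqp : q ≫ spectralProj bX = plusProj π b := by
    rw [spectralProj, ← Category.assoc, hq, (isCodiff_plus hd).comp_proj]
  have : LocallyOfFinitePresentation (plusProj π b) := inferInstance
  -- `X^+_b → X` is flat and of finite presentation, hence open, so preimages of dense sets are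
  -- dense.
  have hden : Dense ((q ⁻¹ᵁ (spectralProj bX ⁻¹ᵁ U.1) : (plusSurface π b).Opens) : Set (plusSurface π b)) := by
    rw [← Scheme.Hom.comp_preimage, hqp]
    exact (U.1.2.dense hU).preimage (plusProj π b).isOpenMap
  refine ⟨spectralProj bX ⁻¹ᵁ U.1, ?_, hden, hW.isIso_restrict hb hd h hδ₀ hχ hq⟩
  -- The image of a dense set under the continuous surjection `q` is dense, and it lies in the
  -- chosen open subset.
  have hs := (surjective_of_comp_eq_plusIncl hb hd hq).denseRange.dense_image q.continuous hden
  refine hs.mono ?_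
  rintro _ ⟨y, hy, rfl⟩
  exact hy

end Surjective

/-! ### Openness of separability of the characteristic polynomial. -/

section Separable

variable {k : Type u} [Field k] {C : Scheme.{u}} [C.Over (Spec (.of k))]
  [LocallyOfFinitePresentation (C ↘ Spec (.of k))] {n : ℕ} {b : HitchinBase k C n}
  {W : C.affineOpens} {t : Γ(C, W.1)} {D : VectorField k C W.1}

lemma IsChart.pair_injective (hW : IsChart W t D) {c : RatPoint k C} (hc : ⊤ ≤ c.1 ⁻¹ᵁ W.1) :
    Function.Injective fun ξ : CotangentVector c ↦ ξ.pair W hc D := fun ξ ξ' e ↦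
  Subtype.ext (hW.cotangent_hom_ext (ξ.2.trans ξ'.2.symm) (ξ.le_preimage hc) (ξ'.le_preimage hc)
    ((Scheme.ΓSpecIso (.of k)).commRingCatIsoToRingEquiv.injective e))

lemma IsChart.separable_of_isCycleAt (hW : IsChart W t D) {c : RatPoint k C}
    (hc : ⊤ ≤ c.1 ⁻¹ᵁ W.1) {ξ : Fin n → CotangentVector c} (hξ : Function.Injective ξ)
    (h : IsCycleAt b c ξ) : ((charPoly b W D).map (valueAt c.1 W.1 hc)).Separable := by
  rw [h W hc D, Polynomial.separable_prod_X_sub_C_iff]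
  exact (hW.pair_injective hc).comp hξ

/-- Separability of a monic polynomial is invertibility of a resultant, a function on the base. It
therefore spreads from a point to a basic open neighbourhood. -/
lemma isUnit_map_resultant_derivative_iff {R S : Type u} [CommRing R] [CommRing S] (φ : R →+* S)
    {χ : Polynomial R} (hχ : χ.Monic) :
    IsUnit (φ (χ.resultant χ.derivative)) ↔ (χ.map φ).Separable := by
  cases subsingleton_or_nontrivial S
  · exact ⟨fun _ ↦ Polynomial.separable_of_subsingleton _, fun _ ↦ isUnit_of_subsingleton _⟩
  rw [Polynomial.Separable, ← Polynomial.isUnit_resultant_iff_isCoprime (hχ.map φ),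
    ← Polynomial.resultant_map_map, hχ.natDegree_map, Polynomial.derivative_map]
  -- The degree of the derivative may drop under `φ`; this changes the resultant only by a power of
  -- the leading coefficient of `χ`, which is one.
  have hd : ((Polynomial.derivative χ).map φ).natDegree ≤ (Polynomial.derivative χ).natDegree :=
    Polynomial.natDegree_map_le
  obtain ⟨m, hm⟩ := Nat.exists_eq_add_of_le hd
  rw [hm, Polynomial.resultant_add_right_deg _ _ _ _ _ le_rfl]
  have : (χ.map φ).coeff χ.natDegree = 1 := by
    rw [Polynomial.coeff_map, Polynomial.coeff_natDegree, hχ.leadingCoeff, map_one]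
  rw [this, one_pow, one_mul]

/-- The characteristic polynomial is separable on a neighbourhood of a point where its zeros are
distinct. -/
lemma exists_isChart_separable [SmoothOfRelativeDimension 1 (C ↘ Spec (.of k))] {c : RatPoint k C}
    {ξ : Fin n → CotangentVector c} (hξ : Function.Injective ξ) (h : IsCycleAt b c ξ) :
    ∃ (W : C.affineOpens) (t : Γ(C, W.1)) (D : VectorField k C W.1), IsChart W t D ∧
      ⊤ ≤ c.1 ⁻¹ᵁ W.1 ∧ (charPoly b W D).Separable := by
  obtain ⟨W, t, D, hx, hW⟩ := exists_isChart (k := k) (c.1 (IsLocalRing.closedPoint k))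
  have hc : ⊤ ≤ c.1 ⁻¹ᵁ W.1 := top_le_preimage_of_mem _ hx
  have hs := hW.separable_of_isCycleAt hc hξ h
  have hm : (charPoly b W D).Monic := monic_monicOfCoeffs _
  rw [← isUnit_map_resultant_derivative_iff _ hm] at hs
  set r := (charPoly b W D).resultant (charPoly b W D).derivative
  let W' : C.affineOpens := ⟨C.basicOpen r, (isAffineOpen_val W).basicOpen r⟩
  have hWW : W'.1 ≤ W.1 := C.basicOpen_le r
  refine ⟨W', _, _, hW.res hWW, ?_, ?_⟩
  · refine top_le_preimage_of_mem _ ?_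
    have e := Scheme.basicOpen_appLE c.1 ⊤ W.1 hc r
    have hu : IsUnit ((c.1.appLE W.1 ⊤ hc).hom r) :=
      (MulEquiv.isUnit_map (Scheme.ΓSpecIso (.of k)).commRingCatIsoToRingEquiv).mp hs
    have e' := (Scheme.basicOpen_of_isUnit _ hu).symm.trans e
    have : IsLocalRing.closedPoint k ∈ (⊤ : (Spec (.of k)).Opens) := trivial
    rw [e'] at this
    exact this.2
  · rw [charPoly_derRestrict, ← isUnit_map_resultant_derivative_iff _ hm]
    exact isUnit_res_of_basicOpen r rfl hWW

end Separable

/-! ### The fibral criterion of smoothness. -/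

section SmoothFiber

variable {X C : Scheme.{u}} (π : X ⟶ C)

instance [LocallyOfFinitePresentation π] (y : C) :
    LocallyOfFinitePresentation (π.fiberToSpecResidueField y) := by
  exact locallyOfFinitePresentation_isStableUnderBaseChange.of_isPullback
    (IsPullback.of_hasPullback π (C.fromSpecResidueField y)) ‹_›

/-- The fibre of `U` is an open subscheme of the fibre of `π`, and it lies in the smooth locus by
`H`. -/
lemma smooth_fiber_of_smoothLocus [LocallyOfFinitePresentation π] (W : C.affineOpens)
    (U : X.affineOpens) (h : U.1 ≤ π ⁻¹ᵁ W.1) (p : Spec Γ(C, W.1))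
    (H : π.fiberι (affineIncl W p) ⁻¹ᵁ U.1 ≤
      (π.fiberToSpecResidueField (affineIncl W p)).smoothLocus) :
    Smooth ((Spec.map (π.appLE W.1 U.1 h)).fiberToSpecResidueField p) := by
  have e : Spec.map (π.appLE W.1 U.1 h) ≫ affineIncl W = affineIncl U ≫ π :=
    IsAffineOpen.SpecMap_appLE_fromSpec π _ _ h
  set π' := pullback.snd π (affineIncl W)
  let j : Spec Γ(X, U.1) ⟶ pullback π (affineIncl W) := pullback.lift (affineIncl U) _ e.symm
  have hj : j ≫ pullback.fst π (affineIncl W) = affineIncl U := pullback.lift_fst _ _ _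
  have hj' : j ≫ π' = Spec.map (π.appLE W.1 U.1 h) := pullback.lift_snd _ _ _
  have : IsOpenImmersion (j ≫ pullback.fst π (affineIncl W)) := by rw [hj]; infer_instance
  have : IsOpenImmersion j := .of_comp j (pullback.fst π (affineIncl W))
  obtain ⟨m, hm', hp⟩ : ∃ m : π'.fiber p ⟶ π.fiber (affineIncl W p),
      m ≫ π.fiberι _ = π'.fiberι p ≫ pullback.fst π (affineIncl W) ∧
      IsPullback m (π'.fiberToSpecResidueField p) (π.fiberToSpecResidueField (affineIncl W p))
        (Spec.map ((affineIncl W).residueFieldMap p)) :=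
    ⟨_, pullback.lift_fst _ _ _,
      isPullback_fiberToSpecResidueField_of_isPullback (IsPullback.of_hasPullback _ _) p⟩
  -- Passing to the open subset `W` does not change the residue field.
  have : IsIso m := hp.isIso_fst_of_isIso
  rw [← hj']
  let o : (j ≫ π').fiber p ⟶ π'.fiber p :=
    (pullbackRightPullbackFstIso π' ((Spec Γ(C, W.1)).fromSpecResidueField p) j).inv ≫
      pullback.snd j (pullback.fst π' _)
  have ho : o ≫ π'.fiberToSpecResidueField p = (j ≫ π').fiberToSpecResidueField p :=
    (Category.assoc _ _ _).trans (pullbackRightPullbackFstIso_inv_snd_snd _ _ _)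
  have ho' : o ≫ π'.fiberι p = (j ≫ π').fiberι p ≫ j :=
    (Category.assoc _ _ _).trans (pullbackRightPullbackFstIso_inv_snd_fst _ _ _)
  have : IsOpenImmersion o := by
    have h₁ : IsOpenImmersion (pullbackRightPullbackFstIso π'
      ((Spec Γ(C, W.1)).fromSpecResidueField p) j).inv := inferInstance
    have h₂ : IsOpenImmersion (pullback.snd j (pullback.fst π'
      ((Spec Γ(C, W.1)).fromSpecResidueField p))) := inferInstance
    exact @IsOpenImmersion.comp _ _ _ _ _ h₁ h₂
  have hs : Smooth ((o ≫ m) ≫ π.fiberToSpecResidueField (affineIncl W p)) := by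
    rw [← Scheme.Hom.smoothLocus_eq_top_iff, ← Scheme.Hom.preimage_smoothLocus_eq, ← top_le_iff]
    intro x _
    refine H ?_
    have hx : (π.fiberι (affineIncl W p)) ((o ≫ m) x) =
        affineIncl U ((j ≫ π').fiberι p x) := by
      rw [← Scheme.Hom.comp_apply, ← Scheme.Hom.comp_apply, Category.assoc, hm', reassoc_of% ho', hj]
    change (π.fiberι (affineIncl W p)) ((o ≫ m) x) ∈ U.1
    rw [hx]
    have : affineIncl U ((j ≫ π').fiberι p x) ∈ Set.range (affineIncl U) := ⟨_, rfl⟩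
    rwa [IsAffineOpen.range_fromSpec] at this
  have e' : (o ≫ m) ≫ π.fiberToSpecResidueField (affineIncl W p) =
      (j ≫ π').fiberToSpecResidueField p ≫ Spec.map ((affineIncl W).residueFieldMap p) := by
    rw [Category.assoc, hp.w]
    exact (Category.assoc _ _ _).symm.trans (congrArg (· ≫ _) ho)
  rw [e'] at hs
  have hs' : Smooth (((j ≫ π').fiberToSpecResidueField p ≫
    Spec.map ((affineIncl W).residueFieldMap p)) ≫
      inv (Spec.map ((affineIncl W).residueFieldMap p))) := inferInstance
  rwa [Category.assoc, IsIso.hom_inv_id, Category.comp_id] at hs'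

lemma formallySmooth_fiber (R S : Type u) [CommRing R] [CommRing S] [Algebra R S]
    (p : PrimeSpectrum R) [Smooth ((Spec.map (CommRingCat.ofHom <|
      algebraMap R S)).fiberToSpecResidueField p)] :
    Algebra.FormallySmooth p.asIdeal.ResidueField (p.asIdeal.Fiber S) := by
  let e := Spec.fiberToSpecResidueFieldIso R S p
  have e₁ : e.inv.left ≫ (Spec.map (CommRingCat.ofHom <|
      algebraMap R S)).fiberToSpecResidueField p ≫ e.hom.right = Spec.map (CommRingCat.ofHom <|
        algebraMap p.asIdeal.ResidueField (p.asIdeal.Fiber S)) := by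
    have := e.inv.w
    have h' := congrArg (fun f ↦ f.right) e.inv_hom_id
    dsimp at this h'
    exact (Category.assoc _ _ _).symm.trans ((congrArg (· ≫ e.hom.right) this).trans
      ((Category.assoc _ _ _).trans ((congrArg (_ ≫ ·) h').trans (Category.comp_id _))))
  have hs : Smooth (Spec.map (CommRingCat.ofHom <|
        algebraMap p.asIdeal.ResidueField (p.asIdeal.Fiber S))) := by
    rw [← e₁]
    have : IsIso e.inv.left := inferInstance
    have : IsIso e.hom.right := inferInstance
    infer_instance
  have h₁ : (algebraMap p.asIdeal.ResidueField (p.asIdeal.Fiber S)).Smooth :=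
    (HasRingHomProperty.Spec_iff (P := @Smooth)).mp hs
  exact RingHom.formallySmooth_algebraMap.mp h₁.formallySmooth

/-- A flat morphism of finite presentation is smooth where its fibre is smooth. The commutative
algebra is `Algebra.IsSmoothAt.of_formallySmooth_fiber`; what remains is to reduce to affine
schemes. -/
lemma mem_smoothLocus_of_fiber [LocallyOfFinitePresentation π] [Flat π] (y : C) (z : π.fiber y)
    (hz : z ∈ (π.fiberToSpecResidueField y).smoothLocus) : π.fiberι y z ∈ π.smoothLocus := by
  obtain ⟨_, ⟨W, hW, rfl⟩, hy, -⟩ :=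
    C.isBasis_affineOpens.exists_subset_of_mem_open (Set.mem_univ y) isOpen_univ
  have hzy : π (π.fiberι y z) = y := by
    have : π.fiberι y z ∈ Set.range (π.fiberι y) := ⟨z, rfl⟩
    rw [Scheme.Hom.range_fiberι] at this
    exact this
  -- The smooth locus of the fibre is the trace of an open `O` of `X`. An affine neighbourhood
  -- inside `O` then has a smooth fibre everywhere over the point, not only at `z`.
  obtain ⟨O, hO, hO'⟩ := (π.fiberι y).isEmbedding.isInducing.isOpen_iff.mp
    (π.fiberToSpecResidueField y).smoothLocus.2
  obtain ⟨_, ⟨U, hU, rfl⟩, hzU, hUO⟩ :=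
    X.isBasis_affineOpens.exists_subset_of_mem_open (a := π.fiberι y z)
      (u := ((π ⁻¹ᵁ W : X.Opens) : Set X) ∩ O) ⟨by
        change π (π.fiberι y z) ∈ W; rwa [hzy], by
        rw [← Set.mem_preimage, hO']; exact hz⟩ ((π ⁻¹ᵁ W).2.inter hO)
  have h : U ≤ π ⁻¹ᵁ W := fun x hx ↦ (hUO hx).1
  obtain ⟨p, rfl⟩ : y ∈ Set.range (affineIncl ⟨W, hW⟩) := by rwa [IsAffineOpen.range_fromSpec]
  have hs := smooth_fiber_of_smoothLocus π ⟨W, hW⟩ ⟨U, hU⟩ h p fun x hx ↦     hO'.le (hUO hx).2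
  have := π.finitePresentation_appLE hW hU h
  have hfl := π.flat_appLE hW hU h
  rw [Scheme.Hom.mem_smoothLocus, formallySmooth_stalkMap_iff W hW U hU h hzU]
  algebraize [(π.appLE W U h).hom]
  have hp : hW.primeIdealOf ⟨_, h hzU⟩ = p := by
    refine (affineIncl ⟨W, hW⟩).isOpenEmbedding.injective ?_
    exact (hW.fromSpec_primeIdealOf ⟨_, h hzU⟩).trans hzy
  have : p.asIdeal.IsPrime := PrimeSpectrum.isPrime (R := Γ(C, W)) p
  have : (hU.primeIdealOf ⟨_, hzU⟩).asIdeal.LiesOver p.asIdeal :=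
    ⟨congr($((IsAffineOpen.comap_primeIdealOf_appLE W hW U hU h hzU).trans hp).1).symm⟩
  have := formallySmooth_fiber Γ(C, W) Γ(X, U) p
  exact Algebra.IsSmoothAt.of_formallySmooth_fiber p.asIdeal _

end SmoothFiber

/-! ### Extension of derivations along formally smooth algebras. -/

section FormallySmooth

variable {k A B : Type u} [CommRing k] [CommRing A] [CommRing B] [Algebra k A] [Algebra k B]
  [Algebra A B] [IsScalarTower k A B] (D : Derivation k A A)

/-- The dual numbers over `B`, regarded as an `A`-algebra by means of a derivation of `A`. -/
def DerivationDualNumber (_ : Derivation k A A) (B : Type u) : Type u := TrivSqZeroExt B B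

instance : CommRing (DerivationDualNumber D B) := inferInstanceAs (CommRing (TrivSqZeroExt B B))

/-- The homomorphism `a ↦ a + D(a) ε`. -/
def derivationRingHom : A →+* TrivSqZeroExt B B where
  toFun a := TrivSqZeroExt.inl (algebraMap A B a) + TrivSqZeroExt.inr (algebraMap A B (D a))
  map_one' := by ext <;> simp
  map_zero' := by ext <;> simp
  map_mul' x y := by
    ext
    · simp
    · simp only [map_mul, Derivation.leibniz, smul_eq_mul, map_add, TrivSqZeroExt.snd_add,
        TrivSqZeroExt.snd_inl, TrivSqZeroExt.snd_inr, zero_add, TrivSqZeroExt.snd_mul,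
        TrivSqZeroExt.fst_add, TrivSqZeroExt.fst_inl, TrivSqZeroExt.fst_inr, add_zero,
        MulOpposite.smul_eq_mul_unop, MulOpposite.unop_op]
      ring
  map_add' x y := by
    rw [map_add, map_add, map_add, TrivSqZeroExt.inl_add, TrivSqZeroExt.inr_add]
    abel

instance : Algebra A (DerivationDualNumber D B) :=
  (derivationRingHom D : A →+* TrivSqZeroExt B B).toAlgebra

/-- The reduction modulo `ε`. -/
def DerivationDualNumber.fst : DerivationDualNumber D B →ₐ[A] B where
  __ := (TrivSqZeroExt.fstHom B B B).toRingHom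
  commutes' a := by
    change TrivSqZeroExt.fst (TrivSqZeroExt.inl (algebraMap A B a) +
      TrivSqZeroExt.inr (algebraMap A B (D a))) = _
    simp

lemma mul_eq_zero_of_fst_eq_zero {x y : TrivSqZeroExt B B} (hx : x.fst = 0) (hy : y.fst = 0) :
    x * y = 0 := by
  ext
  · rw [TrivSqZeroExt.fst_mul, hx, zero_mul, TrivSqZeroExt.fst_zero]
  · rw [TrivSqZeroExt.snd_mul, hx, hy, zero_smul, MulOpposite.op_zero, zero_smul, add_zero,
      TrivSqZeroExt.snd_zero]

/-- An extension of `D` is an `A`-algebra section of `B[ε] → B`, where `A` acts on `B[ε]` through `a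
↦ a + D(a) ε`. The kernel has square zero, so formal smoothness provides one. -/
lemma exists_derivation_extend_of_formallySmooth [Algebra.FormallySmooth A B] :
    ∃ δ : Derivation k B B, ∀ a, δ (algebraMap A B a) = algebraMap A B (D a) := by
  have hs : Function.Surjective (DerivationDualNumber.fst (B := B) D) := fun b ↦
    ⟨(TrivSqZeroExt.inl b : TrivSqZeroExt B B), TrivSqZeroExt.fst_inl B b⟩
  have hn : IsNilpotent (RingHom.ker (DerivationDualNumber.fst (B := B) D)) := by
    refine ⟨2, ?_⟩
    rw [pow_two, Ideal.zero_eq_bot, eq_bot_iff, Ideal.mul_le]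
    intro x hx y hy
    have hx' : TrivSqZeroExt.fst (R := B) (M := B) x = 0 := hx
    have hy' : TrivSqZeroExt.fst (R := B) (M := B) y = 0 := hy
    exact mul_eq_zero_of_fst_eq_zero hx' hy'
  let s := Algebra.FormallySmooth.liftOfSurjective (AlgHom.id A B)
    (DerivationDualNumber.fst (B := B) D) hs hn
  have h₁ (b : B) : TrivSqZeroExt.fst (R := B) (M := B) (s b) = b :=
    Algebra.FormallySmooth.liftOfSurjective_apply (AlgHom.id A B) _ hs hn b
  have h₂ (a : A) : TrivSqZeroExt.snd (R := B) (M := B) (s (algebraMap A B a)) =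
      algebraMap A B (D a) := by
    rw [s.commutes]
    change TrivSqZeroExt.snd (TrivSqZeroExt.inl (algebraMap A B a) +
      TrivSqZeroExt.inr (algebraMap A B (D a))) = _
    rw [TrivSqZeroExt.snd_add, TrivSqZeroExt.snd_inl, TrivSqZeroExt.snd_inr, zero_add]
  have hmul (x y : B) : TrivSqZeroExt.snd (R := B) (M := B) (s (x * y)) =
      x * TrivSqZeroExt.snd (R := B) (M := B) (s y) +
        y * TrivSqZeroExt.snd (R := B) (M := B) (s x) := by
    rw [map_mul]
    refine (TrivSqZeroExt.snd_mul (R := B) (M := B) _ _).trans ?_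
    rw [h₁, h₁, smul_eq_mul, MulOpposite.smul_eq_mul_unop, MulOpposite.unop_op, mul_comm y]
  have hadd (x y : B) : TrivSqZeroExt.snd (R := B) (M := B) (s (x + y)) =
      TrivSqZeroExt.snd (R := B) (M := B) (s x) + TrivSqZeroExt.snd (R := B) (M := B) (s y) := by
    rw [map_add]; rfl
  have hk (c : k) : TrivSqZeroExt.snd (R := B) (M := B) (s (algebraMap k B c)) = 0 := by
    rw [IsScalarTower.algebraMap_apply k A B, h₂, D.map_algebraMap, map_zero]
  let l : B →ₗ[k] B :=
    { toFun := fun b ↦ TrivSqZeroExt.snd (R := B) (M := B) (s b)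
      map_add' := hadd
      map_smul' := fun c x ↦ by
        rw [Algebra.smul_def, hmul, hk, mul_zero, add_zero, ← Algebra.smul_def]; rfl }
  exact ⟨Derivation.mk' l hmul, h₂⟩

end FormallySmooth

/-! ### Lifting the coordinate vector field along a smooth morphism. -/

section SmoothLocus

variable {k : Type u} [Field k] {X C : Scheme.{u}} [X.Over (Spec (.of k))] [C.Over (Spec (.of k))]
  (π : X ⟶ C) [π.IsOver (Spec (.of k))]

lemma formallySmooth_appLE [LocallyOfFinitePresentation π] {W : C.Opens} (hW : IsAffineOpen W)
    {U : X.Opens} (hU : IsAffineOpen U) (h : U ≤ π ⁻¹ᵁ W) (hs : U ≤ π.smoothLocus) :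
    (π.appLE W U h).hom.FormallySmooth := by
  have := π.finitePresentation_appLE hW hU h
  algebraize [(π.appLE W U h).hom]
  refine Algebra.smoothLocus_eq_univ_iff.mp (Set.eq_univ_iff_forall.mpr fun q ↦ ?_)
  have hx : hU.fromSpec q ∈ U := by
    have : hU.fromSpec q ∈ Set.range hU.fromSpec := ⟨q, rfl⟩
    rwa [hU.range_fromSpec] at this
  have hq : hU.primeIdealOf ⟨_, hx⟩ = q :=
    hU.fromSpec.isOpenEmbedding.injective (hU.fromSpec_primeIdealOf ⟨_, hx⟩)
  have := (formallySmooth_stalkMap_iff W hW U hU h hx).mp (hs hx)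
  rwa [hq] at this

/-- Where `π` is smooth the field `D` extends to `U`; this makes the coordinate of the curve part of
a coordinate system on `X`. -/
lemma exists_vectorField_apply_eq_one [LocallyOfFinitePresentation π] {W : C.affineOpens}
    {t : Γ(C, W.1)} {D : VectorField k C W.1} (hW : IsChart W t D) (U : X.affineOpens)
    (h : U.1 ≤ π ⁻¹ᵁ W.1) (hs : U.1 ≤ π.smoothLocus) :
    ∃ δ : VectorField k X U.1, δ ((π.appLE W.1 U.1 h).hom t) = 1 := by
  have := formallySmooth_appLE π W.2 U.2 h hs
  algebraize [(π.appLE W.1 U.1 h).hom]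
  have : IsScalarTower k Γ(C, W.1) Γ(X, U.1) :=
    .of_algebraMap_eq fun a ↦ (appLE_algebraMap π W.1 U.1 h a).symm
  obtain ⟨δ, hδ⟩ := exists_derivation_extend_of_formallySmooth (B := Γ(X, U.1)) D
  refine ⟨δ, (hδ t).trans ?_⟩
  rw [hW.apply_self, map_one]

end SmoothLocus

/-! ### Codimension of the non-smooth locus. -/

section Codimension

/-- An irreducible component of a noetherian space contains a non-empty open subset, which meets
`L`; hence the generic point of a component through `x` lies in `L`. -/
lemma exists_mem_specializes_of_dense {T : Type*} [TopologicalSpace T] [NoetherianSpace T]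
    [QuasiSober T] {L : Set T} (hL : IsOpen L) (hd : Dense L) (x : T) : ∃ g ∈ L, g ⤳ x := by
  obtain ⟨o, ho, hne, hle⟩ := NoetherianSpace.exists_isOpen_nonempty_subset_irreducibleComponent
    (irreducibleComponent x) (irreducibleComponent_mem_irreducibleComponents x)
  obtain ⟨g, hg⟩ := QuasiSober.sober (S := irreducibleComponent x)
    isIrreducible_irreducibleComponent isClosed_irreducibleComponent
  obtain ⟨y, hy, hyL⟩ := hd.inter_open_nonempty o ho hne
  refine ⟨g, (hg.specializes (hle hy)).mem_open hL hyL, hg.specializes mem_irreducibleComponent⟩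

variable {X C : Scheme.{u}} (π : X ⟶ C)

lemma two_le_ringKrullDim_stalk {x y z : X} (h₁ : x ⤳ y) (h₁' : x ≠ y) (h₂ : y ⤳ z)
    (h₂' : y ≠ z) : 2 ≤ ringKrullDim (X.presheaf.stalk z) := by
  rw [ringKrullDim_stalk_eq_coheight]
  have lt {a b : X} (h : a ⤳ b) (hne : a ≠ b) : b < a :=
    lt_iff_le_not_ge.mpr ⟨Scheme.le_iff_specializes.mpr h, fun h' ↦
      hne (h.antisymm (Scheme.le_iff_specializes.mp h')).eq⟩
  have e₁ := Order.coheight_add_one_le (lt h₁ h₁')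
  have e₂ := Order.coheight_add_one_le (lt h₂ h₂')
  have : (2 : ℕ∞) ≤ Order.coheight z := by
    refine le_trans ?_ e₂
    rw [← one_add_one_eq_two]
    gcongr
    exact le_trans le_add_self e₁
  exact WithBot.coe_le_coe.mpr this

lemma mem_smoothLocus_of_generic [LocallyOfFinitePresentation π] [Flat π] [IrreducibleSpace C]
    [Smooth (π.fiberToSpecResidueField (genericPoint C))] {x : X} (hx : π x = genericPoint C) :
    x ∈ π.smoothLocus := by
  obtain ⟨z, rfl⟩ : x ∈ Set.range (π.fiberι (genericPoint C)) := by
    rwa [Scheme.Hom.range_fiberι]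
  refine mem_smoothLocus_of_fiber π _ z ?_
  rw [Scheme.Hom.smoothLocus_eq_top]
  trivial

/-- A reduced fibre over a perfect field has a dense smooth locus, which contains the generic point
of a component of the fibre through `x`. -/
lemma exists_mem_smoothLocus_specializes [LocallyOfFinitePresentation π] [QuasiCompact π] [Flat π]
    (x : X) [IsReduced (π.fiber (π x))] [PerfectField (C.residueField (π x))] :
    ∃ y ∈ π.smoothLocus, y ⤳ x ∧ π y = π x := by
  have : IsLocallyNoetherian (π.fiber (π x)) :=
    LocallyOfFiniteType.isLocallyNoetherian (π.fiberToSpecResidueField (π x))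
  have : IsNoetherian (π.fiber (π x)) := {}
  obtain ⟨g, hg, hgx⟩ := exists_mem_specializes_of_dense
    (π.fiberToSpecResidueField (π x)).smoothLocus.2
    (Scheme.Hom.dense_smoothLocus_of_perfectField (K := C.residueField (π x))
      (π.fiberToSpecResidueField (π x)))
    (π.asFiber x)
  refine ⟨π.fiberι _ g, mem_smoothLocus_of_fiber π _ g hg, ?_, ?_⟩
  · have := hgx.map (π.fiberι (π x)).continuous
    rwa [Scheme.Hom.fiberι_asFiber] at this
  · have : π.fiberι (π x) g ∈ Set.range (π.fiberι (π x)) := ⟨g, rfl⟩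
    rwa [Scheme.Hom.range_fiberι] at this

/-- If the fibres of `π` are reduced, then the locus where `π` is not smooth has codimension at
least two. -/
lemma two_le_ringKrullDim_of_notMem_smoothLocus [LocallyOfFinitePresentation π] [QuasiCompact π]
    [Flat π] [IrreducibleSpace X] [IrreducibleSpace C] [Surjective π]
    [Smooth (π.fiberToSpecResidueField (genericPoint C))]
    (hr : ∀ c : C, IsReduced (π.fiber c)) (hp : ∀ c : C, PerfectField (C.residueField c))
    {x : X} (hx : x ∉ π.smoothLocus) : 2 ≤ ringKrullDim (X.presheaf.stalk x) := by
  have := hr (π x)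
  have := hp (π x)
  obtain ⟨y, hy, hyx, e⟩ := exists_mem_smoothLocus_specializes π x
  -- The chain is: generic point of `X`, then `y`, then `x`. The first two differ, since otherwise
  -- `x` would lie over the generic point of `C`, where `π` is smooth; the last two differ since
  -- only `y` is in the smooth locus.
  refine two_le_ringKrullDim_stalk (genericPoint_specializes y) ?_ hyx (by rintro rfl; exact hx hy)
  rintro rfl
  refine hx (mem_smoothLocus_of_generic π ?_)
  rw [← e]
  obtain ⟨z, hz⟩ := π.surjective (genericPoint C)
  refine (genericPoint_specializes (π (genericPoint X))).antisymm ?_ |>.eq.symm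
  rw [← hz]
  exact (genericPoint_specializes z).map π.continuous

end Codimension

/-! ### Multiplicity-free values at general points. -/

section Heart

variable {k : Type u} [Field k] {X C : Scheme.{u}} [X.Over (Spec (.of k))]
  [C.Over (Spec (.of k))] {π : X ⟶ C} [π.IsOver (Spec (.of k))]
  [LocallyOfFinitePresentation (X ↘ Spec (.of k))]
  [LocallyOfFinitePresentation (C ↘ Spec (.of k))] {n : ℕ} {b : HitchinBase k C n}
  {bX : HitchinBase k X n} [SmoothOfRelativeDimension 1 (C ↘ Spec (.of k))]

lemma apply_genericPoint (π : X ⟶ C) [Surjective π] [IrreducibleSpace X] [IrreducibleSpace C] :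
    π (genericPoint X) = genericPoint C := by
  obtain ⟨z, hz⟩ := π.surjective (genericPoint C)
  refine Specializes.antisymm ?_ (genericPoint_specializes (π (genericPoint X))) |>.eq
  rw [← hz]
  exact (genericPoint_specializes z).map π.continuous

/-- A neighbourhood of the generic point of `X` on which everything used generically is available:
smoothness of `π`, a lift of `D`, and a separable characteristic polynomial. -/
lemma exists_isChart_separable_le [LocallyOfFinitePresentation π] [Flat π] [Surjective π]
    [IrreducibleSpace X] [IrreducibleSpace C] [Smooth (π.fiberToSpecResidueField (genericPoint C))]
    (h : b ∈ heartLocus k C n) (O : X.Opens) (hO : (O : Set X).Nonempty) :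
    ∃ (W : C.affineOpens) (t : Γ(C, W.1)) (D : VectorField k C W.1) (U : X.affineOpens)
      (hU : U.1 ≤ π ⁻¹ᵁ W.1) (δ : VectorField k X U.1), IsChart W t D ∧
      (charPoly b W D).Separable ∧ δ ((π.appLE W.1 U.1 hU).hom t) = 1 ∧ U.1 ≤ O ∧
      U.1 ≤ π.smoothLocus ∧ genericPoint X ∈ U.1 := by
  obtain ⟨-, c, ξ, hξ, hc⟩ := h
  obtain ⟨W, t, D, hW, hcW, hs⟩ := exists_isChart_separable hξ hc
  have hη : π (genericPoint X) ∈ W.1 := by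
    rw [apply_genericPoint]
    exact (genericPoint_spec C).mem_open_set_iff W.1.2 |>.mpr ⟨_, trivial,
      hcW (show IsLocalRing.closedPoint k ∈ ⊤ from trivial)⟩
  obtain ⟨y, hy⟩ := hO
  obtain ⟨_, ⟨U, hU, rfl⟩, hηU, hU'⟩ :=
    X.isBasis_affineOpens.exists_subset_of_mem_open (a := genericPoint X)
      (u := ((π ⁻¹ᵁ W.1 ⊓ (O ⊓ π.smoothLocus) : X.Opens) : Set X))
      ⟨hη, (genericPoint_spec X).mem_open_set_iff O.2 |>.mpr ⟨y, trivial, hy⟩,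
        mem_smoothLocus_of_generic π (apply_genericPoint π)⟩ (Opens.isOpen _)
  have hUW : U ≤ π ⁻¹ᵁ W.1 := fun z hz ↦ (hU' hz).1
  have hUs : U ≤ π.smoothLocus := fun z hz ↦ (hU' hz).2.2
  obtain ⟨δ, hδ⟩ := exists_vectorField_apply_eq_one π hW ⟨U, hU⟩ hUW hUs
  exact ⟨W, t, D, ⟨U, hU⟩, hUW, δ, hW, hs, hδ, fun z hz ↦ (hU' hz).2.1, hUs, hηU⟩

/-- A scheme locally of finite type over a field is Jacobson, so a non-empty open contains a closed
point of `X`; over algebraically closed `k` it is rational. -/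
lemma exists_ratPoint_mem [IsAlgClosed k] (O : X.Opens) (hO : (O : Set X).Nonempty) :
    ∃ x : RatPoint k X, ⊤ ≤ x.1 ⁻¹ᵁ O := by
  have : JacobsonSpace X := LocallyOfFiniteType.jacobsonSpace (X ↘ Spec (.of k))
  obtain ⟨y, hy, hyc⟩ := nonempty_inter_closedPoints hO O.2.isLocallyClosed
  obtain ⟨p, hp⟩ := (pointEquivClosedPoint (X ↘ Spec (.of k))).surjective ⟨y, hyc⟩
  refine ⟨p, top_le_preimage_of_mem _ ?_⟩
  have : p.1 (IsLocalRing.closedPoint k) = y := congrArg Subtype.val hp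
  rwa [this]

/-- At a point of `U`, the values of `bX` are given by distinct cotangent vectors. -/
lemma IsChart.exists_isCycleAt_injective (hb : IsPullbackOf π b bX)
    (hm : b ∈ postulatedImage k C n) {W : C.affineOpens} {t : Γ(C, W.1)} {D : VectorField k C W.1}
    (hW : IsChart W t D) (hs : (charPoly b W D).Separable) {U : X.affineOpens}
    (hU : U.1 ≤ π ⁻¹ᵁ W.1) {δ : VectorField k X U.1} (hδ : δ ((π.appLE W.1 U.1 hU).hom t) = 1)
    (x : RatPoint k X) (hx : ⊤ ≤ x.1 ⁻¹ᵁ U.1) :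
    ∃ ξ : Fin n → CotangentVector x, Function.Injective ξ ∧ IsCycleAt bX x ξ := by
  obtain ⟨ξ', hξ'⟩ := hm (x.map π)
  obtain ⟨ξ, hd, hξ⟩ := exists_isCycleAt_pullback hb x hξ'
  have hcW : ⊤ ≤ (x.map π).1 ⁻¹ᵁ W.1 := hx.trans (x.1.preimage_mono hU)
  have h₁ : ((charPoly b W D).map (valueAt (x.map π).1 W.1 hcW)).Separable := hs.map
  rw [hξ' W hcW D, Polynomial.separable_prod_X_sub_C_iff] at h₁
  refine ⟨ξ, fun i j hij ↦ h₁ ?_, hξ⟩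
  have e (i) : (ξ i).pair U hx δ = (ξ' i).pair W hcW D := by
    rw [(hd i).pair_chart hW U hU hx hcW, hδ, map_one, one_mul]
  simp only [← e, hij]

end Heart

/-! ### Flat and quasi-finite algebras over a factorial domain. -/

section QuasiFiniteOverUFD

open RingTheory.Sequence

variable {R B : Type u} [CommRing R] [IsDomain R] [CommRing B] [Algebra R B]

lemma isWeaklyRegular_singleton_of_ne_zero {f : R} (hf : f ≠ 0) : IsWeaklyRegular R [f] :=
  (isWeaklyRegular_singleton_iff R f).mpr fun _ _ h ↦ mul_left_cancel₀ hf h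

lemma isWeaklyRegular_pair {f g : R} (hf : Prime f) (hg : ¬ f ∣ g) : IsWeaklyRegular R [f, g] := by
  rw [isWeaklyRegular_cons_iff]
  refine ⟨fun _ _ h ↦ mul_left_cancel₀ hf.ne_zero h, (isWeaklyRegular_singleton_iff _ g).mpr ?_⟩
  rw [isSMulRegular_iff_right_eq_zero_of_smul]
  intro x hx
  obtain ⟨x, rfl⟩ := Submodule.Quotient.mk_surjective _ x
  rw [← Submodule.Quotient.mk_smul, Submodule.Quotient.mk_eq_zero] at hx
  rw [Submodule.Quotient.mk_eq_zero]
  rw [Submodule.mem_smul_pointwise_iff_exists] at hx ⊢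
  obtain ⟨y, -, hy⟩ := hx
  obtain ⟨z, rfl⟩ := (hf.dvd_mul.mp ⟨y, hy.symm⟩).resolve_left hg
  exact ⟨z, trivial, rfl⟩

lemma eq_of_lt_of_ringKrullDim_le_two (hR : ringKrullDim R ≤ 2) {P₁ P₂ P₃ : PrimeSpectrum R}
    (h₀ : P₁.asIdeal ≠ ⊥) (h₁ : P₁ < P₂) (h₂ : P₂ ≤ P₃) : P₂ = P₃ := by
  by_contra hne
  have h₀' : ⊥ < P₁ := bot_lt_iff_ne_bot.mpr fun e ↦ h₀ (by rw [e]; rfl)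
  have e₁ := Order.height_add_one_le h₀'
  have e₂ := Order.height_add_one_le h₁
  have e₃ := Order.height_add_one_le (lt_of_le_of_ne h₂ hne)
  have e : ((3 : ℕ) : ℕ∞) ≤ Order.height P₃ := by
    refine le_trans ?_ e₃
    have : ((1 : ℕ) : ℕ∞) ≤ Order.height P₁ := le_trans le_add_self e₁
    have : ((2 : ℕ) : ℕ∞) ≤ Order.height P₂ := le_trans (add_le_add_left this 1) e₂
    exact add_le_add_left this 1
  have h : ((3 : ℕ) : WithBot ℕ∞) ≤ ((2 : ℕ) : WithBot ℕ∞) :=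
    (WithBot.coe_le_coe.mpr e).trans ((Order.height_le_krullDim P₃).trans hR)
  rw [Nat.cast_le] at h
  omega

lemma ringKrullDim_quotient_eq_zero [IsLocalRing B] {I : Ideal B} (hI : I ≤ IsLocalRing.maximalIdeal B)
    (h : ∀ P : Ideal B, P.IsPrime → I ≤ P → P = IsLocalRing.maximalIdeal B) :
    ringKrullDim (B ⧸ I) = 0 := by
  rw [ringKrullDim_quotient]
  have : Unique (PrimeSpectrum.zeroLocus (R := B) I) :=
    { default := ⟨IsLocalRing.closedPoint B, hI⟩
      uniq := fun P ↦ Subtype.ext (PrimeSpectrum.ext (h P.1.asIdeal P.1.2 P.2)) }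
  exact Order.krullDim_eq_zero_of_unique

/-- A noetherian local ring which is flat and quasi-finite over a factorial domain of dimension at
most two is Cohen-Macaulay. -/
lemma isCohenMacaulayLocalRing_of_quasiFinite [UniqueFactorizationMonoid R]
    (hR : ringKrullDim R ≤ 2) [IsLocalRing B] [IsNoetherianRing B] [Module.Flat R B]
    [Algebra.QuasiFinite R B] : IsCohenMacaulayLocalRing B := by
  refine ⟨inferInstance, ?_⟩
  set m := IsLocalRing.maximalIdeal B
  set Q := m.under R with hQ
  -- It suffices to find a weakly regular sequence in `R` over which `Q` is minimal. Flatness keeps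
  -- it regular in `B`, and incomparability of primes in a quasi-finite algebra makes `m` the only
  -- prime over it, so the quotient has dimension zero.
  suffices H : ∃ rs : List R, (∀ r ∈ rs, r ∈ Q) ∧ IsWeaklyRegular R rs ∧
      ∀ P : Ideal R, P.IsPrime → P ≤ Q → (∀ r ∈ rs, r ∈ P) → P = Q by
    obtain ⟨rs, h₁, h₂, h₃⟩ := H
    have hm : ∀ r ∈ rs.map (algebraMap R B), r ∈ m := by
      intro r hr
      obtain ⟨r', hr', rfl⟩ := List.mem_map.mp hr
      exact h₁ r' hr'
    have hle : Ideal.ofList (rs.map (algebraMap R B)) ≤ m := Ideal.span_le.mpr hm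
    have hreg : IsRegular B (rs.map (algebraMap R B)) :=
      (IsLocalRing.isRegular_iff_isWeaklyRegular_of_subset_maximalIdeal hm).mpr h₂.of_flat
    refine ⟨_, hm, hreg, ?_⟩
    rw [← ringKrullDim_add_length_eq_ringKrullDim_of_isRegular _ hreg,
      ringKrullDim_quotient_eq_zero hle, zero_add]
    intro P hP hPI
    refine Algebra.QuasiFinite.eq_of_le_of_under_eq (R := R) P m
      (IsLocalRing.le_maximalIdeal hP.ne_top) ?_
    refine h₃ _ inferInstance (Ideal.comap_mono (IsLocalRing.le_maximalIdeal hP.ne_top)) fun r hr ↦ ?_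
    exact hPI (Ideal.subset_span (List.mem_map.mpr ⟨r, hr, rfl⟩))
  have : Q.IsPrime := inferInstance
  -- The cases are: `Q` zero with the empty sequence, `Q` principal with a prime generator, and
  -- otherwise a prime element and an element that it does not divide.
  by_cases h₀ : Q = ⊥
  · exact ⟨[], by simp, .nil R R, fun P _ hP _ ↦ by rw [h₀] at hP ⊢; exact le_bot_iff.mp hP⟩
  obtain ⟨f, hfQ, hf⟩ := Ideal.IsPrime.exists_mem_prime_of_ne_bot ‹_› h₀
  by_cases h : ∀ g ∈ Q, f ∣ g
  · refine ⟨[f], by simpa using hfQ, isWeaklyRegular_singleton_of_ne_zero hf.ne_zero,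
      fun P _ hPQ hP ↦ hPQ.antisymm fun g hg ↦ ?_⟩
    obtain ⟨r, rfl⟩ := h g hg
    exact P.mul_mem_right _ (hP f (by simp))
  · push Not at h
    obtain ⟨g, hgQ, hg⟩ := h
    refine ⟨[f, g], by simp [hfQ, hgQ], isWeaklyRegular_pair hf hg, fun P hP' hPQ hP ↦ ?_⟩
    have hF : (Ideal.span {f}).IsPrime := (Ideal.span_singleton_prime hf.ne_zero).mpr hf
    have hfP : f ∈ P := hP f (by simp)
    have hgP : g ∈ P := hP g (by simp)
    -- The chain `0 < (f) < P ≤ Q` already has the maximal length in dimension two, so `P = Q`.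
    refine congrArg PrimeSpectrum.asIdeal (eq_of_lt_of_ringKrullDim_le_two hR
      (P₁ := ⟨_, hF⟩) (P₂ := ⟨P, hP'⟩) (P₃ := ⟨Q, this⟩) ?_ (lt_of_le_of_ne ?_ fun e ↦ ?_) hPQ)
    · simpa using hf.ne_zero
    · exact (Ideal.span_singleton_le_iff_mem P).mpr hfP
    · have e' : Ideal.span {f} = P := congrArg PrimeSpectrum.asIdeal e
      exact hg (Ideal.mem_span_singleton.mp (e' ▸ hgP))

/-- A prime ideal of height at least two, in a ring which is quasi-finite over a factorial domain,
contains a regular sequence of length two. -/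
lemma exists_isWeaklyRegular_pair [UniqueFactorizationMonoid R] [Algebra.QuasiFinite R B]
    {P₀ P₁ P : Ideal B} [P₀.IsPrime] [P₁.IsPrime] [P.IsPrime] (h₁ : P₀ < P₁) (h₂ : P₁ < P) :
    ∃ f g : R, f ≠ 0 ∧ algebraMap R B f ∈ P ∧ algebraMap R B g ∈ P ∧ IsWeaklyRegular R [f, g] := by
  -- By incomparability, strict inclusions of primes remain strict after contraction to `R`.
  have lt {P₀ P₁ : Ideal B} [P₀.IsPrime] [P₁.IsPrime] (h : P₀ < P₁) : P₀.under R < P₁.under R :=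
    lt_of_le_of_ne (Ideal.comap_mono h.le) fun e ↦
      h.ne (Algebra.QuasiFinite.eq_of_le_of_under_eq (R := R) _ _ h.le e)
  have hne : P₁.under R ≠ ⊥ := (bot_le.trans_lt (lt h₁)).ne'
  obtain ⟨f, hfQ, hf⟩ := Ideal.IsPrime.exists_mem_prime_of_ne_bot
    (inferInstanceAs (P₁.under R).IsPrime) hne
  obtain ⟨g, hg, hg'⟩ := Set.exists_of_ssubset (lt h₂)
  refine ⟨f, g, hf.ne_zero, h₂.le hfQ, hg, isWeaklyRegular_pair hf fun ⟨r, hr⟩ ↦ hg' ?_⟩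
  rw [hr]
  exact Ideal.mul_mem_right _ _ hfQ

/-- By flatness `g` is a nonzerodivisor modulo `f` in `B`. This is the algebraic core of the
extension over codimension two. -/
lemma exists_eq_mul_of_isWeaklyRegular {R B : Type u} [CommRing R] [CommRing B] [Algebra R B]
    [Module.Flat R B] {f g : R} (h : IsWeaklyRegular R [f, g]) {x y : B}
    (e : algebraMap R B g * x = algebraMap R B f * y) : ∃ z, x = algebraMap R B f * z := by
  have h' : IsWeaklyRegular B [algebraMap R B f, algebraMap R B g] := h.of_flat
  rw [isWeaklyRegular_cons_iff, isWeaklyRegular_singleton_iff,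
    isSMulRegular_iff_right_eq_zero_of_smul (M := QuotSMulTop (algebraMap R B f) B)] at h'
  have := h'.2 (Submodule.Quotient.mk x) (by
    rw [← Submodule.Quotient.mk_smul, Submodule.Quotient.mk_eq_zero, smul_eq_mul, e]
    exact Submodule.smul_mem_pointwise_smul _ _ _ trivial)
  rw [Submodule.Quotient.mk_eq_zero, Submodule.mem_smul_pointwise_iff_exists] at this
  obtain ⟨z, -, hz⟩ := this
  exact ⟨z, hz.symm⟩

end QuasiFiniteOverUFD

lemma exists_bot_lt_lt_of_two_le_ringKrullDim {A S : Type*} [CommRing A] [IsDomain A] [CommRing S]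
    [Algebra A S] (P : Ideal A) [P.IsPrime] [IsLocalization.AtPrime S P]
    (h : 2 ≤ ringKrullDim S) : ∃ P₁ : Ideal A, P₁.IsPrime ∧ ⊥ < P₁ ∧ P₁ < P := by
  rw [IsLocalization.AtPrime.ringKrullDim_eq_height P S,
    (PrimeSpectrum.height_eq_orderHeight (⟨P, ‹_›⟩ : PrimeSpectrum A) : P.height = _)] at h
  obtain ⟨l, hl, hl'⟩ := Order.exists_series_of_le_height (n := 2) (⟨P, ‹_›⟩ : PrimeSpectrum A)
    (WithBot.coe_le_coe.mp h)
  have h₁ : l.toFun ⟨0, by omega⟩ < l.toFun ⟨1, by omega⟩ := l.strictMono (Fin.mk_lt_mk.mpr one_pos)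
  have h₂ : l.toFun ⟨1, by omega⟩ < l.last := l.strictMono (by
    rw [Fin.lt_def]; change 1 < l.length; omega)
  rw [hl] at h₂
  exact ⟨_, (l.toFun ⟨1, by omega⟩).2, bot_le.trans_lt h₁, h₂⟩

/-! ### Finite flat coverings of a smooth surface. -/

section FiniteFlat

variable {k : Type u} [Field k] {X Z : Scheme.{u}} [X.Over (Spec (.of k))] {p : Z ⟶ X}

lemma ringKrullDim_mvPolynomial_le_two : ringKrullDim (MvPolynomial (Fin 2) k) ≤ 2 := by
  rw [MvPolynomial.ringKrullDim_of_isNoetherianRing, ringKrullDim_eq_zero_of_field, zero_add,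
    Nat.card_fin]
  rfl

/-- A finite flat covering of a smooth surface is Cohen-Macaulay. -/
lemma isCohenMacaulay_of_isFinite_of_flat [SmoothOfRelativeDimension 2 (X ↘ Spec (.of k))]
    [IsLocallyNoetherian X] [IsFinite p] [Flat p] : IsCohenMacaulay Z := by
  have hZ : IsLocallyNoetherian Z := LocallyOfFiniteType.isLocallyNoetherian p
  refine ⟨hZ, fun z ↦ ?_⟩
  obtain ⟨U, g, hx, -, hg⟩ := exists_etale_mvPolynomial (k := k) 2 (p z)
  have hV : IsAffineOpen (p ⁻¹ᵁ U.1) := (isAffineOpen_val U).preimage p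
  have := hV.isLocalization_stalk ⟨z, hx⟩
  have h₁ : (p.app U.1).hom.Finite := p.finite_app _ (isAffineOpen_val U)
  have h₂ : (p.app U.1).hom.Flat := by
    have := p.flat_appLE (isAffineOpen_val U) hV le_rfl
    rwa [← Scheme.Hom.app_eq_appLE] at this
  let _ := g.toAlgebra
  let _ := (p.app U.1).hom.toAlgebra
  let _ := ((p.app U.1).hom.comp g).toAlgebra
  let _ : Algebra Γ(Z, p ⁻¹ᵁ U.1) (Z.presheaf.stalk z) :=
    TopCat.Presheaf.algebra_section_stalk Z.presheaf ⟨z, hx⟩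
  let _ : Algebra (MvPolynomial (Fin 2) k) (Z.presheaf.stalk z) :=
    ((algebraMap Γ(Z, p ⁻¹ᵁ U.1) (Z.presheaf.stalk z)).comp ((p.app U.1).hom.comp g)).toAlgebra
  have : IsScalarTower (MvPolynomial (Fin 2) k) Γ(X, U.1) Γ(Z, p ⁻¹ᵁ U.1) :=
    .of_algebraMap_eq' rfl
  have : IsScalarTower (MvPolynomial (Fin 2) k) Γ(Z, p ⁻¹ᵁ U.1) (Z.presheaf.stalk z) :=
    .of_algebraMap_eq' rfl
  have : Algebra.Etale (MvPolynomial (Fin 2) k) Γ(X, U.1) := hg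
  have : Module.Finite Γ(X, U.1) Γ(Z, p ⁻¹ᵁ U.1) := h₁
  have : Module.Flat Γ(X, U.1) Γ(Z, p ⁻¹ᵁ U.1) := h₂
  have : Module.Flat (MvPolynomial (Fin 2) k) Γ(X, U.1) := inferInstance
  have : Algebra.QuasiFinite (MvPolynomial (Fin 2) k) Γ(Z, p ⁻¹ᵁ U.1) := .trans _ Γ(X, U.1) _
  have : Module.Flat (MvPolynomial (Fin 2) k) Γ(Z, p ⁻¹ᵁ U.1) := .trans _ Γ(X, U.1) _
  -- Comparison with `k[x_1, x_2]`, over which the surface is étale, replaces the regularity of its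
  -- local rings: the polynomial ring is factorial of dimension two.
  have : Algebra.QuasiFinite (MvPolynomial (Fin 2) k) (Z.presheaf.stalk z) :=
    have : Algebra.QuasiFinite Γ(Z, p ⁻¹ᵁ U.1) (Z.presheaf.stalk z) :=
      .of_isLocalization (S := Γ(Z, p ⁻¹ᵁ U.1)) (hV.primeIdealOf ⟨z, hx⟩).asIdeal.primeCompl
    .trans _ Γ(Z, p ⁻¹ᵁ U.1) _
  have : Module.Flat (MvPolynomial (Fin 2) k) (Z.presheaf.stalk z) :=
    have : Module.Flat Γ(Z, p ⁻¹ᵁ U.1) (Z.presheaf.stalk z) :=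
      IsLocalization.flat _ (hV.primeIdealOf ⟨z, hx⟩).asIdeal.primeCompl
    .trans _ Γ(Z, p ⁻¹ᵁ U.1) _
  exact isCohenMacaulayLocalRing_of_quasiFinite (R := MvPolynomial (Fin 2) k)
    ringKrullDim_mvPolynomial_le_two

section Dominant

variable [IsIntegral X] [IsLocallyNoetherian X]

lemma isSchemeTheoreticallyDominant_ι [Flat p] (O : X.Opens) (hO : (O : Set X).Nonempty) :
    IsSchemeTheoreticallyDominant (p ⁻¹ᵁ O).ι := by
  have : IsDominant O.ι := ⟨by
    rw [DenseRange, Scheme.Opens.range_ι]; exact O.2.dense hO⟩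
  have : IsSchemeTheoreticallyDominant O.ι := .of_isDominant _
  exact .of_isPullback (isPullback_morphismRestrict p O)

instance (O : X.Opens) : QuasiCompact (p ⁻¹ᵁ O).ι :=
  have h : IsPullback (p ∣_ O) (p ⁻¹ᵁ O).ι O.ι p := isPullback_morphismRestrict p O
  MorphismProperty.of_isPullback h inferInstance

/-- A non-empty open subset of the integral scheme `X` is scheme-theoretically dense, and flatness
preserves this for its preimage in `Z`. -/
lemma res_injective_of_flat [Flat p] (O : X.Opens) (hO : (O : Set X).Nonempty) {S T : Z.Opens}
    (h : T ≤ S) (h' : S ⊓ p ⁻¹ᵁ O ≤ T) :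
    Function.Injective (Z.presheaf.map (homOfLE h).op).hom := by
  have := isSchemeTheoreticallyDominant_ι (p := p) O hO
  have hi := (p ⁻¹ᵁ O).ι.app_injective S
  have hle : (p ⁻¹ᵁ O).ι ''ᵁ ((p ⁻¹ᵁ O).ι ⁻¹ᵁ S) ≤ T := by
    rw [Scheme.Hom.image_preimage_eq_opensRange_inf, Scheme.Opens.opensRange_ι, inf_comm]
    exact h'
  intro s t hst
  refine hi ?_
  have e : (p ⁻¹ᵁ O).ι.app S = Z.presheaf.map (homOfLE h).op ≫ Z.presheaf.map (homOfLE hle).op := by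
    rw [Scheme.Opens.ι_app, ← Functor.map_comp]
    rfl
  rw [e]
  exact congrArg (Z.presheaf.map (homOfLE hle).op).hom hst

lemma ne_zero_iff_basicOpen_nonempty {U : X.Opens} (f : Γ(X, U)) :
    f ≠ 0 ↔ ((X.basicOpen f : X.Opens) : Set X).Nonempty := by
  rw [ne_eq, ← basicOpen_eq_bot_iff, ← Opens.coe_eq_empty, Set.nonempty_iff_ne_empty]

/-- Multiplication by a nonzero function of the base is injective. -/
lemma eq_zero_of_app_mul_eq_zero [Flat p] {U : X.Opens} {T : Z.Opens} (hT : T ≤ p ⁻¹ᵁ U)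
    {f : Γ(X, U)} (hf : f ≠ 0) {s : Γ(Z, T)} (h : (p.appLE U T hT).hom f * s = 0) : s = 0 := by
  have hle : T ⊓ p ⁻¹ᵁ (X.basicOpen f) ≤ T := inf_le_left
  refine res_injective_of_flat (p := p) (X.basicOpen f)
    ((ne_zero_iff_basicOpen_nonempty f).mp hf) hle le_rfl ?_
  have h' := congrArg (Z.presheaf.map (homOfLE hle).op).hom h
  rw [map_mul, map_zero] at h'
  rw [map_zero]
  refine (IsUnit.mul_right_eq_zero ?_).mp h'
  refine isUnit_res_of_basicOpen _ ?_ hle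
  exact Scheme.basicOpen_appLE p T U hT f

/-- Functions on a finite flat covering of a smooth surface extend over closed subsets of
codimension two. -/
lemma exists_extension [SmoothOfRelativeDimension 2 (X ↘ Spec (.of k))] [IsFinite p] [Flat p]
    (V : X.Opens) (hV : ∀ x, x ∉ V → 2 ≤ ringKrullDim (X.presheaf.stalk x))
    (U : X.affineOpens) (g : MvPolynomial (Fin 2) k →+* Γ(X, U.1)) (hg : g.Etale)
    {T : Z.Opens} (hT : T ≤ p ⁻¹ᵁ U.1) (hT' : p ⁻¹ᵁ U.1 ⊓ p ⁻¹ᵁ V ≤ T) (s : Γ(Z, T)) :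
    ∃ s' : Γ(Z, p ⁻¹ᵁ U.1), (Z.presheaf.map (homOfLE hT).op).hom s' = s := by
  have hB : IsAffineOpen (p ⁻¹ᵁ U.1) := (isAffineOpen_val U).preimage p
  let r := (Z.presheaf.map (homOfLE hT).op).hom
  let φ := (p.app U.1).hom
  let _ := (r.comp φ).toAlgebra
  let M : Submodule Γ(X, U.1) Γ(Z, T) :=
    { carrier := Set.range r
      add_mem' := by rintro _ _ ⟨x, rfl⟩ ⟨y, rfl⟩; exact ⟨x + y, map_add _ _ _⟩
      zero_mem' := ⟨0, map_zero _⟩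
      smul_mem' := by rintro a _ ⟨x, rfl⟩; exact ⟨φ a * x, map_mul r _ _⟩ }
  by_contra hs
  have hsM : (Submodule.Quotient.mk s : Γ(Z, T) ⧸ M) ≠ 0 := by
    rw [ne_eq, Submodule.Quotient.mk_eq_zero]
    exact hs
  have : IsNoetherianRing Γ(X, U.1) := IsLocallyNoetherian.component_noetherian U
  -- If `s` does not extend, the quotient by the extendable functions `M` has an associated prime
  -- `P`: the ideal of all `a` such that `a s'` extends. Each position of the corresponding point
  -- leads to a contradiction.
  obtain ⟨P, hP, -⟩ := exists_le_isAssociatedPrime_of_isNoetherianRing Γ(X, U.1) _ hsM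
  rw [isAssociatedPrime_iff] at hP
  obtain ⟨hP, s', hs'⟩ := hP
  obtain ⟨s', rfl⟩ := Submodule.Quotient.mk_surjective _ s'
  have mem (a : Γ(X, U.1)) : a ∈ P ↔ r (φ a) * s' ∈ M := by
    rw [hs', Submodule.mem_colon_singleton, Submodule.mem_bot, ← Submodule.Quotient.mk_smul,
      Submodule.Quotient.mk_eq_zero]
    rfl
  let y : PrimeSpectrum Γ(X, U.1) := ⟨P, hP⟩
  let x : X := affineIncl U y
  have hxU : x ∈ U.1 := by
    have : affineIncl U y ∈ Set.range (affineIncl U) := ⟨_, rfl⟩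
    rwa [IsAffineOpen.range_fromSpec] at this
  have hy : (isAffineOpen_val U).primeIdealOf ⟨x, hxU⟩ = y :=
    (isAffineOpen_val U).fromSpec.isOpenEmbedding.injective
      ((isAffineOpen_val U).fromSpec_primeIdealOf ⟨x, hxU⟩)
  have hne : ((V : X.Opens) : Set X).Nonempty := by
    refine ⟨genericPoint X, by_contra fun h ↦ ?_⟩
    have h' := hV _ h
    rw [ringKrullDim_eq_zero_of_field (X.presheaf.stalk (genericPoint X))] at h'
    exact absurd h' (by decide)
  by_cases hxV : x ∈ V
  -- If the point lies in `V`, then `s'` is defined on a basic open `f ≠ 0` inside `V`, so `f ^ m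
  -- s'` extends and `f` would lie in `P`.
  · obtain ⟨f, hf, hfV⟩ : ∃ f : Γ(X, U.1), f ∉ P ∧ X.basicOpen f ≤ V := by
      obtain ⟨f, hfV, hxf⟩ := (isAffineOpen_val U).exists_basicOpen_le (V := V) ⟨x, hxV⟩ hxU
      refine ⟨f, ?_, hfV⟩
      have : y ∈ affineIncl U ⁻¹ᵁ (X.basicOpen f) := hxf
      rwa [IsAffineOpen.fromSpec_preimage_basicOpen] at this
    have hD : p ⁻¹ᵁ (X.basicOpen f) = Z.basicOpen (φ f) := Scheme.preimage_basicOpen p f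
    have hDB : Z.basicOpen (φ f) ≤ p ⁻¹ᵁ U.1 := Z.basicOpen_le _
    have hDT : Z.basicOpen (φ f) ≤ T := le_trans (le_inf hDB (by
      rw [← hD]; exact p.preimage_mono hfV)) hT'
    have := hB.isLocalization_basicOpen (φ f)
    obtain ⟨m, b, hm⟩ := IsLocalization.Away.surj (φ f)
      ((Z.presheaf.map (homOfLE hDT).op).hom s')
    refine hf (hP.mem_of_pow_mem m ((mem _).mpr ⟨b, ?_⟩))
    refine res_injective_of_flat (p := p) (X.basicOpen f) ((ne_zero_iff_basicOpen_nonempty f).mp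
      fun h ↦ hf (h ▸ P.zero_mem)) hDT (by rw [hD]; exact inf_le_right) ?_
    rw [map_mul, map_pow, map_pow, map_pow, mul_comm]
    refine Eq.trans ?_ (Eq.trans hm.symm ?_)
    · exact presheaf_map_map _ _ _
    · congr 2
      exact (presheaf_map_map _ _ _).symm
  · have := (isAffineOpen_val U).isLocalization_stalk ⟨x, hxU⟩
    rw [hy] at this
    let _ : Algebra Γ(X, U.1) (X.presheaf.stalk x) :=
      TopCat.Presheaf.algebra_section_stalk X.presheaf ⟨x, hxU⟩
    have : IsLocalization.AtPrime (X.presheaf.stalk x) P := this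
    have : Nonempty U.1 := ⟨⟨x, hxU⟩⟩
    obtain ⟨P₁, hP₁, hlt, hlt'⟩ := exists_bot_lt_lt_of_two_le_ringKrullDim P (hV x hxV)
    let _ := g.toAlgebra
    have : Algebra.Etale (MvPolynomial (Fin 2) k) Γ(X, U.1) := hg
    -- Otherwise `P` has height at least two and contains a regular pair `a, c` from the polynomial
    -- ring. With `a s' = x₁` and `c s' = x₂` extended, `c x₁ = a x₂` makes `x₁` divisible by `a`;
    -- the quotient extends `s'`, so `1 ∈ P`.
    obtain ⟨a, c, ha, haP, hcP, hac⟩ := exists_isWeaklyRegular_pair (R := MvPolynomial (Fin 2) k)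
      hlt hlt'
    obtain ⟨x₁, hx₁⟩ := (mem _).mp haP
    obtain ⟨x₂, hx₂⟩ := (mem _).mp hcP
    have hflat : φ.Flat := by
      have := p.flat_appLE (isAffineOpen_val U) hB le_rfl
      rwa [← Scheme.Hom.app_eq_appLE] at this
    let _ := φ.toAlgebra
    let _ := (φ.comp g).toAlgebra
    have : Module.Flat Γ(X, U.1) Γ(Z, p ⁻¹ᵁ U.1) := hflat
    have : IsScalarTower (MvPolynomial (Fin 2) k) Γ(X, U.1) Γ(Z, p ⁻¹ᵁ U.1) :=
      .of_algebraMap_eq' rfl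
    have : Module.Flat (MvPolynomial (Fin 2) k) Γ(Z, p ⁻¹ᵁ U.1) := .trans _ Γ(X, U.1) _
    have hr : Function.Injective r := res_injective_of_flat (p := p) V hne hT hT'
    obtain ⟨z, rfl⟩ := exists_eq_mul_of_isWeaklyRegular (B := Γ(Z, p ⁻¹ᵁ U.1)) hac (x := x₁)
      (y := x₂) (hr (by
        change r (φ (g c) * x₁) = r (φ (g a) * x₂)
        have h₁ : r x₁ = r (φ (g a)) * s' := hx₁
        have h₂ : r x₂ = r (φ (g c)) * s' := hx₂
        rw [map_mul, map_mul, h₁, h₂]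
        ring))
    have hga : g a ≠ 0 := fun h ↦ ha (FaithfulSMul.algebraMap_injective _ Γ(X, U.1)
      (h.trans (map_zero (algebraMap (MvPolynomial (Fin 2) k) Γ(X, U.1))).symm))
    refine hP.ne_top ((Ideal.eq_top_iff_one P).mpr ((mem 1).mpr ⟨z, ?_⟩))
    rw [map_one, map_one, one_mul]
    refine sub_eq_zero.mp (eq_zero_of_app_mul_eq_zero (p := p) hT hga ?_)
    have h₁ : r (φ (g a) * z) = r (φ (g a)) * s' := hx₁
    have h₂ : (p.appLE U.1 T hT).hom (g a) = r (φ (g a)) := rfl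
    rw [mul_sub, h₂, ← h₁, map_mul, sub_self]

end Dominant

end FiniteFlat

/-! ### Extension of morphisms over codimension two. -/

section Extend

lemma isIso_of_isAffineHom_of_bijective {G Z : Scheme.{u}} (r : G ⟶ Z) [IsAffineHom r]
    (H : ∀ z : Z, ∃ U : Z.affineOpens, z ∈ U.1 ∧ Function.Bijective (r.app U.1).hom) : IsIso r := by
  choose U hz hU using H
  have hloc : IsZariskiLocalAtTarget (MorphismProperty.isomorphisms Scheme.{u}) := inferInstance
  refine hloc.of_forall_exists_morphismRestrict fun z ↦ ⟨(U z).1, hz z, ?_⟩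
  have : IsIso (r.app (U z).1) := by
    rw [ConcreteCategory.isIso_iff_bijective]; exact hU z
  have : IsIso (r ∣_ (U z).1).appTop := by
    rw [morphismRestrict_appTop]
    have e : (U z).1.ι ''ᵁ ⊤ = (U z).1 := by simp
    have : IsIso (r.app ((U z).1.ι ''ᵁ ⊤)) := by rw [e]; infer_instance
    refine IsIso.comp_isIso' this ?_
    refine @Functor.map_isIso _ _ _ _ _ _ _ _ ?_
    refine @isIso_op _ _ _ _ _ ?_
    exact (eqToIso (image_morphismRestrict_preimage r _ ⊤)).isIso_hom
  have : IsAffine (U z).1 := isAffineOpen_val (U z)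
  have : IsAffine (r ⁻¹ᵁ (U z).1) := (isAffineOpen_val (U z)).preimage r
  exact (MorphismProperty.arrow_mk_iso_iff (MorphismProperty.isomorphisms Scheme.{u})
    (arrowIsoSpecΓOfIsAffine (r ∣_ (U z).1))).mpr
    (inferInstanceAs (IsIso (Spec.map (r ∣_ (U z).1).appTop)))

lemma bijective_app_of_comp {T G Z : Scheme.{u}} {a : T ⟶ G} {r : G ⟶ Z} {U : Z.Opens}
    (h : Function.Bijective ((a ≫ r).app U).hom)
    (hi : Function.Injective (a.app (r ⁻¹ᵁ U)).hom) : Function.Bijective (r.app U).hom := by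
  have e (s) : ((a ≫ r).app U).hom s = (a.app (r ⁻¹ᵁ U)).hom ((r.app U).hom s) :=
    congr($(Scheme.Hom.comp_app a r U) s)
  refine ⟨fun s t hst ↦ h.1 ?_, fun s ↦ ?_⟩
  · rw [e, e, hst]
  · obtain ⟨t, ht⟩ := h.2 ((a.app (r ⁻¹ᵁ U)).hom s)
    exact ⟨t, hi ((e t).symm.trans ht)⟩

/-- The equalizer of `f` and `g` is a closed subscheme, as `s` is separated; `ι` factors through it,
so its ideal vanishes. -/
lemma ext_of_isSchemeTheoreticallyDominant {T Z Y X : Scheme.{u}} (ι : T ⟶ Z) [QuasiCompact ι]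
    [IsSchemeTheoreticallyDominant ι] {f g : Z ⟶ Y} (s : Y ⟶ X) [IsSeparated s]
    (h : f ≫ s = g ≫ s) (h' : ι ≫ f = ι ≫ g) : f = g := by
  let d : Z ⟶ pullback s s := pullback.lift f g h
  let e : pullback d (pullback.diagonal s) ⟶ Z := pullback.fst _ _
  have he : e ≫ f = e ≫ g := by
    have h₁ : e ≫ d = pullback.snd _ _ ≫ pullback.diagonal s := pullback.condition
    have h₂ := congrArg (· ≫ pullback.fst s s) h₁
    have h₃ := congrArg (· ≫ pullback.snd s s) h₁
    simp only [Category.assoc, d, pullback.lift_fst, pullback.lift_snd, pullback.diagonal_fst,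
      pullback.diagonal_snd, Category.comp_id] at h₂ h₃
    rw [h₂, h₃]
  let l : T ⟶ pullback d (pullback.diagonal s) := pullback.lift ι (ι ≫ f) (by
    refine pullback.hom_ext ?_ ?_
    · rw [Category.assoc, Category.assoc, pullback.diagonal_fst, Category.comp_id]
      exact congrArg (ι ≫ ·) (pullback.lift_fst f g h)
    · rw [Category.assoc, Category.assoc, pullback.diagonal_snd, Category.comp_id, h']
      exact congrArg (ι ≫ ·) (pullback.lift_snd f g h))
  have hl : l ≫ e = ι := pullback.lift_fst _ _ _
  have : IsClosedImmersion e := inferInstance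
  have hk : e.ker = ⊥ := by
    refine le_bot_iff.mp ?_
    rw [← Scheme.Hom.ker_eq_bot ι, ← hl]
    exact Scheme.Hom.le_ker_comp _ _
  have : IsIso e := IsClosedImmersion.isIso_of_ker_eq e (𝟙 Z) e (Category.comp_id e) (by simp [hk])
  rwa [cancel_epi e] at he

variable {k : Type u} [Field k] {X Y Z : Scheme.{u}} [X.Over (Spec (.of k))] [IsIntegral X]
  [IsLocallyNoetherian X] {p' : Z ⟶ X} {p : Y ⟶ X}

variable (k) in
/-- Morphisms from a finite flat covering of a smooth surface to an affine scheme over the surface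
extend over closed subsets of codimension two. -/
lemma exists_extend [SmoothOfRelativeDimension 2 (X ↘ Spec (.of k))] [IsFinite p'] [Flat p']
    [IsAffineHom p] (V : X.Opens) (hV : ∀ x, x ∉ V → 2 ≤ ringKrullDim (X.presheaf.stalk x))
    (f : (p' ⁻¹ᵁ V).toScheme ⟶ Y) (hf : f ≫ p = (p' ⁻¹ᵁ V).ι ≫ p') :
    ∃ f' : Z ⟶ Y, (p' ⁻¹ᵁ V).ι ≫ f' = f ∧ f' ≫ p = p' := by
  let γ : (p' ⁻¹ᵁ V).toScheme ⟶ pullback p' p := pullback.lift (p' ⁻¹ᵁ V).ι f hf.symm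
  have hγ₁ : γ ≫ pullback.fst p' p = (p' ⁻¹ᵁ V).ι := pullback.lift_fst _ _ _
  have hγ₂ : γ ≫ pullback.snd p' p = f := pullback.lift_snd _ _ _
  have : QuasiCompact (γ ≫ pullback.fst p' p) := by rw [hγ₁]; infer_instance
  have : QuasiCompact γ := .of_comp γ (pullback.fst p' p)
  let r : γ.image ⟶ Z := γ.imageι ≫ pullback.fst p' p
  have hr : γ.toImage ≫ r = (p' ⁻¹ᵁ V).ι := by
    rw [← Category.assoc, γ.toImage_imageι, hγ₁]
  have hfst : IsAffineHom (pullback.fst p' p) :=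
    isAffineHom_isStableUnderBaseChange.of_isPullback (IsPullback.of_hasPullback p' p).flip ‹_›
  have : IsAffineHom r := by
    have : IsAffineHom γ.imageι := inferInstance
    exact inferInstanceAs (IsAffineHom (γ.imageι ≫ pullback.fst p' p))
  -- Functions on the image inject into functions over `p'⁻¹(V)`, and the latter extend to `Z`; so
  -- `r` is bijective on functions.
  have : IsIso r := by
    refine isIso_of_isAffineHom_of_bijective r fun z ↦ ?_
    obtain ⟨U, g, hx, -, hg⟩ := exists_etale_mvPolynomial (k := k) 2 (p' z)
    have hB : IsAffineOpen (p' ⁻¹ᵁ U.1) := (isAffineOpen_val U).preimage p'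
    refine ⟨⟨p' ⁻¹ᵁ U.1, hB⟩, hx, ?_⟩
    have hi : Function.Injective (γ.toImage.app (r ⁻¹ᵁ p' ⁻¹ᵁ U.1)) :=
      γ.toImage_app_injective ⟨pullback.fst p' p ⁻¹ᵁ p' ⁻¹ᵁ U.1, hB.preimage _⟩
    have hne : ((V : X.Opens) : Set X).Nonempty := by
      refine ⟨genericPoint X, by_contra fun h ↦ ?_⟩
      have h' := hV _ h
      rw [ringKrullDim_eq_zero_of_field (X.presheaf.stalk (genericPoint X))] at h'
      exact absurd h' (by decide)
    have := isSchemeTheoreticallyDominant_ι (p := p') V hne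
    have hbij : Function.Bijective ((γ.toImage ≫ r).app (p' ⁻¹ᵁ U.1)).hom := by
      rw [hr]
      refine ⟨Scheme.Hom.app_injective _ _, fun s ↦ ?_⟩
      have hT : (p' ⁻¹ᵁ V).ι ''ᵁ ((p' ⁻¹ᵁ V).ι ⁻¹ᵁ (p' ⁻¹ᵁ U.1)) ≤ p' ⁻¹ᵁ U.1 :=
        Scheme.Hom.image_preimage_le _ _
      obtain ⟨s', hs'⟩ := exists_extension V hV U g hg hT (by
        rw [Scheme.Hom.image_preimage_eq_opensRange_inf, Scheme.Opens.opensRange_ι, inf_comm]) s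
      refine ⟨s', ?_⟩
      rw [Scheme.Opens.ι_app]
      exact hs'
    exact bijective_app_of_comp hbij hi
  refine ⟨inv r ≫ γ.imageι ≫ pullback.snd p' p, ?_, ?_⟩
  · rw [← hr, Category.assoc, IsIso.hom_inv_id_assoc, γ.toImage_imageι_assoc, hγ₂]
  · rw [Category.assoc, Category.assoc, ← pullback.condition]
    exact IsIso.inv_hom_id_assoc r p'

end Extend

/-! ### Lengths of the local rings of `K[y]/∏ (y - c_i)`. -/

open Polynomial in
lemma length_quotient_prod_X_sub_C {K : Type u} [Field K] (a : K) (m : ℕ) :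
    Ring.ord K[X] ((X - C a) ^ m) = m := by
  rw [Ring.ord_pow (mem_nonZeroDivisors_of_ne_zero (X_sub_C_ne_zero a)),
    Ring.ord_of_irreducible (irreducible_X_sub_C a)]
  simp

/-- The length of the local rings of `K[y]/(∏ (y - c_i))`. -/
lemma length_localization_of_eq_prod {K B S : Type u} [Field K] [CommRing B] [CommRing S]
    [Algebra B S] {ι : Type} [Fintype ι] (c : ι → K) (φ : Polynomial K →+* B)
    (hφ : Function.Surjective φ)
    (hker : RingHom.ker φ = Ideal.span {∏ i, (Polynomial.X - Polynomial.C (c i))}) (P : Ideal B)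
    [P.IsPrime] [IsLocalization.AtPrime S P] :
    Module.length S S = Nat.card {i // φ (Polynomial.X - Polynomial.C (c i)) ∈ P} := by
  classical
  set χ : Polynomial K := ∏ i, (Polynomial.X - Polynomial.C (c i)) with hχ
  have h₀ : φ χ = 0 := by
    rw [← RingHom.mem_ker, hker]; exact Ideal.mem_span_singleton_self χ
  have h₁ : ∃ i, φ (Polynomial.X - Polynomial.C (c i)) ∈ P := by
    have : φ χ ∈ P := h₀ ▸ P.zero_mem
    rw [hχ, map_prod] at this
    simpa using (Ideal.IsPrime.prod_mem_iff (p := P)).mp this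
  obtain ⟨i₀, hi₀⟩ := h₁
  set l : Polynomial K := Polynomial.X - Polynomial.C (c i₀) with hl
  have hlp : Prime l := Polynomial.prime_X_sub_C _
  -- The prime `P` corresponds to the maximal ideal `(l)` of `K[y]`.
  have hmem (r : Polynomial K) : φ r ∈ P ↔ l ∣ r := by
    constructor
    · intro hr
      by_contra hd
      obtain ⟨u, v, huv⟩ : IsCoprime l r :=
        (Irreducible.coprime_iff_not_dvd hlp.irreducible).mpr hd
      refine (Ideal.ne_top_iff_one P).mp (Ideal.IsPrime.ne_top ‹_›) ?_
      rw [← map_one φ, ← huv, map_add, map_mul, map_mul]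
      exact P.add_mem (P.mul_mem_left _ hi₀) (P.mul_mem_left _ hr)
    · rintro ⟨s, rfl⟩
      rw [map_mul]
      exact P.mul_mem_right _ hi₀
  have hmem' (i) : φ (Polynomial.X - Polynomial.C (c i)) ∈ P ↔ c i = c i₀ := by
    rw [hmem, hl, Polynomial.dvd_iff_isRoot, Polynomial.IsRoot, Polynomial.eval_sub,
      Polynomial.eval_X, Polynomial.eval_C, sub_eq_zero, eq_comm]
  set m := Nat.card {i // φ (Polynomial.X - Polynomial.C (c i)) ∈ P} with hm
  -- `m` is the multiplicity of the root `c i₀`, and `g` is the product of the remaining factors.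
  obtain ⟨g, hg, hgP⟩ : ∃ g, χ = l ^ m * g ∧ ¬ l ∣ g := by
    refine ⟨∏ i with c i ≠ c i₀, (Polynomial.X - Polynomial.C (c i)), ?_, ?_⟩
    · rw [hχ, ← Finset.prod_filter_mul_prod_filter_not Finset.univ (fun i ↦ c i = c i₀)]
      congr 1
      rw [Finset.prod_congr rfl (g := fun _ ↦ l) (fun i hi ↦ by
        rw [(Finset.mem_filter.mp hi).2]), Finset.prod_const, hm]
      congr 1
      rw [Nat.card_congr (Equiv.subtypeEquivRight hmem'), Nat.card_eq_fintype_card,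
        Fintype.card_subtype]
    · intro hd
      obtain ⟨i, hi, hdi⟩ := (Prime.dvd_finsetProd_iff hlp _).mp hd
      exact (Finset.mem_filter.mp hi).2 ((hmem' i).mp ((hmem _).mpr hdi))
  -- The cofactor `g` becomes invertible in the local ring, so `ψ` is surjective with kernel `(l ^
  -- m)`.
  let ψ : Polynomial K →+* S := (algebraMap B S).comp φ
  have hunit (r : Polynomial K) (hr : ¬ l ∣ r) : IsUnit (ψ r) :=
    IsLocalization.map_units S (⟨φ r, fun h ↦ hr ((hmem r).mp h)⟩ : P.primeCompl)
  have hψl : ψ (l ^ m) = 0 := by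
    have : ψ (l ^ m) * ψ g = 0 := by
      rw [← map_mul, ← hg]
      exact (congrArg (algebraMap B S) h₀).trans (map_zero _)
    exact ((hunit g hgP).mul_left_eq_zero).mp this
  have hψs : Function.Surjective ψ := by
    intro s
    obtain ⟨⟨r, t⟩, hs⟩ := IsLocalization.surj P.primeCompl s
    obtain ⟨r, rfl⟩ := hφ r
    obtain ⟨t, ht⟩ := t
    obtain ⟨t, rfl⟩ := hφ t
    have htl : ¬ l ∣ t := fun h ↦ ht ((hmem t).mpr h)
    obtain ⟨u, v, huv⟩ : IsCoprime (l ^ m) t :=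
      ((Irreducible.coprime_iff_not_dvd hlp.irreducible).mpr htl).pow_left
    refine ⟨r * v, (hunit t htl).mul_left_injective ?_⟩
    have e : ψ v * ψ t = 1 := by
      rw [← map_mul, ← map_one ψ, ← huv, map_add, map_mul ψ u, hψl, mul_zero, zero_add, map_mul]
    change ψ (r * v) * ψ t = s * ψ t
    rw [map_mul, mul_assoc, e, mul_one]
    exact hs.symm
  have hψk : RingHom.ker ψ = Ideal.span {l ^ m} := by
    refine le_antisymm (fun r hr ↦ ?_) ?_
    · obtain ⟨⟨t, ht⟩, h⟩ := (IsLocalization.map_eq_zero_iff P.primeCompl S (φ r)).mp hr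
      obtain ⟨t, rfl⟩ := hφ t
      have htl : ¬ l ∣ t := fun h ↦ ht ((hmem t).mpr h)
      have : t * r ∈ RingHom.ker φ := by rw [RingHom.mem_ker, map_mul]; exact h
      rw [hker, Ideal.mem_span_singleton] at this
      rw [Ideal.mem_span_singleton]
      have hd : l ^ m ∣ t * r := (Dvd.intro g hg.symm).trans this
      exact IsCoprime.dvd_of_dvd_mul_left
        ((Irreducible.coprime_iff_not_dvd hlp.irreducible).mpr htl).pow_left hd
    · rw [Ideal.span_singleton_le_iff_mem]
      exact hψl
  let _ : Algebra (Polynomial K) S := ψ.toAlgebra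
  rw [← Module.length_eq_of_surjective (S := Polynomial K) (R := S) (M := S) hψs,
    ← length_quotient_prod_X_sub_C (c i₀) m, Ring.ord]
  refine LinearEquiv.length_eq (AlgEquiv.toLinearEquiv ?_)
  exact ((Ideal.quotientEquivAlgOfEq (Polynomial K) hψk.symm).trans
    (Ideal.quotientKerAlgEquivOfSurjective (f := Algebra.ofId (Polynomial K) S) hψs)).symm

lemma length_eq_of_ringEquiv {R S : Type u} [CommRing R] [CommRing S] (e : R ≃+* S) :
    Module.length R R = Module.length S S := by
  let _ : Algebra R S := e.toRingHom.toAlgebra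
  rw [← Module.length_eq_of_surjective (S := R) (R := S) (M := S) e.surjective]
  exact LinearEquiv.length_eq (AlgEquiv.toLinearEquiv
    (AlgEquiv.ofBijective (Algebra.ofId R S) e.bijective))

lemma length_stalk_specAdjoinRoot {K : Type u} [Field K] {n : ℕ} (c : Fin n → K)
    {χ : Polynomial (CommRingCat.of K)} (hχ : χ = ∏ i, (Polynomial.X - Polynomial.C (c i)))
    (w : specAdjoinRoot χ) :
    Module.length ((specAdjoinRoot χ).presheaf.stalk w) ((specAdjoinRoot χ).presheaf.stalk w) =
      Nat.card {i // AdjoinRoot.mk χ (Polynomial.X - Polynomial.C (c i)) ∈ w.asIdeal} := by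
  let w' : PrimeSpectrum (AdjoinRoot χ) := w
  have := StructureSheaf.IsLocalization.to_stalk (AdjoinRoot χ) w'
  refine length_localization_of_eq_prod (K := K) (B := AdjoinRoot χ)
    (S := (Spec.structureSheaf (AdjoinRoot χ)).presheaf.stalk w') c (AdjoinRoot.mk χ)
    (AdjoinRoot.mk_surjective) ?_ w'.asIdeal
  subst hχ
  exact Ideal.mk_ker

lemma length_stalk_of_iso {Y Z : Scheme.{u}} (e : Y ≅ Z) (y : Y) :
    Module.length (Y.presheaf.stalk y) (Y.presheaf.stalk y) =
      Module.length (Z.presheaf.stalk (e.hom y)) (Z.presheaf.stalk (e.hom y)) :=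
  length_eq_of_ringEquiv (asIso (e.hom.stalkMap y)).commRingCatIsoToRingEquiv.symm

/-! ### Values of functions at rational points. -/

section Value

variable {k : Type u} [Field k] {Y : Scheme.{u}}

lemma valueAt_eq_zero_iff (y : Spec (.of k) ⟶ Y) {V : Y.Opens} (hy : ⊤ ≤ y ⁻¹ᵁ V) (s : Γ(Y, V)) :
    valueAt y V hy s = 0 ↔ y (IsLocalRing.closedPoint k) ∉ Y.basicOpen s := by
  rw [← not_iff_not, not_not]
  refine (isUnit_iff_ne_zero (a := valueAt y V hy s)).symm.trans ?_
  have e : (y.appLE V ⊤ hy).hom s = (Scheme.ΓSpecIso (.of k)).inv.hom (valueAt y V hy s) := by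
    have := congr($((Scheme.ΓSpecIso (.of k)).hom_inv_id).hom ((y.appLE V ⊤ hy).hom s))
    exact this.symm
  have e₂ : (Spec (.of k)).basicOpen ((y.appLE V ⊤ hy).hom s) =
      PrimeSpectrum.basicOpen (valueAt y V hy s) := by
    rw [e]; exact basicOpen_eq_of_affine (R := .of k) (valueAt y V hy s)
  have e₃ := Scheme.basicOpen_appLE y ⊤ V hy s
  constructor
  · intro h
    have : IsLocalRing.closedPoint k ∈ (Spec (.of k)).basicOpen ((y.appLE V ⊤ hy).hom s) := by
      rw [e₂]
      exact fun hm ↦ (IsLocalRing.mem_maximalIdeal _).mp hm h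
    rw [e₃] at this
    exact this.2
  · intro h
    have h' : IsLocalRing.closedPoint k ∈ (Spec (.of k)).basicOpen ((y.appLE V ⊤ hy).hom s) := by
      rw [e₃]; exact ⟨trivial, h⟩
    rw [e₂] at h'
    by_contra hu
    exact h' ((IsLocalRing.mem_maximalIdeal _).mpr hu)

lemma id_appLE_top_top (h : (⊤ : Y.Opens) ≤ (𝟙 Y : Y ⟶ Y) ⁻¹ᵁ ⊤) :
    (𝟙 Y : Y ⟶ Y).appLE ⊤ ⊤ h = 𝟙 _ := by
  rw [appLE_top_top, Scheme.Hom.id_appTop]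

lemma valueAt_algebraMap [Y.Over (Spec (.of k))] (y : RatPoint k Y) {V : Y.Opens}
    (hy : ⊤ ≤ y.1 ⁻¹ᵁ V) (a : k) : valueAt y.1 V hy (algebraMap k _ a) = a := by
  have e : (Y ↘ Spec (.of k)).appLE ⊤ V (le_preimage_top _ _) ≫ y.1.appLE V ⊤ hy =
      𝟙 _ := by
    rw [Scheme.Hom.appLE_comp_appLE]
    exact (appLE_congr_hom y.2 _).trans (id_appLE_top_top _)
  have e' : (Scheme.ΓSpecIso (.of k)).inv ≫ ((Y ↘ Spec (.of k)).appLE ⊤ V (le_preimage_top _ _) ≫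
      y.1.appLE V ⊤ hy) ≫ (Scheme.ΓSpecIso (.of k)).hom = 𝟙 _ := by
    rw [e]; simp
  exact congr(($e').hom a)

variable {X : Scheme.{u}} [X.Over (Spec (.of k))] [LocallyOfFinitePresentation (X ↘ Spec (.of k))]

/-- `LiesOverAt` compares only points of the underlying space. The linear function minus the
constant `a` vanishes at the common point, so it has value zero at both vectors. -/
lemma CotangentVector.pair_eq_of_apply_eq {x : RatPoint k X} {ξ ξ' : CotangentVector x}
    (h : ξ.1 (IsLocalRing.closedPoint k) = ξ'.1 (IsLocalRing.closedPoint k)) (U : X.affineOpens)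
    (hx : ⊤ ≤ x.1 ⁻¹ᵁ U.1) (δ : VectorField k X U.1) : ξ.pair U hx δ = ξ'.pair U hx δ := by
  let a := ξ.pair U hx δ
  have key (ξ : CotangentVector x) : valueAt ξ.1 _ (ξ.le_preimage hx)
      (linearFunction U δ - (cotangentProj k X).app U.1 (algebraMap k _ a)) =
      ξ.pair U hx δ - a := by
    have e := valueAt_eq_comp ξ.1 (cotangentProj k X) ξ.2.symm le_rfl (ξ.le_preimage hx) hx
      (algebraMap k _ a)
    rw [valueAt_algebraMap x] at e
    rw [map_sub]
    refine congr(_ - $(?_))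
    rw [Scheme.Hom.app_eq_appLE]
    exact e.symm
  have h₁ := key ξ
  rw [sub_self, valueAt_eq_zero_iff, h, ← valueAt_eq_zero_iff ξ'.1 (ξ'.le_preimage hx), key ξ',
    sub_eq_zero] at h₁
  exact h₁.symm

end Value

/-! ### The fibres of `X^+_b` lie over the values of `b_X`. -/

section LiesOver

variable {k : Type u} [Field k] {X C : Scheme.{u}} [X.Over (Spec (.of k))]
  [C.Over (Spec (.of k))] {π : X ⟶ C} [π.IsOver (Spec (.of k))]
  [LocallyOfFinitePresentation (X ↘ Spec (.of k))]
  [LocallyOfFinitePresentation (C ↘ Spec (.of k))] {n : ℕ} {b : HitchinBase k C n}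
  {bX : HitchinBase k X n} [CompactSpace C] [C.IsSeparated] [CompactSpace X] [X.IsSeparated]
  [SmoothOfRelativeDimension 1 (C ↘ Spec (.of k))]
  {d : pullback (cotangentProj k C) π ⟶ cotangentBundle k X}
  {W : C.affineOpens} {t : Γ(C, W.1)} {D : VectorField k C W.1} {U : X.affineOpens}
  {δ₀ : VectorField k X U.1}

/-- The `K`-point `y = a` of `Spec K[y]/(χ)`. -/
def specAdjoinRootPoint {K : Type u} [Field K] {χ : Polynomial (CommRingCat.of K)} (a : K)
    (h : χ.eval₂ (RingHom.id K) a = 0) : Spec (.of K) ⟶ specAdjoinRoot χ :=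
  Spec.map (CommRingCat.ofHom (AdjoinRoot.lift (RingHom.id K) a h))

lemma mem_asIdeal_iff_specAdjoinRootPoint {K : Type u} [Field K]
    {χ : Polynomial (CommRingCat.of K)} (a : K) (h : χ.eval₂ (RingHom.id K) a = 0)
    (w : specAdjoinRoot χ) :
    AdjoinRoot.mk χ (Polynomial.X - Polynomial.C a) ∈ w.asIdeal ↔
      specAdjoinRootPoint a h (IsLocalRing.closedPoint K) = w := by
  let ψ : AdjoinRoot χ →+* K := AdjoinRoot.lift (RingHom.id K) a h
  have e : (specAdjoinRootPoint a h (IsLocalRing.closedPoint K)).asIdeal = RingHom.ker ψ := by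
    change Ideal.comap ψ (IsLocalRing.maximalIdeal K) = _
    rw [IsLocalRing.maximalIdeal_eq_bot]; rfl
  have hs : Function.Surjective ψ := fun r ↦ ⟨AdjoinRoot.of χ r, AdjoinRoot.lift_of h⟩
  have hψ (p : Polynomial K) : ψ (AdjoinRoot.mk χ p) = p.eval a := by
    refine (AdjoinRoot.lift_mk h p).trans ?_
    rfl
  constructor
  · intro hw
    refine PrimeSpectrum.ext ?_
    rw [e]
    refine (RingHom.ker_isMaximal_of_surjective ψ hs).eq_of_le w.2.ne_top fun r hr ↦ ?_
    obtain ⟨p, rfl⟩ := AdjoinRoot.mk_surjective r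
    rw [RingHom.mem_ker, hψ] at hr
    obtain ⟨s, rfl⟩ := Polynomial.dvd_iff_isRoot.mpr hr
    rw [map_mul]
    exact Ideal.mul_mem_right _ _ hw
  · rintro rfl
    rw [e, RingHom.mem_ker, hψ]
    simp

/-- The fibre over `x` is `Spec k[y]/∏ (y - c_i)`, with `c_i` the coordinates of the cycle of `b` at
`π(x)`. The length at a point counts the `i` with `y = c_i` there, and that point is mapped to
`ξ_i`. -/
lemma IsChart.liesOverAt (hb : IsPullbackOf π b bX) (hW : IsChart W t D)
    (hd : IsCodifferential π d) (h : U.1 ≤ π ⁻¹ᵁ W.1) (hδ₀ : δ₀ ((π.appLE W.1 U.1 h).hom t) = 1)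
    (hm : b ∈ postulatedImage k C n) (x : RatPoint k X) (hx : ⊤ ≤ x.1 ⁻¹ᵁ U.1) :
    LiesOverAt bX (plusProj π b) (plusIncl π b ≫ d) x := by
  obtain ⟨ξ', hξ'⟩ := hm (x.map π)
  obtain ⟨ξ, hξd, hξ⟩ := exists_isCycleAt_pullback hb x hξ'
  refine ⟨ξ, hξ, fun z ↦ ?_⟩
  have hcW : ⊤ ≤ (x.map π).1 ⁻¹ᵁ W.1 := fun y hy ↦ h (hx hy)
  let c : Fin n → k := fun i ↦ (ξ' i).pair W hcW D
  have hpair (i) : (ξ i).pair U hx δ₀ = c i := by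
    rw [(hξd i).pair_chart hW U h hx hcW δ₀, hδ₀, map_one, one_mul]
  set χ : Polynomial (CommRingCat.of k) := (charPoly b W D).map (valueAt (x.map π).1 W.1 hcW) with hχ'
  have hχ : χ = ∏ i, (Polynomial.X - Polynomial.C (c i)) := hξ' W hcW D
  obtain ⟨g, hg, Hg⟩ := hW.exists_isPullback_plus (b := b) (A := .of k) (f := x.1) hcW hχ'
  let E : specAdjoinRoot χ ≅ pullback (plusProj π b) x.1 := hg.isoPullback
  have hE : E.hom ≫ pullback.fst (plusProj π b) x.1 = g := hg.isoPullback_hom_fst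
  obtain ⟨w, rfl⟩ : ∃ w, E.hom w = z := ⟨E.inv z, by simp⟩
  have hroot (i) : χ.eval₂ (RingHom.id k) (c i) = 0 := by
    rw [hχ]
    refine (Polynomial.eval₂_finsetProd _ _ _ _).trans (Finset.prod_eq_zero (Finset.mem_univ i) ?_)
    simp
  let ζ (i) := specAdjoinRootPoint (c i) (hroot i)
  have hζ (i) : ζ i ≫ specAdjoinRootProj χ = 𝟙 _ := by
    dsimp only [ζ, specAdjoinRootPoint]
    rw [← Spec.map_comp, ← CommRingCat.ofHom_comp, AdjoinRoot.lift_comp_of]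
    exact Spec.map_id _
  have hζf (i) : (ζ i).appTop.hom (specAdjoinRootFun χ) =
      (Scheme.ΓSpecIso (.of k)).inv.hom (c i) := by
    have e := Scheme.ΓSpecIso_inv_naturality
      (CommRingCat.ofHom (AdjoinRoot.lift (RingHom.id k) (c i) (hroot i)))
    have e' := congr(($e).hom (AdjoinRoot.root χ))
    refine e'.symm.trans ?_
    exact congrArg (fun r ↦ (Scheme.ΓSpecIso (.of k)).inv.hom r) (AdjoinRoot.lift_root (hroot i))
  have hζv (i) : (ζ i ≫ g) ≫ plusProj π b = x.1 := by
    rw [Category.assoc, hg.w, ← Category.assoc, hζ, Category.id_comp]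
  have hζξ' (i) : (ζ i ≫ g) ≫ plusToCotangent π b = (ξ' i).1 := by
    have e₀ : ((ζ i ≫ g) ≫ plusToCotangent π b) ≫ cotangentProj k C = (x.map π).1 := by
      rw [Category.assoc, plusToCotangent_comp, ← Category.assoc, hζv]; rfl
    let ξ'' : CotangentVector (x.map π) := ⟨(ζ i ≫ g) ≫ plusToCotangent π b, e₀⟩
    refine congrArg Subtype.val (hW.pair_injective hcW (a₁ := ξ'') (a₂ := ξ' i) ?_)
    have hgW : ⊤ ≤ (g ≫ plusToCotangent π b) ⁻¹ᵁ (cotangentProj k C ⁻¹ᵁ W.1) :=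
      le_preimage_plusToCotangent h (by rw [hg.w]; exact fun y hy ↦ hx trivial)
    have e₁ := valueAt_eq_comp (ζ i) (g ≫ plusToCotangent π b) (Category.assoc _ _ _) hgW
      (top_le_preimage_top _) (ξ''.le_preimage hcW) (linearFunction W D)
    refine e₁.trans ((congrArg _ (Hg hgW)).trans ?_)
    refine (congrArg (fun r ↦ (Scheme.ΓSpecIso (.of k)).hom.hom r)
      (congr($(appLE_top_top (ζ i) _).hom _).trans (hζf i))).trans ?_
    exact congr($((Scheme.ΓSpecIso (.of k)).inv_hom_id).hom (c i))
  have hζξ (i) : (ζ i ≫ g) ≫ plusIncl π b ≫ d = (ξ i).1 := by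
    have h₁ := (isCodiff_plus hd).comp plusToCotangent_comp (ζ i ≫ g)
    rw [hζv, hζξ'] at h₁
    -- Both sides are the image of `ξ'_i` under the codifferential at `x`.
    exact h₁.unique (ξ' i).2 (hξd i)
  rw [← length_stalk_of_iso E w, length_stalk_specAdjoinRoot c hχ]
  refine congrArg _ (Nat.card_congr (Equiv.subtypeEquivRight fun i ↦ ?_))
  have hwz : (pullback.fst (plusProj π b) x.1 ≫ plusIncl π b ≫ d) (E.hom w) =
      (g ≫ plusIncl π b ≫ d) w := by
    rw [← hE]; rfl
  have hξz (i) : (ξ i).1 (IsLocalRing.closedPoint k) =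
      (g ≫ plusIncl π b ≫ d) (ζ i (IsLocalRing.closedPoint k)) := by
    rw [← hζξ]; rfl
  rw [hwz]
  constructor
  · intro hi
    rw [hξz, (mem_asIdeal_iff_specAdjoinRootPoint _ (hroot i) w).mp hi]
  -- Conversely `w` is the point `y = c_{i'}` for some `i'`. Pairing with `δ₀` recovers the root, so
  -- vectors with the same image have `c_i = c_{i'}`.
  · intro hi
    obtain ⟨i', hi'⟩ : ∃ i', AdjoinRoot.mk χ (Polynomial.X - Polynomial.C (c i')) ∈ w.asIdeal := by
      have : AdjoinRoot.mk χ χ ∈ w.asIdeal := by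
        rw [AdjoinRoot.mk_self]; exact w.asIdeal.zero_mem
      rw [congrArg (AdjoinRoot.mk χ) hχ, map_prod] at this
      have := (w.2.prod_mem_iff).mp this
      simpa using this
    have hc : c i = c i' := by
      rw [← hpair, ← hpair]
      refine CotangentVector.pair_eq_of_apply_eq ?_ U hx δ₀
      rw [hi, hξz i', (mem_asIdeal_iff_specAdjoinRootPoint _ (hroot i') w).mp hi']
    rwa [hc]

end LiesOver

/-! ### Restrictions of morphisms to open subsets of the target. -/

section Restrict

lemma isPullback_morphismRestrict_homOfLE {Y Z : Scheme.{u}} (f : Y ⟶ Z) {O' O : Z.Opens}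
    (hO : O' ≤ O) : IsPullback (Y.homOfLE (f.preimage_mono hO)) (f ∣_ O') (f ∣_ O)
      (Z.homOfLE hO) := by
  refine (IsPullback.of_bot (v₁₁ := Y.homOfLE (f.preimage_mono hO)) (h₁₁ := f ∣_ O')
    (v₁₂ := Z.homOfLE hO) (h₂₁ := f ∣_ O) (v₂₁ := (f ⁻¹ᵁ O).ι) (v₂₂ := O.ι) (h₃₁ := f) ?_ ?_
    (isPullback_morphismRestrict f O)).flip
  · rw [Scheme.homOfLE_ι, Scheme.homOfLE_ι]
    exact isPullback_morphismRestrict f O'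
  · rw [← cancel_mono O.ι]
    simp [Category.assoc]

/-- A property which is local at the target holds for the restriction of a morphism to an open
subset, if it holds for the restrictions to the members of a covering. -/
lemma morphismRestrict_of_forall_exists (P : MorphismProperty Scheme.{u})
    [IsZariskiLocalAtTarget P] {Y Z : Scheme.{u}} (f : Y ⟶ Z) (O : Z.Opens)
    (H : ∀ z ∈ O, ∃ O' : Z.Opens, z ∈ O' ∧ O' ≤ O ∧ P (f ∣_ O')) : P (f ∣_ O) := by
  refine of_isPullback_openImmersion P fun z ↦ ?_
  obtain ⟨O', hz, hO, h⟩ := H z.1 z.2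
  refine ⟨O', f ⁻¹ᵁ O', Z.homOfLE hO, Y.homOfLE (f.preimage_mono hO), f ∣_ O', inferInstance, ?_,
    isPullback_morphismRestrict_homOfLE f hO, h⟩
  refine ⟨⟨z.1, hz⟩, ?_⟩
  apply Subtype.ext
  simp

end Restrict

/-! ### `X^+_b` has the property of the Cohen-Macaulay spectral surface. -/

section Plus

variable {k : Type u} [Field k] {X C : Scheme.{u}} [X.Over (Spec (.of k))]
  [C.Over (Spec (.of k))] {π : X ⟶ C} [π.IsOver (Spec (.of k))]
  [LocallyOfFinitePresentation (X ↘ Spec (.of k))]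
  [LocallyOfFinitePresentation (C ↘ Spec (.of k))] {n : ℕ} {b : HitchinBase k C n}
  {bX : HitchinBase k X n} [CompactSpace C] [C.IsSeparated] [CompactSpace X] [X.IsSeparated]
  [SmoothOfRelativeDimension 1 (C ↘ Spec (.of k))]
  {d : pullback (cotangentProj k C) π ⟶ cotangentBundle k X}

lemma isClosedImmersion_plusIncl [LocallyOfFinitePresentation π] (hd : IsCodifferential π d) :
    IsClosedImmersion ((plusIncl π b ≫ d) ∣_ (cotangentProj k X ⁻¹ᵁ π.smoothLocus)) := by
  refine morphismRestrict_of_forall_exists @IsClosedImmersion _ _ fun z hz ↦ ?_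
  obtain ⟨W, t, D, U, hW, hU, h, hs⟩ :=
    exists_chart_le (k := k) π (cotangentProj k X z) π.smoothLocus hz
  obtain ⟨δ₀, hδ₀⟩ := exists_vectorField_apply_eq_one π hW U h hs
  exact ⟨cotangentProj k X ⁻¹ᵁ U.1, hU, (cotangentProj k X).preimage_mono hs,
    hW.isClosedImmersion_plusIncl hd h hδ₀⟩

lemma perfectField_residueField [CharZero k] (c : C) : PerfectField (C.residueField c) := by
  let φ : k →+* C.residueField c := (C.residue c).hom.comp
    ((C.presheaf.germ ⊤ c trivial).hom.comp (algebraMap k Γ(C, ⊤)))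
  have : CharZero (C.residueField c) := charZero_of_injective_ringHom φ.injective
  infer_instance

/-- The open subset is the smooth locus of `π`. Reducedness of the fibres enters only through its
codimension estimate. -/
lemma isCMSpectralSurface_plus [CharZero k] [LocallyOfFinitePresentation π] [QuasiCompact π]
    [Flat π] [Surjective π] [IrreducibleSpace X] [IrreducibleSpace C]
    [Smooth (π.fiberToSpecResidueField (genericPoint C))] (hb : IsPullbackOf π b bX)
    (hd : IsCodifferential π d) (hm : b ∈ postulatedImage k C n)
    (hr : ∀ c : C, IsReduced (π.fiber c)) :
    IsCMSpectralSurface bX (plusProj π b) (plusIncl π b ≫ d) where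
  comp_proj := (isCodiff_plus hd).comp_proj
  isFinite := inferInstance
  flat := inferInstance
  degree := finrank_plusProj π b
  exists_open := by
    refine ⟨π.smoothLocus, fun z hz ↦ two_le_ringKrullDim_of_notMem_smoothLocus π hr
      (perfectField_residueField (k := k)) hz, isClosedImmersion_plusIncl hd, fun x hx ↦ ?_⟩
    obtain ⟨W, t, D, U, hW, hU, h, hs⟩ := exists_chart_le (k := k) π
      (x.1 (IsLocalRing.closedPoint k)) π.smoothLocus (hx (Set.mem_univ _))
    obtain ⟨δ₀, hδ₀⟩ := exists_vectorField_apply_eq_one π hW U h hs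
    exact hW.liesOverAt hb hd h hδ₀ hm x (top_le_preimage_of_mem x.1 hU)

end Plus

/-! ### Functions vanishing on fibres over rational points. -/

section Vanishing

/-- `B` is projective over `A`, so linear forms detect zero. The value of a linear form at `F` lies
in every maximal ideal, and these intersect in zero in a Jacobson domain. -/
lemma eq_zero_of_forall_isMaximal {A B : Type u} [CommRing A] [IsDomain A] [IsNoetherianRing A]
    [IsJacobsonRing A] [CommRing B] [Algebra A B] [Module.Finite A B] [Module.Flat A B] (F : B)
    (hF : ∀ m : Ideal A, m.IsMaximal → F ∈ m.map (algebraMap A B)) : F = 0 := by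
  have : Module.FinitePresentation A B := Module.finitePresentation_of_finite A B
  have : Module.Projective A B := Module.Flat.projective_of_finitePresentation
  refine (Module.forall_dual_apply_eq_zero_iff A F).mp fun f ↦ ?_
  have h (m : Ideal A) (hm : m.IsMaximal) : f F ∈ m := by
    have h₁ := hF m hm
    rw [← Ideal.mul_top (m.map (algebraMap A B)), ← smul_eq_mul, ← Submodule.restrictScalars_mem A,
      Ideal.smul_restrictScalars] at h₁
    exact Submodule.smul_induction_on h₁
      (fun r hr y _ ↦ by rw [map_smul]; exact m.mul_mem_right _ hr)
      (fun y z hy hz ↦ by rw [map_add]; exact m.add_mem hy hz)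
  have hj : (⊥ : Ideal A).jacobson = ⊥ := by
    rw [← Ideal.radical_eq_jacobson]
    exact Ideal.radical_bot_of_isReduced
  have : f F ∈ (⊥ : Ideal A).jacobson := Ideal.mem_sInf.mpr fun m hm ↦ h m hm.2
  rw [hj] at this
  exact this

variable {k : Type u} [Field k] {X : Scheme.{u}} [X.Over (Spec (.of k))]
  [LocallyOfFinitePresentation (X ↘ Spec (.of k))] {n : ℕ} {a : HitchinBase k X n}

lemma valueAt_spectralFunction {x : RatPoint k X} {ξ : Fin n → CotangentVector x}
    (hξ : IsCycleAt a x ξ) (i : Fin n) (U : X.affineOpens) (hx : ⊤ ≤ x.1 ⁻¹ᵁ U.1)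
    (δ : VectorField k X U.1) :
    valueAt (ξ i).1 _ ((ξ i).le_preimage hx) (spectralFunction a U δ) = 0 := by
  have e₁ := appLE_spectralFunction a U δ (ξ i).1 (ξ i).2 ((ξ i).le_preimage hx) hx
  have e₂ := congrArg (Scheme.ΓSpecIso (.of k)).hom.hom e₁
  rw [Polynomial.hom_eval₂] at e₂
  refine e₂.trans ?_
  have e₃ : ((charPoly a U δ).map (valueAt x.1 U.1 hx)).eval ((ξ i).pair U hx δ) = 0 := by
    rw [hξ U hx δ, Polynomial.eval_prod]
    exact Finset.prod_eq_zero (Finset.mem_univ i) (by simp)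
  rw [Polynomial.eval_map] at e₃
  exact e₃

/-- If the value of `a` at `x` is a multiplicity-free cycle, then the fibre of a covering which
lies over this value is contained in the spectral cover. -/
lemma LiesOverAt.appLE_eq_zero {Y : Scheme.{u}} {p : Y ⟶ X} {j : Y ⟶ cotangentBundle k X}
    {x : RatPoint k X} (h : LiesOverAt a p j x) {U : X.affineOpens} {δ₀ : VectorField k X U.1}
    (hs : (charPoly a U δ₀).Separable) (hx : ⊤ ≤ x.1 ⁻¹ᵁ U.1) (δ : VectorField k X U.1)
    (hV : ⊤ ≤ (pullback.fst p x.1 ≫ j) ⁻¹ᵁ (cotangentProj k X ⁻¹ᵁ U.1)) :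
    ((pullback.fst p x.1 ≫ j).appLE _ ⊤ hV).hom (spectralFunction a U δ) = 0 := by
  obtain ⟨ξ, hξ, hl⟩ := h
  -- Separability makes the vectors `ξ_i` distinguishable by their pairings with `δ₀`, so at most
  -- one of them sits at a given point.
  have hinj : Function.Injective fun i ↦ (ξ i).pair U hx δ₀ := by
    have h₁ : ((charPoly a U δ₀).map (valueAt x.1 U.1 hx)).Separable := hs.map
    rwa [hξ U hx δ₀, Polynomial.separable_prod_X_sub_C_iff] at h₁
  have hle (z : (pullback p x.1 : Scheme.{u})) : Subsingleton {i : Fin n //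
      (ξ i).1 (IsLocalRing.closedPoint k) = (pullback.fst p x.1 ≫ j) z} :=
    ⟨fun i i' ↦ Subtype.ext (hinj (CotangentVector.pair_eq_of_apply_eq (i.2.trans i'.2.symm) U hx δ₀))⟩
  have hne (z : (pullback p x.1 : Scheme.{u})) : Nonempty {i : Fin n //
      (ξ i).1 (IsLocalRing.closedPoint k) = (pullback.fst p x.1 ≫ j) z} := by
    by_contra hne
    have := not_nonempty_iff.mp hne
    have := hl z
    rw [Nat.card_of_isEmpty, Nat.cast_zero, Module.length_eq_zero_iff] at this
    exact not_subsingleton _ this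
  -- All local rings of the fibre have length one, hence are fields. On a reduced scheme vanishing
  -- may be tested pointwise.
  have : IsReduced (pullback p x.1 : Scheme.{u}) := by
    have (z : (pullback p x.1 : Scheme.{u})) :
        _root_.IsReduced ((pullback p x.1).presheaf.stalk z) := by
      have h₁ := hl z
      rw [Nat.card_eq_one_iff_unique.mpr ⟨hle z, hne z⟩, Nat.cast_one, Module.length_eq_one_iff,
        isSimpleModule_self_iff_isUnit] at h₁
      have : IsDomain ((pullback p x.1).presheaf.stalk z) :=
        IsField.isDomain ⟨h₁.1.1, mul_comm, fun hr ↦ (h₁.2 _ hr).exists_right_inv⟩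
      infer_instance
    exact isReduced_of_isReduced_stalk _
  rw [← basicOpen_eq_bot_iff]
  refine (Scheme.basicOpen_appLE _ _ _ _ _).trans (le_bot_iff.mp fun z hz ↦ ?_)
  obtain ⟨i, hi⟩ := hne z
  refine (valueAt_eq_zero_iff (ξ i).1 ((ξ i).le_preimage hx) _).mp
    (valueAt_spectralFunction hξ i U hx δ) ?_
  rw [hi]
  exact hz.2

end Vanishing

/-! ### Lifting along closed immersions. -/

section Lift

/-- Lifting along closed immersions may be done after restriction along a scheme-theoretically
dominant morphism. -/
lemma exists_lift_of_isSchemeTheoreticallyDominant {T Y S Z : Scheme.{u}} (ι : T ⟶ Y)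
    [QuasiCompact ι] [IsSchemeTheoreticallyDominant ι] (i : S ⟶ Z) [IsClosedImmersion i]
    (j : Y ⟶ Z) (l : T ⟶ S) (h : l ≫ i = ι ≫ j) : ∃ q : Y ⟶ S, q ≫ i = j := by
  let e : pullback j i ⟶ Y := pullback.fst j i
  have : IsClosedImmersion e := inferInstance
  -- The closed subscheme of `Y` over which `j` lands in `S` contains the image of the
  -- scheme-theoretically dominant `ι`, so it is all of `Y`.
  have hk : e.ker = ⊥ := by
    refine le_bot_iff.mp ?_
    rw [← Scheme.Hom.ker_eq_bot ι, ← pullback.lift_fst ι l h.symm]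
    exact Scheme.Hom.le_ker_comp _ _
  have : IsIso e := IsClosedImmersion.isIso_of_ker_eq e (𝟙 Y) e (Category.comp_id e) (by simp [hk])
  refine ⟨inv e ≫ pullback.snd j i, ?_⟩
  rw [Category.assoc, ← pullback.condition]
  exact IsIso.inv_hom_id_assoc e j

end Lift

/-! ### Coverings over multiplicity-free values map to the spectral cover. -/

section SpectralLift

variable {k : Type u} [Field k] [IsAlgClosed k] {X : Scheme.{u}} [X.Over (Spec (.of k))]
  [LocallyOfFinitePresentation (X ↘ Spec (.of k))] {n : ℕ} {a : HitchinBase k X n}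

/-- The `k`-point of an affine open subset attached to a maximal ideal. -/
lemma exists_ratPoint_of_isMaximal (U : X.affineOpens) (m : Ideal Γ(X, U.1)) [m.IsMaximal] :
    ∃ φ : Γ(X, U.1) →+* k, (∀ c, φ (algebraMap k _ c) = c) ∧ RingHom.ker φ = m ∧
      (Spec.map (CommRingCat.ofHom φ) ≫ affineIncl U) ≫ (X ↘ Spec (.of k)) = 𝟙 _ := by
  have := finitePresentation_sections k X U.2
  let _ : Field (Γ(X, U.1) ⧸ m) := Ideal.Quotient.field m
  have : Algebra.FiniteType k (Γ(X, U.1) ⧸ m) := inferInstance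
  have : Module.Finite k (Γ(X, U.1) ⧸ m) := finite_of_finite_type_of_isJacobsonRing k _
  let e : k ≃+* (Γ(X, U.1) ⧸ m) := RingEquiv.ofBijective (algebraMap k _)
    IsAlgClosed.algebraMap_bijective_of_isIntegral
  let φ : Γ(X, U.1) →+* k := e.symm.toRingHom.comp (Ideal.Quotient.mk m)
  have hφ (c) : φ (algebraMap k _ c) = c := e.symm_apply_apply c
  refine ⟨φ, hφ, ?_, ?_⟩
  · ext r
    rw [RingHom.mem_ker, ← Ideal.Quotient.eq_zero_iff_mem]
    exact e.symm.map_eq_zero_iff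
  · rw [Category.assoc]
    have h₁ := IsAffineOpen.SpecMap_appLE_fromSpec (X ↘ Spec (.of k))
      (isAffineOpen_top (Spec (.of k))) (isAffineOpen_val U) (le_preimage_top _ _)
    rw [IsAffineOpen.fromSpec_top, Scheme.isoSpec_Spec_inv, ← Spec.map_comp] at h₁
    rw [← h₁, ← Spec.map_comp, ← Spec.map_id]
    exact congrArg Spec.map (CommRingCat.hom_ext (RingHom.ext hφ))

lemma appLE_specMap_fromSpec {Y : Scheme.{u}} (V : Y.affineOpens) {R : CommRingCat.{u}}
    (ψ : Γ(Y, V.1) ⟶ R) (h : ⊤ ≤ (Spec.map ψ ≫ affineIncl V) ⁻¹ᵁ V.1) (F : Γ(Y, V.1)) :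
    ((Spec.map ψ ≫ affineIncl V).appLE V.1 ⊤ h).hom F = (Scheme.ΓSpecIso R).inv.hom (ψ.hom F) := by
  have e := comp_appLE_apply (affineIncl V) (Spec.map ψ) (top_le_fromSpec_preimage V.2)
    (top_le_preimage_top _) F
  refine e.trans ?_
  rw [fromSpec_appLE V.2, appLE_top_top]
  exact congr($(Scheme.ΓSpecIso_inv_naturality ψ).hom F).symm

variable [CompactSpace X] [X.IsSeparated] [IsIntegral X] [IsLocallyNoetherian X]

/-- The spectral functions vanish on the fibre over every rational point, that is modulo every
maximal ideal of the base, so they vanish by flatness and finiteness. -/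
lemma app_spectralFunction_eq_zero_of_liesOverAt {Y : Scheme.{u}} {j : Y ⟶ cotangentBundle k X}
    [IsFinite (j ≫ cotangentProj k X)] [Flat (j ≫ cotangentProj k X)] {U : X.affineOpens}
    (hne : (U.1 : Set X).Nonempty)
    (hl : ∀ x : RatPoint k X, ⊤ ≤ x.1 ⁻¹ᵁ U.1 → LiesOverAt a (j ≫ cotangentProj k X) j x)
    {δ₀ : VectorField k X U.1} (hs : (charPoly a U δ₀).Separable) (δ : VectorField k X U.1) :
    (j.appLE (cotangentProj k X ⁻¹ᵁ U.1) ((j ≫ cotangentProj k X) ⁻¹ᵁ U.1) le_rfl).hom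
      (spectralFunction a U δ) = 0 := by
  set p := j ≫ cotangentProj k X with hp
  have hV : IsAffineOpen (p ⁻¹ᵁ U.1) := (isAffineOpen_val U).preimage p
  let V : Y.affineOpens := ⟨p ⁻¹ᵁ U.1, hV⟩
  have h₁ : (p.app U.1).hom.Finite := p.finite_app _ (isAffineOpen_val U)
  have h₂ : (p.app U.1).hom.Flat := by
    have := p.flat_appLE (isAffineOpen_val U) hV le_rfl
    rwa [← Scheme.Hom.app_eq_appLE] at this
  let _ : Algebra Γ(X, U.1) Γ(Y, V.1) := (p.app U.1).hom.toAlgebra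
  have : Module.Finite Γ(X, U.1) Γ(Y, V.1) := h₁
  have : Module.Flat Γ(X, U.1) Γ(Y, V.1) := h₂
  have : Nonempty U.1 := ⟨⟨_, hne.some_mem⟩⟩
  have : IsNoetherianRing Γ(X, U.1) := IsLocallyNoetherian.component_noetherian U
  have := finitePresentation_sections k X U.2
  have : IsJacobsonRing Γ(X, U.1) := isJacobsonRing_of_finiteType (A := k)
  refine eq_zero_of_forall_isMaximal (A := Γ(X, U.1)) (B := Γ(Y, V.1)) _ fun m hm ↦ ?_
  obtain ⟨φ, hφ, hker, hx⟩ := exists_ratPoint_of_isMaximal (k := k) U m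
  let x : RatPoint k X := ⟨Spec.map (CommRingCat.ofHom φ) ≫ affineIncl U, hx⟩
  have hxU : ⊤ ≤ x.1 ⁻¹ᵁ U.1 := (top_le_preimage_top _).trans
    ((Spec.map (CommRingCat.ofHom φ)).preimage_mono (top_le_fromSpec_preimage U.2))
  let I : Ideal Γ(Y, V.1) := m.map (algebraMap Γ(X, U.1) Γ(Y, V.1))
  let ψ : Γ(Y, V.1) ⟶ .of (Γ(Y, V.1) ⧸ I) := CommRingCat.ofHom (Ideal.Quotient.mk I)
  let θ : k →+* Γ(Y, V.1) ⧸ I := (ψ.hom.comp (p.app U.1).hom).comp (algebraMap k Γ(X, U.1))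
  have hθ (r : Γ(X, U.1)) : θ (φ r) = ψ.hom ((p.app U.1).hom r) := by
    have hr : algebraMap k Γ(X, U.1) (φ r) - r ∈ m := by
      rw [← hker, RingHom.mem_ker, map_sub, hφ, sub_self]
    have : ψ.hom ((p.app U.1).hom (algebraMap k Γ(X, U.1) (φ r) - r)) = 0 :=
      Ideal.Quotient.eq_zero_iff_mem.mpr (Ideal.mem_map_of_mem _ hr)
    rw [map_sub, map_sub, sub_eq_zero] at this
    exact this
  have hw : (Spec.map ψ ≫ affineIncl V) ≫ p = Spec.map (CommRingCat.ofHom θ) ≫ x.1 := by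
    have e₁ := IsAffineOpen.SpecMap_appLE_fromSpec p (isAffineOpen_val U) hV le_rfl
    rw [Category.assoc]
    refine (congrArg (Spec.map ψ ≫ ·) e₁.symm).trans ?_
    rw [← Category.assoc, ← Category.assoc, ← Spec.map_comp, ← Spec.map_comp]
    refine congrArg (Spec.map · ≫ _) (CommRingCat.hom_ext (RingHom.ext fun r ↦ ?_))
    refine Eq.trans ?_ (hθ r).symm
    rw [Scheme.Hom.app_eq_appLE]
    rfl
  -- The reduction modulo `m` maps to the fibre over `x`, which carries the known vanishing back to
  -- functions.
  let l : Spec (.of (Γ(Y, V.1) ⧸ I)) ⟶ pullback p x.1 := pullback.lift _ _ hw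
  have hl₁ : l ≫ pullback.fst p x.1 ≫ j = (Spec.map ψ ≫ affineIncl V) ≫ j :=
    pullback.lift_fst_assoc _ _ _ _
  have hP : ⊤ ≤ (pullback.fst p x.1 ≫ j) ⁻¹ᵁ (cotangentProj k X ⁻¹ᵁ U.1) := by
    have : ⊤ ≤ (pullback.fst p x.1 ≫ p) ⁻¹ᵁ U.1 := by
      rw [pullback.condition]; exact fun y _ ↦ hxU trivial
    exact this
  have h₃ := (hl x hxU).appLE_eq_zero hs hxU δ hP
  have h₄ := comp_appLE_apply (pullback.fst p x.1 ≫ j) l hP (top_le_preimage_top _)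
    (spectralFunction a U δ)
  rw [h₃, map_zero, appLE_congr_hom hl₁] at h₄
  have h₅ : ⊤ ≤ (Spec.map ψ ≫ affineIncl V) ⁻¹ᵁ V.1 := (top_le_preimage_top _).trans
    ((Spec.map ψ).preimage_mono (top_le_fromSpec_preimage V.2))
  have h₆ := comp_appLE_apply j (Spec.map ψ ≫ affineIncl V) (V := V.1)
    (U := cotangentProj k X ⁻¹ᵁ U.1) le_rfl h₅ (spectralFunction a U δ)
  have h₇ := (appLE_specMap_fromSpec V ψ h₅ _).symm.trans (h₆.symm.trans h₄)
  have h₈ := (Scheme.ΓSpecIso (.of (Γ(Y, V.1) ⧸ I))).symm.commRingCatIsoToRingEquiv.map_eq_zero_iff.mp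
    h₇
  exact Ideal.Quotient.eq_zero_iff_mem.mp h₈

/-- A covering which lies over multiplicity-free values of `a` on some non-empty open subset, factors
through the spectral cover. -/
lemma exists_spectral_lift_of_liesOverAt {Y : Scheme.{u}} {j : Y ⟶ cotangentBundle k X}
    [IsFinite (j ≫ cotangentProj k X)] [Flat (j ≫ cotangentProj k X)] {U : X.affineOpens}
    (hne : (U.1 : Set X).Nonempty)
    (hl : ∀ x : RatPoint k X, ⊤ ≤ x.1 ⁻¹ᵁ U.1 → LiesOverAt a (j ≫ cotangentProj k X) j x)
    {δ₀ : VectorField k X U.1} (hs : (charPoly a U δ₀).Separable) :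
    ∃ q : Y ⟶ spectralCover a, q ≫ spectralIncl a = j := by
  set p := j ≫ cotangentProj k X with hp
  have := isSchemeTheoreticallyDominant_ι (p := p) U.1 hne
  have h : ⊤ ≤ ((p ⁻¹ᵁ U.1).ι ≫ j) ⁻¹ᵁ (cotangentProj k X ⁻¹ᵁ U.1) := fun y _ ↦ y.2
  obtain ⟨l, hl'⟩ := exists_spectral_lift a ((p ⁻¹ᵁ U.1).ι ≫ j) fun x ↦ ⟨U, ⊤, h, trivial, fun δ ↦ by
    have e := comp_appLE_apply j (p ⁻¹ᵁ U.1).ι (V := p ⁻¹ᵁ U.1) (U := cotangentProj k X ⁻¹ᵁ U.1)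
      le_rfl (fun y _ ↦ y.2) (spectralFunction a U δ) (V' := ⊤)
    refine e.trans ((congrArg _ (app_spectralFunction_eq_zero_of_liesOverAt hne hl hs δ)).trans (map_zero _))⟩
  exact exists_lift_of_isSchemeTheoreticallyDominant (p ⁻¹ᵁ U.1).ι (spectralIncl a) j l hl'

end SpectralLift

/-! ### Closed immersions between coverings of equal degree. -/

section Rank

lemma isPullback_fromSpec_appLE {Y S : Scheme.{u}} (r : Y ⟶ S) [IsAffineHom r] {U : S.Opens}
    (hU : IsAffineOpen U) (hV : IsAffineOpen (r ⁻¹ᵁ U)) :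
    IsPullback hV.fromSpec (Spec.map (r.appLE U (r ⁻¹ᵁ U) le_rfl)) r hU.fromSpec := by
  have h : hV.isoSpec.inv ≫ (r ∣_ U) = Spec.map (r.appLE U (r ⁻¹ᵁ U) le_rfl) ≫ hU.isoSpec.inv := by
    rw [← cancel_mono U.ι, Category.assoc, Category.assoc, morphismRestrict_ι]
    exact (IsAffineOpen.SpecMap_appLE_fromSpec r hU hV le_rfl).symm
  exact (IsPullback.of_horiz_isIso ⟨h⟩).paste_horiz (isPullback_morphismRestrict r U).flip

/-- A closed immersion between finite flat coverings of the same degree is an isomorphism. -/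
lemma isIso_of_isClosedImmersion_of_finrank_eq {Y₁ Y₂ S : Scheme.{u}} (i : Y₁ ⟶ Y₂) (r : Y₂ ⟶ S)
    [IsClosedImmersion i] [IsFinite r] [Flat r] [IsFinite (i ≫ r)] [Flat (i ≫ r)]
    (h : ∀ s, (i ≫ r).finrank s = r.finrank s) : IsIso i := by
  refine isIso_of_isAffineHom_of_bijective i fun y ↦ ?_
  obtain ⟨_, ⟨U, hU, rfl⟩, hy, -⟩ := S.isBasis_affineOpens.exists_subset_of_mem_open
    (a := r y) (u := Set.univ) trivial isOpen_univ
  have hU : IsAffineOpen U := hU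
  have hV₂ : IsAffineOpen (r ⁻¹ᵁ U) := hU.preimage r
  have hV₁ : IsAffineOpen ((i ≫ r) ⁻¹ᵁ U) := hU.preimage (i ≫ r)
  refine ⟨⟨r ⁻¹ᵁ U, hV₂⟩, hy, ?_⟩
  let B₁ := Γ(Y₁, (i ≫ r) ⁻¹ᵁ U)
  let B₂ := Γ(Y₂, r ⁻¹ᵁ U)
  let φ₁ : Γ(S, U) ⟶ B₁ := (i ≫ r).appLE U ((i ≫ r) ⁻¹ᵁ U) le_rfl
  let φ₂ : Γ(S, U) ⟶ B₂ := r.appLE U (r ⁻¹ᵁ U) le_rfl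
  let _ : Algebra Γ(S, U) B₁ := φ₁.hom.toAlgebra
  let _ : Algebra Γ(S, U) B₂ := φ₂.hom.toAlgebra
  have hf₁ : Module.Finite Γ(S, U) B₁ := by
    have := (i ≫ r).finite_app U hU
    rw [Scheme.Hom.app_eq_appLE] at this
    exact this
  have hf₂ : Module.Finite Γ(S, U) B₂ := by
    have := r.finite_app U hU
    rw [Scheme.Hom.app_eq_appLE] at this
    exact this
  have hl₁ : Module.Flat Γ(S, U) B₁ := (i ≫ r).flat_appLE hU hV₁ le_rfl
  have hl₂ : Module.Flat Γ(S, U) B₂ := r.flat_appLE hU hV₂ le_rfl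
  let ψ : B₂ →+* B₁ := (i.app (r ⁻¹ᵁ U)).hom
  have hψ (a : Γ(S, U)) : ψ (φ₂.hom a) = φ₁.hom a := by
    have := comp_appLE_apply r i (U := U) (V := r ⁻¹ᵁ U) (V' := (i ≫ r) ⁻¹ᵁ U) le_rfl le_rfl a
    refine Eq.trans ?_ this.symm
    exact congr($(Scheme.Hom.app_eq_appLE (f := i) (U := r ⁻¹ᵁ U)).hom _)
  let l : B₂ →ₗ[Γ(S, U)] B₁ :=
    { ψ with
      map_smul' a b := by
        change ψ (φ₂.hom a * b) = φ₁.hom a * ψ b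
        rw [map_mul, hψ] }
  -- A surjection between finite projective modules of equal rank is bijective.
  refine Module.bijective_of_surjective_of_rankAtStalk_eq (φ := l)
    (i.app_surjective _ hV₂) fun m hm ↦ ?_
  rw [← Scheme.Hom.finrank_SpecMap_algebraMap, ← Scheme.Hom.finrank_SpecMap_algebraMap]
  have h₁ := Scheme.Hom.finrank_of_isPullback _ _ _ _ (isPullback_fromSpec_appLE (i ≫ r) hU hV₁)
    ⟨m, hm.isPrime⟩
  have h₂ := Scheme.Hom.finrank_of_isPullback _ _ _ _ (isPullback_fromSpec_appLE r hU hV₂)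
    ⟨m, hm.isPrime⟩
  exact h₂.trans ((h _).symm.trans h₁.symm)

end Rank

/-! ### Isomorphisms of coverings embedded away from codimension two. -/

section Gluing

variable {k : Type u} [Field k] {X T Y₁ Y₂ : Scheme.{u}} [X.Over (Spec (.of k))] {τ : T ⟶ X}
  [IsAffineHom τ] {j₁ : Y₁ ⟶ T} {j₂ : Y₂ ⟶ T}

lemma isClosedImmersion_restrict_of_le {Y Z : Scheme.{u}} {f : Y ⟶ Z} {O O' : Z.Opens}
    (h : IsClosedImmersion (f ∣_ O)) (hO : O' ≤ O) : IsClosedImmersion (f ∣_ O') :=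
  MorphismProperty.of_isPullback (P := @IsClosedImmersion)
    (isPullback_morphismRestrict_homOfLE f hO) h

lemma eq_of_comp_eq_of_isClosedImmersion_restrict {S Y Z : Scheme.{u}} {f : Y ⟶ Z} {O : Z.Opens}
    (h : IsClosedImmersion (f ∣_ O)) {a b : S ⟶ Y} (e : a ≫ f = b ≫ f)
    (ha : ⊤ ≤ (a ≫ f) ⁻¹ᵁ O) : a = b := by
  have hP := isPullback_morphismRestrict f O
  let c : S ⟶ O := IsOpenImmersion.lift O.ι (a ≫ f) (by
    rw [Scheme.Opens.range_ι]
    rintro _ ⟨s, rfl⟩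
    exact ha (Set.mem_univ s))
  have hc : c ≫ O.ι = a ≫ f := IsOpenImmersion.lift_fac _ _ _
  have h' : hP.lift c a hc = hP.lift c b (hc.trans e) := by
    rw [← cancel_mono (f ∣_ O), hP.lift_fst, hP.lift_fst]
  rw [← hP.lift_snd c a hc, h', hP.lift_snd]

/-- A closed immersion, over an open subset of the base, between finite flat coverings of the same
degree is an isomorphism over this subset. -/
lemma isIso_of_isClosedImmersion_restrict [IsFinite (j₁ ≫ τ)] [Flat (j₁ ≫ τ)] [IsFinite (j₂ ≫ τ)]
    [Flat (j₂ ≫ τ)] {U : X.Opens} (h : IsClosedImmersion (j₁ ∣_ (τ ⁻¹ᵁ U)))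
    (w : ((j₁ ≫ τ) ⁻¹ᵁ U).toScheme ⟶ ((j₂ ≫ τ) ⁻¹ᵁ U).toScheme)
    (hw : w ≫ ((j₂ ≫ τ) ⁻¹ᵁ U).ι ≫ j₂ = ((j₁ ≫ τ) ⁻¹ᵁ U).ι ≫ j₁)
    (hr : ∀ x, (j₁ ≫ τ).finrank x = (j₂ ≫ τ).finrank x) : IsIso w := by
  have : IsFinite j₂ := .of_comp j₂ τ
  have : IsSeparated j₂ := inferInstance
  obtain ⟨i₁, hi₁, hc₁⟩ : ∃ i : ((j₁ ≫ τ) ⁻¹ᵁ U).toScheme ⟶ (τ ⁻¹ᵁ U).toScheme,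
      i ≫ (τ ⁻¹ᵁ U).ι = ((j₁ ≫ τ) ⁻¹ᵁ U).ι ≫ j₁ ∧ IsClosedImmersion i :=
    ⟨j₁ ∣_ (τ ⁻¹ᵁ U), morphismRestrict_ι _ _, h⟩
  obtain ⟨i₂, hi₂, hs₂⟩ : ∃ i : ((j₂ ≫ τ) ⁻¹ᵁ U).toScheme ⟶ (τ ⁻¹ᵁ U).toScheme,
      i ≫ (τ ⁻¹ᵁ U).ι = ((j₂ ≫ τ) ⁻¹ᵁ U).ι ≫ j₂ ∧ IsSeparated i :=
    ⟨j₂ ∣_ (τ ⁻¹ᵁ U), morphismRestrict_ι _ _, MorphismProperty.of_isPullback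
      (isPullback_morphismRestrict j₂ (τ ⁻¹ᵁ U)).flip ‹IsSeparated j₂›⟩
  have hw' : w ≫ i₂ = i₁ := by
    rw [← cancel_mono (τ ⁻¹ᵁ U).ι, Category.assoc, hi₁, hi₂]
    exact hw
  have : IsClosedImmersion (w ≫ i₂) := by rw [hw']; exact hc₁
  -- Cancellation: the composite with the separated morphism `i₂` is a closed immersion.
  have : IsClosedImmersion w := .of_comp w i₂
  have e : w ≫ ((j₂ ≫ τ) ∣_ U) = (j₁ ≫ τ) ∣_ U := by
    rw [← cancel_mono U.ι, Category.assoc, morphismRestrict_ι, morphismRestrict_ι]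
    simpa only [Category.assoc] using congr($hw ≫ τ)
  have f₁ : IsFinite ((j₁ ≫ τ) ∣_ U) := MorphismProperty.of_isPullback
    (isPullback_morphismRestrict (j₁ ≫ τ) U).flip ‹IsFinite (j₁ ≫ τ)›
  have f₂ : IsFinite ((j₂ ≫ τ) ∣_ U) := MorphismProperty.of_isPullback
    (isPullback_morphismRestrict (j₂ ≫ τ) U).flip ‹IsFinite (j₂ ≫ τ)›
  have l₁ : Flat ((j₁ ≫ τ) ∣_ U) := MorphismProperty.of_isPullback
    (isPullback_morphismRestrict (j₁ ≫ τ) U).flip ‹Flat (j₁ ≫ τ)›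
  have l₂ : Flat ((j₂ ≫ τ) ∣_ U) := MorphismProperty.of_isPullback
    (isPullback_morphismRestrict (j₂ ≫ τ) U).flip ‹Flat (j₂ ≫ τ)›
  have f₃ : IsFinite (w ≫ ((j₂ ≫ τ) ∣_ U)) := e ▸ f₁
  have l₃ : Flat (w ≫ ((j₂ ≫ τ) ∣_ U)) := e ▸ l₁
  refine isIso_of_isClosedImmersion_of_finrank_eq w ((j₂ ≫ τ) ∣_ U) fun s ↦ ?_
  have e₁ := Scheme.Hom.finrank_of_isPullback _ _ _ _
    (isPullback_morphismRestrict (j₁ ≫ τ) U).flip s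
  have e₂ := Scheme.Hom.finrank_of_isPullback _ _ _ _
    (isPullback_morphismRestrict (j₂ ≫ τ) U).flip s
  rw [e₂, ← hr, ← e₁]
  exact congr(Scheme.Hom.finrank $e s)

variable [IsIntegral X] [IsLocallyNoetherian X]

variable (k) in
/-- A morphism between finite flat coverings of a smooth surface which are embedded in an affine
scheme over the surface away from codimension two, extends if it is defined over some non-empty
open subset. -/
lemma exists_comp_eq_of_restrict [SmoothOfRelativeDimension 2 (X ↘ Spec (.of k))]
    [IsFinite (j₁ ≫ τ)] [Flat (j₁ ≫ τ)] [IsFinite (j₂ ≫ τ)] (V : X.Opens)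
    (hV : ∀ x, x ∉ V → 2 ≤ ringKrullDim (X.presheaf.stalk x))
    (h : IsClosedImmersion (j₂ ∣_ (τ ⁻¹ᵁ V))) {U : X.Opens} (hUV : U ≤ V)
    (hU : (U : Set X).Nonempty) (w : ((j₁ ≫ τ) ⁻¹ᵁ U).toScheme ⟶ Y₂)
    (hw : w ≫ j₂ = ((j₁ ≫ τ) ⁻¹ᵁ U).ι ≫ j₁) : ∃ f : Y₁ ⟶ Y₂, f ≫ j₂ = j₁ := by
  let O : Y₁.Opens := (j₁ ≫ τ) ⁻¹ᵁ V
  have hVne : (V : Set X).Nonempty := hU.mono hUV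
  have hO := isSchemeTheoreticallyDominant_ι (p := j₁ ≫ τ) V hVne
  let O' : O.toScheme.Opens := (O.ι ≫ j₁ ≫ τ) ⁻¹ᵁ U
  have hO' : IsSchemeTheoreticallyDominant O'.ι :=
    isSchemeTheoreticallyDominant_ι (p := O.ι ≫ j₁ ≫ τ) U hU
  have hP := isPullback_morphismRestrict j₂ (τ ⁻¹ᵁ V)
  let r : O'.toScheme ⟶ ((j₁ ≫ τ) ⁻¹ᵁ U).toScheme := O.ι ∣_ ((j₁ ≫ τ) ⁻¹ᵁ U)
  have hr : r ≫ ((j₁ ≫ τ) ⁻¹ᵁ U).ι = O'.ι ≫ O.ι := morphismRestrict_ι _ _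
  let j₁' : O.toScheme ⟶ (τ ⁻¹ᵁ V).toScheme := j₁ ∣_ (τ ⁻¹ᵁ V)
  have hj₁' : j₁' ≫ (τ ⁻¹ᵁ V).ι = O.ι ≫ j₁ := morphismRestrict_ι _ _
  have hl : (O'.ι ≫ j₁') ≫ (τ ⁻¹ᵁ V).ι = (r ≫ w) ≫ j₂ := by
    rw [Category.assoc, hj₁', Category.assoc, hw, reassoc_of% hr]
  -- From `U` to `V`: over `V` the covering `Y₂` is a closed subscheme of `T`, so the morphism to it
  -- extends from a scheme-theoretically dense open subset.
  obtain ⟨g, hg⟩ := exists_lift_of_isSchemeTheoreticallyDominant O'.ι (j₂ ∣_ (τ ⁻¹ᵁ V)) j₁'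
    (hP.lift (O'.ι ≫ j₁') (r ≫ w) hl) (hP.lift_fst _ _ _)
  have hg' : (g ≫ (j₂ ⁻¹ᵁ (τ ⁻¹ᵁ V)).ι) ≫ j₂ = O.ι ≫ j₁ := by
    rw [Category.assoc, ← morphismRestrict_ι, ← Category.assoc, hg, hj₁']
  -- From `V` to `X`: extension over codimension two, as `Y₂` is affine over `X`.
  obtain ⟨f, hf, hfp⟩ := exists_extend k (p' := j₁ ≫ τ) (p := j₂ ≫ τ) V hV
    (g ≫ (j₂ ⁻¹ᵁ (τ ⁻¹ᵁ V)).ι) (by rw [← Category.assoc, hg', Category.assoc])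
  refine ⟨f, ext_of_isSchemeTheoreticallyDominant O.ι τ (by rw [Category.assoc, hfp]) ?_⟩
  rw [← Category.assoc, hf, hg']

variable (k) in
/-- Finite flat coverings of a smooth surface which are embedded in an affine scheme over the
surface away from codimension two, are isomorphic if they are so generically. -/
lemma exists_iso_of_restrict [SmoothOfRelativeDimension 2 (X ↘ Spec (.of k))]
    [IsFinite (j₁ ≫ τ)] [Flat (j₁ ≫ τ)] [IsFinite (j₂ ≫ τ)] [Flat (j₂ ≫ τ)] (V : X.Opens)
    (hV : ∀ x, x ∉ V → 2 ≤ ringKrullDim (X.presheaf.stalk x))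
    (h₁ : IsClosedImmersion (j₁ ∣_ (τ ⁻¹ᵁ V))) (h₂ : IsClosedImmersion (j₂ ∣_ (τ ⁻¹ᵁ V)))
    {U : X.Opens} (hUV : U ≤ V) (hU : (U : Set X).Nonempty)
    (w : ((j₁ ≫ τ) ⁻¹ᵁ U).toScheme ≅ ((j₂ ≫ τ) ⁻¹ᵁ U).toScheme)
    (hw : w.hom ≫ ((j₂ ≫ τ) ⁻¹ᵁ U).ι ≫ j₂ = ((j₁ ≫ τ) ⁻¹ᵁ U).ι ≫ j₁) :
    ∃ e : Y₁ ≅ Y₂, e.hom ≫ j₂ = j₁ := by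
  have hVne : (V : Set X).Nonempty := hU.mono hUV
  obtain ⟨f, hf⟩ := exists_comp_eq_of_restrict k V hV h₂ hUV hU (w.hom ≫ ((j₂ ≫ τ) ⁻¹ᵁ U).ι)
    (by rw [Category.assoc, hw])
  obtain ⟨g, hg⟩ := exists_comp_eq_of_restrict k V hV h₁ hUV hU (w.inv ≫ ((j₁ ≫ τ) ⁻¹ᵁ U).ι)
    (by rw [Category.assoc, ← hw, Iso.inv_hom_id_assoc])
  -- An endomorphism compatible with the map to `T` is the identity over `V`, where that map is a
  -- monomorphism, hence everywhere by density. Thus the two extensions are mutually inverse.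
  have key {Y : Scheme.{u}} {j : Y ⟶ T} [IsFinite (j ≫ τ)] [Flat (j ≫ τ)]
      (h : IsClosedImmersion (j ∣_ (τ ⁻¹ᵁ V))) (e : Y ⟶ Y) (he : e ≫ j = j) : e = 𝟙 Y := by
    have := isSchemeTheoreticallyDominant_ι (p := j ≫ τ) V hVne
    refine ext_of_isSchemeTheoreticallyDominant ((j ≫ τ) ⁻¹ᵁ V).ι (j ≫ τ)
      (by rw [← Category.assoc, he, Category.id_comp]) ?_
    refine eq_of_comp_eq_of_isClosedImmersion_restrict h (by simp [he]) fun y _ ↦ ?_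
    rw [Category.assoc, he]
    exact y.2
  exact ⟨⟨f, g, key h₁ _ (by rw [Category.assoc, hg, hf]), key h₂ _ (by rw [Category.assoc, hf, hg])⟩,
    hf⟩

end Gluing

/-! ### Uniqueness of the Cohen-Macaulay spectral surface. -/

section Uniqueness

lemma exists_lift_of_isIso_morphismRestrict {Y Y' Z : Scheme.{u}} {q : Y ⟶ Z} {S : Z.Opens}
    (h : IsIso (q ∣_ S)) (f : Y' ⟶ Z) :
    ∃ w : (f ⁻¹ᵁ S).toScheme ⟶ (q ⁻¹ᵁ S).toScheme, w ≫ (q ⁻¹ᵁ S).ι ≫ q = (f ⁻¹ᵁ S).ι ≫ f :=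
  ⟨(f ∣_ S) ≫ inv (q ∣_ S), by
    rw [← morphismRestrict_ι q S, Category.assoc, IsIso.inv_hom_id_assoc, morphismRestrict_ι]⟩

variable {k : Type u} [Field k] [IsAlgClosed k] [CharZero k] {X C : Scheme.{u}}
  [X.Over (Spec (.of k))] [C.Over (Spec (.of k))] {π : X ⟶ C} [π.IsOver (Spec (.of k))]
  [LocallyOfFinitePresentation (X ↘ Spec (.of k))]
  [LocallyOfFinitePresentation (C ↘ Spec (.of k))] {n : ℕ} {b : HitchinBase k C n}
  {bX : HitchinBase k X n} [CompactSpace C] [C.IsSeparated] [CompactSpace X] [X.IsSeparated]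
  [SmoothOfRelativeDimension 1 (C ↘ Spec (.of k))]
  [SmoothOfRelativeDimension 2 (X ↘ Spec (.of k))]
  {d : pullback (cotangentProj k C) π ⟶ cotangentBundle k X}
  {q : plusSurface π b ⟶ spectralCover bX}

/-- If the fibres of `π` are reduced, then `X^+_b` is the Cohen-Macaulay spectral surface. -/
lemma IsCMSpectralSurface.exists_iso_plus [IsIntegral X] [IsLocallyNoetherian X]
    [IrreducibleSpace C] [LocallyOfFinitePresentation π] [QuasiCompact π] [Flat π] [Surjective π]
    [Smooth (π.fiberToSpecResidueField (genericPoint C))] (h : b ∈ heartLocus k C n)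
    (hb : IsPullbackOf π b bX) (hd : IsCodifferential π d)
    (hq : q ≫ spectralIncl bX = plusIncl π b ≫ d) (hr : ∀ c : C, IsReduced (π.fiber c))
    {Y : Scheme.{u}} {p : Y ⟶ X} {j : Y ⟶ cotangentBundle k X} (hY : IsCMSpectralSurface bX p j) :
    ∃ (qCM : Y ⟶ spectralCover bX) (e : plusSurface π b ≅ Y),
      qCM ≫ spectralIncl bX = j ∧ e.hom ≫ qCM = q := by
  obtain ⟨hjp, hpf, hpl, hpn, V₁, hV₁, hj, hl⟩ := hY
  subst hjp
  have hV₁ne : (V₁ : Set X).Nonempty := by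
    refine ⟨genericPoint X, by_contra fun h ↦ ?_⟩
    have h' := hV₁ _ h
    rw [ringKrullDim_eq_zero_of_field (X.presheaf.stalk (genericPoint X))] at h'
    exact absurd h' (by decide)
  obtain ⟨W, t, D, U, hU, δ₀, hW, hs, hδ₀, hUV₁, hUs, hη⟩ :=
    exists_isChart_separable_le (π := π) h V₁ hV₁ne
  have hne : (U.1 : Set X).Nonempty := ⟨_, hη⟩
  have hsX : (charPoly bX U δ₀).Separable := by
    rw [charPoly_pullback_of_eq_one hb hW U hU δ₀ hδ₀]
    exact hs.map
  -- `U` lies in the set `V₁` where `Y` lies over the values of `b_X`, and these are multiplicity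
  -- free on `U`.
  obtain ⟨qCM, rfl⟩ := exists_spectral_lift_of_liesOverAt (j := j) hne
    (fun x hx ↦ hl x (hx.trans (x.1.preimage_mono hUV₁))) hsX
  have hplus : (q ≫ spectralIncl bX) ≫ cotangentProj k X = plusProj π b := by
    rw [hq]; exact (isCodiff_plus hd).comp_proj
  have hiso := hW.isIso_restrict hb hd hU hδ₀ hs hq
  have hclosed := isClosedImmersion_plusIncl (b := b) hd
  rw [← hq] at hclosed
  have : IsFinite ((q ≫ spectralIncl bX) ≫ cotangentProj k X) := by rw [hplus]; infer_instance
  have : Flat ((q ≫ spectralIncl bX) ≫ cotangentProj k X) := by rw [hplus]; infer_instance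
  obtain ⟨w, hw₀⟩ : ∃ w : (((qCM ≫ spectralIncl bX) ≫ cotangentProj k X) ⁻¹ᵁ U.1).toScheme ⟶
      (((q ≫ spectralIncl bX) ≫ cotangentProj k X) ⁻¹ᵁ U.1).toScheme,
      w ≫ (((q ≫ spectralIncl bX) ≫ cotangentProj k X) ⁻¹ᵁ U.1).ι ≫ q =
        (((qCM ≫ spectralIncl bX) ≫ cotangentProj k X) ⁻¹ᵁ U.1).ι ≫ qCM :=
    exists_lift_of_isIso_morphismRestrict hiso qCM
  have hw : w ≫ (((q ≫ spectralIncl bX) ≫ cotangentProj k X) ⁻¹ᵁ U.1).ι ≫ q ≫ spectralIncl bX =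
      (((qCM ≫ spectralIncl bX) ≫ cotangentProj k X) ⁻¹ᵁ U.1).ι ≫ qCM ≫ spectralIncl bX := by
    simpa only [Category.assoc] using congr($hw₀ ≫ spectralIncl bX)
  -- Inverting `q` over `U` gives a morphism from `Y` to `X^+_b`. It is a closed immersion because
  -- `Y` is embedded in `T^*_X` there, and both coverings have degree `n`.
  have hwi : IsIso w := isIso_of_isClosedImmersion_restrict
    (isClosedImmersion_restrict_of_le hj ((cotangentProj k X).preimage_mono hUV₁)) w hw fun x ↦ by
      rw [hpn, hplus, finrank_plusProj]
  -- Both coverings are embedded over `V₁ ⊓ π.smoothLocus`, whose complement still has codimension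
  -- at least two.
  obtain ⟨e, he⟩ := exists_iso_of_restrict k (V₁ ⊓ π.smoothLocus) (fun x hx ↦ by
      by_cases h₁ : x ∈ V₁
      · exact two_le_ringKrullDim_of_notMem_smoothLocus π hr (perfectField_residueField (k := k))
          fun h₂ ↦ hx ⟨h₁, h₂⟩
      · exact hV₁ x h₁)
    (isClosedImmersion_restrict_of_le hj ((cotangentProj k X).preimage_mono inf_le_left))
    (isClosedImmersion_restrict_of_le hclosed ((cotangentProj k X).preimage_mono inf_le_right))
    (le_inf hUV₁ hUs) hne (asIso w) hw
  refine ⟨qCM, e.symm, rfl, ?_⟩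
  have : Mono (spectralIncl bX) := inferInstance
  rw [← cancel_mono (spectralIncl bX), Category.assoc, ← he]
  exact e.inv_hom_id_assoc _

end Uniqueness

end SpectralSurface

end

/-! ### Assembly of the theorem. -/

theorem mainTheorem11 {k : Type u} [Field k] [IsAlgClosed k] [CharZero k] {X C : Scheme.{u}}
    [X.Over (Spec (.of k))] [IsIntegral X] [IsProper (X ↘ Spec (.of k))]
    [Smooth (X ↘ Spec (.of k))] [SmoothOfRelativeDimension 2 (X ↘ Spec (.of k))]
    [C.Over (Spec (.of k))] [IsIntegral C] [IsProper (C ↘ Spec (.of k))]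
    [Smooth (C ↘ Spec (.of k))] [SmoothOfRelativeDimension 1 (C ↘ Spec (.of k))]
    (π : X ⟶ C) [π.IsOver (Spec (.of k))] [IsProper π] [Flat π] [Surjective π]
    [SmoothOfRelativeDimension 1 (π.fiberToSpecResidueField (genericPoint C))]
    (n : ℕ) (hn : 1 ≤ n) (b : HitchinBase k C n) (hb : b ∈ postulatedImage k C n) :
    (∃! bX : HitchinBase k X n, IsPullbackOf π b bX) ∧
    (∃! d : pullback (cotangentProj k C) π ⟶ cotangentBundle k X, IsCodifferential π d) ∧
    ∀ (bX : HitchinBase k X n), IsPullbackOf π b bX →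
    ∀ (d : pullback (cotangentProj k C) π ⟶ cotangentBundle k X), IsCodifferential π d →
      bX ∈ postulatedImage k X n ∧
      ∃ q : plusSurface π b ⟶ spectralCover bX,
        q ≫ spectralIncl bX = plusIncl π b ≫ d ∧
        q ≫ spectralProj bX = plusProj π b ∧
        IsFinite q ∧
        (b ∈ heartLocus k C n →
          bX ∈ heartLocus k X n ∧
          IsGenericIso q ∧
          ((∀ c : C, IsReduced (π.fiber c)) →
            IsFiniteCohenMacaulayfication q ∧
            IsCMSpectralSurface bX (plusProj π b) (q ≫ spectralIncl bX) ∧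
            ∀ (Y : Scheme.{u}) (p : Y ⟶ X) (j : Y ⟶ cotangentBundle k X),
              IsCMSpectralSurface bX p j →
              ∃ (qCM : Y ⟶ spectralCover bX) (e : plusSurface π b ≅ Y),
                qCM ≫ spectralIncl bX = j ∧ e.hom ≫ qCM = q)) := by
  have hX : LocallyOfFiniteType (X ↘ Spec (.of k)) := inferInstance
  have : IsLocallyNoetherian X := LocallyOfFiniteType.isLocallyNoetherian (X ↘ Spec (.of k))
  have : IsLocallyNoetherian C := LocallyOfFiniteType.isLocallyNoetherian (C ↘ Spec (.of k))
  have : CompactSpace X := QuasiCompact.compactSpace_of_compactSpace (X ↘ Spec (.of k))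
  have : CompactSpace C := QuasiCompact.compactSpace_of_compactSpace (C ↘ Spec (.of k))
  have : X.IsSeparated := ⟨by
    rw [← terminal.comp_from (X ↘ Spec (.of k))]; infer_instance⟩
  have : C.IsSeparated := ⟨by
    rw [← terminal.comp_from (C ↘ Spec (.of k))]; infer_instance⟩
  have : LocallyOfFinitePresentation π := inferInstance
  have : Smooth (π.fiberToSpecResidueField (genericPoint C)) :=
    SmoothOfRelativeDimension.smooth 1 _
  refine ⟨existsUnique_isPullbackOf π b, existsUnique_isCodifferential k π, fun bX hbX d hd ↦
    ⟨pullback_mem_postulatedImage hbX hb, ?_⟩⟩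
  obtain ⟨q, hq⟩ := exists_plus_lift hbX hd
  have hqp : q ≫ spectralProj bX = plusProj π b := by
    rw [spectralProj, ← Category.assoc, hq, (isCodiff_plus hd).comp_proj]
  have hqf : IsFinite q := isFinite_of_comp_spectralProj hqp
  refine ⟨q, hq, hqp, hqf, fun h ↦ ?_⟩
  -- One chart around the generic point serves both the generic isomorphism and, at any rational
  -- point of `U`, the multiplicity-free value required for the heart locus.
  obtain ⟨W, t, D, U, hU, δ, hW, hs, hδ, -, -, hη⟩ := exists_isChart_separable_le (π := π) h ⊤
    ⟨genericPoint X, trivial⟩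
  have hne : (U.1 : Set X).Nonempty := ⟨_, hη⟩
  have hgen : IsGenericIso q := isGenericIso_of_separable hbX hd hq hW hU hδ hs hne
  obtain ⟨x, hx⟩ := exists_ratPoint_mem (k := k) U.1 hne
  obtain ⟨ξ, hξ, hc⟩ := hW.exists_isCycleAt_injective hbX hb hs hU hδ x hx
  refine ⟨⟨pullback_mem_postulatedImage hbX hb, x, ξ, hξ, hc⟩, hgen, fun hr ↦
    ⟨⟨hqf, hgen, isCohenMacaulay_of_isFinite_of_flat (k := k) (p := plusProj π b)⟩, ?_, ?_⟩⟩
  · rw [hq]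
    exact isCMSpectralSurface_plus hbX hd hb hr
  · intro Y p j hY
    exact hY.exists_iso_plus h hbX hd hq hr
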